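/- **Setting.** Let $(\epsilon_i)_{i\in\mathbb Z}$ be iid random elements of a measurable space $S$, let $g_1,g_2\colon S^\infty\to L^2([0,1])$ be measurable, and put $\varepsilon_i^{(k)}=g_k(\epsilon_i,\epsilon_{i-1},\ldots)$, $k=1,2$. Suppose that $\mathbb E\,\varepsilon^{(k)}_0=0$ and that for $k=1,2$ there is a $p>4$ with $$\sum_{\ell=0}^\infty\big(\mathbb E\|\varepsilon^{(k)}_0-\varepsilon^{(k)}_{0,\ell}\|^p\big)^{1/p}<\infty,\qquad \varepsilon^{(k)}_{0,\ell}=g_k(\epsilon_0,\ldots,\epsilon_{-\ell+1},\epsilon^*_{-\ell},\epsilon^*_{-\ell-1},\ldots),$$ where $(\epsilon_i^*)$ is an independent copy of $(\epsilon_i)$. Let $\mu\in L^2([0,1])$, $\tau\in(0,1)$, $k^*=\lfloor\tau n\rfloor$. The sample of size $n$ is $X_1,\ldots,X_n$ with $X_i=\mu+\varepsilon_i^{(1)}$ for $i\le k^*$ and $X_i=\mu+\varepsilon_i^{(2)}$ for $i>k^*$. For $k=1,2$ let $c_k$ be the covariance operator of $\varepsilon_0^{(k)}$ (with kernel $C_k$),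 $\lambda_1^{(k)}\ge\lambda_2^{(k)}\ge\cdots\ge 0$ its eigenvalues, and $\mathrm{tr}(c_k)=\sum_j\lambda_j^{(k)}=\int C_k(t,t)\,dt$. Let $d$ be such that $\lambda_1^{(k)}>\cdots>\lambda_d^{(k)}>\lambda_{d+1}^{(k)}$ for $k=1,2$. Let $\varphi_1^*,\ldots,\varphi_d^*$ be orthonormal eigenfunctions for the $d$ largest eigenvalues of $c^*=\tau c_1+(1-\tau)c_2$, let $$\theta^{(k)}_{i,j}=\big\langle\varepsilon^{(k)}_i\otimes\varepsilon^{(k)}_i-\mathbb E[\varepsilon^{(k)}_i\otimes\varepsilon^{(k)}_i],\varphi_j^*\otimes\varphi_j^*\big\rangle,$$ and suppose that the $d\times d$ matrices $\Sigma_d^{(k)}=\big(\sum_{i\in\mathbb Z}\mathrm{Cov}(\theta^{(k)}_{0,j},\theta^{(k)}_{i,j'})\big)_{j,j'}$, $k=1,2$, are invertible. Suppose that the alternative $H_A$ holds: $(\lambda^{(1)}_1,\ldots,\lambda^{(1)}_d)\neq(\lambda^{(2)}_1,\ldots,\lambda^{(2)}_d)$. **Statistics.** With $\bar X=n^{-1}\sum_{i=1}^nX_i$,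 let $\hat c_x$ be the integral operator with kernel $\hat C_x(t,t')=n^{-1}\sum_{i\le\lfloor nx\rfloor}(X_i(t)-\bar X(t))(X_i(t')-\bar X(t'))$, $\hat\lambda_1(x)\ge\hat\lambda_2(x)\ge\cdots$ its eigenvalues, and $\hat\varphi_1,\ldots,\hat\varphi_d$ any choice of orthonormal eigenfunctions for the $d$ largest eigenvalues of $\hat c_1$. Let $w\colon\mathbb R\to\mathbb R$ be continuous with $w(0)=1$, $w(-u)=w(u)$, $w\le1$, $w(u)=0$ for $|u|>m$ for some $m>0$, $\lim_{u\downarrow0}u^{-b}(1-w(u))\in(0,\infty)$ for some $b>0$, and $\int w(u)\,du>0$ (automatic if $w\ge0$). Let $h=h(n)\to\infty$ with $h/\sqrt n\to0$. For sequences $(a_i),(b_i)$ with means $\bar a,\bar b$ over $1\le i\le n$ put $$\mathrm{LR}_n(a,b)=\sum_{\ell\in\mathbb Z}w(\ell/h)\,\frac1n\sum_{1\le i,\,i+\ell\le n}(a_i-\bar a)(b_{i+\ell}-\bar b).$$ Let $\hat\theta_{i,j}=\langle(X_i-\bar X)\otimes(X_i-\bar X)-\hat C_1,\hat\varphi_j\otimes\hat\varphi_j\rangle$,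 $\hat\Sigma_d(j,j')=\mathrm{LR}_n(\hat\theta_{\cdot,j},\hat\theta_{\cdot,j'})$, $\hat\sigma_j^2=\hat\Sigma_d(j,j)$, $\hat\xi_i=\|X_i-\bar X\|^2$, $\hat\sigma_T^2=\mathrm{LR}_n(\hat\xi,\hat\xi)$, $T_n(x)=n^{-1}\sum_{i\le\lfloor nx\rfloor}\|X_i-\bar X\|^2$, and let $\kappa_n(x)\in\mathbb R^d$ have the entries $\kappa_{n,j}(x)=\sqrt n\big(\hat\lambda_j(x)-\tfrac{\lfloor nx\rfloor}n\hat\lambda_j(1)\big)$. Put $$J_n(\delta)=\sup_{\delta\le x\le1}\kappa_n(x)^\top\hat\Sigma_d^{-1}\kappa_n(x),\qquad I_{j,n}(\delta)=\sup_{\delta\le x\le1}\frac{1}{\hat\sigma_j}|\kappa_{n,j}(x)|,\qquad M_n=\frac{\sqrt n}{\hat\sigma_T}\sup_{0\le x\le1}|T_n(x)-xT_n(1)|,$$ each set to $0$ where $\hat\Sigma_d$ is singular, respectively where $\hat\sigma_j^2\le0$ or $\hat\sigma_T^2\le0$. **Theorem.** Let $\delta>0$. (a) If $\delta<\tau$ and,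 for each $j\le d$, the $j$-th eigenspaces of $c_1$ and $c_2$ coincide, then $J_n(\delta)\to\infty$ in probability as $n\to\infty$. (b) If $\delta<\tau$, the $j$-th eigenspaces of $c_1$ and $c_2$ coincide for each $j\le d$, and $\lambda^{(1)}_{j_0}\ne\lambda^{(2)}_{j_0}$ for some $j_0\le d$, then $I_{j_0,n}(\delta)\to\infty$ in probability as $n\to\infty$. (c) If $\mathrm{tr}(c_1)\neq\mathrm{tr}(c_2)$, then $M_n\to\infty$ in probability as $n\to\infty$. -/

import Mathlib

open MeasureTheory ProbabilityTheory Filter Topology InnerProductSpace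
open scoped RealInnerProductSpace ENNReal Matrix

namespace SpectralBreak

noncomputable section

/-- The Hilbert space `L²([0,1])` (Lebesgue measure). -/
abbrev L2 : Type := Lp ℝ 2 (volume.restrict (Set.Icc (0 : ℝ) 1))

/-- `x ⊗ x` as an operator: `f ↦ ⟨x, f⟩ x`, that is, the integral operator on `L²([0,1])` with
kernel `(t, t') ↦ x(t) x(t')`. -/
abbrev tensorSq (x : L2) : L2 →L[ℝ] L2 := rankOne ℝ x x

/-- The Hilbert-Schmidt inner product `⟨A, φ ⊗ φ⟩ = ∫∫ A(t,t') φ(t) φ(t') dt dt'`. -/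
def pairing (A : L2 →L[ℝ] L2) (φ : L2) : ℝ := ⟪A φ, φ⟫

/-- The eigenvalue number `j + 1` in decreasing order, counted with multiplicity, of a positive
compact operator `T`: the largest `r` for which there are `j + 1` orthonormal eigenvectors of `T`
all of whose eigenvalues are at least `r`. So `eigval T 0` is the largest eigenvalue. -/
def eigval (T : L2 →L[ℝ] L2) (j : ℕ) : ℝ :=
  sSup {r : ℝ | ∃ (v : Fin (j + 1) → L2) (s : Fin (j + 1) → ℝ),
    Orthonormal ℝ v ∧ ∀ i, r ≤ s i ∧ T (v i) = s i • v i}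

/-- `φ` is an orthonormal system of eigenfunctions belonging to the `d` largest eigenvalues
of `T`. -/
def IsEigenfunctions {d : ℕ} (T : L2 →L[ℝ] L2) (φ : Fin d → L2) : Prop :=
  Orthonormal ℝ φ ∧ ∀ j : Fin d, T (φ j) = eigval T j • φ j

/-- The eigenspace of `T` that belongs to the eigenvalue number `j + 1`. -/
def eigspace (T : L2 →L[ℝ] L2) (j : ℕ) : Submodule ℝ L2 :=
  Module.End.eigenspace (T : Module.End ℝ L2) (eigval T j)

/-- The trace of a positive trace class operator, as the sum of its eigenvalues. For a covariance
operator with kernel `C` this is `∫ C(t,t) dt`. -/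
def opTrace (T : L2 →L[ℝ] L2) : ℝ := ∑' j : ℕ, eigval T j

/-! ### Population quantities -/

section Population

variable {Ω S : Type*} [MeasurableSpace Ω] [MeasurableSpace S]

/-- The covariance operator `E[(Y - EY) ⊗ (Y - EY)]` of a random element of `L²([0,1])`, i.e. the
integral operator whose kernel is the covariance kernel of `Y`. -/
def covOp (P : Measure Ω) (Y : Ω → L2) : L2 →L[ℝ] L2 :=
  ∫ ω, tensorSq (Y ω - ∫ ω', Y ω' ∂P) ∂P

/-- The Bernoulli shift `g(ϵ_i, ϵ_{i-1}, …)`. -/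
def shiftProcess (g : (ℕ → S) → L2) (e : ℤ → Ω → S) (i : ℤ) (ω : Ω) : L2 :=
  g fun m : ℕ => e (i - m) ω

/-- Keep the first `l` coordinates of `s` and take all others from `s'`. -/
def splice (l : ℕ) (s s' : ℕ → S) : ℕ → S := fun m => if m < l then s m else s' m

/-- `L^p`-`m`-approximability for some `p > 4`: the sum over `l ≥ 0` of
`(E ‖g(ϵ_0, ϵ_{-1}, …) - g(ϵ_0, …, ϵ_{-l+1}, ϵ*_{-l}, ϵ*_{-l-1}, …)‖^p)^{1/p}` is finite, where
the `ϵ_i` and `ϵ*_i` are independent with law `ν`. The moments depend only on the joint law of the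
innovations, so they are written on the product space. -/
def LpApproximable (ν : Measure S) [IsProbabilityMeasure ν] (g : (ℕ → S) → L2) : Prop :=
  ∃ p : ℝ, 4 < p ∧
    ∑' l : ℕ, eLpNorm (fun z : (ℕ → S) × (ℕ → S) => g z.1 - g (splice l z.1 z.2))
      (ENNReal.ofReal p)
      ((Measure.infinitePi fun _ : ℕ => ν).prod (Measure.infinitePi fun _ : ℕ => ν)) ≠ ∞

/-- The innovations are iid with law `ν`. -/
structure IsIIDInnovation (P : Measure Ω) (ν : Measure S) (e : ℤ → Ω → S) : Prop where
  measurable : ∀ i, Measurable (e i)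
  indep : iIndepFun e P
  law : ∀ i, P.map (e i) = ν

/-- The errors of one stationary segment: a measurable, centered, weakly dependent Bernoulli
shift. (As `L²([0,1])` is separable, `StronglyMeasurable` is Borel measurability.) -/
structure IsSegment (P : Measure Ω) (ν : Measure S) [IsProbabilityMeasure ν] (e : ℤ → Ω → S)
    (g : (ℕ → S) → L2) : Prop where
  measurable : StronglyMeasurable g
  approximable : LpApproximable ν g
  centered : ∫ ω, shiftProcess g e 0 ω ∂P = 0

/-- The scores `θ_{i,j} = ⟨ε_i ⊗ ε_i - E[ε_i ⊗ ε_i], φ_j ⊗ φ_j⟩`. -/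
def theta {d : ℕ} (P : Measure Ω) (ε : ℤ → Ω → L2) (φ : Fin d → L2) (i : ℤ) (j : Fin d)
    (ω : Ω) : ℝ :=
  pairing (tensorSq (ε i ω) - ∫ ω', tensorSq (ε i ω') ∂P) (φ j)

/-- The long-run covariance matrix of the score vectors,
`Σ(j, j') = ∑_{i ∈ ℤ} Cov(θ_{0,j}, θ_{i,j'})`. -/
def longRunCov {d : ℕ} (P : Measure Ω) (ε : ℤ → Ω → L2) (φ : Fin d → L2) :
    Matrix (Fin d) (Fin d) ℝ :=
  Matrix.of fun j j' => ∑' i : ℤ, cov[theta P ε φ 0 j, theta P ε φ i j'; P]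

/-- The observations `X_i = μ + ε_i` of the sample of size `n`, with errors
`g₁(ϵ_i, ϵ_{i-1}, …)` for `i ≤ k* = ⌊τ n⌋` and `g₂(ϵ_i, ϵ_{i-1}, …)` for `i > k*`. -/
def obs (μ : L2) (g₁ g₂ : (ℕ → S) → L2) (e : ℤ → Ω → S) (τ : ℝ) (n : ℕ) (ω : Ω) (i : ℤ) : L2 :=
  μ + if i ≤ ⌊τ * n⌋ then shiftProcess g₁ e i ω else shiftProcess g₂ e i ω

end Population

/-! ### Sample quantities, for a sample `x 1, …, x n` -/

/-- The sample mean. -/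
def sampleMean (x : ℤ → L2) (n : ℕ) : L2 := (n : ℝ)⁻¹ • ∑ i ∈ Finset.Icc (1 : ℤ) n, x i

/-- The partial sample covariance operator `ĉ_u`, with kernel
`n⁻¹ ∑_{i ≤ ⌊n u⌋} (x_i(t) - x̄(t)) (x_i(t') - x̄(t'))`. -/
def partialCov (x : ℤ → L2) (n : ℕ) (u : ℝ) : L2 →L[ℝ] L2 :=
  (n : ℝ)⁻¹ • ∑ i ∈ Finset.Icc (1 : ℤ) ⌊n * u⌋, tensorSq (x i - sampleMean x n)

/-- The lag-`l` sample cross-covariance of two real sequences,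
`n⁻¹ ∑_i (a_i - ā) (b_{i+l} - b̄)` over the `i` with `1 ≤ i ≤ n` and `1 ≤ i + l ≤ n`. -/
def sampleCrossCov (n : ℕ) (a b : ℤ → ℝ) (l : ℤ) : ℝ :=
  (n : ℝ)⁻¹ * ∑ i ∈ Finset.Icc (max 1 (1 - l)) (min (n : ℤ) (n - l)),
    (a i - (n : ℝ)⁻¹ * ∑ k ∈ Finset.Icc (1 : ℤ) n, a k) *
    (b (i + l) - (n : ℝ)⁻¹ * ∑ k ∈ Finset.Icc (1 : ℤ) n, b k)

/-- The kernel lag-window estimator `∑_{l ∈ ℤ} w(l / h) γ̂_l`; only `|l| < n` contributes. -/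
def lagWindow (w : ℝ → ℝ) (h : ℝ) (n : ℕ) (a b : ℤ → ℝ) : ℝ :=
  ∑' l : ℤ, w (l / h) * sampleCrossCov n a b l

/-- The estimated scores
`θ̂_{i,j} = ⟨(x_i - x̄) ⊗ (x_i - x̄) - Ĉ_1, φ̂_j ⊗ φ̂_j⟩`. -/
def thetaHat {d : ℕ} (x : ℤ → L2) (n : ℕ) (φ : Fin d → L2) (j : Fin d) (i : ℤ) : ℝ :=
  pairing (tensorSq (x i - sampleMean x n) - partialCov x n 1) (φ j)

/-- The estimator `Σ̂_d` of the long-run covariance matrix of the scores. -/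
def sigmaHat {d : ℕ} (w : ℝ → ℝ) (h : ℝ) (x : ℤ → L2) (n : ℕ) (φ : Fin d → L2) :
    Matrix (Fin d) (Fin d) ℝ :=
  Matrix.of fun j j' => lagWindow w h n (thetaHat x n φ j) (thetaHat x n φ j')

/-- The CUSUM vector `κ_n(u)`, with entries `√n (λ̂_j(u) - (⌊n u⌋ / n) λ̂_j(1))`. -/
def kappa (d : ℕ) (x : ℤ → L2) (n : ℕ) (u : ℝ) : Fin d → ℝ := fun j =>
  √(n : ℝ) * (eigval (partialCov x n u) j -
    ((⌊n * u⌋ : ℤ) : ℝ) / n * eigval (partialCov x n 1) j)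

/-- `J_n(δ) = sup_{δ ≤ u ≤ 1} κ_n(u)ᵀ Σ̂_d⁻¹ κ_n(u)`. -/
def statJ {d : ℕ} (w : ℝ → ℝ) (h : ℝ) (δ : ℝ) (x : ℤ → L2) (n : ℕ) (φ : Fin d → L2) : ℝ :=
  ⨆ u : Set.Icc δ 1, kappa d x n u ⬝ᵥ ((sigmaHat w h x n φ)⁻¹ *ᵥ kappa d x n u)

/-- `I_{j,n}(δ) = sup_{δ ≤ u ≤ 1} (√n / σ̂_j) |λ̂_j(u) - (⌊n u⌋ / n) λ̂_j(1)|`, with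
`σ̂_j² = Σ̂_d(j, j)`. -/
def statI {d : ℕ} (w : ℝ → ℝ) (h : ℝ) (δ : ℝ) (x : ℤ → L2) (n : ℕ) (φ : Fin d → L2)
    (j : Fin d) : ℝ :=
  ⨆ u : Set.Icc δ 1, (√(sigmaHat w h x n φ j j))⁻¹ * |kappa d x n u j|

/-- The partial sample trace `T_n(u) = n⁻¹ ∑_{i ≤ ⌊n u⌋} ‖x_i - x̄‖²`. -/
def partialTrace (x : ℤ → L2) (n : ℕ) (u : ℝ) : ℝ :=
  (n : ℝ)⁻¹ * ∑ i ∈ Finset.Icc (1 : ℤ) ⌊n * u⌋, ‖x i - sampleMean x n‖ ^ 2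

/-- The estimator `σ̂_T²`, from `ξ̂_i = ‖x_i - x̄‖²`. -/
def sigmaHatTrace (w : ℝ → ℝ) (h : ℝ) (x : ℤ → L2) (n : ℕ) : ℝ :=
  lagWindow w h n (fun i => ‖x i - sampleMean x n‖ ^ 2) (fun i => ‖x i - sampleMean x n‖ ^ 2)

/-- `M_n = sup_{0 ≤ u ≤ 1} (√n / σ̂_T) |T_n(u) - u T_n(1)|`. -/
def statM (w : ℝ → ℝ) (h : ℝ) (x : ℤ → L2) (n : ℕ) : ℝ :=
  ⨆ u : Set.Icc (0 : ℝ) 1, √(n : ℝ) / √(sigmaHatTrace w h x n) *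
    |partialTrace x n u - u * partialTrace x n 1|

/-! ### Weight function, bandwidth and mode of convergence -/

/-- The conditions on the weight function. -/
structure IsWeight (w : ℝ → ℝ) : Prop where
  zero : w 0 = 1
  even : ∀ u, w (-u) = w u
  le_one : ∀ u, w u ≤ 1
  bounded_support : ∃ m : ℝ, 0 < m ∧ ∀ u, m < |u| → w u = 0
  continuous : Continuous w
  order : ∃ b : ℝ, 0 < b ∧ ∃ q : ℝ, 0 < q ∧
    Tendsto (fun u : ℝ => u ^ (-b) * (1 - w u)) (𝓝[>] 0) (𝓝 q)
  integral_pos : 0 < ∫ u, w u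

/-- The conditions on the bandwidth: `h(n) > 0` eventually, `1 / h(n) → 0`, `h(n) / √n → 0`. -/
structure IsBandwidth (h : ℕ → ℝ) : Prop where
  tendsto_atTop : Tendsto h atTop atTop
  rate : Tendsto (fun n : ℕ => h n / √(n : ℝ)) atTop (𝓝 0)

/-- `Y_n → ∞` in probability. -/
def TendstoInProbTop {Ω : Type*} [MeasurableSpace Ω] (P : Measure Ω) (Y : ℕ → Ω → ℝ) : Prop :=
  ∀ K : ℝ, Tendsto (fun n => P {ω | Y n ω ≤ K}) atTop (𝓝 0)

end

end SpectralBreak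

/-! Each statistic is a supremum over `u`, so its value at the break `u = τ` is a lower bound. There
the CUSUM of the eigenvalues divided by `√n` tends to `τ(1 - τ)(λ⁽¹⁾ - λ⁽²⁾)`: the partial
covariance operators converge at rate `n^{-1/2}` and Weyl's inequality transfers this to eigenvalues
(`tendsto_kappa_div`). The squared numerators are therefore of order `n`. The long-run covariance
estimators are not consistent under the alternative, and the theorem comes down to showing that they
are still positive and of smaller order than `n`.

Since the first `d` eigenspaces are one-dimensional and shared, each `φ*_j` is an eigenfunction of
both `c₁` and `c₂` (`common_eigenfunctions`). Hence `⟨ε_i, φ*_j⟩²` has mean `λ_j⁽ᵏ⁾` in regime `k`,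
and the estimated scores are centered noise plus a step of height `D_j = λ_j⁽¹⁾ - λ_j⁽²⁾`, up to a
constant and an error `O(n^{-1/2})(1 + ‖ε_i‖²)` (`isApproxFeature_thetaHat`). Expanding the bilinear
lag-window estimator gives `Σ̂ = s_n D Dᵀ + V + o_P(1)` with `V = τ Σ⁽¹⁾ + (1 - τ) Σ⁽²⁾`
(`tendsto_lagWindow_sub`, `tendsto_sigmaHat_sub`). Here `s_n` is the lag-window form of a centered
step. It behaves like `h τ(1 - τ) ∫ w`: it diverges because `∫ w > 0` (`tendsto_quadForm_stepSeq`),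
and it is `o(n)` because `h = o(√n)` (`tendsto_stepForm_div`).

If `D_j ≠ 0`, then `n / σ̂_j² → ∞`, which gives (b). The same argument for `‖ε_i‖²`, whose mean is
the trace, gives (c). For (a), `Σ̂` is positive definite with probability tending to one because `V`
is and `s_n D Dᵀ` only helps (`exists_posDef_of_sub_le`). Then Cauchy-Schwarz in the form `κᵀ Σ̂⁻¹ κ
≥ (κ·D)² / (Dᵀ Σ̂ D)` (`sq_dotProduct_le_of_posDef`) leaves a quotient of order `n / s_n`.

The probabilistic core is the `L¹` convergence of the noise part of `Σ̂` with growing bandwidth,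
using only second moments of the scores (`eventually_integral_abs_quadForm_sub_le`). The scores are
decomposed into dyadic blocks depending on `2 ^ r` innovations. For two finitely dependent
sequences, the terms with long lags are orthogonal at a distance and contribute `√(h / n)`, while
the short lags are few. Summed over blocks this yields a first-moment bound free of `h`
(`IsMultiScale.integral_abs_quadForm_le`), so the tail blocks are uniformly negligible, and finitely
many bounded blocks concentrate. -/

namespace SpectralBreak

/-! ### Eigenvalues of positive compact operators: deflation and variational bounds. -/

section Operators

/-- A positive compact operator. -/
structure IsPosCompact {E : Type*} [NormedAddCommGroup E] [InnerProductSpace ℝ E]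
    (T : E →L[ℝ] E) : Prop where
  pos : T.IsPositive
  compact : IsCompactOperator T

section General

variable {E : Type*} [NormedAddCommGroup E] [InnerProductSpace ℝ E]

theorem IsPosCompact.symm {T : E →L[ℝ] E} (hT : IsPosCompact T) (x y : E) :
    ⟪T x, y⟫ = ⟪x, T y⟫ := hT.pos.1 x y

theorem IsPosCompact.nonneg {T : E →L[ℝ] E} (hT : IsPosCompact T) (x : E) : 0 ≤ ⟪T x, x⟫ :=
  hT.pos.inner_nonneg_left x

theorem inner_apply_self_le_opNorm (T : E →L[ℝ] E) (x : E) : ⟪T x, x⟫ ≤ ‖T‖ * ‖x‖ ^ 2 := by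
  calc ⟪T x, x⟫ ≤ ‖T x‖ * ‖x‖ := real_inner_le_norm _ _
    _ ≤ ‖T‖ * ‖x‖ * ‖x‖ := by gcongr; exact T.le_opNorm x
    _ = _ := by ring

/-- If `‖T‖` were in the resolvent set, all Rayleigh quotients would stay below `‖T‖ - ε`; but for a
symmetric operator the norm is the supremum of their absolute values, and positivity makes the
absolute values superfluous. A nonzero spectral value of a compact operator is an eigenvalue. -/
theorem IsPosCompact.exists_top_eigenvector [CompleteSpace E] {T : E →L[ℝ] E}
    (hT : IsPosCompact T) (h0 : T ≠ 0) : ∃ v : E, ‖v‖ = 1 ∧ T v = ‖T‖ • v := by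
  have hnt : Nontrivial E := by
    by_contra h
    rw [not_nontrivial_iff_subsingleton] at h
    exact h0 (Subsingleton.elim _ _)
  have hn : ‖T‖ ≠ 0 := norm_ne_zero_iff.2 h0
  have hspec : ‖T‖ ∈ spectrum ℝ T := by
    by_contra h
    obtain ⟨ε, hε, hx⟩ := T.rayleighQuotient_le_of_norm_mem_resolventSet
      (by simpa [spectrum.mem_resolventSet_iff, spectrum.mem_iff] using h)
    have h1 := T.norm_eq_iSup_rayleighQuotient hT.pos.1
    have h2 : ⨆ x, |T.rayleighQuotient x| ≤ ‖T‖ - ε := by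
      refine ciSup_le fun x => ?_
      rw [abs_of_nonneg]
      · exact hx x
      · exact div_nonneg (hT.pos.2 x) (by positivity)
    linarith
  have hev := (hT.compact.hasEigenvalue_iff_mem_spectrum hn).2 hspec
  obtain ⟨v, hv⟩ := hev.exists_hasEigenvector
  refine ⟨‖v‖⁻¹ • v, ?_, ?_⟩
  · rw [norm_smul, norm_inv, norm_norm, inv_mul_cancel₀ (norm_ne_zero_iff.2 hv.2)]
  · have := hv.apply_eq_smul
    rw [map_smul]
    change ‖v‖⁻¹ • (T : Module.End ℝ E) v = _
    rw [this, smul_comm]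

/-- A linear combination of `m` vectors, not all coefficients zero, that is orthogonal to fewer
than `m` given vectors. -/
theorem exists_orthogonal_combination {j m : ℕ} (hjm : j < m) (v : Fin m → E) (u : Fin j → E) :
    ∃ c : Fin m → ℝ, c ≠ 0 ∧ ∀ i, ⟪u i, ∑ k, c k • v k⟫ = 0 := by
  let f : (Fin m → ℝ) →ₗ[ℝ] (Fin j → ℝ) :=
    { toFun := fun c i => ⟪u i, ∑ k, c k • v k⟫
      map_add' := fun c c' => by
        ext i; simp [add_smul, Finset.sum_add_distrib, inner_add_right]
      map_smul' := fun t c => by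
        ext i; simp [mul_smul, ← Finset.smul_sum, inner_smul_right] }
  have hk : LinearMap.ker f ≠ ⊥ := LinearMap.ker_ne_bot_of_finrank_lt (by simpa using hjm)
  obtain ⟨c, hc, hc0⟩ := Submodule.exists_mem_ne_zero_of_ne_bot hk
  exact ⟨c, hc0, fun i => congrFun (LinearMap.mem_ker.1 hc) i⟩

theorem norm_sq_orthonormal_combination {m : ℕ} {v : Fin m → E} (hv : Orthonormal ℝ v)
    (c : Fin m → ℝ) : ‖∑ k, c k • v k‖ ^ 2 = ∑ k, c k ^ 2 := by
  rw [← real_inner_self_eq_norm_sq, hv.inner_sum]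
  simp [sq]

theorem sum_sq_pos_of_ne_zero {m : ℕ} {c : Fin m → ℝ} (hc : c ≠ 0) : 0 < ∑ k, c k ^ 2 := by
  obtain ⟨k, hk⟩ := Function.ne_iff.1 hc
  exact Finset.sum_pos' (fun _ _ => sq_nonneg _) ⟨k, Finset.mem_univ _, by
    have : c k ≠ 0 := hk
    positivity⟩

theorem inner_apply_eigen_combination {m : ℕ} {v : Fin m → E} (hv : Orthonormal ℝ v)
    {T : E →L[ℝ] E} {s : Fin m → ℝ} (hT : ∀ i, T (v i) = s i • v i) (c : Fin m → ℝ) :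
    ⟪T (∑ k, c k • v k), ∑ k, c k • v k⟫ = ∑ k, s k * c k ^ 2 := by
  have : T (∑ k, c k • v k) = ∑ k, (c k * s k) • v k := by
    rw [map_sum]
    exact Finset.sum_congr rfl fun k _ => by rw [map_smul, hT, smul_smul]
  rw [this, hv.inner_sum]
  exact Finset.sum_congr rfl fun k _ => by simp; ring

/-- `T` with the eigenpairs `(l i, u i)` removed. -/
noncomputable def deflate {j : ℕ} (T : E →L[ℝ] E) (u : Fin j → E) (l : Fin j → ℝ) : E →L[ℝ] E :=
  T - ∑ i, l i • rankOne ℝ (u i) (u i)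

theorem deflate_apply {j : ℕ} (T : E →L[ℝ] E) (u : Fin j → E) (l : Fin j → ℝ) (x : E) :
    deflate T u l x = T x - ∑ i, (l i * ⟪u i, x⟫) • u i := by
  simp [deflate, mul_smul]

theorem deflate_apply_of_orthogonal {j : ℕ} (T : E →L[ℝ] E) (u : Fin j → E) (l : Fin j → ℝ)
    {x : E} (hx : ∀ i, ⟪u i, x⟫ = 0) : deflate T u l x = T x := by
  simp [deflate_apply, hx]

theorem isCompactOperator_rankOne (x y : E) : IsCompactOperator (rankOne ℝ x y) := by
  have h : IsCompactOperator (ContinuousLinearMap.toSpanSingleton ℝ x) :=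
    isCompactOperator_of_locallyCompactSpace_rng (ContinuousLinearMap.toSpanSingleton ℝ x)
  exact h.comp_clm (innerSL ℝ y)

theorem isCompactOperator_sum {ι : Type*} (s : Finset ι) (f : ι → E →L[ℝ] E)
    (hf : ∀ i ∈ s, IsCompactOperator (f i)) : IsCompactOperator (∑ i ∈ s, f i : E →L[ℝ] E) :=
  Submodule.sum_mem (compactOperator (RingHom.id ℝ) E E) hf

/-- With `p` the projection of `x` on the span of `u`, the deflation sends `x` to `T (x - p)`. This
is orthogonal to `p` because the span is invariant under the symmetric `T`, so the form at `x`
equals that of `T` at `x - p`. -/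
theorem deflate_isPosCompact {j : ℕ} {T : E →L[ℝ] E} (hT : IsPosCompact T) {u : Fin j → E}
    (hu : Orthonormal ℝ u) {l : Fin j → ℝ} (hl : ∀ i, T (u i) = l i • u i) :
    IsPosCompact (deflate T u l) := by
  refine ⟨(ContinuousLinearMap.isPositive_iff _).2 ⟨fun x y => ?_, fun x => ?_⟩, ?_⟩
  · change ⟪deflate T u l x, y⟫ = ⟪x, deflate T u l y⟫
    simp only [deflate_apply, inner_sub_left, inner_sub_right, hT.symm x y, sum_inner, inner_sum,
      inner_smul_left, inner_smul_right]
    congr 1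
    refine Finset.sum_congr rfl fun i _ => ?_
    rw [real_inner_comm x (u i)]
    simp; ring
  · set p := ∑ i, ⟪u i, x⟫ • u i with hp
    have hTp : T p = ∑ i, (l i * ⟪u i, x⟫) • u i := by
      rw [hp, map_sum]
      exact Finset.sum_congr rfl fun i _ => by rw [map_smul, hl, smul_smul, mul_comm]
    have hup : ∀ i, ⟪u i, x - p⟫ = 0 := fun i => by
      rw [inner_sub_right, hp, hu.inner_right_fintype]; simp
    have h1 : deflate T u l x = T (x - p) := by rw [deflate_apply, ← hTp, map_sub]
    have h2 : ⟪T (x - p), p⟫ = 0 := by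
      rw [hT.symm, hTp, inner_sum]
      refine Finset.sum_eq_zero fun i _ => ?_
      rw [inner_smul_right, real_inner_comm (u i) (x - p), hup, mul_zero]
    have h3 := hT.nonneg (x - p)
    rw [inner_sub_right, h2, sub_zero] at h3
    rwa [h1]
  · exact hT.compact.sub (isCompactOperator_sum _ _ fun i _ =>
      (isCompactOperator_rankOne _ _).smul (l i))

end General

/-- The dimension count of Courant-Fischer: a space of dimension `j + 1` contains a nonzero vector
orthogonal to `j` given ones. Only a lower bound of the form on the span is asked, so `v` need not
consist of eigenvectors; Weyl's inequality uses this. -/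
theorem eigval_set_le_of_forall_orthogonal {T : L2 →L[ℝ] L2} {j : ℕ} (u : Fin j → L2) {b : ℝ}
    (hb : ∀ x, (∀ i, ⟪u i, x⟫ = 0) → ⟪T x, x⟫ ≤ b * ‖x‖ ^ 2) {r : ℝ} {v : Fin (j + 1) → L2}
    (hv : Orthonormal ℝ v) (hr : ∀ c : Fin (j + 1) → ℝ,
      r * (∑ k, c k ^ 2) ≤ ⟪T (∑ k, c k • v k), ∑ k, c k • v k⟫) : r ≤ b := by
  obtain ⟨c, hc0, hc⟩ := exists_orthogonal_combination (Nat.lt_succ_self j) v u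
  have h1 := hb _ hc
  rw [norm_sq_orthonormal_combination hv] at h1
  exact le_of_mul_le_mul_right ((hr c).trans h1) (sum_sq_pos_of_ne_zero hc0)

theorem eigval_le {T : L2 →L[ℝ] L2} {j : ℕ} (u : Fin j → L2) {b : ℝ} (hb0 : 0 ≤ b)
    (hb : ∀ x, (∀ i, ⟪u i, x⟫ = 0) → ⟪T x, x⟫ ≤ b * ‖x‖ ^ 2) : eigval T j ≤ b := by
  -- `hb0` covers the case of an empty set, whose supremum is `0` by default.
  refine Real.sSup_le ?_ hb0
  rintro r ⟨v, s, hv, hs⟩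
  refine eigval_set_le_of_forall_orthogonal u hb hv fun c => ?_
  rw [inner_apply_eigen_combination hv (fun i => (hs i).2), Finset.mul_sum]
  exact Finset.sum_le_sum fun k _ => mul_le_mul_of_nonneg_right (hs k).1 (sq_nonneg _)

theorem eigval_bddAbove (T : L2 →L[ℝ] L2) (j : ℕ) :
    BddAbove {r : ℝ | ∃ (v : Fin (j + 1) → L2) (s : Fin (j + 1) → ℝ),
      Orthonormal ℝ v ∧ ∀ i, r ≤ s i ∧ T (v i) = s i • v i} := by
  refine ⟨‖T‖, ?_⟩
  rintro r ⟨v, s, hv, hs⟩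
  have h1 := inner_apply_self_le_opNorm T (v 0)
  rw [(hs 0).2, inner_smul_left, real_inner_self_eq_norm_sq, hv.1 0] at h1
  simp at h1
  exact (hs 0).1.trans h1

theorem le_eigval {T : L2 →L[ℝ] L2} {j : ℕ} {r : ℝ} {v : Fin (j + 1) → L2}
    {s : Fin (j + 1) → ℝ} (hv : Orthonormal ℝ v) (hr : ∀ i, r ≤ s i)
    (hs : ∀ i, T (v i) = s i • v i) : r ≤ eigval T j :=
  le_csSup (eigval_bddAbove T j) ⟨v, s, hv, fun i => ⟨hr i, hs i⟩⟩

theorem eigval_nonneg {T : L2 →L[ℝ] L2} (hT : IsPosCompact T) (j : ℕ) : 0 ≤ eigval T j := by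
  rcases Set.eq_empty_or_nonempty {r : ℝ | ∃ (v : Fin (j + 1) → L2) (s : Fin (j + 1) → ℝ),
      Orthonormal ℝ v ∧ ∀ i, r ≤ s i ∧ T (v i) = s i • v i} with h | ⟨r, v, s, hv, hs⟩
  · rw [eigval, h, Real.sSup_empty]
  · refine le_eigval hv (fun i => ?_) fun i => (hs i).2
    have h1 := hT.nonneg (v i)
    rw [(hs i).2, inner_smul_left, real_inner_self_eq_norm_sq, hv.1 i] at h1
    simpa using h1

theorem orthonormal_snoc {j : ℕ} {u : Fin j → L2} (hu : Orthonormal ℝ u) {v : L2}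
    (hv : ‖v‖ = 1) (huv : ∀ i, ⟪u i, v⟫ = 0) :
    Orthonormal ℝ (Fin.snoc u v : Fin (j + 1) → L2) := by
  refine ⟨fun i => ?_, fun i k hik => ?_⟩
  · refine Fin.lastCases ?_ (fun i => ?_) i
    · simpa using hv
    · simpa using hu.1 i
  · revert hik
    refine Fin.lastCases ?_ (fun i => ?_) i <;> refine Fin.lastCases ?_ (fun k => ?_) k <;> intro hik
    · exact absurd rfl hik
    · simpa [real_inner_comm] using huv k
    · simpa using huv i
    · simpa using hu.2 (fun h => hik (by rw [h]))

/-- If `r` exceeded `eigval T j`, take the first `k` with `eigval T k < r`. Then `u 0, …, u (k - 1)`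
and `v` are `k + 1` orthonormal eigenvectors with eigenvalues at least `r`, which contradicts the
choice of `k`. Monotonicity of `eigval` is not needed. -/
theorem le_eigval_snoc {T : L2 →L[ℝ] L2} {j : ℕ} {u : Fin j → L2} (hu : IsEigenfunctions T u)
    {v : L2} (hv : ‖v‖ = 1) (huv : ∀ i, ⟪u i, v⟫ = 0) {r : ℝ} (hTv : T v = r • v) :
    r ≤ eigval T j := by
  by_contra hlt
  push Not at hlt
  classical
  have hex : ∃ k, k ≤ j ∧ eigval T k < r := ⟨j, le_rfl, hlt⟩
  obtain ⟨hkj, hk⟩ := Nat.find_spec hex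
  set k := Nat.find hex with hkdef
  have hmin : ∀ i, i < k → r ≤ eigval T i := fun i hi => by
    by_contra h
    exact Nat.find_min hex hi ⟨hi.le.trans hkj, not_le.1 h⟩
  have hu' : Orthonormal ℝ (fun i : Fin k => u (Fin.castLE hkj i)) :=
    hu.1.comp _ (Fin.castLE_injective hkj)
  have := le_eigval (T := T) (r := r)
    (s := (Fin.snoc (fun i : Fin k => eigval T i) r : Fin (k + 1) → ℝ))
    (orthonormal_snoc hu' hv (fun i => huv _)) (fun i => by
      refine Fin.lastCases ?_ (fun i => ?_) i
      · simp
      · simpa using hmin i i.2) (fun i => by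
      refine Fin.lastCases ?_ (fun i => ?_) i
      · simpa using hTv
      · simpa using hu.2 (Fin.castLE hkj i))
  linarith

/-- The deflation annihilates `u` and is symmetric, so its eigenvectors for a nonzero eigenvalue are
orthogonal to `u`; on that complement it agrees with `T`. -/
theorem deflate_top {T : L2 →L[ℝ] L2} (hT : IsPosCompact T) {j : ℕ} {u : Fin j → L2}
    (hu : IsEigenfunctions T u) (h0 : deflate T u (fun i => eigval T i) ≠ 0) :
    ∃ v : L2, ‖v‖ = 1 ∧ (∀ i, ⟪u i, v⟫ = 0) ∧
      T v = ‖deflate T u (fun i => eigval T i)‖ • v := by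
  set D := deflate T u (fun i => eigval T i) with hD
  have hDpc : IsPosCompact D := deflate_isPosCompact hT hu.1 hu.2
  obtain ⟨v, hv, hDv⟩ := hDpc.exists_top_eigenvector h0
  have hDu : ∀ i, D (u i) = 0 := fun i => by
    rw [hD, deflate_apply, hu.2 i, Finset.sum_eq_single i]
    · simp [hu.1.1 i]
    · intro k _ hk
      rw [hu.1.2 hk]; simp
    · simp
  have huv : ∀ i, ⟪u i, v⟫ = 0 := fun i => by
    have h1 : ⟪D (u i), v⟫ = ⟪u i, D v⟫ := hDpc.symm _ _
    rw [hDu, hDv, inner_zero_left, inner_smul_right] at h1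
    exact (mul_eq_zero.1 h1.symm).resolve_left (norm_ne_zero_iff.2 h0)
  exact ⟨v, hv, huv, by rw [← hDv, hD, deflate_apply_of_orthogonal _ _ _ huv]⟩

theorem norm_deflate_le {T : L2 →L[ℝ] L2} (hT : IsPosCompact T) {j : ℕ} {u : Fin j → L2}
    (hu : IsEigenfunctions T u) : ‖deflate T u (fun i => eigval T i)‖ ≤ eigval T j := by
  by_cases h0 : deflate T u (fun i => eigval T i) = 0
  · rw [h0, norm_zero]; exact eigval_nonneg hT j
  · obtain ⟨v, hv, huv, hTv⟩ := deflate_top hT hu h0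
    exact le_eigval_snoc hu hv huv hTv

theorem inner_apply_le_eigval {T : L2 →L[ℝ] L2} (hT : IsPosCompact T) {j : ℕ} {u : Fin j → L2}
    (hu : IsEigenfunctions T u) {x : L2} (hx : ∀ i, ⟪u i, x⟫ = 0) :
    ⟪T x, x⟫ ≤ eigval T j * ‖x‖ ^ 2 := by
  rw [← deflate_apply_of_orthogonal T u (fun i => eigval T i) hx]
  exact (inner_apply_self_le_opNorm _ x).trans
    (mul_le_mul_of_nonneg_right (norm_deflate_le hT hu) (sq_nonneg _))

end Operators

/-! ### Existence of eigenfunctions, Weyl's inequality and the trace formula. -/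

section Operators

/-- `L²([0,1])` contains a sequence of nonzero pairwise orthogonal vectors. -/
theorem exists_orthonormal_seq : ∃ f : ℕ → L2, Orthonormal ℝ f := by
  let s : ℕ → Set ℝ := fun k => Set.Ioc (1 / ((k : ℝ) + 2)) (1 / ((k : ℝ) + 1))
  have hs : ∀ k, MeasurableSet (s k) := fun k => measurableSet_Ioc
  have hlt : ∀ k : ℕ, 1 / ((k : ℝ) + 2) < 1 / ((k : ℝ) + 1) := fun k =>
    one_div_lt_one_div_of_lt (by positivity) (by linarith)
  have hfin : ∀ k, (volume.restrict (Set.Icc (0 : ℝ) 1)) (s k) ≠ ∞ := fun k => measure_ne_top _ _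
  have hpos : ∀ k, 0 < (volume.restrict (Set.Icc (0 : ℝ) 1)).real (s k) := fun k => by
    rw [measureReal_restrict_apply (hs k), Set.inter_eq_left.2]
    · simpa [s] using hlt k
    · intro x hx
      refine ⟨(by positivity : (0 : ℝ) < 1 / ((k : ℝ) + 2)).le.trans hx.1.le, hx.2.trans ?_⟩
      rw [div_le_one (by positivity)]
      linarith [(Nat.cast_nonneg k : (0 : ℝ) ≤ k)]
  have hlt' : ∀ i k, i < k → s i ∩ s k = ∅ := fun i k hik => by
    ext x
    simp only [s, Set.mem_inter_iff, Set.mem_Ioc, Set.mem_empty_iff_false, iff_false]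
    rintro ⟨⟨h1, -⟩, -, h2⟩
    have : 1 / ((k : ℝ) + 1) ≤ 1 / ((i : ℝ) + 2) := by
      apply one_div_le_one_div_of_le (by positivity)
      have : (i : ℝ) + 1 ≤ k := by exact_mod_cast hik
      linarith
    linarith
  let g : ℕ → L2 := fun k => indicatorConstLp 2 (hs k) (hfin k) (1 : ℝ)
  have hg : ∀ i k, ⟪g i, g k⟫ = (volume.restrict (Set.Icc (0 : ℝ) 1)).real (s i ∩ s k) := by
    intro i k
    rw [L2.inner_indicatorConstLp_indicatorConstLp]
    simp
  have hg0 : ∀ k, ‖g k‖ ≠ 0 := fun k h => by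
    have h1 := hg k k
    rw [real_inner_self_eq_norm_sq, h, Set.inter_self] at h1
    have := hpos k
    rw [zero_pow two_ne_zero] at h1
    linarith
  refine ⟨fun k => ‖g k‖⁻¹ • g k, fun k => ?_, fun i k hik => ?_⟩
  · rw [norm_smul, norm_inv, norm_norm, inv_mul_cancel₀ (hg0 k)]
  · have : ⟪g i, g k⟫ = 0 := by
      rw [hg]
      rcases lt_or_gt_of_ne hik with h | h
      · rw [hlt' i k h]; simp
      · rw [Set.inter_comm, hlt' k i h]; simp
    simp [inner_smul_left, inner_smul_right, this]

theorem exists_unit_orthogonal {j : ℕ} (u : Fin j → L2) :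
    ∃ v : L2, ‖v‖ = 1 ∧ ∀ i, ⟪u i, v⟫ = 0 := by
  obtain ⟨f, hf⟩ := exists_orthonormal_seq
  have hf' : Orthonormal ℝ (fun k : Fin (j + 1) => f k) := hf.comp _ Fin.val_injective
  obtain ⟨c, hc0, hc⟩ := exists_orthogonal_combination (Nat.lt_succ_self j)
    (fun k : Fin (j + 1) => f k) u
  set y := ∑ k, c k • f k
  have hy : ‖y‖ ≠ 0 := fun h => by
    have h1 := norm_sq_orthonormal_combination hf' c
    have h2 := sum_sq_pos_of_ne_zero hc0
    rw [← h1] at h2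
    change 0 < ‖y‖ ^ 2 at h2
    rw [h] at h2
    norm_num at h2
  refine ⟨‖y‖⁻¹ • y, ?_, fun i => ?_⟩
  · rw [norm_smul, norm_inv, norm_norm, inv_mul_cancel₀ hy]
  · rw [inner_smul_right, hc i, mul_zero]

/-- The spectral theorem by repeated deflation. It shows in particular that the supremum in `eigval`
is attained by eigenvectors. -/
theorem exists_isEigenfunctions {T : L2 →L[ℝ] L2} (hT : IsPosCompact T) (j : ℕ) :
    ∃ u : Fin j → L2, IsEigenfunctions T u := by
  induction j with
  | zero => exact ⟨fun i => i.elim0, ⟨fun i => i.elim0, fun i => i.elim0⟩, fun i => i.elim0⟩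
  | succ j ih =>
    obtain ⟨u, hu⟩ := ih
    suffices h : ∃ v : L2, ‖v‖ = 1 ∧ (∀ i, ⟪u i, v⟫ = 0) ∧ T v = eigval T j • v by
      obtain ⟨v, hv, huv, hTv⟩ := h
      refine ⟨Fin.snoc u v, orthonormal_snoc hu.1 hv huv, fun i => ?_⟩
      refine Fin.lastCases ?_ (fun i => ?_) i
      · simpa using hTv
      · simpa using hu.2 i
    by_cases h0 : deflate T u (fun i => eigval T i) = 0
    -- Here `T` vanishes on the complement of `u`; as the space is infinite-dimensional, a further
    -- eigenvector exists there, with eigenvalue `0`.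
    · obtain ⟨v, hv, huv⟩ := exists_unit_orthogonal u
      have hT0 : ∀ x, (∀ i, ⟪u i, x⟫ = 0) → T x = 0 := fun x hx => by
        rw [← deflate_apply_of_orthogonal T u (fun i => eigval T i) hx, h0]; simp
      have : eigval T j = 0 := le_antisymm
        (eigval_le u le_rfl fun x hx => by rw [hT0 x hx]; simp) (eigval_nonneg hT j)
      exact ⟨v, hv, huv, by rw [hT0 v huv, this, zero_smul]⟩
    · obtain ⟨v, hv, huv, hTv⟩ := deflate_top hT hu h0
      refine ⟨v, hv, huv, ?_⟩
      rw [hTv, le_antisymm (eigval_le u (norm_nonneg _) fun x hx => ?_) (norm_deflate_le hT hu)]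
      rw [← deflate_apply_of_orthogonal T u (fun i => eigval T i) hx]
      exact inner_apply_self_le_opNorm _ x

theorem le_eigval_of_forall_combination {T : L2 →L[ℝ] L2} (hT : IsPosCompact T) {j : ℕ} {r : ℝ}
    {v : Fin (j + 1) → L2} (hv : Orthonormal ℝ v) (hr : ∀ c : Fin (j + 1) → ℝ,
      r * (∑ k, c k ^ 2) ≤ ⟪T (∑ k, c k • v k), ∑ k, c k • v k⟫) : r ≤ eigval T j := by
  obtain ⟨u, hu⟩ := exists_isEigenfunctions hT j
  exact eigval_set_le_of_forall_orthogonal u (fun x hx => inner_apply_le_eigval hT hu hx) hv hr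

theorem eigval_antitone {T : L2 →L[ℝ] L2} (hT : IsPosCompact T) : Antitone (eigval T) := by
  refine antitone_nat_of_succ_le fun j => ?_
  refine Real.sSup_le ?_ (eigval_nonneg hT j)
  rintro r ⟨v, s, hv, hs⟩
  exact le_eigval (hv.comp _ (Fin.castSucc_injective _)) (fun i => (hs i.castSucc).1)
    fun i => (hs i.castSucc).2

theorem eigval_eq {T : L2 →L[ℝ] L2} {j : ℕ} {v : Fin (j + 1) → L2}
    {s : Fin (j + 1) → ℝ} {b : ℝ} (hv : Orthonormal ℝ v) (hs : ∀ i, T (v i) = s i • v i)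
    (hb0 : 0 ≤ b) (hbs : ∀ i, b ≤ s i)
    (hb : ∀ x, (∀ i : Fin j, ⟪v i.castSucc, x⟫ = 0) → ⟪T x, x⟫ ≤ b * ‖x‖ ^ 2) :
    eigval T j = b :=
  le_antisymm (eigval_le _ hb0 hb) (le_eigval hv hbs hs)

/-- **Weyl's inequality.** -/
theorem eigval_le_add_norm_sub {A B : L2 →L[ℝ] L2} (hA : IsPosCompact A) (hB : IsPosCompact B)
    (j : ℕ) : eigval A j ≤ eigval B j + ‖A - B‖ := by
  obtain ⟨u, hu⟩ := exists_isEigenfunctions hA (j + 1)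
  have : eigval A j - ‖A - B‖ ≤ eigval B j := by
    refine le_eigval_of_forall_combination hB hu.1 fun c => ?_
    set x := ∑ k, c k • u k with hx
    have h1 : eigval A j * ∑ k, c k ^ 2 ≤ ⟪A x, x⟫ := by
      rw [hx, inner_apply_eigen_combination hu.1 hu.2, Finset.mul_sum]
      exact Finset.sum_le_sum fun k _ => mul_le_mul_of_nonneg_right
        (eigval_antitone hA (Nat.lt_succ_iff.1 k.2)) (sq_nonneg _)
    have h2 := inner_apply_self_le_opNorm (A - B) x
    rw [sub_apply, inner_sub_left, hx, norm_sq_orthonormal_combination hu.1, ← hx] at h2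
    linarith
  linarith

theorem abs_eigval_sub_le {A B : L2 →L[ℝ] L2} (hA : IsPosCompact A) (hB : IsPosCompact B)
    (j : ℕ) : |eigval A j - eigval B j| ≤ ‖A - B‖ := by
  have h1 := eigval_le_add_norm_sub hA hB j
  have h2 := eigval_le_add_norm_sub hB hA j
  rw [norm_sub_rev] at h2
  rw [abs_le]
  constructor <;> linarith

theorem IsPosCompact.smul {E : Type*} [NormedAddCommGroup E] [InnerProductSpace ℝ E]
    {T : E →L[ℝ] E} (hT : IsPosCompact T) {t : ℝ} (ht : 0 ≤ t) : IsPosCompact (t • T) :=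
  ⟨hT.pos.smul_of_nonneg ht, hT.compact.smul t⟩

theorem IsPosCompact.add {E : Type*} [NormedAddCommGroup E] [InnerProductSpace ℝ E]
    {T T' : E →L[ℝ] E} (hT : IsPosCompact T) (hT' : IsPosCompact T') : IsPosCompact (T + T') :=
  ⟨hT.pos.add hT'.pos, hT.compact.add hT'.compact⟩

theorem isPosCompact_tensorSq (x : L2) : IsPosCompact (tensorSq x) :=
  ⟨InnerProductSpace.isPositive_rankOne_self x, isCompactOperator_rankOne x x⟩

theorem isPosCompact_sum {ι : Type*} (s : Finset ι) {f : ι → L2 →L[ℝ] L2}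
    (hf : ∀ i ∈ s, IsPosCompact (f i)) : IsPosCompact (∑ i ∈ s, f i) := by
  refine Finset.sum_induction f IsPosCompact (fun _ _ h h' => h.add h') ?_ hf
  exact ⟨ContinuousLinearMap.isPositive_zero, isCompactOperator_zero⟩

theorem eigval_smul {T : L2 →L[ℝ] L2} (hT : IsPosCompact T) {t : ℝ} (ht : 0 ≤ t) (j : ℕ) :
    eigval (t • T) j = t * eigval T j := by
  obtain ⟨u, hu⟩ := exists_isEigenfunctions hT (j + 1)
  refine eigval_eq (s := fun i => t * eigval T i) hu.1 (fun i => ?_)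
    (mul_nonneg ht (eigval_nonneg hT j)) (fun i => ?_) fun x hx => ?_
  · rw [smul_apply, hu.2, smul_smul]
  · exact mul_le_mul_of_nonneg_left (eigval_antitone hT (Nat.lt_succ_iff.1 i.2)) ht
  · rw [smul_apply, inner_smul_left, mul_assoc]
    exact mul_le_mul_of_nonneg_left (inner_apply_le_eigval hT
      ⟨hu.1.comp _ (Fin.castSucc_injective j), fun i => hu.2 _⟩ hx) ht

/-- The eigenvalues of a positive compact operator sum to its trace. -/
theorem hasSum_eigval {T : L2 →L[ℝ] L2} (hT : IsPosCompact T) {ι : Type*}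
    (b : HilbertBasis ι ℝ L2) (hs : Summable fun k => ⟪T (b k), b k⟫) :
    HasSum (eigval T) (∑' k, ⟪T (b k), b k⟫) := by
  choose u hu using exists_isEigenfunctions hT
  set D : ℕ → L2 →L[ℝ] L2 := fun j => deflate T (u j) (fun i => eigval T i) with hD
  have hDpc : ∀ j, IsPosCompact (D j) := fun j => deflate_isPosCompact hT (hu j).1 (hu j).2
  have hkey : ∀ j k, ⟪D j (b k), b k⟫ = ⟪T (b k), b k⟫ -
      ∑ i : Fin j, eigval T i * ⟪u j i, b k⟫ ^ 2 := fun j k => by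
    simp only [hD, deflate_apply, inner_sub_left, sum_inner, inner_smul_left]
    congr 1
    exact Finset.sum_congr rfl fun i _ => by simp; ring
  have hbk : ∀ x : L2, HasSum (fun k => ⟪x, b k⟫ ^ 2) (‖x‖ ^ 2) := fun x => by
    have := b.hasSum_inner_mul_inner x x
    rw [real_inner_self_eq_norm_sq] at this
    refine this.congr_fun fun k => ?_
    rw [real_inner_comm x (b k)]; ring
  have hsum : ∀ j, HasSum (fun k => ⟪D j (b k), b k⟫)
      (∑' k, ⟪T (b k), b k⟫ - ∑ i ∈ Finset.range j, eigval T i) := fun j => by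
    simp only [hkey]
    refine hs.hasSum.sub ?_
    rw [Finset.sum_range]
    refine hasSum_sum fun i _ => ?_
    have := (hbk (u j i)).mul_left (eigval T i)
    rwa [(hu j).1.1 i, one_pow, mul_one] at this
  have hle : ∀ j, ∑ i ∈ Finset.range j, eigval T i ≤ ∑' k, ⟪T (b k), b k⟫ := fun j => by
    have := (hsum j).nonneg fun k => (hDpc j).nonneg _
    linarith
  have hsumm : Summable (eigval T) :=
    summable_of_sum_range_le (eigval_nonneg hT) hle
  -- The diagonal entries of the deflations are dominated by those of `T`, and each is at most `‖D
  -- j‖ ≤ eigval T j`. This tends to `0` since partial sums of the eigenvalues are bounded by the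
  -- trace.
  have hlim : Tendsto (fun j => ∑' k, ⟪D j (b k), b k⟫) atTop (𝓝 (∑' _ : ι, (0 : ℝ))) := by
    refine tendsto_tsum_of_dominated_convergence hs (fun k => ?_) (.of_forall fun j k => ?_)
    · refine squeeze_zero (fun j => (hDpc j).nonneg _) (fun j => ?_)
        hsumm.tendsto_atTop_zero
      refine (inner_apply_self_le_opNorm _ _).trans ?_
      rw [b.orthonormal.1 k, one_pow, mul_one]
      exact norm_deflate_le hT (hu j)
    · rw [Real.norm_of_nonneg ((hDpc j).nonneg _), hkey]
      have : 0 ≤ ∑ i : Fin j, eigval T i * ⟪u j i, b k⟫ ^ 2 :=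
        Finset.sum_nonneg fun i _ => mul_nonneg (eigval_nonneg hT _) (sq_nonneg _)
      linarith
  rw [tsum_zero] at hlim
  refine (hasSum_iff_tendsto_nat_of_nonneg (eigval_nonneg hT) _).2 ?_
  have h2 := (tendsto_const_nhds (x := ∑' k, ⟪T (b k), b k⟫)).sub hlim
  rw [sub_zero] at h2
  refine h2.congr fun j => ?_
  rw [(hsum j).tsum_eq]
  ring

end Operators

/-! ### Spectral gaps, common eigenfunctions and perturbation of eigenfunctions. -/

section Operators

/-- An eigenvector equation can only hold approximately along the eigenfunctions of nearby
eigenvalues. -/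
theorem gap_mul_norm_le {T : L2 →L[ℝ] L2} (hT : ∀ x y, ⟪T x, y⟫ = ⟪x, T y⟫) {d : ℕ}
    {u : Fin d → L2} (hu : Orthonormal ℝ u) {s : Fin d → ℝ} (hs : ∀ i, T (u i) = s i • u i)
    (j : Fin d) {g : ℝ} (hg : ∀ i < j, s j + g ≤ s i)
    (hopt : ∀ x, (∀ i ≤ j, ⟪u i, x⟫ = 0) → ⟪T x, x⟫ ≤ (s j - g) * ‖x‖ ^ 2)
    {x : L2} (hx : ⟪u j, x⟫ = 0) : g * ‖x‖ ≤ ‖T x - s j • x‖ := by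
  let c : Fin d → ℝ := fun i => if i < j then ⟪u i, x⟫ else 0
  set a := ∑ i, c i • u i with ha
  set y := x - a with hy
  have hTa : T a = ∑ i, (s i * c i) • u i := by
    rw [ha, map_sum]
    exact Finset.sum_congr rfl fun i _ => by rw [map_smul, hs, smul_smul, mul_comm]
  have huy : ∀ i ≤ j, ⟪u i, y⟫ = 0 := fun i hi => by
    rw [hy, inner_sub_right, ha, hu.inner_right_fintype]
    rcases hi.lt_or_eq with h | rfl
    · simp [c, h]
    · simp [c, hx]
  have hcy : ∀ t : Fin d → ℝ, ⟪∑ i, (t i * c i) • u i, y⟫ = 0 := fun t => by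
    rw [sum_inner]
    refine Finset.sum_eq_zero fun i _ => ?_
    rw [inner_smul_left]
    by_cases h : i < j
    · rw [huy i h.le, mul_zero]
    · simp [c, h]
  have hay : ⟪a, y⟫ = 0 := by simpa [ha] using hcy fun _ => 1
  have hTay : ⟪T a, y⟫ = 0 := by rw [hTa]; exact hcy s
  have hxa : x = a + y := by rw [hy]; abel
  have hnx : ‖x‖ ^ 2 = ‖a‖ ^ 2 + ‖y‖ ^ 2 := by
    rw [hxa, norm_add_sq_real, hay]; ring
  have hnay : ‖a - y‖ = ‖x‖ := by
    have : ‖a - y‖ ^ 2 = ‖x‖ ^ 2 := by rw [hnx, norm_sub_sq_real, hay]; ring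
    exact (sq_eq_sq₀ (norm_nonneg _) (norm_nonneg _)).1 this
  have hTaa : (s j + g) * ‖a‖ ^ 2 ≤ ⟪T a, a⟫ := by
    rw [ha, norm_sq_orthonormal_combination hu, inner_apply_eigen_combination hu hs,
      Finset.mul_sum]
    refine Finset.sum_le_sum fun i _ => ?_
    by_cases h : i < j
    · exact mul_le_mul_of_nonneg_right (hg i h) (sq_nonneg _)
    · simp [c, h]
  have hTyy := hopt y huy
  -- `T - s j` is positive on `a` and negative on `y`. Testing against the reflection `a - y` makes
  -- both parts count with the same sign, and the reflection has the norm of `x`.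
  have hinner : ⟪T x - s j • x, a - y⟫ =
      (⟪T a, a⟫ - s j * ‖a‖ ^ 2) - (⟪T y, y⟫ - s j * ‖y‖ ^ 2) := by
    have h1 : ⟪T y, a⟫ = 0 := by rw [hT, real_inner_comm, hTay]
    have h2 : ⟪y, a⟫ = 0 := by rw [real_inner_comm, hay]
    rw [hxa, map_add, ← real_inner_self_eq_norm_sq, ← real_inner_self_eq_norm_sq]
    simp only [inner_sub_left, inner_sub_right, inner_add_left, smul_add,
      real_inner_smul_left, h1, h2, hay, hTay]
    ring
  have hle : ⟪T x - s j • x, a - y⟫ ≤ ‖T x - s j • x‖ * ‖x‖ := by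
    rw [← hnay]; exact real_inner_le_norm _ _
  have hge : g * ‖x‖ ^ 2 ≤ ‖T x - s j • x‖ * ‖x‖ := by
    rw [hnx]; linarith
  rcases (norm_nonneg x).eq_or_lt with h0 | h0
  · rw [← h0, mul_zero]; exact norm_nonneg _
  · exact le_of_mul_le_mul_right (by linarith) h0

theorem IsEigenfunctions.restrict {T : L2 →L[ℝ] L2} {d k : ℕ} {u : Fin d → L2}
    (hu : IsEigenfunctions T u) (hk : k ≤ d) :
    IsEigenfunctions T fun i : Fin k => u (Fin.castLE hk i) :=
  ⟨hu.1.comp _ (Fin.castLE_injective hk), fun _ => hu.2 _⟩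

/-- If the eigenspaces of the first `d` eigenvalues of two operators agree and are
one-dimensional, then the first `d` eigenfunctions of a mixture are common eigenfunctions, and
their eigenvalues are isolated. -/
theorem common_eigenfunctions {c₁ c₂ : L2 →L[ℝ] L2} (h₁ : IsPosCompact c₁) (h₂ : IsPosCompact c₂)
    {τ : ℝ} (hτ : τ ∈ Set.Ioo (0 : ℝ) 1) {d : ℕ}
    (hgap₁ : ∀ j : Fin d, eigval c₁ (j + 1) < eigval c₁ j)
    (hgap₂ : ∀ j : Fin d, eigval c₂ (j + 1) < eigval c₂ j)
    (hE : ∀ j : Fin d, eigspace c₁ j = eigspace c₂ j) {φ : Fin d → L2}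
    (hφ : IsEigenfunctions (τ • c₁ + (1 - τ) • c₂) φ) (j : Fin d) :
    c₁ (φ j) = eigval c₁ j • φ j ∧ c₂ (φ j) = eigval c₂ j • φ j ∧
    ∃ g : ℝ, 0 < g ∧ ∀ x, ⟪φ j, x⟫ = 0 → g * ‖x‖ ≤ ‖(τ • c₁ + (1 - τ) • c₂) x -
      eigval (τ • c₁ + (1 - τ) • c₂) j • x‖ := by
  set c := τ • c₁ + (1 - τ) • c₂ with hc
  have hτ' : 0 < 1 - τ := by linarith [hτ.2]
  have hcpc : IsPosCompact c := (h₁.smul hτ.1.le).add (h₂.smul hτ'.le)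
  obtain ⟨u, hu₁⟩ := exists_isEigenfunctions h₁ d
  have hu₂ : IsEigenfunctions c₂ u := ⟨hu₁.1, fun i => by
    have h : u i ∈ eigspace c₁ i := Module.End.mem_eigenspace_iff.2 (hu₁.2 i)
    rw [hE] at h
    exact Module.End.mem_eigenspace_iff.1 h⟩
  set s : ℕ → ℝ := fun i => τ * eigval c₁ i + (1 - τ) * eigval c₂ i with hs
  have hsanti : Antitone s := fun i k hik => by
    have := eigval_antitone h₁ hik
    have := eigval_antitone h₂ hik
    simp only [hs]
    have := hτ.1
    gcongr
  have hslt : ∀ i : Fin d, s (i + 1) < s i := fun i => by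
    have := mul_lt_mul_of_pos_left (hgap₁ i) hτ.1
    have := mul_lt_mul_of_pos_left (hgap₂ i) hτ'
    simp only [hs]; linarith
  have hcu : ∀ i : Fin d, c (u i) = s i • u i := fun i => by
    simp only [hc, hs, add_apply, smul_apply, hu₁.2, hu₂.2, smul_smul, add_smul]
  have hopt : ∀ k (hk : k ≤ d) x, (∀ i : Fin k, ⟪u (Fin.castLE hk i), x⟫ = 0) →
      ⟪c x, x⟫ ≤ s k * ‖x‖ ^ 2 := fun k hk x hx => by
    have e1 := mul_le_mul_of_nonneg_left
      (inner_apply_le_eigval h₁ (hu₁.restrict hk) hx) hτ.1.le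
    have e2 := mul_le_mul_of_nonneg_left
      (inner_apply_le_eigval h₂ (hu₂.restrict hk) hx) hτ'.le
    simp only [hc, hs, add_apply, smul_apply, inner_add_left, real_inner_smul_left]
    linarith
  have hev : ∀ i : Fin d, eigval c i = s i := fun i =>
    eigval_eq (hu₁.restrict i.2).1 (s := fun k : Fin (i + 1) => s k) (fun k => hcu _)
      (add_nonneg (mul_nonneg hτ.1.le (eigval_nonneg h₁ _))
        (mul_nonneg hτ'.le (eigval_nonneg h₂ _)))
      (fun k => hsanti (Nat.lt_succ_iff.1 k.2)) (fun x hx => hopt i i.2.le x hx)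
  -- For `j = 0` there is no larger eigenvalue to stay away from, and any positive constant serves.
  have hlow : ∃ g₁ : ℝ, 0 < g₁ ∧ ∀ i < j, s j + g₁ ≤ s i := by
    obtain ⟨j, hj⟩ := j
    rcases j with _ | k
    · exact ⟨1, one_pos, fun i hi => absurd hi (by simp [Fin.lt_def])⟩
    · refine ⟨s k - s (k + 1), by linarith [hslt ⟨k, by omega⟩], fun i hi => ?_⟩
      have : s k ≤ s i := hsanti (Nat.lt_succ_iff.1 hi)
      simp only
      linarith
  obtain ⟨g₁, hg₁, hlow⟩ := hlow
  set g := min g₁ (s j - s (j + 1)) with hgdef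
  have hg : 0 < g := lt_min hg₁ (by linarith [hslt j])
  have hgapu : ∀ x, ⟪u j, x⟫ = 0 → g * ‖x‖ ≤ ‖c x - s j • x‖ := fun x hx => by
    refine gap_mul_norm_le hcpc.symm hu₁.1 (s := fun i => s i) hcu j (fun i hi => ?_)
      (fun x hx => ?_) hx
    · linarith [hlow i hi, min_le_left g₁ (s j - s (j + 1))]
    · refine (hopt (j + 1) j.2 x fun i => hx _ (Nat.lt_succ_iff.1 i.2)).trans ?_
      have := min_le_right g₁ (s j - s (j + 1))
      exact mul_le_mul_of_nonneg_right (by linarith) (sq_nonneg _)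
  -- The part `q` of `φ j` orthogonal to `u j` solves the same eigenvalue equation, so the gap
  -- forces `q = 0`.
  have hφu : φ j = ⟪u j, φ j⟫ • u j := by
    set q := φ j - ⟪u j, φ j⟫ • u j with hq
    have h1 : ⟪u j, q⟫ = 0 := by
      rw [hq, inner_sub_right, inner_smul_right, real_inner_self_eq_norm_sq, hu₁.1.1 j]; ring
    have h2 : c q - s j • q = 0 := by
      rw [hq, map_sub, map_smul, hcu, hφ.2 j, hev, smul_sub, smul_comm (s j)]; abel
    have h3 := hgapu q h1
    rw [h2, norm_zero] at h3
    have h4 : ‖q‖ = 0 := le_antisymm (by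
      by_contra h
      have := mul_pos hg (not_le.1 h)
      linarith) (norm_nonneg _)
    exact sub_eq_zero.1 (norm_eq_zero.1 h4)
  have hα : ⟪u j, φ j⟫ ≠ 0 := fun h => by
    have h1 := hφ.1.1 j
    rw [hφu, h, zero_smul, norm_zero] at h1
    exact zero_ne_one h1
  refine ⟨?_, ?_, g, hg, fun x hx => ?_⟩
  · rw [hφu, map_smul, hu₁.2, smul_comm]
  · rw [hφu, map_smul, hu₂.2, smul_comm]
  · rw [hev]
    refine hgapu x ?_
    rw [hφu, real_inner_smul_left] at hx
    exact (mul_eq_zero.1 hx).resolve_left hα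

/-- Perturbation of an isolated eigenfunction. -/
theorem abs_inner_sq_sub_le {A c : L2 →L[ℝ] L2} {φ ψ : L2} {l m g : ℝ} (hφ : ‖φ‖ = 1)
    (hψ : ‖ψ‖ = 1) (hcφ : c φ = l • φ) (hg : 0 < g)
    (hgap : ∀ x, ⟪φ, x⟫ = 0 → g * ‖x‖ ≤ ‖c x - l • x‖) (hAψ : A ψ = m • ψ)
    (hml : |m - l| ≤ ‖A - c‖) (x : L2) :
    |⟪x, ψ⟫ ^ 2 - ⟪x, φ⟫ ^ 2| ≤ 8 / g * ‖A - c‖ * ‖x‖ ^ 2 := by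
  set t := ⟪φ, ψ⟫ with ht
  set q := ψ - t • φ with hq
  have h1 : ⟪φ, q⟫ = 0 := by
    rw [hq, inner_sub_right, inner_smul_right, real_inner_self_eq_norm_sq, hφ]; ring
  have hψq : ψ = t • φ + q := by rw [hq]; abel
  have hn : t ^ 2 + ‖q‖ ^ 2 = 1 := by
    have : ‖ψ‖ ^ 2 = t ^ 2 + ‖q‖ ^ 2 := by
      rw [hψq, norm_add_sq_real, real_inner_smul_left, h1, norm_smul, hφ]
      simp
    rw [← this, hψ, one_pow]
  have hq1 : g * ‖q‖ ≤ 2 * ‖A - c‖ := by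
    refine (hgap q h1).trans ?_
    have : c q - l • q = (m - l) • ψ - (A - c) ψ := by
      rw [sub_apply, hAψ, hq, map_sub, map_smul, hcφ, smul_sub, smul_comm l, sub_smul]
      abel
    rw [this]
    calc ‖(m - l) • ψ - (A - c) ψ‖ ≤ ‖(m - l) • ψ‖ + ‖(A - c) ψ‖ := norm_sub_le _ _
      _ ≤ ‖A - c‖ + ‖A - c‖ := by
        gcongr
        · rw [norm_smul, hψ, mul_one]; exact hml
        · simpa [hψ] using (A - c).le_opNorm ψ
      _ = _ := by ring
  have hq2 : ‖q‖ ≤ 2 / g * ‖A - c‖ := by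
    rw [div_mul_eq_mul_div, le_div_iff₀ hg]; linarith
  have hqle : ‖q‖ ≤ 1 := by
    have : ‖q‖ ^ 2 ≤ 1 := by nlinarith [sq_nonneg t]
    exact (sq_le_one_iff₀ (norm_nonneg _)).1 this
  have htle : |t| ≤ 1 := by
    have : t ^ 2 ≤ 1 := by nlinarith [sq_nonneg ‖q‖]
    exact (sq_le_one_iff_abs_le_one _).1 this
  have hxφ : |⟪x, φ⟫| ≤ ‖x‖ := by simpa [hφ] using abs_real_inner_le_norm x φ
  have hxψ : |⟪x, ψ⟫| ≤ ‖x‖ := by simpa [hψ] using abs_real_inner_le_norm x ψ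
  have hxq : |⟪x, q⟫| ≤ ‖x‖ * ‖q‖ := abs_real_inner_le_norm x q
  -- Squares do not see the arbitrary sign of `ψ`, so no alignment of `ψ` with `φ` is needed; every
  -- term carries a factor of the small component `q`.
  have hexp : ⟪x, ψ⟫ ^ 2 - ⟪x, φ⟫ ^ 2 =
      ⟪x, q⟫ * (⟪x, ψ⟫ + t * ⟪x, φ⟫) - ‖q‖ ^ 2 * ⟪x, φ⟫ ^ 2 := by
    have e : ⟪x, ψ⟫ = t * ⟪x, φ⟫ + ⟪x, q⟫ := by
      conv_lhs => rw [hψq]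
      rw [inner_add_right, inner_smul_right]
    have : t ^ 2 = 1 - ‖q‖ ^ 2 := by linarith
    rw [e]
    linear_combination (⟪x, φ⟫ ^ 2) * this
  rw [hexp]
  calc |⟪x, q⟫ * (⟪x, ψ⟫ + t * ⟪x, φ⟫) - ‖q‖ ^ 2 * ⟪x, φ⟫ ^ 2|
      ≤ |⟪x, q⟫| * (|⟪x, ψ⟫| + |t| * |⟪x, φ⟫|) + ‖q‖ ^ 2 * |⟪x, φ⟫| ^ 2 := by
        have h2 := norm_sub_le (⟪x, q⟫ * (⟪x, ψ⟫ + t * ⟪x, φ⟫)) (‖q‖ ^ 2 * ⟪x, φ⟫ ^ 2)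
        have h3 := abs_add_le ⟪x, ψ⟫ (t * ⟪x, φ⟫)
        simp only [Real.norm_eq_abs, abs_mul, abs_pow, abs_norm] at h2 h3 ⊢
        exact h2.trans (by gcongr)
    _ ≤ (‖x‖ * ‖q‖) * (‖x‖ + 1 * ‖x‖) + (‖q‖ * 1) * ‖x‖ ^ 2 := by
        rw [sq ‖q‖]
        gcongr
    _ = 3 * ‖x‖ ^ 2 * ‖q‖ := by ring
    _ ≤ 4 * ‖x‖ ^ 2 * (2 / g * ‖A - c‖) := by gcongr; norm_num
    _ = _ := by ring

end Operators

/-! ### Second moments of weighted sums of weakly correlated variables. -/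

section SecondMoments

variable {Ω : Type*} [MeasurableSpace Ω] {P : Measure Ω}
variable {H : Type*} [NormedAddCommGroup H]

theorem lpNorm_two_sq {f : Ω → H} (hf : MemLp f 2 P) :
    lpNorm f 2 P ^ 2 = ∫ ω, ‖f ω‖ ^ 2 ∂P := by
  rw [lpNorm_eq_integral_norm_rpow_toReal (by norm_num) (by norm_num) hf.1]
  have h0 : 0 ≤ ∫ ω, ‖f ω‖ ^ (2 : ℝ) ∂P := integral_nonneg fun ω => by positivity
  simp only [ENNReal.toReal_ofNat, Real.rpow_ofNat] at h0 ⊢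
  rw [inv_eq_one_div, ← Real.sqrt_eq_rpow, Real.sq_sqrt h0]

theorem MemLp.norm_sq_integrable {f : Ω → H} (hf : MemLp f 2 P) :
    Integrable (fun ω => ‖f ω‖ ^ 2) P := by
  simpa using hf.integrable_norm_pow (p := 2) (by norm_num)

theorem lpNorm_le_of_integral_sq_le {f : Ω → H} (hf : MemLp f 2 P) {t : ℝ} (ht : 0 ≤ t)
    (h : ∫ ω, ‖f ω‖ ^ 2 ∂P ≤ t ^ 2) : lpNorm f 2 P ≤ t := by
  rw [← lpNorm_two_sq hf] at h
  exact le_of_sq_le_sq h ht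

theorem integral_norm_mul_norm_le {H' : Type*} [NormedAddCommGroup H'] {f : Ω → H} {g : Ω → H'}
    (hf : MemLp f 2 P) (hg : MemLp g 2 P) :
    ∫ ω, ‖f ω‖ * ‖g ω‖ ∂P ≤ lpNorm f 2 P * lpNorm g 2 P := by
  have hf' : MemLp (fun ω => ‖f ω‖) 2 P := hf.norm
  have hg' : MemLp (fun ω => ‖g ω‖) 2 P := hg.norm
  have h := real_inner_le_norm hf'.toLp hg'.toLp
  rw [L2.inner_def, Lp.norm_toLp, Lp.norm_toLp, eLpNorm_norm, eLpNorm_norm,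
    toReal_eLpNorm hf.1, toReal_eLpNorm hg.1] at h
  refine le_trans (le_of_eq (integral_congr_ae ?_)) h
  filter_upwards [hf'.coeFn_toLp, hg'.coeFn_toLp] with ω h1 h2
  rw [h1, h2]
  simp [mul_comm]

theorem integrable_norm_mul_norm {H' : Type*} [NormedAddCommGroup H'] {f : Ω → H} {g : Ω → H'}
    (hf : MemLp f 2 P) (hg : MemLp g 2 P) : Integrable (fun ω => ‖f ω‖ * ‖g ω‖) P :=
  hf.norm.integrable_mul hg.norm

theorem integral_norm_le_lpNorm_two [IsProbabilityMeasure P] {f : Ω → H} (hf : MemLp f 2 P) :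
    ∫ ω, ‖f ω‖ ∂P ≤ lpNorm f 2 P := by
  have h := integral_norm_mul_norm_le hf (memLp_const (1 : ℝ) (μ := P))
  rw [lpNorm_const' (by norm_num) (by norm_num)] at h
  simpa using h

section Inner

variable [InnerProductSpace ℝ H]

theorem integrable_inner_of_memLp {f g : Ω → H} (hf : MemLp f 2 P) (hg : MemLp g 2 P) :
    Integrable (fun ω => ⟪f ω, g ω⟫) P :=
  (integrable_norm_mul_norm hf hg).mono' (hf.1.inner hg.1)
    (.of_forall fun _ => norm_inner_le_norm (𝕜 := ℝ) _ _)

theorem abs_integral_inner_le {f g : Ω → H} (hf : MemLp f 2 P) (hg : MemLp g 2 P) :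
    |∫ ω, ⟪f ω, g ω⟫ ∂P| ≤ lpNorm f 2 P * lpNorm g 2 P := by
  refine (norm_integral_le_integral_norm (fun ω => ⟪f ω, g ω⟫)).trans
    (le_trans ?_ (integral_norm_mul_norm_le hf hg))
  exact integral_mono (integrable_inner_of_memLp hf hg).norm (integrable_norm_mul_norm hf hg)
    fun _ => norm_inner_le_norm (𝕜 := ℝ) _ _

theorem lpNorm_sub_integral_le [CompleteSpace H] [IsProbabilityMeasure P] {f : Ω → H}
    (hf : MemLp f 2 P) : lpNorm (fun ω => f ω - ∫ ω', f ω' ∂P) 2 P ≤ 2 * lpNorm f 2 P := by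
  have h := lpNorm_sub_le hf (g := fun _ => ∫ ω', f ω' ∂P) (by norm_num : (1 : ℝ≥0∞) ≤ 2)
  rw [lpNorm_const' (by norm_num) (by norm_num)] at h
  simp only [probReal_univ, Real.one_rpow, mul_one] at h
  have h2 : ‖∫ ω', f ω' ∂P‖ ≤ lpNorm f 2 P :=
    (norm_integral_le_integral_norm _).trans (integral_norm_le_lpNorm_two hf)
  have e : (fun ω => f ω - ∫ ω', f ω' ∂P) = f - fun _ => ∫ ω', f ω' ∂P := rfl
  rw [e]
  linarith

/-- Sums over integers of a summable function of the distance to a given integer. -/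
theorem sum_natAbs_le {κ : ℕ → ℝ} (h0 : ∀ m, 0 ≤ κ m) (hs : Summable κ) (s : Finset ℤ) (i : ℤ) :
    ∑ j ∈ s, κ (i - j).natAbs ≤ 2 * ∑' m, κ m := by
  rw [← Finset.sum_filter_add_sum_filter_not s (fun j => j ≤ i), two_mul]
  refine add_le_add ?_ ?_
  · have hinj : Set.InjOn (fun j : ℤ => (i - j).natAbs) (s.filter fun j => j ≤ i) := by
      intro a ha b hb hab
      simp only [Finset.coe_filter, Set.mem_ofPred_eq] at ha hb hab
      omega
    rw [← Finset.sum_image (f := κ) hinj]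
    exact hs.sum_le_tsum _ fun m _ => h0 m
  · have hinj : Set.InjOn (fun j : ℤ => (i - j).natAbs) (s.filter fun j => ¬ j ≤ i) := by
      intro a ha b hb hab
      simp only [Finset.coe_filter, Set.mem_ofPred_eq] at ha hb hab
      omega
    rw [← Finset.sum_image (f := κ) hinj]
    exact hs.sum_le_tsum _ fun m _ => h0 m

/-- Second moment of a weighted sum of weakly correlated terms. -/
theorem integral_norm_sum_sq_le {κ : ℕ → ℝ} (h0 : ∀ m, 0 ≤ κ m) (hs : Summable κ)
    {T : ℤ → Ω → H} (hT : ∀ i, MemLp (T i) 2 P)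
    (hκ : ∀ i j, |∫ ω, ⟪T i ω, T j ω⟫ ∂P| ≤ κ (i - j).natAbs) (s : Finset ℤ) (c : ℤ → ℝ) :
    ∫ ω, ‖∑ i ∈ s, c i • T i ω‖ ^ 2 ∂P ≤ 2 * (∑' m, κ m) * ∑ i ∈ s, c i ^ 2 := by
  have hexp : ∫ ω, ‖∑ i ∈ s, c i • T i ω‖ ^ 2 ∂P =
      ∑ i ∈ s, ∑ j ∈ s, c i * c j * ∫ ω, ⟪T i ω, T j ω⟫ ∂P := by
    simp_rw [← real_inner_self_eq_norm_sq, sum_inner, inner_sum, real_inner_smul_left,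
      real_inner_smul_right, ← mul_assoc]
    rw [integral_finsetSum]
    · refine Finset.sum_congr rfl fun i _ => ?_
      rw [integral_finsetSum]
      · exact Finset.sum_congr rfl fun j _ => integral_const_mul _ _
      · exact fun j _ => (integrable_inner_of_memLp (hT i) (hT j)).const_mul _
    · exact fun i _ => integrable_finsetSum _ fun j _ =>
        (integrable_inner_of_memLp (hT i) (hT j)).const_mul _
  rw [hexp]
  calc ∑ i ∈ s, ∑ j ∈ s, c i * c j * ∫ ω, ⟪T i ω, T j ω⟫ ∂P
      ≤ ∑ i ∈ s, ∑ j ∈ s, (c i ^ 2 / 2 * κ (i - j).natAbs + c j ^ 2 / 2 * κ (i - j).natAbs) := by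
        refine Finset.sum_le_sum fun i _ => Finset.sum_le_sum fun j _ => ?_
        refine (le_abs_self _).trans ?_
        rw [abs_mul, ← add_mul]
        refine mul_le_mul ?_ (hκ i j) (abs_nonneg _) (by positivity)
        rw [abs_le]
        constructor <;> nlinarith [sq_nonneg (c i + c j), sq_nonneg (c i - c j)]
    _ = ∑ i ∈ s, c i ^ 2 * ∑ j ∈ s, κ (i - j).natAbs := by
        simp_rw [Finset.sum_add_distrib]
        rw [Finset.sum_comm (f := fun i j => c j ^ 2 / 2 * κ (i - j).natAbs)]
        rw [← Finset.sum_add_distrib]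
        refine Finset.sum_congr rfl fun i _ => ?_
        rw [← Finset.sum_add_distrib, Finset.mul_sum]
        refine Finset.sum_congr rfl fun j _ => ?_
        rw [← Int.natAbs_neg (j - i), neg_sub]
        ring
    _ ≤ ∑ i ∈ s, c i ^ 2 * (2 * ∑' m, κ m) :=
        Finset.sum_le_sum fun i _ =>
          mul_le_mul_of_nonneg_left (sum_natAbs_le h0 hs s i) (sq_nonneg _)
    _ = _ := by rw [← Finset.sum_mul]; ring

/-- Second moment of a sum of uniformly bounded terms that are uncorrelated at distance `M`. -/
theorem integral_norm_sum_sq_le_of_separated {M : ℕ} {t : ℝ} {T : ℤ → Ω → H}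
    (hT : ∀ i, MemLp (T i) 2 P) (ht : ∀ i, lpNorm (T i) 2 P ≤ t)
    (hsep : ∀ i j : ℤ, i + M ≤ j → ∫ ω, ⟪T i ω, T j ω⟫ ∂P = 0) (s : Finset ℤ) (c : ℤ → ℝ) :
    ∫ ω, ‖∑ i ∈ s, c i • T i ω‖ ^ 2 ∂P ≤ 2 * (M * t ^ 2) * ∑ i ∈ s, c i ^ 2 := by
  have ht0 : 0 ≤ t := lpNorm_nonneg.trans (ht 0)
  have hsupp : ∀ m ∉ Finset.range M, (if m < M then t ^ 2 else 0 : ℝ) = 0 := fun m hm => by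
    rw [if_neg (by simpa using hm)]
  have := integral_norm_sum_sq_le (κ := fun m => if m < M then t ^ 2 else 0)
    (fun m => by positivity) (summable_of_ne_finset_zero hsupp) hT (fun i j => ?_) s c
  · rw [tsum_eq_sum hsupp, Finset.sum_ite_of_true (fun m hm => by simpa using hm)] at this
    simpa using this
  · split_ifs with h
    · refine (abs_integral_inner_le (hT i) (hT j)).trans ?_
      rw [sq]
      exact mul_le_mul (ht i) (ht j) lpNorm_nonneg ht0
    · rcases le_total i j with hij | hij
      · rw [hsep i j (by omega), abs_zero]
      · rw [integral_congr_ae (.of_forall fun ω => real_inner_comm (T j ω) (T i ω)),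
          hsep j i (by omega), abs_zero]

end Inner

end SecondMoments

/-! ### Independence of σ-algebras generated by disjoint sets of innovations. -/

section Sigma

/-- The σ-algebra generated by the innovations with index in `s`. -/
abbrev sig {Ω S : Type*} [MeasurableSpace S] (e : ℤ → Ω → S) (s : Set ℤ) : MeasurableSpace Ω :=
  ⨆ i ∈ s, MeasurableSpace.comap (e i) inferInstance

theorem sig_mono {Ω S : Type*} [MeasurableSpace S] {e : ℤ → Ω → S} {s t : Set ℤ} (h : s ⊆ t) :
    sig e s ≤ sig e t :=
  biSup_mono h

theorem measurable_innovation_sig {Ω S : Type*} [MeasurableSpace S] (e : ℤ → Ω → S) {s : Set ℤ} {i : ℤ} (hi : i ∈ s) :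
    Measurable[sig e s] (e i) := by
  have h : MeasurableSpace.comap (e i) inferInstance ≤ sig e s :=
    le_iSup₂_of_le (f := fun i _ => MeasurableSpace.comap (e i) inferInstance) i hi le_rfl
  exact (comap_measurable (e i)).mono h le_rfl

variable {Ω S : Type*} [MeasurableSpace Ω] [MeasurableSpace S] {P : Measure Ω} {ν : Measure S}
  {e : ℤ → Ω → S}

theorem sig_le (he : IsIIDInnovation P ν e) (s : Set ℤ) : sig e s ≤ ‹MeasurableSpace Ω› :=
  iSup₂_le fun i _ => (he.measurable i).comap_le

theorem indep_sig (he : IsIIDInnovation P ν e) {s t : Set ℤ} (h : Disjoint s t) :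
    Indep (sig e s) (sig e t) P :=
  indep_iSup_of_disjoint (fun i => (he.measurable i).comap_le) he.indep.iIndep h

theorem indepFun_of_sig {H H' : Type*} [TopologicalSpace H] [TopologicalSpace.PseudoMetrizableSpace H]
    [MeasurableSpace H] [BorelSpace H] [TopologicalSpace H']
    [TopologicalSpace.PseudoMetrizableSpace H'] [MeasurableSpace H'] [BorelSpace H']
    (he : IsIIDInnovation P ν e) {s t : Set ℤ} (h : Disjoint s t)
    {X : Ω → H} {Y : Ω → H'} (hX : StronglyMeasurable[sig e s] X)
    (hY : StronglyMeasurable[sig e t] Y) : IndepFun X Y P :=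
  indep_of_indep_of_le_left (indep_of_indep_of_le_right (indep_sig he h)
    hY.measurable.comap_le) hX.measurable.comap_le

theorem integral_inner_eq_zero_of_sig {H : Type*} [NormedAddCommGroup H] [InnerProductSpace ℝ H]
    [CompleteSpace H] (he : IsIIDInnovation P ν e) {s t : Set ℤ} (h : Disjoint s t)
    {X Y : Ω → H} (hX : StronglyMeasurable[sig e s] X) (hY : StronglyMeasurable[sig e t] Y)
    (hXi : Integrable X P) (hYi : Integrable Y P) (h0 : ∫ ω, X ω ∂P = 0) :
    ∫ ω, ⟪X ω, Y ω⟫ ∂P = 0 := by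
  borelize H
  have := (indepFun_of_sig he h hX hY).integral_bilin hXi hYi (innerSL ℝ)
  rw [h0, map_zero] at this
  exact this

end Sigma

/-! ### Quadratic forms with banded weights, split into long and short lags. -/

/-- The quadratic form `n⁻¹ ∑_{i,j} u(j - i) a_i b_j` over `1 ≤ i, j ≤ n`. -/
noncomputable def quadForm (u : ℤ → ℝ) (n : ℕ) (a b : ℤ → ℝ) : ℝ :=
  (n : ℝ)⁻¹ * ∑ i ∈ Finset.Icc (1 : ℤ) n, ∑ j ∈ Finset.Icc (1 : ℤ) n, u (j - i) * (a i * b j)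

/-- Lag weights bounded by `W` that vanish beyond lag `B`. -/
structure IsBandKernel (u : ℤ → ℝ) (W : ℝ) (B : ℕ) : Prop where
  bound : ∀ l, |u l| ≤ W
  band : ∀ l : ℤ, B < l.natAbs → u l = 0

theorem IsBandKernel.nonneg {u : ℤ → ℝ} {W : ℝ} {B : ℕ} (hu : IsBandKernel u W B) : 0 ≤ W :=
  (abs_nonneg _).trans (hu.bound 0)

theorem IsBandKernel.flip {u : ℤ → ℝ} {W : ℝ} {B : ℕ} (hu : IsBandKernel u W B) :
    IsBandKernel (fun l => u (-l)) W B :=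
  ⟨fun l => hu.bound _, fun l hl => hu.band _ (by omega)⟩

theorem card_near_le (s : Finset ℤ) (i : ℤ) (B : ℕ) :
    (s.filter fun j => (j - i).natAbs ≤ B).card ≤ 2 * B + 1 := by
  have : s.filter (fun j => (j - i).natAbs ≤ B) ⊆ Finset.Icc (i - B) (i + B) := by
    intro j hj
    simp only [Finset.mem_filter, Finset.mem_Icc] at hj ⊢
    omega
  refine (Finset.card_le_card this).trans ?_
  simp
  omega

theorem IsBandKernel.sum_abs_le {u : ℤ → ℝ} {W : ℝ} {B : ℕ} (hu : IsBandKernel u W B)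
    (s : Finset ℤ) (i : ℤ) : ∑ j ∈ s, |u (j - i)| ≤ (2 * B + 1) * W := by
  rw [← Finset.sum_filter_add_sum_filter_not s (fun j => (j - i).natAbs ≤ B),
    Finset.sum_eq_zero (s := s.filter fun j => ¬ (j - i).natAbs ≤ B), add_zero]
  · refine (Finset.sum_le_card_nsmul _ _ W fun j _ => hu.bound _).trans ?_
    rw [nsmul_eq_mul]
    refine mul_le_mul_of_nonneg_right ?_ hu.nonneg
    exact_mod_cast card_near_le s i B
  · intro j hj
    rw [hu.band _ (by simpa using (Finset.mem_filter.1 hj).2), abs_zero]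

theorem IsBandKernel.sum_sq_le {u : ℤ → ℝ} {W : ℝ} {B : ℕ} (hu : IsBandKernel u W B)
    (s : Finset ℤ) (i : ℤ) : ∑ j ∈ s, u (j - i) ^ 2 ≤ (2 * B + 1) * W ^ 2 := by
  calc ∑ j ∈ s, u (j - i) ^ 2 ≤ ∑ j ∈ s, W * |u (j - i)| := by
        refine Finset.sum_le_sum fun j _ => ?_
        rw [← sq_abs, sq]
        exact mul_le_mul_of_nonneg_right (hu.bound _) (abs_nonneg _)
    _ ≤ W * ((2 * B + 1) * W) := by
        rw [← Finset.mul_sum]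
        exact mul_le_mul_of_nonneg_left (hu.sum_abs_le s i) hu.nonneg
    _ = _ := by ring

/-- The part of the quadratic form with lags at least `L` in one direction. -/
noncomputable def farSum {Ω : Type*} (u : ℤ → ℝ) (n L : ℕ) (α β : ℤ → Ω → ℝ) (ω : Ω) : ℝ :=
  ∑ i ∈ Finset.Icc (1 : ℤ) n, α i ω *
    ∑ j ∈ (Finset.Icc (1 : ℤ) n).filter (fun j => j ≤ i - L), u (j - i) * β j ω

/-- The part of the quadratic form with lags less than `L`. -/
noncomputable def nearSum {Ω : Type*} (u : ℤ → ℝ) (n L : ℕ) (α β : ℤ → Ω → ℝ) (ω : Ω) : ℝ :=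
  ∑ i ∈ Finset.Icc (1 : ℤ) n, α i ω *
    ∑ j ∈ (Finset.Icc (1 : ℤ) n).filter (fun j => (j - i).natAbs < L), u (j - i) * β j ω

/-- For `L > 0` the cases `j ≤ i - L`, `i ≤ j - L` and `|j - i| < L` partition all pairs. The second
becomes a `farSum` after exchanging the sequences and reflecting the weights. -/
theorem quadForm_eq_far_add_near {Ω : Type*} {L : ℕ} (u : ℤ → ℝ) (n : ℕ) (hL : 0 < L) (α β : ℤ → Ω → ℝ) (ω : Ω) :
    quadForm u n (fun i => α i ω) (fun i => β i ω) = (n : ℝ)⁻¹ * (farSum u n L α β ω +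
      farSum (fun l => u (-l)) n L β α ω + nearSum u n L α β ω) := by
  rw [quadForm]
  congr 1
  have h2 : farSum (fun l => u (-l)) n L β α ω = ∑ i ∈ Finset.Icc (1 : ℤ) n,
      ∑ j ∈ Finset.Icc (1 : ℤ) n, if i ≤ j - L then u (j - i) * (α i ω * β j ω) else 0 := by
    rw [farSum, Finset.sum_comm]
    refine Finset.sum_congr rfl fun j _ => ?_
    rw [Finset.mul_sum, Finset.sum_filter]
    refine Finset.sum_congr rfl fun i _ => ?_
    split_ifs
    · rw [neg_sub]; ring
    · rfl
  rw [h2, farSum, nearSum, ← Finset.sum_add_distrib, ← Finset.sum_add_distrib]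
  refine Finset.sum_congr rfl fun i _ => ?_
  rw [Finset.mul_sum, Finset.mul_sum, Finset.sum_filter, Finset.sum_filter,
    ← Finset.sum_add_distrib, ← Finset.sum_add_distrib]
  refine Finset.sum_congr rfl fun j _ => ?_
  split_ifs <;> first | omega | ring

theorem stronglyMeasurable_weighted_sum {Ω : Type*} {m : MeasurableSpace Ω} (s : Finset ℤ) (c : ℤ → ℝ)
    {f : ℤ → Ω → ℝ} (hf : ∀ i ∈ s, StronglyMeasurable[m] (f i)) :
    StronglyMeasurable[m] fun ω => ∑ i ∈ s, c i * f i ω := by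
  have : StronglyMeasurable[m] (∑ i ∈ s, fun ω => c i * f i ω) :=
    Finset.stronglyMeasurable_sum _ fun i hi => (hf i hi).const_mul _
  convert this using 1
  ext ω
  simp

/-! ### Moment bounds for quadratic forms of finitely dependent sequences. -/

section Window

variable {Ω S : Type*} [MeasurableSpace Ω] [MeasurableSpace S] {P : Measure Ω} {ν : Measure S}
  {e : ℤ → Ω → S}

/-- A bounded centered sequence whose `i`-th term is a function of the innovations with index
in `(i - L, i]`. -/
structure IsWindow (P : Measure Ω) (e : ℤ → Ω → S) (L : ℕ) (A a : ℝ) (α : ℤ → Ω → ℝ) : Prop where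
  meas : ∀ i, StronglyMeasurable[sig e (Set.Ioc (i - L) i)] (α i)
  bdd : ∀ i ω, |α i ω| ≤ A
  mean : ∀ i, ∫ ω, α i ω ∂P = 0
  norm : ∀ i, lpNorm (α i) 2 P ≤ a

variable {L : ℕ} {A a A' b : ℝ} {α β : ℤ → Ω → ℝ}

theorem IsWindow.mono (h : IsWindow P e L A a α) {L' : ℕ} (hL : L ≤ L') :
    IsWindow P e L' A a α :=
  ⟨fun i => (h.meas i).mono (sig_mono (Set.Ioc_subset_Ioc_left (by omega))), h.bdd, h.mean, h.norm⟩

theorem IsWindow.stronglyMeasurable (h : IsWindow P e L A a α) (he : IsIIDInnovation P ν e)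
    (i : ℤ) : StronglyMeasurable (α i) := (h.meas i).mono (sig_le he _)

theorem memLp_of_forall_abs_le [IsFiniteMeasure P] {f : Ω → ℝ} (hf : StronglyMeasurable f)
    (h : ∀ ω, |f ω| ≤ A) {p : ℝ≥0∞} : MemLp f p P :=
  MemLp.of_bound hf.aestronglyMeasurable A (.of_forall h)

theorem lpNorm_le_of_forall_abs_le [IsProbabilityMeasure P] {f : Ω → ℝ}
    (hf : StronglyMeasurable f) (h : ∀ ω, |f ω| ≤ A) (hA : 0 ≤ A) : lpNorm f 2 P ≤ A := by
  refine lpNorm_le_of_integral_sq_le (memLp_of_forall_abs_le hf h) hA ?_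
  have : ∫ ω, ‖f ω‖ ^ 2 ∂P ≤ ∫ _, A ^ 2 ∂P := by
    refine integral_mono (MemLp.norm_sq_integrable (memLp_of_forall_abs_le hf h))
      (integrable_const _) fun ω => ?_
    have := h ω
    simp only [Real.norm_eq_abs]
    gcongr
  simpa using this

theorem IsWindow.norm_nonneg (h : IsWindow P e L A a α) : 0 ≤ a := lpNorm_nonneg.trans (h.norm 0)

variable [IsProbabilityMeasure P]

theorem IsWindow.memLp (h : IsWindow P e L A a α) (he : IsIIDInnovation P ν e) (i : ℤ)
    {p : ℝ≥0∞} : MemLp (α i) p P :=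
  memLp_of_forall_abs_le (h.stronglyMeasurable he i) (h.bdd i)

theorem IsWindow.bdd_nonneg (h : IsWindow P e L A a α) : 0 ≤ A := by
  obtain ⟨ω⟩ := P.nonempty_of_neZero
  exact (abs_nonneg _).trans (h.bdd 0 ω)

theorem IsWindow.integral_sum_sq_le (h : IsWindow P e L A a α) (he : IsIIDInnovation P ν e)
    (s : Finset ℤ) (c : ℤ → ℝ) :
    ∫ ω, (∑ i ∈ s, c i * α i ω) ^ 2 ∂P ≤ 2 * (L * a ^ 2) * ∑ i ∈ s, c i ^ 2 := by
  have := integral_norm_sum_sq_le_of_separated (M := L) (P := P) (fun i => h.memLp he i) h.norm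
    (fun i j hij => integral_inner_eq_zero_of_sig he (s := Set.Ioc (i - L) i)
      (t := Set.Ioc (j - L) j) (Set.disjoint_left.2 fun x hx hx' => by
        simp only [Set.mem_Ioc] at hx hx'; omega) (h.meas i) (h.meas j)
      ((h.memLp he i (p := 1)).integrable le_rfl) ((h.memLp he j (p := 1)).integrable le_rfl)
      (h.mean i)) s c
  simpa using this

theorem abs_weighted_sum_le (s : Finset ℤ) (c f : ℤ → ℝ) {W : ℝ} (hc : ∀ i, |c i| ≤ W)
    (hW : 0 ≤ W) (hf : ∀ i, |f i| ≤ A) : |∑ i ∈ s, c i * f i| ≤ s.card * (W * A) := by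
  refine (Finset.abs_sum_le_sum_abs _ _).trans ?_
  rw [← nsmul_eq_mul]
  refine Finset.sum_le_card_nsmul _ _ _ fun i _ => ?_
  rw [abs_mul]
  exact mul_le_mul (hc i) (hf i) (abs_nonneg _) hW

/-- The inner sum `U i` uses only innovations up to `i - L`, so it is independent of the centered `α
i`. Hence the second moment of `T i = α i * U i` factorizes, and `T i`, `T j` are orthogonal at
distance `L`. This saves one factor of the bandwidth over the trivial bound. The uniform bounds `A`,
`A'` only provide integrability and do not enter the estimate. -/
theorem integral_farSum_sq_le (hα : IsWindow P e L A a α) (hβ : IsWindow P e L A' b β)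
    (he : IsIIDInnovation P ν e) {u : ℤ → ℝ} {W : ℝ} {B : ℕ} (hu : IsBandKernel u W B) (n : ℕ) :
    MemLp (farSum u n L α β) 2 P ∧
    ∫ ω, farSum u n L α β ω ^ 2 ∂P ≤ (2 * L * a * b * W) ^ 2 * (2 * B + 1) * n := by
  set U : ℤ → Ω → ℝ := fun i ω =>
    ∑ j ∈ (Finset.Icc (1 : ℤ) n).filter (fun j => j ≤ i - L), u (j - i) * β j ω with hU
  have hUm : ∀ i, StronglyMeasurable[sig e (Set.Iic (i - L))] (U i) := fun i =>
    stronglyMeasurable_weighted_sum _ _ fun j hj => (hβ.meas j).mono (sig_mono fun x hx => by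
      have := (Finset.mem_filter.1 hj).2
      simp only [Set.mem_Iic]
      exact hx.2.trans this)
  have hUb : ∀ i ω, |U i ω| ≤ n * (W * A') := fun i ω => by
    refine (abs_weighted_sum_le _ _ _ (fun j => hu.bound _) hu.nonneg
      fun j => hβ.bdd j ω).trans ?_
    refine mul_le_mul_of_nonneg_right ?_ (mul_nonneg hu.nonneg hβ.bdd_nonneg)
    have := Finset.card_filter_le (Finset.Icc (1 : ℤ) n) (fun j => j ≤ i - L)
    rw [Int.card_Icc] at this
    have h2 : ((Finset.Icc (1 : ℤ) n).filter (fun j => j ≤ i - L)).card ≤ n := by omega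
    exact_mod_cast h2
  have hU2 : ∀ i, ∫ ω, U i ω ^ 2 ∂P ≤ 2 * (L * b ^ 2) * ((2 * B + 1) * W ^ 2) := fun i =>
    (hβ.integral_sum_sq_le he _ _).trans
      (mul_le_mul_of_nonneg_left (hu.sum_sq_le _ _) (by positivity))
  set T : ℤ → Ω → ℝ := fun i ω => α i ω * U i ω with hT
  have hTm : ∀ i, StronglyMeasurable[sig e (Set.Iic i)] (T i) := fun i =>
    ((hα.meas i).mono (sig_mono fun x hx => hx.2)).mul ((hUm i).mono
      (sig_mono (Set.Iic_subset_Iic.2 (by omega))))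
  have hTb : ∀ i ω, |T i ω| ≤ A * (n * (W * A')) := fun i ω => by
    rw [hT, abs_mul]
    exact mul_le_mul (hα.bdd i ω) (hUb i ω) (abs_nonneg _) hα.bdd_nonneg
  have hTL : ∀ i, MemLp (T i) 2 P := fun i =>
    memLp_of_forall_abs_le ((hTm i).mono (sig_le he _)) (hTb i)
  have hdisj : ∀ i : ℤ, Disjoint (Set.Ioc (i - L) i) (Set.Iic (i - L)) := fun i =>
    Set.disjoint_left.2 fun x hx hx' => absurd hx.1 (not_lt.2 hx')
  set t := a * (√(2 * L) * b * W * √(2 * B + 1)) with ht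
  have ht0 : 0 ≤ t := by
    have := hα.norm_nonneg; have := hβ.norm_nonneg; have := hu.nonneg
    positivity
  have hTn : ∀ i, lpNorm (T i) 2 P ≤ t := fun i => by
    refine lpNorm_le_of_integral_sq_le (hTL i) ht0 ?_
    have hind := indepFun_of_sig he (hdisj i) ((hα.meas i).pow 2) ((hUm i).pow 2)
    have hm := hind.integral_mul_eq_mul_integral
      (((hα.stronglyMeasurable he i).pow 2).aestronglyMeasurable)
      ((((hUm i).mono (sig_le he _)).pow 2).aestronglyMeasurable)
    simp only [Pi.mul_apply, Pi.pow_apply] at hm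
    have e1 : ∫ ω, ‖T i ω‖ ^ 2 ∂P = (∫ ω, α i ω ^ 2 ∂P) * ∫ ω, U i ω ^ 2 ∂P := by
      rw [← hm]
      refine integral_congr_ae (.of_forall fun ω => ?_)
      simp only [hT, Real.norm_eq_abs, sq_abs]
      ring
    have e2 : ∫ ω, α i ω ^ 2 ∂P ≤ a ^ 2 := by
      have h1 := lpNorm_two_sq (hα.memLp he i (p := 2))
      simp only [Real.norm_eq_abs, sq_abs] at h1
      rw [← h1]
      exact pow_le_pow_left₀ lpNorm_nonneg (hα.norm i) 2
    rw [e1]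
    calc _ ≤ a ^ 2 * (2 * (L * b ^ 2) * ((2 * B + 1) * W ^ 2)) :=
          mul_le_mul e2 (hU2 i) (integral_nonneg fun ω => sq_nonneg _) (sq_nonneg _)
      _ = t ^ 2 := by
          rw [ht]
          have h1 : √(2 * (L : ℝ)) ^ 2 = 2 * L := Real.sq_sqrt (by positivity)
          have h2 : √(2 * (B : ℝ) + 1) ^ 2 = 2 * B + 1 := Real.sq_sqrt (by positivity)
          rw [mul_pow, mul_pow, mul_pow, mul_pow, h1, h2]; ring
  -- Both `T i` and `U j` belong to the past up to `j - L`, and the centered factor `α j` is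
  -- independent of that past.
  have hsep : ∀ i j : ℤ, i + L ≤ j → ∫ ω, ⟪T i ω, T j ω⟫ ∂P = 0 := fun i j hij => by
    have hXm : StronglyMeasurable[sig e (Set.Iic (j - L))] fun ω => U j ω * T i ω :=
      (hUm j).mul ((hTm i).mono (sig_mono (Set.Iic_subset_Iic.2 (by omega))))
    have hm := (indepFun_of_sig he (hdisj j) (hα.meas j) hXm).integral_mul_eq_mul_integral
      ((hα.stronglyMeasurable he j).aestronglyMeasurable)
      ((hXm.mono (sig_le he _)).aestronglyMeasurable)
    rw [hα.mean j, zero_mul] at hm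
    rw [← hm]
    refine integral_congr_ae (.of_forall fun ω => ?_)
    simp [hT]
    ring
  have hfar : farSum u n L α β = fun ω => ∑ i ∈ Finset.Icc (1 : ℤ) n, (1 : ℝ) • T i ω := by
    ext ω; simp [farSum, hT, hU]
  constructor
  · rw [hfar]
    exact memLp_finsetSum _ fun i _ => (hTL i).const_smul (1 : ℝ)
  · have := integral_norm_sum_sq_le_of_separated hTL hTn hsep (Finset.Icc (1 : ℤ) n) (fun _ => 1)
    simp only [Real.norm_eq_abs, sq_abs] at this
    rw [hfar]
    refine this.trans (le_of_eq ?_)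
    have h1 : √(2 * (L : ℝ)) ^ 2 = 2 * L := Real.sq_sqrt (by positivity)
    have h2 : √(2 * (B : ℝ) + 1) ^ 2 = 2 * B + 1 := Real.sq_sqrt (by positivity)
    have h3 : t ^ 2 = a ^ 2 * (2 * L * b ^ 2 * W ^ 2 * (2 * B + 1)) := by
      rw [ht, mul_pow, mul_pow, mul_pow, mul_pow, h1, h2]
    have h4 : ∑ _i ∈ Finset.Icc (1 : ℤ) n, (1 : ℝ) ^ 2 = n := by simp
    rw [h3, h4]
    ring

theorem integral_abs_le_of_sq_le {f : Ω → ℝ} (hf : MemLp f 2 P) {t : ℝ} (ht : 0 ≤ t)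
    (h : ∫ ω, f ω ^ 2 ∂P ≤ t ^ 2) : ∫ ω, |f ω| ∂P ≤ t := by
  refine (integral_norm_le_lpNorm_two hf).trans (lpNorm_le_of_integral_sq_le hf ht ?_)
  simpa using h

theorem integral_abs_farSum_le (hα : IsWindow P e L A a α) (hβ : IsWindow P e L A' b β)
    (he : IsIIDInnovation P ν e) {u : ℤ → ℝ} {W : ℝ} {B : ℕ} (hu : IsBandKernel u W B) {n : ℕ}
    (hn : 0 < n) :
    ∫ ω, |(n : ℝ)⁻¹ * farSum u n L α β ω| ∂P ≤ 2 * L * a * b * W * √((2 * B + 1) / n) := by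
  obtain ⟨h1, h2⟩ := integral_farSum_sq_le hα hβ he hu n
  have hn' : (0 : ℝ) < n := by exact_mod_cast hn
  have := hα.norm_nonneg; have := hβ.norm_nonneg; have := hu.nonneg
  refine integral_abs_le_of_sq_le (h1.const_mul _) (by positivity) ?_
  simp_rw [mul_pow (n : ℝ)⁻¹]
  rw [integral_const_mul, mul_pow _ √_, Real.sq_sqrt (by positivity)]
  calc _ ≤ (n : ℝ)⁻¹ ^ 2 * ((2 * L * a * b * W) ^ 2 * (2 * B + 1) * n) := by gcongr
    _ = _ := by field_simp

/-- Each `i` meets at most `2 * L` indices `j`, and Cauchy-Schwarz bounds each product; the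
bandwidth plays no role. -/
theorem integral_abs_nearSum_le (hα : IsWindow P e L A a α) (hβ : IsWindow P e L A' b β)
    (he : IsIIDInnovation P ν e) {u : ℤ → ℝ} {W : ℝ} {B : ℕ} (hu : IsBandKernel u W B) {n : ℕ}
    (hn : 0 < n) (hL : 0 < L) :
    ∫ ω, |(n : ℝ)⁻¹ * nearSum u n L α β ω| ∂P ≤ 2 * L * a * b * W := by
  have hn' : (0 : ℝ) < n := by exact_mod_cast hn
  have := hα.norm_nonneg; have := hβ.norm_nonneg; have := hu.nonneg
  have hint : ∀ i j, Integrable (fun ω => ‖α i ω‖ * ‖β j ω‖) P := fun i j =>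
    integrable_norm_mul_norm (hα.memLp he i) (hβ.memLp he j)
  have hpt : ∀ ω, |(n : ℝ)⁻¹ * nearSum u n L α β ω| ≤ (n : ℝ)⁻¹ * ∑ i ∈ Finset.Icc (1 : ℤ) n,
      ∑ j ∈ (Finset.Icc (1 : ℤ) n).filter (fun j => (j - i).natAbs < L),
        W * (‖α i ω‖ * ‖β j ω‖) := fun ω => by
    rw [abs_mul, abs_of_pos (inv_pos.2 hn'), nearSum]
    refine mul_le_mul_of_nonneg_left ?_ (inv_pos.2 hn').le
    refine (Finset.abs_sum_le_sum_abs _ _).trans (Finset.sum_le_sum fun i _ => ?_)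
    rw [Finset.mul_sum]
    refine (Finset.abs_sum_le_sum_abs _ _).trans (Finset.sum_le_sum fun j _ => ?_)
    rw [abs_mul, abs_mul, mul_left_comm, Real.norm_eq_abs, Real.norm_eq_abs]
    exact mul_le_mul_of_nonneg_right (hu.bound _) (by positivity)
  have hcard : ∀ i : ℤ, (((Finset.Icc (1 : ℤ) n).filter
      (fun j => (j - i).natAbs < L)).card : ℝ) ≤ 2 * L := fun i => by
    have := card_near_le (Finset.Icc (1 : ℤ) n) i (L - 1)
    have h2 : ((Finset.Icc (1 : ℤ) n).filter (fun j => (j - i).natAbs < L)) =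
        ((Finset.Icc (1 : ℤ) n).filter (fun j => (j - i).natAbs ≤ L - 1)) :=
      Finset.filter_congr fun j _ => by omega
    rw [h2]
    have h3 : ((Finset.Icc (1 : ℤ) n).filter (fun j => (j - i).natAbs ≤ L - 1)).card ≤ 2 * L := by
      omega
    exact_mod_cast h3
  have hintW : ∀ i j, Integrable (fun ω => W * (‖α i ω‖ * ‖β j ω‖)) P := fun i j =>
    (hint i j).const_mul _
  calc ∫ ω, |(n : ℝ)⁻¹ * nearSum u n L α β ω| ∂P
      ≤ ∫ ω, (n : ℝ)⁻¹ * ∑ i ∈ Finset.Icc (1 : ℤ) n,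
        ∑ j ∈ (Finset.Icc (1 : ℤ) n).filter (fun j => (j - i).natAbs < L),
          W * (‖α i ω‖ * ‖β j ω‖) ∂P :=
        integral_mono_of_nonneg (.of_forall fun ω => abs_nonneg _)
          ((integrable_finsetSum _ fun i _ => integrable_finsetSum _ fun j _ =>
            hintW i j).const_mul _) (.of_forall hpt)
    _ = (n : ℝ)⁻¹ * ∑ i ∈ Finset.Icc (1 : ℤ) n,
        ∑ j ∈ (Finset.Icc (1 : ℤ) n).filter (fun j => (j - i).natAbs < L),
          W * ∫ ω, ‖α i ω‖ * ‖β j ω‖ ∂P := by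
        rw [integral_const_mul, integral_finsetSum _ fun i _ =>
          integrable_finsetSum _ fun j _ => hintW i j]
        congr 1
        refine Finset.sum_congr rfl fun i _ => ?_
        rw [integral_finsetSum _ fun j _ => hintW i j]
        exact Finset.sum_congr rfl fun j _ => integral_const_mul _ _
    _ ≤ (n : ℝ)⁻¹ * ∑ i ∈ Finset.Icc (1 : ℤ) n, 2 * L * (W * (a * b)) := by
        refine mul_le_mul_of_nonneg_left (Finset.sum_le_sum fun i _ => ?_) (by positivity)
        refine (Finset.sum_le_card_nsmul _ _ (W * (a * b)) fun j _ => ?_).trans ?_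
        · refine mul_le_mul_of_nonneg_left ?_ hu.nonneg
          exact (integral_norm_mul_norm_le (hα.memLp he i) (hβ.memLp he j)).trans
            (mul_le_mul (hα.norm i) (hβ.norm j) lpNorm_nonneg hα.norm_nonneg)
        · rw [nsmul_eq_mul]
          exact mul_le_mul_of_nonneg_right (hcard i) (by positivity)
    _ = 2 * L * a * b * W := by
        simp
        field_simp

end Window

/-! ### First absolute moments of sums and of centered variables. -/

section Integrals

variable {Ω : Type*} [MeasurableSpace Ω] {P : Measure Ω} {f g h : Ω → ℝ}

theorem integral_abs_add_le (hf : Integrable f P) (hg : Integrable g P) :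
    ∫ ω, |f ω + g ω| ∂P ≤ ∫ ω, |f ω| ∂P + ∫ ω, |g ω| ∂P := by
  rw [← integral_add hf.abs hg.abs]
  exact integral_mono (hf.add hg).abs (hf.abs.add hg.abs) fun ω => abs_add_le _ _

theorem integral_abs_add_add_le (hf : Integrable f P) (hg : Integrable g P)
    (hh : Integrable h P) :
    ∫ ω, |f ω + g ω + h ω| ∂P ≤ ∫ ω, |f ω| ∂P + ∫ ω, |g ω| ∂P + ∫ ω, |h ω| ∂P :=
  (integral_abs_add_le (f := fun ω => f ω + g ω) (hf.add hg) hh).trans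
    (add_le_add (integral_abs_add_le hf hg) le_rfl)

theorem integral_abs_sub_integral_le [IsProbabilityMeasure P] (hf : Integrable f P) :
    ∫ ω, |f ω - ∫ ω', f ω' ∂P| ∂P ≤ 2 * ∫ ω, |f ω| ∂P := by
  have h := integral_abs_add_le hf (integrable_const (-∫ ω', f ω' ∂P))
  simp only [← sub_eq_add_neg, integral_const, probReal_univ, one_smul, abs_neg] at h
  linarith [abs_integral_le_integral_abs (f := f) (μ := P)]

theorem integral_abs_add_sub_integral_le [IsProbabilityMeasure P] (hf : Integrable f P)
    (hg : Integrable g P) : ∫ ω, |f ω + g ω - ∫ ω', f ω' + g ω' ∂P| ∂P ≤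
      ∫ ω, |f ω - ∫ ω', f ω' ∂P| ∂P + ∫ ω, |g ω - ∫ ω', g ω' ∂P| ∂P := by
  rw [integral_add hf hg]
  have h := integral_abs_add_le (hf.sub (integrable_const (∫ ω', f ω' ∂P)))
    (hg.sub (integrable_const (∫ ω', g ω' ∂P)))
  refine le_trans (le_of_eq ?_) h
  refine integral_congr_ae (.of_forall fun ω => ?_)
  simp only [Pi.sub_apply]
  congr 1
  ring

end Integrals

/-! ### Concentration of quadratic forms of bounded finitely dependent sequences. -/

section Window

variable {Ω S : Type*} [MeasurableSpace Ω] [MeasurableSpace S] {P : Measure Ω} {ν : Measure S}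
  {e : ℤ → Ω → S} {L : ℕ} {A a A' b : ℝ} {α β : ℤ → Ω → ℝ} [IsProbabilityMeasure P]

theorem memLp_farSum (hα : IsWindow P e L A a α) (hβ : IsWindow P e L A' b β)
    (he : IsIIDInnovation P ν e) {u : ℤ → ℝ} {W : ℝ} {B : ℕ} (hu : IsBandKernel u W B) (n : ℕ) :
    MemLp (farSum u n L α β) 2 P := (integral_farSum_sq_le hα hβ he hu n).1

theorem memLp_nearSum (hα : IsWindow P e L A a α) (hβ : IsWindow P e L A' b β)
    (he : IsIIDInnovation P ν e) {u : ℤ → ℝ} {W : ℝ} {B : ℕ} (hu : IsBandKernel u W B) (n : ℕ) :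
    MemLp (nearSum u n L α β) 2 P := by
  have h : StronglyMeasurable (nearSum u n L α β) := by
    have : StronglyMeasurable (∑ i ∈ Finset.Icc (1 : ℤ) n, fun ω => α i ω *
        ∑ j ∈ (Finset.Icc (1 : ℤ) n).filter (fun j => (j - i).natAbs < L), u (j - i) * β j ω) :=
      Finset.stronglyMeasurable_sum _ fun i _ => (hα.stronglyMeasurable he i).mul
        (stronglyMeasurable_weighted_sum _ _ fun j _ => hβ.stronglyMeasurable he j)
    convert this using 1
    ext ω
    simp [nearSum]
  refine memLp_of_forall_abs_le (A := n * (A * (n * (W * A')))) h fun ω => ?_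
  refine (Finset.abs_sum_le_sum_abs _ _).trans ?_
  have hc : ∀ i : ℤ, (((Finset.Icc (1 : ℤ) n).filter
      (fun j => (j - i).natAbs < L)).card : ℝ) ≤ n := fun i => by
    have := Finset.card_filter_le (Finset.Icc (1 : ℤ) n) (fun j => (j - i).natAbs < L)
    rw [Int.card_Icc] at this
    have h2 : ((Finset.Icc (1 : ℤ) n).filter (fun j => (j - i).natAbs < L)).card ≤ n := by omega
    exact_mod_cast h2
  refine (Finset.sum_le_card_nsmul _ _ (A * (n * (W * A'))) fun i _ => ?_).trans ?_
  · rw [abs_mul]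
    refine mul_le_mul (hα.bdd i ω) ?_ (abs_nonneg _) hα.bdd_nonneg
    exact (abs_weighted_sum_le _ _ _ (fun j => hu.bound _) hu.nonneg fun j => hβ.bdd j ω).trans
      (mul_le_mul_of_nonneg_right (hc i) (mul_nonneg hu.nonneg hβ.bdd_nonneg))
  · simp

/-- First moment of the quadratic form of two finitely dependent sequences. -/
theorem IsWindow.integral_abs_quadForm_le (hα : IsWindow P e L A a α)
    (hβ : IsWindow P e L A' b β) (he : IsIIDInnovation P ν e) {u : ℤ → ℝ} {W : ℝ} {B : ℕ}
    (hu : IsBandKernel u W B) {n : ℕ} (hn : 2 * B + 1 ≤ n) (hL : 0 < L) :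
    Integrable (fun ω => quadForm u n (fun i => α i ω) (fun i => β i ω)) P ∧
    ∫ ω, |quadForm u n (fun i => α i ω) (fun i => β i ω)| ∂P ≤ 6 * L * a * b * W := by
  have hn0 : 0 < n := by omega
  have hn' : (0 : ℝ) < n := by exact_mod_cast hn0
  have h1 := ((memLp_farSum hα hβ he hu n).integrable (by norm_num)).const_mul (n : ℝ)⁻¹
  have h2 := ((memLp_farSum hβ hα he hu.flip n).integrable (by norm_num)).const_mul (n : ℝ)⁻¹
  have h3 := ((memLp_nearSum hα hβ he hu n).integrable (by norm_num)).const_mul (n : ℝ)⁻¹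
  simp_rw [quadForm_eq_far_add_near u n hL, mul_add]
  refine ⟨(h1.add h2).add h3, ?_⟩
  have hsq : √((2 * (B : ℝ) + 1) / n) ≤ 1 := by
    rw [Real.sqrt_le_one, div_le_one hn']
    exact_mod_cast hn
  have := hα.norm_nonneg; have := hβ.norm_nonneg; have := hu.nonneg
  have i1 := integral_abs_farSum_le hα hβ he hu hn0
  have i2 := integral_abs_farSum_le hβ hα he hu.flip hn0
  have i3 := integral_abs_nearSum_le hα hβ he hu hn0 hL
  have j1 : 2 * L * a * b * W * √((2 * (B : ℝ) + 1) / n) ≤ 2 * L * a * b * W * 1 := by gcongr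
  have j2 : 2 * L * b * a * W * √((2 * (B : ℝ) + 1) / n) ≤ 2 * L * b * a * W * 1 := by gcongr
  have key := integral_abs_add_add_le h1 h2 h3
  linarith

/-- The summand with index `i` involves innovations in `(i - 2L, i + L]` only. Centered summands are
therefore uncorrelated at distance `3L`, and the variance of their average is `O(1/n)`. Products of
two terms are squared here, which is why uniform bounds are needed. -/
theorem integral_abs_nearSum_sub_le (hα : IsWindow P e L A a α) (hβ : IsWindow P e L A b β)
    (he : IsIIDInnovation P ν e) {u : ℤ → ℝ} {W : ℝ} {B : ℕ} (hu : IsBandKernel u W B) {n : ℕ}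
    (hn : 0 < n) (hL : 0 < L) :
    ∫ ω, |(n : ℝ)⁻¹ * nearSum u n L α β ω - ∫ ω', (n : ℝ)⁻¹ * nearSum u n L α β ω' ∂P| ∂P ≤
      12 * L ^ 2 * W * A ^ 2 * √(1 / n) := by
  have hn' : (0 : ℝ) < n := by exact_mod_cast hn
  have hA := hα.bdd_nonneg
  have hW := hu.nonneg
  have hL1 : (1 : ℝ) ≤ L := by exact_mod_cast hL
  set V : ℤ → Ω → ℝ := fun i ω => α i ω *
    ∑ j ∈ (Finset.Icc (1 : ℤ) n).filter (fun j => (j - i).natAbs < L), u (j - i) * β j ω with hV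
  have hVm : ∀ i, StronglyMeasurable[sig e (Set.Ioc (i - 2 * L) (i + L))] (V i) := fun i =>
    ((hα.meas i).mono (sig_mono (Set.Ioc_subset_Ioc (by omega) (by omega)))).mul
      (stronglyMeasurable_weighted_sum _ _ fun j hj => (hβ.meas j).mono (sig_mono (by
        have := (Finset.mem_filter.1 hj).2
        exact Set.Ioc_subset_Ioc (by omega) (by omega))))
  have hcard : ∀ i : ℤ, (((Finset.Icc (1 : ℤ) n).filter
      (fun j => (j - i).natAbs < L)).card : ℝ) ≤ 2 * L := fun i => by
    have := card_near_le (Finset.Icc (1 : ℤ) n) i (L - 1)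
    have h2 : ((Finset.Icc (1 : ℤ) n).filter (fun j => (j - i).natAbs < L)) =
        ((Finset.Icc (1 : ℤ) n).filter (fun j => (j - i).natAbs ≤ L - 1)) :=
      Finset.filter_congr fun j _ => by omega
    rw [h2]
    have h3 : ((Finset.Icc (1 : ℤ) n).filter (fun j => (j - i).natAbs ≤ L - 1)).card ≤ 2 * L := by
      omega
    exact_mod_cast h3
  have hVb : ∀ i ω, |V i ω| ≤ 2 * L * W * A ^ 2 := fun i ω => by
    rw [hV, abs_mul]
    calc _ ≤ A * (2 * L * (W * A)) := by
          refine mul_le_mul (hα.bdd i ω) ?_ (abs_nonneg _) hA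
          exact (abs_weighted_sum_le _ _ _ (fun j => hu.bound _) hW fun j => hβ.bdd j ω).trans
            (mul_le_mul_of_nonneg_right (hcard i) (mul_nonneg hW hA))
      _ = _ := by ring
  have hVL : ∀ i, MemLp (V i) 2 P := fun i =>
    memLp_of_forall_abs_le ((hVm i).mono (sig_le he _)) (hVb i)
  have hVi : ∀ i, Integrable (V i) P := fun i => (hVL i).integrable (by norm_num)
  set T : ℤ → Ω → ℝ := fun i ω => V i ω - ∫ ω', V i ω' ∂P with hT
  have hTm : ∀ i, StronglyMeasurable[sig e (Set.Ioc (i - 2 * L) (i + L))] (T i) := fun i =>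
    (hVm i).sub stronglyMeasurable_const
  have hTL : ∀ i, MemLp (T i) 2 P := fun i => (hVL i).sub (memLp_const _)
  have hTi : ∀ i, Integrable (T i) P := fun i => (hTL i).integrable (by norm_num)
  have hTn : ∀ i, lpNorm (T i) 2 P ≤ 4 * L * W * A ^ 2 := fun i => by
    have h1 := lpNorm_sub_integral_le (hVL i)
    have h2 := lpNorm_le_of_forall_abs_le ((hVm i).mono (sig_le he _)) (hVb i)
      (by positivity) (P := P)
    linarith
  have hT0 : ∀ i, ∫ ω, T i ω ∂P = 0 := fun i => by
    rw [hT, integral_sub (hVi i) (integrable_const _)]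
    simp
  have hsum := integral_norm_sum_sq_le_of_separated (M := 3 * L) hTL hTn
    (fun i j hij => integral_inner_eq_zero_of_sig he (Set.disjoint_left.2 fun x hx hx' => by
      simp only [Set.mem_Ioc] at hx hx'; push_cast at hij; omega) (hTm i) (hTm j) (hTi i) (hTi j)
      (hT0 i)) (Finset.Icc (1 : ℤ) n) (fun _ => (n : ℝ)⁻¹)
  have hrew : ∀ ω, (n : ℝ)⁻¹ * nearSum u n L α β ω -
      ∫ ω', (n : ℝ)⁻¹ * nearSum u n L α β ω' ∂P =
      ∑ i ∈ Finset.Icc (1 : ℤ) n, (n : ℝ)⁻¹ • T i ω := fun ω => by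
    have : ∫ ω', nearSum u n L α β ω' ∂P = ∑ i ∈ Finset.Icc (1 : ℤ) n, ∫ ω', V i ω' ∂P := by
      simp only [nearSum]
      exact integral_finsetSum _ fun i _ => hVi i
    rw [integral_const_mul, this, ← mul_sub, nearSum, ← Finset.sum_sub_distrib, Finset.mul_sum]
    rfl
  simp_rw [hrew]
  refine integral_abs_le_of_sq_le (memLp_finsetSum _ fun i _ => (hTL i).const_smul (n : ℝ)⁻¹)
    (by positivity) ?_
  simp only [Real.norm_eq_abs, sq_abs] at hsum
  refine hsum.trans ?_
  have h4 : ∑ _i ∈ Finset.Icc (1 : ℤ) n, (n : ℝ)⁻¹ ^ 2 = 1 / n := by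
    simp; field_simp
  rw [h4, mul_pow _ √_, Real.sq_sqrt (by positivity)]
  refine mul_le_mul_of_nonneg_right ?_ (by positivity)
  push_cast
  have hL3 : (L : ℝ) ^ 3 ≤ L ^ 4 := pow_le_pow_right₀ hL1 (by norm_num)
  have : 0 ≤ W ^ 2 * A ^ 4 := by positivity
  nlinarith [mul_le_mul_of_nonneg_left hL3 this]

/-- Concentration of the quadratic form of two bounded finitely dependent sequences. -/
theorem IsWindow.integral_abs_quadForm_sub_le (hα : IsWindow P e L A a α)
    (hβ : IsWindow P e L A b β) (he : IsIIDInnovation P ν e) {u : ℤ → ℝ} {W : ℝ} {B : ℕ}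
    (hu : IsBandKernel u W B) {n : ℕ} (hn : 0 < n) (hL : 0 < L) :
    ∫ ω, |quadForm u n (fun i => α i ω) (fun i => β i ω) -
      ∫ ω', quadForm u n (fun i => α i ω') (fun i => β i ω') ∂P| ∂P ≤
      (8 * L * a * b * W + 12 * L ^ 2 * W * A ^ 2) * √((2 * B + 1) / n) := by
  have h1 := ((memLp_farSum hα hβ he hu n).integrable (by norm_num)).const_mul (n : ℝ)⁻¹
  have h2 := ((memLp_farSum hβ hα he hu.flip n).integrable (by norm_num)).const_mul (n : ℝ)⁻¹
  have h3 := ((memLp_nearSum hα hβ he hu n).integrable (by norm_num)).const_mul (n : ℝ)⁻¹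
  simp_rw [quadForm_eq_far_add_near u n hL, mul_add]
  have i1 := integral_abs_farSum_le hα hβ he hu hn
  have i2 := integral_abs_farSum_le hβ hα he hu.flip hn
  have i3 := integral_abs_nearSum_sub_le hα hβ he hu hn hL
  have h4 : √(1 / (n : ℝ)) ≤ √((2 * (B : ℝ) + 1) / n) := by
    apply Real.sqrt_le_sqrt
    gcongr
    linarith [(Nat.cast_nonneg B : (0 : ℝ) ≤ B)]
  have h5 : 12 * (L : ℝ) ^ 2 * W * A ^ 2 * √(1 / n) ≤
      12 * L ^ 2 * W * A ^ 2 * √((2 * B + 1) / n) := by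
    have := hu.nonneg
    gcongr
  have h12 : Integrable (fun ω => (n : ℝ)⁻¹ * farSum u n L α β ω +
      (n : ℝ)⁻¹ * farSum (fun l => u (-l)) n L β α ω) P := h1.add h2
  have k1 := integral_abs_add_sub_integral_le h12 h3
  have k2 := integral_abs_add_sub_integral_le h1 h2
  have k3 := integral_abs_sub_integral_le h1
  have k4 := integral_abs_sub_integral_le h2
  linarith

end Window

/-! ### Bilinearity of the quadratic form. -/

section QuadForm

variable (u : ℤ → ℝ) (n : ℕ)

theorem quadForm_add_left (a a' b : ℤ → ℝ) :
    quadForm u n (fun i => a i + a' i) b = quadForm u n a b + quadForm u n a' b := by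
  simp only [quadForm, add_mul, mul_add, Finset.sum_add_distrib]

theorem quadForm_add_right (a b b' : ℤ → ℝ) :
    quadForm u n a (fun i => b i + b' i) = quadForm u n a b + quadForm u n a b' := by
  simp only [quadForm, mul_add, Finset.sum_add_distrib]

theorem quadForm_mul_left (t : ℝ) (a b : ℤ → ℝ) :
    quadForm u n (fun i => t * a i) b = t * quadForm u n a b := by
  simp only [quadForm, Finset.mul_sum]
  exact Finset.sum_congr rfl fun i _ => Finset.sum_congr rfl fun j _ => by ring

theorem quadForm_mul_right (t : ℝ) (a b : ℤ → ℝ) :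
    quadForm u n a (fun i => t * b i) = t * quadForm u n a b := by
  simp only [quadForm, Finset.mul_sum]
  exact Finset.sum_congr rfl fun i _ => Finset.sum_congr rfl fun j _ => by ring

theorem quadForm_sub_left (a a' b : ℤ → ℝ) :
    quadForm u n (fun i => a i - a' i) b = quadForm u n a b - quadForm u n a' b := by
  simp only [quadForm, sub_mul, mul_sub, Finset.sum_sub_distrib]

theorem quadForm_sub_right (a b b' : ℤ → ℝ) :
    quadForm u n a (fun i => b i - b' i) = quadForm u n a b - quadForm u n a b' := by
  simp only [quadForm, mul_sub, Finset.sum_sub_distrib]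

theorem quadForm_sum_left {ι : Type*} (s : Finset ι) (a : ι → ℤ → ℝ) (b : ℤ → ℝ) :
    quadForm u n (fun i => ∑ r ∈ s, a r i) b = ∑ r ∈ s, quadForm u n (a r) b := by
  classical
  induction s using Finset.induction_on with
  | empty => simp [quadForm]
  | insert r s hr ih => simp only [Finset.sum_insert hr, quadForm_add_left, ih]

theorem quadForm_sum_right {ι : Type*} (s : Finset ι) (a : ℤ → ℝ) (b : ι → ℤ → ℝ) :
    quadForm u n a (fun i => ∑ r ∈ s, b r i) = ∑ r ∈ s, quadForm u n a (b r) := by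
  classical
  induction s using Finset.induction_on with
  | empty => simp [quadForm]
  | insert r s hr ih => simp only [Finset.sum_insert hr, quadForm_add_right, ih]

theorem abs_quadForm_le {u : ℤ → ℝ} {W : ℝ} (hu : ∀ l, |u l| ≤ W) (a b : ℤ → ℝ) :
    |quadForm u n a b| ≤ (n : ℝ)⁻¹ * ∑ i ∈ Finset.Icc (1 : ℤ) n, ∑ j ∈ Finset.Icc (1 : ℤ) n,
      W * (|a i| * |b j|) := by
  rw [quadForm, abs_mul, abs_of_nonneg (by positivity : (0 : ℝ) ≤ (n : ℝ)⁻¹)]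
  refine mul_le_mul_of_nonneg_left ?_ (by positivity)
  refine (Finset.abs_sum_le_sum_abs _ _).trans (Finset.sum_le_sum fun i _ => ?_)
  refine (Finset.abs_sum_le_sum_abs _ _).trans (Finset.sum_le_sum fun j _ => ?_)
  rw [abs_mul, abs_mul]
  exact mul_le_mul_of_nonneg_right (hu _) (by positivity)

end QuadForm

/-! ### Multi-scale decompositions and a first-moment bound free of the bandwidth. -/

section MultiScale

variable {Ω S : Type*} [MeasurableSpace Ω] [MeasurableSpace S] {P : Measure Ω} {ν : Measure S}
  {e : ℤ → Ω → S}

theorem integrable_quadForm (u : ℤ → ℝ) (n : ℕ) {X Y : ℤ → Ω → ℝ} (hX : ∀ i, MemLp (X i) 2 P)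
    (hY : ∀ i, MemLp (Y i) 2 P) :
    Integrable (fun ω => quadForm u n (fun i => X i ω) (fun i => Y i ω)) P := by
  simp only [quadForm]
  exact (integrable_finsetSum _ fun i _ => integrable_finsetSum _ fun j _ =>
    ((hX i).integrable_mul (hY j)).const_mul _).const_mul _

/-- This bound may grow with `n`; it serves only to pass to the limit in the number of scales at
fixed `n`. -/
theorem integral_abs_quadForm_le_crude {u : ℤ → ℝ} {W : ℝ} (hu : ∀ l, |u l| ≤ W) (n : ℕ)
    {X Y : ℤ → Ω → ℝ} (hX : ∀ i, MemLp (X i) 2 P) (hY : ∀ i, MemLp (Y i) 2 P) :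
    ∫ ω, |quadForm u n (fun i => X i ω) (fun i => Y i ω)| ∂P ≤
      (n : ℝ)⁻¹ * W * ((∑ i ∈ Finset.Icc (1 : ℤ) n, lpNorm (X i) 2 P) *
        ∑ i ∈ Finset.Icc (1 : ℤ) n, lpNorm (Y i) 2 P) := by
  have hint : ∀ i j, Integrable (fun ω => W * (|X i ω| * |Y j ω|)) P := fun i j =>
    (integrable_norm_mul_norm (hX i) (hY j)).const_mul W
  have hW : 0 ≤ W := (abs_nonneg _).trans (hu 0)
  calc _ ≤ ∫ ω, (n : ℝ)⁻¹ * ∑ i ∈ Finset.Icc (1 : ℤ) n, ∑ j ∈ Finset.Icc (1 : ℤ) n,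
      W * (|X i ω| * |Y j ω|) ∂P :=
        integral_mono (integrable_quadForm u n hX hY).abs ((integrable_finsetSum _ fun i _ =>
          integrable_finsetSum _ fun j _ => hint i j).const_mul _)
          fun ω => abs_quadForm_le n hu _ _
    _ = (n : ℝ)⁻¹ * ∑ i ∈ Finset.Icc (1 : ℤ) n, ∑ j ∈ Finset.Icc (1 : ℤ) n,
      W * ∫ ω, |X i ω| * |Y j ω| ∂P := by
        rw [integral_const_mul, integral_finsetSum _ fun i _ =>
          integrable_finsetSum _ fun j _ => hint i j]
        congr 1
        refine Finset.sum_congr rfl fun i _ => ?_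
        rw [integral_finsetSum _ fun j _ => hint i j]
        exact Finset.sum_congr rfl fun j _ => integral_const_mul _ _
    _ ≤ (n : ℝ)⁻¹ * ∑ i ∈ Finset.Icc (1 : ℤ) n, ∑ j ∈ Finset.Icc (1 : ℤ) n,
      W * (lpNorm (X i) 2 P * lpNorm (Y j) 2 P) := by
        gcongr with i _ j _
        exact integral_norm_mul_norm_le (hX i) (hY j)
    _ = _ := by
        rw [Finset.sum_mul_sum, mul_assoc]
        congr 1
        simp_rw [Finset.mul_sum]

/-- `Y` is the sum over `r` of sequences that depend on `2 ^ r` innovations and have rapidly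
decreasing second moments. -/
structure IsMultiScale (P : Measure Ω) (e : ℤ → Ω → S) (c a : ℕ → ℝ) (Y : ℤ → Ω → ℝ)
    (A : ℕ → ℤ → Ω → ℝ) : Prop where
  window : ∀ r, IsWindow P e (2 ^ r) (c r) (a r) (A r)
  memLp : ∀ i, MemLp (Y i) 2 P
  tendsto : ∀ i, Tendsto (fun R => lpNorm (fun ω => Y i ω - ∑ r ∈ Finset.range R, A r i ω) 2 P)
    atTop (𝓝 0)
  summable : Summable fun r => 2 ^ r * a r

variable {c a c' a' : ℕ → ℝ} {Y Y' : ℤ → Ω → ℝ} {A A' : ℕ → ℤ → Ω → ℝ}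

/-- Every term after the first contains a truncation remainder as a factor. -/
theorem quadForm_eq_truncation (u : ℤ → ℝ) (n : ℕ) (y y' p p' : ℤ → ℝ) :
    quadForm u n y y' = quadForm u n p p' + quadForm u n (fun i => y i - p i) y' +
      (quadForm u n y (fun i => y' i - p' i) -
        quadForm u n (fun i => y i - p i) (fun i => y' i - p' i)) := by
  rw [quadForm_sub_left, quadForm_sub_left, quadForm_sub_right, quadForm_sub_right]
  ring

theorem IsMultiScale.nonneg (h : IsMultiScale P e c a Y A) (r : ℕ) : 0 ≤ a r :=
  (h.window r).norm_nonneg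

variable [IsProbabilityMeasure P]

theorem IsMultiScale.memLp_partial (h : IsMultiScale P e c a Y A) (he : IsIIDInnovation P ν e)
    (R : ℕ) (i : ℤ) : MemLp (fun ω => ∑ r ∈ Finset.range R, A r i ω) 2 P :=
  memLp_finsetSum _ fun r _ => (h.window r).memLp he i

/-- First moment of the quadratic form. The bound does not grow with the bandwidth. -/
theorem IsMultiScale.integral_abs_quadForm_le (h : IsMultiScale P e c a Y A)
    (h' : IsMultiScale P e c' a' Y' A') (he : IsIIDInnovation P ν e) {u : ℤ → ℝ} {W : ℝ} {B : ℕ}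
    (hu : IsBandKernel u W B) {n : ℕ} (hn : 2 * B + 1 ≤ n) :
    ∫ ω, |quadForm u n (fun i => Y i ω) (fun i => Y' i ω)| ∂P ≤
      6 * W * (∑' r, 2 ^ r * a r) * ∑' r, 2 ^ r * a' r := by
  have hW := hu.nonneg
  set p : ℕ → ℤ → Ω → ℝ := fun R i ω => ∑ r ∈ Finset.range R, A r i ω with hp
  set p' : ℕ → ℤ → Ω → ℝ := fun R i ω => ∑ r ∈ Finset.range R, A' r i ω with hp'
  have hpL : ∀ R i, MemLp (p R i) 2 P := fun R i => h.memLp_partial he R i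
  have hpL' : ∀ R i, MemLp (p' R i) 2 P := fun R i => h'.memLp_partial he R i
  have hr : ∀ R i, MemLp (fun ω => Y i ω - p R i ω) 2 P := fun R i => (h.memLp i).sub (hpL R i)
  have hr' : ∀ R i, MemLp (fun ω => Y' i ω - p' R i ω) 2 P := fun R i =>
    (h'.memLp i).sub (hpL' R i)
  have hmain : ∀ R, ∫ ω, |quadForm u n (fun i => p R i ω) (fun i => p' R i ω)| ∂P ≤
      6 * W * (∑' r, 2 ^ r * a r) * ∑' r, 2 ^ r * a' r := fun R => by
    have hwin : ∀ r s, Integrable (fun ω => quadForm u n (fun i => A r i ω) (fun i => A' s i ω)) P ∧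
        ∫ ω, |quadForm u n (fun i => A r i ω) (fun i => A' s i ω)| ∂P ≤
          6 * W * ((2 ^ r * a r) * (2 ^ s * a' s)) := fun r s => by
      -- The common window length `2 ^ (r + s)`, rather than the maximum, makes the bound a product,
      -- so the double sum over scales factorizes.
      have := ((h.window r).mono (L' := 2 ^ (r + s))
        (pow_le_pow_right₀ one_le_two (by omega))).integral_abs_quadForm_le
        ((h'.window s).mono (L' := 2 ^ (r + s)) (pow_le_pow_right₀ one_le_two (by omega))) he hu hn
        (by positivity)
      refine ⟨this.1, this.2.trans (le_of_eq ?_)⟩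
      push_cast
      rw [pow_add]; ring
    have hexp : ∀ ω, quadForm u n (fun i => p R i ω) (fun i => p' R i ω) =
        ∑ r ∈ Finset.range R, ∑ s ∈ Finset.range R,
          quadForm u n (fun i => A r i ω) (fun i => A' s i ω) := fun ω => by
      simp only [hp, hp', quadForm_sum_left u n _ (fun r i => A r i ω),
        quadForm_sum_right u n _ _ (fun r i => A' r i ω)]
    calc _ ≤ ∫ ω, ∑ r ∈ Finset.range R, ∑ s ∈ Finset.range R,
          |quadForm u n (fun i => A r i ω) (fun i => A' s i ω)| ∂P := by
          refine integral_mono (integrable_quadForm u n (hpL R) (hpL' R)).abs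
            (integrable_finsetSum _ fun r _ => integrable_finsetSum _ fun s _ =>
              (hwin r s).1.abs) fun ω => ?_
          simp only [hexp]
          exact (Finset.abs_sum_le_sum_abs _ _).trans
            (Finset.sum_le_sum fun r _ => Finset.abs_sum_le_sum_abs _ _)
      _ = ∑ r ∈ Finset.range R, ∑ s ∈ Finset.range R,
          ∫ ω, |quadForm u n (fun i => A r i ω) (fun i => A' s i ω)| ∂P := by
          rw [integral_finsetSum _ fun r _ => integrable_finsetSum _ fun s _ => (hwin r s).1.abs]
          exact Finset.sum_congr rfl fun r _ => integral_finsetSum _ fun s _ => (hwin r s).1.abs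
      _ ≤ ∑ r ∈ Finset.range R, ∑ s ∈ Finset.range R,
          6 * W * ((2 ^ r * a r) * (2 ^ s * a' s)) :=
          Finset.sum_le_sum fun r _ => Finset.sum_le_sum fun s _ => (hwin r s).2
      _ = 6 * W * (∑ r ∈ Finset.range R, 2 ^ r * a r) * ∑ s ∈ Finset.range R, 2 ^ s * a' s := by
          rw [mul_assoc (6 * W), Finset.sum_mul_sum, Finset.mul_sum]
          simp_rw [Finset.mul_sum]
      _ ≤ _ := by
          have e1 := h.summable.sum_le_tsum (Finset.range R) fun r _ =>
            mul_nonneg (by positivity) (h.nonneg r)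
          have e2 := h'.summable.sum_le_tsum (Finset.range R) fun r _ =>
            mul_nonneg (by positivity) (h'.nonneg r)
          have e3 : 0 ≤ ∑ s ∈ Finset.range R, 2 ^ s * a' s :=
            Finset.sum_nonneg fun s _ => mul_nonneg (by positivity) (h'.nonneg s)
          have e4 : 0 ≤ ∑' r, 2 ^ r * a r := tsum_nonneg fun s =>
            mul_nonneg (by positivity) (h.nonneg s)
          gcongr
  set N : (ℤ → Ω → ℝ) → ℝ := fun X => ∑ i ∈ Finset.Icc (1 : ℤ) n, lpNorm (X i) 2 P with hN
  have hlimN : Tendsto (fun R => N fun i ω => Y i ω - p R i ω) atTop (𝓝 0) := by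
    simpa using tendsto_finsetSum (Finset.Icc (1 : ℤ) n) fun i _ => h.tendsto i
  have hlimN' : Tendsto (fun R => N fun i ω => Y' i ω - p' R i ω) atTop (𝓝 0) := by
    simpa using tendsto_finsetSum (Finset.Icc (1 : ℤ) n) fun i _ => h'.tendsto i
  have hle : ∀ R, ∫ ω, |quadForm u n (fun i => Y i ω) (fun i => Y' i ω)| ∂P ≤
      6 * W * (∑' r, 2 ^ r * a r) * (∑' r, 2 ^ r * a' r) +
      (n : ℝ)⁻¹ * W * ((N fun i ω => Y i ω - p R i ω) * N Y') +
      ((n : ℝ)⁻¹ * W * (N Y * N fun i ω => Y' i ω - p' R i ω) +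
      (n : ℝ)⁻¹ * W * ((N fun i ω => Y i ω - p R i ω) * N fun i ω => Y' i ω - p' R i ω)) := by
    intro R
    have i1 := integrable_quadForm u n (hpL R) (hpL' R)
    have i2 := integrable_quadForm u n (hr R) h'.memLp
    have i3 := integrable_quadForm u n h.memLp (hr' R)
    have i4 := integrable_quadForm u n (hr R) (hr' R)
    have b1 := integral_abs_add_add_le i1 i2 (i3.sub i4)
    have b2 := integral_abs_add_le i3 i4.neg
    simp only [Pi.neg_apply, abs_neg, ← sub_eq_add_neg] at b2
    simp only [Pi.sub_apply] at b1
    have b3 := integral_abs_quadForm_le_crude hu.bound n (hr R) h'.memLp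
    have b4 := integral_abs_quadForm_le_crude hu.bound n h.memLp (hr' R)
    have b5 := integral_abs_quadForm_le_crude hu.bound n (hr R) (hr' R)
    have b6 := hmain R
    have hq := fun ω => quadForm_eq_truncation u n (fun i => Y i ω) (fun i => Y' i ω)
      (fun i => p R i ω) (fun i => p' R i ω)
    simp_rw [hq]
    simp only [hN]
    linarith
  have hlim := ((tendsto_const_nhds (x := 6 * W * (∑' r, 2 ^ r * a r) * (∑' r, 2 ^ r * a' r))).add
    ((hlimN.mul_const (N Y')).const_mul ((n : ℝ)⁻¹ * W))).add
    (((hlimN'.const_mul (N Y)).const_mul ((n : ℝ)⁻¹ * W)).add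
    ((hlimN.mul hlimN').const_mul ((n : ℝ)⁻¹ * W)))
  simp only [zero_mul, mul_zero, add_zero] at hlim
  exact ge_of_tendsto' hlim hle

end MultiScale

/-! ### Truncation of the scales and uniform concentration. -/

section MultiScale

variable {Ω S : Type*} [MeasurableSpace Ω] [MeasurableSpace S] {P : Measure Ω} {ν : Measure S}
  {e : ℤ → Ω → S}

theorem isWindow_zero {L : ℕ} {B : ℝ} (hB : 0 ≤ B) :
    IsWindow P e L B 0 (fun _ _ => 0) :=
  ⟨fun _ => stronglyMeasurable_const, fun _ _ => by simpa using hB, fun _ => by simp,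
    fun _ => by simp⟩

theorem IsWindow.mono_bdd {L : ℕ} {C C' b : ℝ} {α : ℤ → Ω → ℝ} (h : IsWindow P e L C b α)
    (hC : C ≤ C') : IsWindow P e L C' b α :=
  ⟨h.meas, fun i ω => (h.bdd i ω).trans hC, h.mean, h.norm⟩

variable [IsProbabilityMeasure P]
variable {c a c' a' : ℕ → ℝ} {Y Y' : ℤ → Ω → ℝ} {A A' : ℕ → ℤ → Ω → ℝ}

/-- Dropping finitely many scales leaves a sequence of the same kind, so the bandwidth-free bound
applies to it with a tail of a convergent series in place of the full sum. -/
theorem IsMultiScale.remainder (h : IsMultiScale P e c a Y A) (he : IsIIDInnovation P ν e)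
    (R : ℕ) : IsMultiScale P e c (fun r => if r < R then 0 else a r)
      (fun i ω => Y i ω - ∑ r ∈ Finset.range R, A r i ω)
      (fun r => if r < R then fun _ _ => 0 else A r) where
  window r := by
    split_ifs
    · exact isWindow_zero (h.window r).bdd_nonneg
    · exact h.window r
  memLp i := (h.memLp i).sub (h.memLp_partial he R i)
  tendsto i := by
    refine (h.tendsto i).congr' ?_
    filter_upwards [eventually_ge_atTop R] with R' hR'
    congr 1
    ext ω
    have e1 := Finset.sum_range_add_sum_Ico (fun r => A r i ω) hR'
    have e2 := Finset.sum_range_add_sum_Ico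
      (fun r => (if r < R then fun _ _ => 0 else A r) i ω) hR'
    have e3 : ∑ r ∈ Finset.range R, (if r < R then fun _ _ => 0 else A r) i ω = 0 :=
      Finset.sum_eq_zero fun r hr => by rw [if_pos (Finset.mem_range.1 hr)]
    have e4 : ∑ r ∈ Finset.Ico R R', (if r < R then fun _ _ => 0 else A r) i ω =
        ∑ r ∈ Finset.Ico R R', A r i ω :=
      Finset.sum_congr rfl fun r hr => by rw [if_neg (not_lt.2 (Finset.mem_Ico.1 hr).1)]
    linarith
  summable := by
    refine h.summable.of_nonneg_of_le (fun r => ?_) fun r => ?_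
    · have := h.nonneg r
      split_ifs <;> positivity
    · have := h.nonneg r
      split_ifs
      · simp only [mul_zero]; positivity
      · exact le_rfl

theorem tendsto_tsum_ite_lt {f : ℕ → ℝ} (hf : Summable f) :
    Tendsto (fun R => ∑' r, if r < R then 0 else f r) atTop (𝓝 0) := by
  have h1 : ∀ R, ∑' r, (if r < R then 0 else f r) = ∑' r, f r - ∑ r ∈ Finset.range R, f r := by
    intro R
    have h2 : HasSum (fun r => if r < R then f r else 0) (∑ r ∈ Finset.range R, f r) := by
      have h3 : HasSum (fun r => if r < R then f r else 0)
          (∑ r ∈ Finset.range R, if r < R then f r else 0) :=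
        hasSum_sum_of_ne_finset_zero fun r hr => by rw [if_neg (by simpa using hr)]
      rwa [Finset.sum_ite_of_true fun r hr => by simpa using hr] at h3
    have h3 := hf.hasSum.sub h2
    rw [← h3.tsum_eq]
    congr 1
    ext r
    split_ifs <;> simp
  simp_rw [h1]
  have := hf.hasSum.tendsto_sum_nat
  simpa using (tendsto_const_nhds (x := ∑' r, f r)).sub this

theorem IsWindow.sum {L : ℕ} (he : IsIIDInnovation P ν e) {ι : Type*} (s : Finset ι) {b c : ι → ℝ}
    {α : ι → ℤ → Ω → ℝ} (h : ∀ r ∈ s, IsWindow P e L (c r) (b r) (α r)) :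
    IsWindow P e L (∑ r ∈ s, c r) (∑ r ∈ s, b r) (fun i ω => ∑ r ∈ s, α r i ω) where
  meas i := by
    have := Finset.stronglyMeasurable_sum (m := sig e (Set.Ioc (i - L) i)) s
      fun r hr => (h r hr).meas i
    convert this using 1
    ext ω
    simp
  bdd i ω := (Finset.abs_sum_le_sum_abs _ _).trans (Finset.sum_le_sum fun r hr => (h r hr).bdd i ω)
  mean i := by
    rw [integral_finsetSum _ fun r hr => ((h r hr).memLp he i (p := 1)).integrable le_rfl]
    exact Finset.sum_eq_zero fun r hr => (h r hr).mean i
  norm i := by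
    have := lpNorm_sum_le (μ := P) (p := 2) (s := s) (f := fun r => α r i)
      (fun r hr => (h r hr).memLp he i) (by norm_num)
    have e1 : (fun ω => ∑ r ∈ s, α r i ω) = ∑ r ∈ s, α r i := by ext ω; simp
    rw [e1]
    exact this.trans (Finset.sum_le_sum fun r hr => (h r hr).norm i)

/-- Concentration of the quadratic form, uniformly over all pairs of sequences that have
multi-scale decompositions with given bounds. -/
theorem eventually_integral_abs_quadForm_sub_le (he : IsIIDInnovation P ν e) {W : ℝ}
    {u : ℕ → ℤ → ℝ} {B : ℕ → ℕ} (hu : ∀ n, IsBandKernel (u n) W (B n))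
    (hB : Tendsto (fun n : ℕ => (2 * (B n : ℝ) + 1) / n) atTop (𝓝 0)) (c a c' a' : ℕ → ℝ)
    {ε : ℝ} (hε : 0 < ε) :
    ∀ᶠ n : ℕ in atTop, ∀ (Y Y' : ℤ → Ω → ℝ) (A A' : ℕ → ℤ → Ω → ℝ),
      IsMultiScale P e c a Y A → IsMultiScale P e c' a' Y' A' →
      ∫ ω, |quadForm (u n) n (fun i => Y i ω) (fun i => Y' i ω) -
        ∫ ω', quadForm (u n) n (fun i => Y i ω') (fun i => Y' i ω') ∂P| ∂P ≤ ε := by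
  -- Without summability no sequence satisfies `IsMultiScale`, and the claim is vacuous.
  by_cases hs : Summable fun r => 2 ^ r * a r
  swap
  · exact .of_forall fun n Y Y' A A' h h' => absurd h.summable hs
  by_cases hs' : Summable fun r => 2 ^ r * a' r
  swap
  · exact .of_forall fun n Y Y' A A' h h' => absurd h'.summable hs'
  set D := ∑' r, 2 ^ r * a r
  set D' := ∑' r, 2 ^ r * a' r
  have hT := tendsto_tsum_ite_lt hs
  have hT' := tendsto_tsum_ite_lt hs'
  set E : ℕ → ℝ := fun R => ∑' r, if r < R then 0 else 2 ^ r * a r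
  set E' : ℕ → ℝ := fun R => ∑' r, if r < R then 0 else 2 ^ r * a' r
  have hlim : Tendsto (fun R => 2 * (6 * W * E R * D') + 2 * (6 * W * D * E' R) +
      2 * (6 * W * E R * E' R)) atTop (𝓝 0) := by
    have := ((((hT.const_mul (6 * W)).mul_const D').const_mul 2).add
      ((hT'.const_mul (6 * W * D)).const_mul 2)).add
      (((hT.const_mul (6 * W)).mul hT').const_mul 2)
    simpa using this
  -- The number of scales is fixed from the norms `a`, `a'` alone, before `n`. This gives uniformity
  -- over the sequences, which is needed because the position of the break changes with `n`.
  obtain ⟨R, hR⟩ := (hlim.eventually (gt_mem_nhds (half_pos hε))).exists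
  set C := ∑ r ∈ Finset.range R, c r
  set C' := ∑ r ∈ Finset.range R, c' r
  set b := ∑ r ∈ Finset.range R, a r
  set b' := ∑ r ∈ Finset.range R, a' r
  have hlim2 : Tendsto (fun n => (8 * ((2 ^ R : ℕ) : ℝ) * b * b' * W +
      12 * ((2 ^ R : ℕ) : ℝ) ^ 2 * W * (max C C') ^ 2) * √((2 * (B n : ℝ) + 1) / n)) atTop (𝓝 0) := by
    have := (hB.sqrt.const_mul (8 * ((2 ^ R : ℕ) : ℝ) * b * b' * W +
      12 * ((2 ^ R : ℕ) : ℝ) ^ 2 * W * (max C C') ^ 2))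
    simpa using this
  filter_upwards [hlim2.eventually (gt_mem_nhds (half_pos hε)),
    hB.eventually (gt_mem_nhds one_pos), eventually_gt_atTop 0] with n hn1 hn2 hn3
    Y Y' A A' h h'
  have hBn : 2 * B n + 1 ≤ n := by
    rw [div_lt_one (by exact_mod_cast hn3)] at hn2
    exact_mod_cast hn2.le
  set p : ℤ → Ω → ℝ := fun i ω => ∑ r ∈ Finset.range R, A r i ω
  set p' : ℤ → Ω → ℝ := fun i ω => ∑ r ∈ Finset.range R, A' r i ω
  have hp : IsWindow P e (2 ^ R) C b p := IsWindow.sum he _ fun r hr =>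
    (h.window r).mono (pow_le_pow_right₀ one_le_two (Finset.mem_range.1 hr).le)
  have hp' : IsWindow P e (2 ^ R) C' b' p' := IsWindow.sum he _ fun r hr =>
    (h'.window r).mono (pow_le_pow_right₀ one_le_two (Finset.mem_range.1 hr).le)
  have hρ := h.remainder he R
  have hρ' := h'.remainder he R
  have hDE : ∑' r, 2 ^ r * (if r < R then 0 else a r) = E R := by simp only [mul_ite, mul_zero, E]
  have hDE' : ∑' r, 2 ^ r * (if r < R then 0 else a' r) = E' R := by
    simp only [mul_ite, mul_zero, E']
  have i1 := integrable_quadForm (u n) n (fun i => hp.memLp he i) (fun i => hp'.memLp he i)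
  have i2 := integrable_quadForm (u n) n hρ.memLp h'.memLp
  have i3 := integrable_quadForm (u n) n h.memLp hρ'.memLp
  have i4 := integrable_quadForm (u n) n hρ.memLp hρ'.memLp
  have b1 := (hp.mono_bdd (le_max_left C C')).integral_abs_quadForm_sub_le
    (hp'.mono_bdd (le_max_right C C')) he (hu n) hn3 (by positivity)
  have b2 := hρ.integral_abs_quadForm_le h' he (hu n) hBn
  have b3 := h.integral_abs_quadForm_le hρ' he (hu n) hBn
  have b4 := hρ.integral_abs_quadForm_le hρ' he (hu n) hBn
  rw [hDE] at b2 b4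
  rw [hDE'] at b3 b4
  have k2 := integral_abs_sub_integral_le i2
  have k3 := integral_abs_sub_integral_le i3
  have k4 := integral_abs_sub_integral_le i4.neg
  have k34 := integral_abs_add_sub_integral_le i3 i4.neg
  simp only [Pi.neg_apply, abs_neg, ← sub_eq_add_neg] at k4 k34
  have k12 := integral_abs_add_sub_integral_le i1 i2
  have k := integral_abs_add_sub_integral_le
    (f := fun ω => quadForm (u n) n (fun i => p i ω) (fun i => p' i ω) +
      quadForm (u n) n (fun i => Y i ω - p i ω) (fun i => Y' i ω)) (i1.add i2)
    (g := fun ω => quadForm (u n) n (fun i => Y i ω) (fun i => Y' i ω - p' i ω) -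
      quadForm (u n) n (fun i => Y i ω - p i ω) (fun i => Y' i ω - p' i ω)) (i3.sub i4)
  have hq := fun ω => quadForm_eq_truncation (u n) n (fun i => Y i ω) (fun i => Y' i ω)
    (fun i => p i ω) (fun i => p' i ω)
  simp_rw [hq]
  linarith

end MultiScale

/-! ### Weakly dependent sequences and their covariances. -/

section WeakDep

variable {Ω S : Type*} [MeasurableSpace Ω] [MeasurableSpace S] {P : Measure Ω} {ν : Measure S}
  {e : ℤ → Ω → S}
variable {H : Type*} [NormedAddCommGroup H] [InnerProductSpace ℝ H]

/-- A centered sequence adapted to the past of the innovations, whose `i`-th term is approximated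
with error `δ l` by a bounded function of the last `l` innovations. -/
structure IsWeakDep (P : Measure Ω) (e : ℤ → Ω → S) (c δ : ℕ → ℝ) (Y : ℤ → Ω → H)
    (Z : ℕ → ℤ → Ω → H) : Prop where
  adapted : ∀ i, StronglyMeasurable[sig e (Set.Iic i)] (Y i)
  memLp : ∀ i, MemLp (Y i) 2 P
  mean : ∀ i, ∫ ω, Y i ω ∂P = 0
  approx_meas : ∀ (l : ℕ) (i : ℤ), StronglyMeasurable[sig e (Set.Ioc (i - (l : ℤ)) i)] (Z l i)
  approx_bdd : ∀ l i ω, ‖Z l i ω‖ ≤ c l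
  approx_mean : ∀ l i, ∫ ω, Z l i ω ∂P = 0
  approx_norm : ∀ l i, lpNorm (fun ω => Y i ω - Z l i ω) 2 P ≤ δ l
  antitone : Antitone δ
  summable : Summable δ

variable {c δ : ℕ → ℝ} {Y Y' : ℤ → Ω → H} {Z Z' : ℕ → ℤ → Ω → H}

theorem IsWeakDep.nonneg (h : IsWeakDep P e c δ Y Z) (l : ℕ) : 0 ≤ δ l :=
  lpNorm_nonneg.trans (h.approx_norm l 0)

/-- All conditions are imposed index by index, so a sequence may switch at any time without changing
the bounds. -/
theorem IsWeakDep.piecewise (h : IsWeakDep P e c δ Y Z) (h' : IsWeakDep P e c δ Y' Z') (k : ℤ) :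
    IsWeakDep P e c δ (fun i => if i ≤ k then Y i else Y' i)
      (fun l i => if i ≤ k then Z l i else Z' l i) where
  adapted i := by split_ifs; exacts [h.adapted i, h'.adapted i]
  memLp i := by split_ifs; exacts [h.memLp i, h'.memLp i]
  mean i := by split_ifs; exacts [h.mean i, h'.mean i]
  approx_meas l i := by split_ifs; exacts [h.approx_meas l i, h'.approx_meas l i]
  approx_bdd l i ω := by split_ifs; exacts [h.approx_bdd l i ω, h'.approx_bdd l i ω]
  approx_mean l i := by split_ifs; exacts [h.approx_mean l i, h'.approx_mean l i]
  approx_norm l i := by split_ifs; exacts [h.approx_norm l i, h'.approx_norm l i]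
  antitone := h.antitone
  summable := h.summable

variable [IsProbabilityMeasure P]

theorem IsWeakDep.memLp_approx (h : IsWeakDep P e c δ Y Z) (he : IsIIDInnovation P ν e) (l : ℕ)
    (i : ℤ) : MemLp (Z l i) 2 P :=
  MemLp.of_bound ((h.approx_meas l i).mono (sig_le he _)).aestronglyMeasurable (c l)
    (.of_forall (h.approx_bdd l i))

variable [CompleteSpace H]

/-- The approximation at depth `0` is measurable for the trivial σ-algebra and centered, hence zero;
so `δ 0` bounds the norm of the sequence itself. -/
theorem IsWeakDep.lpNorm_le (h : IsWeakDep P e c δ Y Z) (i : ℤ) :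
    lpNorm (Y i) 2 P ≤ δ 0 := by
  have h1 := h.approx_norm 0 i
  have h2 : Z 0 i = fun _ => 0 := by
    have h3 := h.approx_meas 0 i
    have hb : sig e (Set.Ioc (i - ((0 : ℕ) : ℤ)) i) = ⊥ := by simp [sig]
    rw [hb] at h3
    obtain ⟨z, hz⟩ := stronglyMeasurable_bot_iff.1 h3
    have h4 := h.approx_mean 0 i
    rw [hz] at h4 ⊢
    simp at h4
    rw [h4]
  simpa [h2] using h1

/-- For `j ≤ i`, the approximation of `Y i` by its last `i - j` innovations uses only those after
time `j`. It is therefore uncorrelated with `Y' j`, and only the approximation error remains. -/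
theorem IsWeakDep.abs_integral_inner_le (h : IsWeakDep P e c δ Y Z)
    {c' δ' : ℕ → ℝ} (h' : IsWeakDep P e c' δ' Y' Z')
    (he : IsIIDInnovation P ν e) (i j : ℤ) :
    |∫ ω, ⟪Y i ω, Y' j ω⟫ ∂P| ≤ max (δ 0) (δ' 0) * (max (δ (i - j).natAbs) (δ' (i - j).natAbs)) := by
  wlog hij : j ≤ i generalizing Y Y' Z Z' i j c δ c' δ'
  · have := this h' h j i (by omega)
    rw [integral_congr_ae (.of_forall fun ω => real_inner_comm (Y' j ω) (Y i ω)),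
      max_comm (δ 0), ← Int.natAbs_neg, neg_sub, max_comm (δ _)]
    exact this
  set l := (i - j).natAbs with hl
  have hZ := h.memLp_approx he l i
  have hdisj : Disjoint (Set.Ioc (i - (l : ℤ)) i) (Set.Iic j) :=
    Set.disjoint_left.2 fun x hx hx' => by
      simp only [Set.mem_Ioc, Set.mem_Iic] at hx hx'; omega
  have h0 := integral_inner_eq_zero_of_sig he hdisj (h.approx_meas l i) (h'.adapted j)
    (hZ.integrable (by norm_num)) ((h'.memLp j).integrable (by norm_num)) (h.approx_mean l i)
  have hYZ : MemLp (fun ω => Y i ω - Z l i ω) 2 P := (h.memLp i).sub hZ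
  have e1 : ∫ ω, ⟪Y i ω, Y' j ω⟫ ∂P = ∫ ω, ⟪Y i ω - Z l i ω, Y' j ω⟫ ∂P := by
    simp_rw [inner_sub_left]
    rw [integral_sub (integrable_inner_of_memLp (h.memLp i) (h'.memLp j))
      (integrable_inner_of_memLp hZ (h'.memLp j)), h0, sub_zero]
  rw [e1, mul_comm]
  refine (SpectralBreak.abs_integral_inner_le hYZ (h'.memLp j)).trans ?_
  exact mul_le_mul ((h.approx_norm l i).trans (le_max_left _ _))
    ((h'.lpNorm_le j).trans (le_max_right _ _)) lpNorm_nonneg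
    ((h.nonneg l).trans (le_max_left _ _))

/-- The second moment of a weighted sum of a weakly dependent sequence. -/
theorem IsWeakDep.integral_norm_sum_sq_le (h : IsWeakDep P e c δ Y Z)
    (he : IsIIDInnovation P ν e) (s : Finset ℤ) (t : ℤ → ℝ) :
    ∫ ω, ‖∑ i ∈ s, t i • Y i ω‖ ^ 2 ∂P ≤ 2 * (δ 0 * ∑' l, δ l) * ∑ i ∈ s, t i ^ 2 := by
  rw [← tsum_mul_left]
  refine SpectralBreak.integral_norm_sum_sq_le (κ := fun l => δ 0 * δ l)
    (fun m => mul_nonneg (h.nonneg 0) (h.nonneg m)) (h.summable.mul_left _) h.memLp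
    (fun i j => ?_) s t
  simpa using h.abs_integral_inner_le h he i j

end WeakDep

/-! ### From weak dependence to dyadic blocks. -/

section WeakDepReal

/-- The dyadic blocks of the approximations. -/
def dyadicBlock {Ω : Type*} (Z : ℕ → ℤ → Ω → ℝ) : ℕ → ℤ → Ω → ℝ
  | 0 => Z 1
  | r + 1 => fun i ω => Z (2 ^ (r + 1)) i ω - Z (2 ^ r) i ω

/-- Bounds for the dyadic blocks. -/
noncomputable def dyadicBound (c : ℕ → ℝ) : ℕ → ℝ
  | 0 => c 1
  | r + 1 => c (2 ^ (r + 1)) + c (2 ^ r)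

/-- Norm bounds for the dyadic blocks. -/
noncomputable def dyadicNorm (δ : ℕ → ℝ) : ℕ → ℝ
  | 0 => 2 * δ 0
  | r + 1 => 2 * δ (2 ^ r)

theorem sum_dyadicBlock {Ω : Type*} (Z : ℕ → ℤ → Ω → ℝ) (R : ℕ) (i : ℤ) (ω : Ω) :
    ∑ r ∈ Finset.range (R + 1), dyadicBlock Z r i ω = Z (2 ^ R) i ω := by
  induction R with
  | zero => simp [dyadicBlock]
  | succ R ih => rw [Finset.sum_range_succ, ih]; simp [dyadicBlock]

variable {Ω S : Type*} [MeasurableSpace Ω] [MeasurableSpace S] {P : Measure Ω} {ν : Measure S}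
  {e : ℤ → Ω → S} {c δ : ℕ → ℝ} {Y Y' : ℤ → Ω → ℝ} {Z Z' : ℕ → ℤ → Ω → ℝ}
  [IsProbabilityMeasure P]

/-- Consecutive dyadic approximations differ by at most `2 * δ (2 ^ r)`, by the triangle inequality
through `Y`. Cauchy condensation turns summability of the antitone `δ` into summability of `2 ^ r *
δ (2 ^ r)`; this is why antitonicity is part of `IsWeakDep`. -/
theorem IsWeakDep.isMultiScale (h : IsWeakDep P e c δ Y Z) (he : IsIIDInnovation P ν e) :
    IsMultiScale P e (dyadicBound c) (dyadicNorm δ) Y (dyadicBlock Z) where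
  window r := by
    have hle : ∀ l i, lpNorm (Z l i) 2 P ≤ lpNorm (Y i) 2 P + δ l := fun l i => by
      have h1 := lpNorm_sub_le (h.memLp i) (g := fun ω => Y i ω - Z l i ω) (p := 2) (by norm_num)
      have h2 : (Y i - fun ω => Y i ω - Z l i ω) = Z l i := by ext ω; simp
      rw [h2] at h1
      linarith [h.approx_norm l i]
    cases r with
    | zero =>
      refine ⟨fun i => h.approx_meas 1 i, fun i ω => h.approx_bdd 1 i ω,
        fun i => h.approx_mean 1 i, fun i => ?_⟩
      have := hle 1 i
      have := h.lpNorm_le i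
      have := h.antitone (Nat.zero_le 1)
      simp only [dyadicBlock, dyadicNorm]
      linarith
    | succ r =>
      refine ⟨fun i => ?_, fun i ω => ?_, fun i => ?_, fun i => ?_⟩
      · refine (h.approx_meas _ i).sub ((h.approx_meas _ i).mono (sig_mono ?_))
        refine Set.Ioc_subset_Ioc_left ?_
        have : (2 : ℤ) ^ r ≤ 2 ^ (r + 1) := pow_le_pow_right₀ (by norm_num) (by omega)
        push_cast
        omega
      · exact (norm_sub_le _ _).trans (add_le_add (h.approx_bdd _ i ω) (h.approx_bdd _ i ω))
      · simp only [dyadicBlock]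
        rw [integral_sub ((h.memLp_approx he _ i).integrable (by norm_num))
          ((h.memLp_approx he _ i).integrable (by norm_num)), h.approx_mean, h.approx_mean,
          sub_zero]
      · have hm : ∀ l, MemLp (fun ω => Y i ω - Z l i ω) 2 P := fun l =>
          (h.memLp i).sub (h.memLp_approx he l i)
        have h1 := lpNorm_sub_le (hm (2 ^ r)) (g := fun ω => Y i ω - Z (2 ^ (r + 1)) i ω)
          (p := 2) (by norm_num)
        have h2 : ((fun ω => Y i ω - Z (2 ^ r) i ω) - fun ω => Y i ω - Z (2 ^ (r + 1)) i ω) =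
            dyadicBlock Z (r + 1) i := by ext ω; simp [dyadicBlock]
        rw [h2] at h1
        have h3 : δ (2 ^ (r + 1)) ≤ δ (2 ^ r) :=
          h.antitone (pow_le_pow_right₀ one_le_two (by omega))
        have := h.approx_norm (2 ^ r) i
        have := h.approx_norm (2 ^ (r + 1)) i
        simp only [dyadicNorm]
        linarith
  memLp := h.memLp
  tendsto i := by
    rw [← tendsto_add_atTop_iff_nat 1]
    simp_rw [sum_dyadicBlock]
    refine squeeze_zero (fun R => lpNorm_nonneg) (fun R => h.approx_norm _ i) ?_
    exact h.summable.tendsto_atTop_zero.comp (tendsto_pow_atTop_atTop_of_one_lt (by norm_num))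
  summable := by
    rw [← summable_nat_add_iff 1]
    have h1 := (summable_condensed_iff_of_nonneg h.nonneg
      fun m n _ hmn => h.antitone hmn).2 h.summable
    refine (h1.mul_left 4).congr fun r => ?_
    simp only [dyadicNorm]
    rw [pow_succ]
    ring

end WeakDepReal

/-! ### Sections, Hölder bounds for quadratic maps, and truncation. -/

section Moments

variable {α β E H : Type*} [MeasurableSpace α] [MeasurableSpace β] [NormedAddCommGroup E]
  [NormedAddCommGroup H]

/-- Some section does not exceed the average. Freezing the independent copy at such a point replaces
the coupled sequence by a function of finitely many innovations, with no loss in the error. -/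
theorem exists_eLpNorm_section_le {μ : Measure α} {ν : Measure β} [IsProbabilityMeasure μ]
    [IsProbabilityMeasure ν] {F : α × β → E} (hF : StronglyMeasurable F) :
    ∃ y, eLpNorm (fun x => F (x, y)) 4 μ ≤ eLpNorm F 4 (μ.prod ν) := by
  have hm : Measurable fun z => ‖F z‖ₑ ^ (4 : ℝ) := hF.enorm.pow_const _
  obtain ⟨y, hy⟩ := exists_le_lintegral (μ := ν) (f := fun y => ∫⁻ x, ‖F (x, y)‖ₑ ^ (4 : ℝ) ∂μ)
    (hm.lintegral_prod_left'.aemeasurable)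
  refine ⟨y, ?_⟩
  rw [eLpNorm_eq_lintegral_rpow_enorm_toReal (by norm_num) (by norm_num),
    eLpNorm_eq_lintegral_rpow_enorm_toReal (by norm_num) (by norm_num),
    lintegral_prod_symm _ (by simpa using hm.aemeasurable)]
  simp only [ENNReal.toReal_ofNat]
  gcongr

instance holderTriple_four_four_two : ENNReal.HolderTriple 4 4 2 where
  inv_add_inv_eq_inv := by
    have h : (4 : ℝ≥0∞) = 2 * 2 := by norm_num
    rw [h, ENNReal.mul_inv (by norm_num) (by norm_num), ← two_mul, ← mul_assoc,
      ENNReal.mul_inv_cancel (by norm_num) (by norm_num), one_mul]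

/-- Hölder's inequality for the product of the increment and the linear growth factor. With
exponents `4, 4, 2`, four moments of the errors give two moments of a quadratic function. -/
theorem memLp_comp_sub_and_lpNorm_le {μ : Measure α} [IsProbabilityMeasure μ] {p r : ℝ≥0∞}
    [ENNReal.HolderTriple p p r] (hp : 1 ≤ p) (hpt : p ≠ ∞) {q : E → H} {K : ℝ}
    (hqc : Continuous q) (hK : 0 ≤ K) (hq : ∀ x y, ‖q x - q y‖ ≤ K * ‖x - y‖ * (1 + ‖x‖ + ‖y‖))
    {f g : α → E} (hf : MemLp f p μ) (hg : MemLp g p μ) :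
    MemLp (fun x => q (f x) - q (g x)) r μ ∧ lpNorm (fun x => q (f x) - q (g x)) r μ ≤
      K * lpNorm (fun x => f x - g x) p μ * (1 + lpNorm f p μ + lpNorm g p μ) := by
  have h0 : MemLp (fun _ : α => (1 : ℝ)) p μ := memLp_const 1
  have h01 : MemLp (fun x => 1 + ‖f x‖) p μ := h0.add hf.norm
  have h1 : MemLp (fun x => 1 + ‖f x‖ + ‖g x‖) p μ := h01.add hg.norm
  have h2 : MemLp (fun x => ‖f x - g x‖) p μ := (hf.sub hg).norm
  have h3 : MemLp (fun x => ‖f x - g x‖ * (1 + ‖f x‖ + ‖g x‖)) r μ := MemLp.mul' h1 h2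
  have hm : AEStronglyMeasurable (fun x => q (f x) - q (g x)) μ :=
    (hqc.comp_aestronglyMeasurable hf.1).sub (hqc.comp_aestronglyMeasurable hg.1)
  have hle : ∀ x, ‖q (f x) - q (g x)‖ ≤
      K * ‖‖f x - g x‖ * (1 + ‖f x‖ + ‖g x‖)‖ := fun x => by
    refine (hq _ _).trans_eq ?_
    rw [Real.norm_of_nonneg (by positivity), mul_assoc]
  refine ⟨h3.of_le_mul hm (.of_forall hle), ?_⟩
  have hle' : ∀ᵐ x ∂μ, ‖q (f x) - q (g x)‖ ≤
      K * ‖‖f x - g x‖ * (1 + ‖f x‖ + ‖g x‖)‖ := .of_forall hle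
  have h4 := eLpNorm_le_mul_eLpNorm_of_ae_le_mul hle' r
  have h5 := eLpNorm_le_eLpNorm_mul_eLpNorm'_of_norm (p := p) (q := p) (r := r) h2.1 h1.1 (fun a b => a * b) 1
    (.of_forall fun x => by simp)
  rw [ENNReal.coe_one, one_mul] at h5
  have h6 : lpNorm (fun x => 1 + ‖f x‖ + ‖g x‖) p μ ≤ 1 + lpNorm f p μ + lpNorm g p μ := by
    have a1 : lpNorm (fun x => 1 + ‖f x‖ + ‖g x‖) p μ ≤ lpNorm (fun x => 1 + ‖f x‖) p μ +
        lpNorm (fun x => ‖g x‖) p μ := lpNorm_add_le h01 (g := fun x => ‖g x‖) hp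
    have a2 : lpNorm (fun x => 1 + ‖f x‖) p μ ≤ lpNorm (fun _ : α => (1 : ℝ)) p μ +
        lpNorm (fun x => ‖f x‖) p μ := lpNorm_add_le h0 (g := fun x => ‖f x‖) hp
    rw [lpNorm_const' (one_pos.trans_le hp).ne' hpt, lpNorm_norm hf.1 p] at a2
    rw [lpNorm_norm hg.1 p] at a1
    simp only [norm_one, probReal_univ, Real.one_rpow, mul_one] at a2
    linarith
  rw [← toReal_eLpNorm hm]
  calc (eLpNorm (fun x => q (f x) - q (g x)) r μ).toReal
      ≤ (ENNReal.ofReal K * (eLpNorm (fun x => ‖f x - g x‖) p μ *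
        eLpNorm (fun x => 1 + ‖f x‖ + ‖g x‖) p μ)).toReal := by
        refine ENNReal.toReal_mono ?_ (h4.trans (by gcongr))
        exact ENNReal.mul_ne_top ENNReal.ofReal_ne_top
          (ENNReal.mul_ne_top h2.eLpNorm_ne_top h1.eLpNorm_ne_top)
    _ = K * lpNorm (fun x => f x - g x) p μ * lpNorm (fun x => 1 + ‖f x‖ + ‖g x‖) p μ := by
        rw [ENNReal.toReal_mul, ENNReal.toReal_mul, ENNReal.toReal_ofReal hK, toReal_eLpNorm h2.1,
          toReal_eLpNorm h1.1, show lpNorm (fun x => ‖f x - g x‖) p μ = lpNorm (fun x => f x - g x) p μ from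
            lpNorm_norm (hf.sub hg).1 p]
        ring
    _ ≤ _ := mul_le_mul_of_nonneg_left h6 (mul_nonneg hK lpNorm_nonneg)

/-- Truncation in `L²`. -/
theorem exists_truncation_lpNorm_le {μ : Measure α} [IsProbabilityMeasure μ] {f : α → H}
    (hf : MemLp f 2 μ) (hfm : StronglyMeasurable f) {ε : ℝ} (hε : 0 < ε) :
    ∃ M : ℝ, 0 ≤ M ∧ lpNorm (fun x => f x - (if ‖f x‖ < M then f x else 0)) 2 μ ≤ ε := by
  obtain ⟨M, hM0, hM⟩ := hf.eLpNorm_indicator_norm_ge_pos_le hfm hε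
  refine ⟨M, hM0.le, ?_⟩
  have h1 : (fun x => f x - (if ‖f x‖ < M then f x else 0)) = {x | M ≤ ↑‖f x‖₊}.indicator f := by
    ext x
    by_cases hx : ‖f x‖ < M
    · rw [Set.indicator_of_notMem (by simpa using hx)]; simp [hx]
    · rw [Set.indicator_of_mem (by simpa using hx)]; simp [hx]
  have h2 : MeasurableSet {x | M ≤ ↑‖f x‖₊} := measurableSet_le measurable_const hfm.norm.measurable
  rw [h1, ← toReal_eLpNorm (hfm.indicator h2).aestronglyMeasurable]
  exact ENNReal.toReal_le_of_le_ofReal hε.le hM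

end Moments

/-! ### The past of the innovations as a point of the product space. -/

section Past

variable {Ω S : Type*} [MeasurableSpace S] {e : ℤ → Ω → S}

/-- The sequence of innovations seen from time `i` backwards. -/
def past (e : ℤ → Ω → S) (i : ℤ) (ω : Ω) : ℕ → S := fun m => e (i - m) ω

theorem measurable_past_sig (i : ℤ) : Measurable[sig e (Set.Iic i)] (past e i) :=
  @measurable_pi_iff _ _ _ (sig e (Set.Iic i)) _ _ |>.2 fun m =>
    measurable_innovation_sig e (by simp)

theorem measurable_splice_past_sig (i : ℤ) (l : ℕ) (s : ℕ → S) :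
    Measurable[sig e (Set.Ioc (i - (l : ℤ)) i)] fun ω => splice l (past e i ω) s := by
  refine @measurable_pi_iff _ _ _ (sig e (Set.Ioc (i - (l : ℤ)) i)) _ _ |>.2 fun m => ?_
  by_cases hm : m < l
  · simp only [splice, hm, if_true, past]
    exact measurable_innovation_sig e (by simp only [Set.mem_Ioc]; omega)
  · simp only [splice, hm, if_false]
    exact measurable_const

theorem measurable_splice (l : ℕ) : Measurable fun z : (ℕ → S) × (ℕ → S) => splice l z.1 z.2 := by
  refine measurable_pi_iff.2 fun m => ?_
  by_cases hm : m < l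
  · simp only [splice, hm, if_true]; fun_prop
  · simp only [splice, hm, if_false]; fun_prop

variable [MeasurableSpace Ω] {P : Measure Ω} {ν : Measure S}

theorem measurePreserving_past [IsProbabilityMeasure ν] (he : IsIIDInnovation P ν e) (i : ℤ) :
    MeasurePreserving (past e i) P (Measure.infinitePi fun _ : ℕ => ν) where
  measurable := (measurable_past_sig i).mono (sig_le he _) le_rfl
  map_eq := by
    have hinj : Function.Injective fun m : ℕ => i - (m : ℤ) := fun m m' h => by
      simp only at h; omega
    have h := iIndepFun.map_fun_eq_infinitePi_map (fun m : ℕ => he.measurable (i - m))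
      (he.indep.precomp hinj)
    simp only [he.law] at h
    exact h

end Past

/-! ### Fourth moments and finite-memory approximations of a segment. -/

section Segment

variable {Ω S : Type*} [MeasurableSpace Ω] [MeasurableSpace S] {P : Measure Ω} {ν : Measure S}
  [IsProbabilityMeasure ν] {e : ℤ → Ω → S} {g : (ℕ → S) → L2}

theorem IsSegment.exists_approx (hg : IsSegment P ν e g) :
    MemLp g 4 (Measure.infinitePi fun _ : ℕ => ν) ∧
    ∃ (s : ℕ → ℕ → S) (D : ℕ → ℝ), Summable D ∧
      ∀ l, MemLp (fun x => g (splice l x (s l))) 4 (Measure.infinitePi fun _ : ℕ => ν) ∧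
        lpNorm (fun x => g x - g (splice l x (s l))) 4 (Measure.infinitePi fun _ : ℕ => ν) ≤ D l := by
  obtain ⟨p, hp, hs⟩ := hg.approximable
  set π := Measure.infinitePi fun _ : ℕ => ν
  set F : ℕ → (ℕ → S) × (ℕ → S) → L2 := fun l z => g z.1 - g (splice l z.1 z.2)
  have hF : ∀ l, StronglyMeasurable (F l) := fun l =>
    (hg.measurable.comp_measurable measurable_fst).sub
      (hg.measurable.comp_measurable (measurable_splice l))
  have h4 : ∀ l, eLpNorm (F l) 4 (π.prod π) ≤ eLpNorm (F l) (ENNReal.ofReal p) (π.prod π) :=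
    fun l => eLpNorm_le_eLpNorm_of_exponent_le (by
      rw [show (4 : ℝ≥0∞) = ENNReal.ofReal 4 by simp]
      exact ENNReal.ofReal_le_ofReal hp.le) (hF l).aestronglyMeasurable
  have htop : ∀ l, eLpNorm (F l) (ENNReal.ofReal p) (π.prod π) ≠ ∞ := ENNReal.ne_top_of_tsum_ne_top hs
  choose s hsec using fun l => exists_eLpNorm_section_le (μ := π) (ν := π) (hF l)
  have hsm : ∀ l, Measurable fun x => splice l x (s l) := fun l =>
    (measurable_splice l).comp (measurable_id.prodMk measurable_const)
  have hd : ∀ l, MemLp (fun x => g x - g (splice l x (s l))) 4 π := fun l =>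
    ⟨(hg.measurable.sub (hg.measurable.comp_measurable (hsm l))).aestronglyMeasurable,
      ((hsec l).trans (h4 l)).trans_lt (htop l).lt_top⟩
  -- At depth `0` the splice is the constant `s 0`, so the first term of the approximability series
  -- already bounds `g` minus a constant.
  have hg4 : MemLp g 4 π := by
    have h0 := (hd 0).add (memLp_const (g (s 0)))
    refine h0.ae_eq (.of_forall fun x => ?_)
    have : splice 0 x (s 0) = s 0 := by ext; simp [splice]
    simp [this]
  refine ⟨hg4, s, fun l => (eLpNorm (F l) (ENNReal.ofReal p) (π.prod π)).toReal,
    ENNReal.summable_toReal hs, fun l => ⟨?_, ?_⟩⟩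
  · refine (hg4.sub (hd l)).ae_eq (.of_forall fun x => ?_)
    simp
  · rw [← toReal_eLpNorm (hd l).1]
    exact ENNReal.toReal_mono (htop l) ((hsec l).trans (h4 l))

end Segment

/-! ### Common bounds for two sequences and monotone error bounds. -/

section Combine

variable {Ω S : Type*} [MeasurableSpace Ω] [MeasurableSpace S] {P : Measure Ω}
  {e : ℤ → Ω → S}
variable {H : Type*} [NormedAddCommGroup H] [InnerProductSpace ℝ H]
variable {c δ c' δ' : ℕ → ℝ} {Y : ℤ → Ω → H} {Z : ℕ → ℤ → Ω → H}

theorem IsWeakDep.mono (h : IsWeakDep P e c δ Y Z) (hc : ∀ l, c l ≤ c' l) (hδ : ∀ l, δ l ≤ δ' l)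
    (ha : Antitone δ') (hs : Summable δ') : IsWeakDep P e c' δ' Y Z :=
  { h with
    approx_bdd := fun l i ω => (h.approx_bdd l i ω).trans (hc l)
    approx_norm := fun l i => (h.approx_norm l i).trans (hδ l)
    antitone := ha
    summable := hs }

/-- Two sequences have common bounds, and so has every sequence that switches from one to the
other. -/
theorem IsWeakDep.exists_piecewise [Nonempty Ω] {Y' : ℤ → Ω → H} {Z' : ℕ → ℤ → Ω → H}
    (h : IsWeakDep P e c δ Y Z)
    (h' : IsWeakDep P e c' δ' Y' Z') : ∃ c'' δ'' : ℕ → ℝ, ∀ k : ℤ, ∃ Z'' : ℕ → ℤ → Ω → H,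
      IsWeakDep P e c'' δ'' (fun i => if i ≤ k then Y i else Y' i) Z'' := by
  obtain ⟨ω⟩ := ‹Nonempty Ω›
  have hc : ∀ l, 0 ≤ c l := fun l => (norm_nonneg _).trans (h.approx_bdd l 0 ω)
  have hc' : ∀ l, 0 ≤ c' l := fun l => (norm_nonneg _).trans (h'.approx_bdd l 0 ω)
  have ha : Antitone (fun l => δ l + δ' l) := fun l m hlm =>
    add_le_add (h.antitone hlm) (h'.antitone hlm)
  have hs : Summable (fun l => δ l + δ' l) := h.summable.add h'.summable
  exact ⟨fun l => c l + c' l, fun l => δ l + δ' l, fun k => ⟨_, IsWeakDep.piecewise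
    (h.mono (fun l => le_add_of_nonneg_right (hc' l))
      (fun l => le_add_of_nonneg_right (h'.nonneg l)) ha hs)
    (h'.mono (fun l => le_add_of_nonneg_left (hc l))
      (fun l => le_add_of_nonneg_left (h.nonneg l)) ha hs) k⟩⟩

/-- Antitone bounds can be had by choosing the best approximation so far. -/
theorem IsWeakDep.of_not_antitone (adapted : ∀ i, StronglyMeasurable[sig e (Set.Iic i)] (Y i))
    (memLp : ∀ i, MemLp (Y i) 2 P) (mean : ∀ i, ∫ ω, Y i ω ∂P = 0)
    (meas : ∀ (l : ℕ) (i : ℤ), StronglyMeasurable[sig e (Set.Ioc (i - (l : ℤ)) i)] (Z l i))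
    (bdd : ∀ l i ω, ‖Z l i ω‖ ≤ c l) (amean : ∀ l i, ∫ ω, Z l i ω ∂P = 0)
    (norm : ∀ l i, lpNorm (fun ω => Y i ω - Z l i ω) 2 P ≤ δ l) (summable : Summable δ) :
    ∃ c' δ' Z', IsWeakDep P e c' δ' Y Z' := by
  have hex : ∀ l : ℕ, ∃ m ∈ Finset.range (l + 1), ∀ m' ∈ Finset.range (l + 1), δ m ≤ δ m' :=
    fun l => Finset.exists_min_image _ δ ⟨0, by simp⟩
  choose m hm hmin using hex
  refine ⟨fun l => c (m l), fun l => δ (m l), fun l => Z (m l), adapted, memLp, mean,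
    fun l i => (meas (m l) i).mono (sig_mono (Set.Ioc_subset_Ioc_left ?_)), fun l => bdd _,
    fun l => amean _, fun l => norm _, ?_, ?_⟩
  · have := hm l
    simp only [Finset.mem_range] at this
    omega
  · intro l l' hl
    refine hmin l' (m l) ?_
    have := hm l
    simp only [Finset.mem_range] at this ⊢
    omega
  · refine summable.of_nonneg_of_le (fun l => lpNorm_nonneg.trans (norm (m l) 0)) fun l => ?_
    exact hmin l l (by simp)

end Combine

/-! ### Weak dependence of functions of quadratic growth. -/

section Transform

variable {Ω S : Type*} [MeasurableSpace Ω] [MeasurableSpace S] {P : Measure Ω} {ν : Measure S}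
  [IsProbabilityMeasure ν] {e : ℤ → Ω → S} {g : (ℕ → S) → L2}
  {H : Type*} [NormedAddCommGroup H] [InnerProductSpace ℝ H]

theorem IsSegment.stronglyMeasurable_shift (hg : IsSegment P ν e g) (i : ℤ) :
    StronglyMeasurable[sig e (Set.Iic i)] (shiftProcess g e i) :=
  hg.measurable.comp_measurable (measurable_past_sig i)

theorem IsSegment.memLp_shift (he : IsIIDInnovation P ν e) (hg : IsSegment P ν e g) (i : ℤ) :
    MemLp (shiftProcess g e i) 4 P :=
  hg.exists_approx.1.comp_measurePreserving (measurePreserving_past he i)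

/-- Expectations of functions of the past do not depend on time. -/
theorem integral_past_eq (he : IsIIDInnovation P ν e) {U : (ℕ → S) → H}
    (hU : StronglyMeasurable U) (i : ℤ) :
    ∫ ω, U (past e i ω) ∂P = ∫ x, U x ∂(Measure.infinitePi fun _ : ℕ => ν) := by
  rw [← (measurePreserving_past he i).map_eq, integral_map
    (measurePreserving_past he i).measurable.aemeasurable hU.aestronglyMeasurable]

variable [IsProbabilityMeasure P] [CompleteSpace H]

theorem integral_past_sub_eq_zero (he : IsIIDInnovation P ν e) {U : (ℕ → S) → H}
    (hU : StronglyMeasurable U) (hU2 : MemLp U 2 (Measure.infinitePi fun _ : ℕ => ν)) (i : ℤ) :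
    ∫ ω, (U (past e i ω) - ∫ x, U x ∂(Measure.infinitePi fun _ : ℕ => ν)) ∂P = 0 := by
  have h : Integrable (fun ω => U (past e i ω)) P :=
    (hU2.comp_measurePreserving (measurePreserving_past he i)).integrable (by norm_num)
  rw [integral_sub h (integrable_const _), integral_const, integral_past_eq he hU i]
  simp

/-- A locally Lipschitz function of quadratic growth of a segment is weakly dependent after
centering. -/
theorem IsSegment.exists_isWeakDep (he : IsIIDInnovation P ν e) (hg : IsSegment P ν e g)
    {q : L2 → H} {K : ℝ} (hqc : Continuous q) (hK : 0 ≤ K)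
    (hq : ∀ x y, ‖q x - q y‖ ≤ K * ‖x - y‖ * (1 + ‖x‖ + ‖y‖)) :
    ∃ c δ Z, IsWeakDep P e c δ
      (fun i ω => q (shiftProcess g e i ω) - ∫ ω', q (shiftProcess g e 0 ω') ∂P) Z := by
  obtain ⟨hg4, s, D, hD, hs⟩ := hg.exists_approx
  set π := Measure.infinitePi fun _ : ℕ => ν with hπ
  have hsm : ∀ l, Measurable fun x => splice l x (s l) := fun l =>
    (measurable_splice l).comp (measurable_id.prodMk measurable_const)
  have hqm : StronglyMeasurable fun x => q (g x) := hqc.comp_stronglyMeasurable hg.measurable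
  have hGm : ∀ l, StronglyMeasurable fun x => q (g (splice l x (s l))) := fun l =>
    hqm.comp_measurable (hsm l)
  have hq2 : MemLp (fun x => q (g x)) 2 π := by
    have h1 := (memLp_comp_sub_and_lpNorm_le (p := 4) (r := 2) (by norm_num) (by norm_num) hqc hK hq
      hg4 (memLp_const (0 : L2))).1
    refine (h1.add (memLp_const (q 0))).ae_eq (.of_forall fun x => ?_)
    simp
  have hdiff := fun l => memLp_comp_sub_and_lpNorm_le (p := 4) (r := 2) (by norm_num) (by norm_num)
    hqc hK hq hg4 (hs l).1
  have hG2 : ∀ l, MemLp (fun x => q (g (splice l x (s l)))) 2 π := fun l => by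
    refine (hq2.sub (hdiff l).1).ae_eq (.of_forall fun x => ?_)
    simp
  have hD0 : ∀ l, 0 ≤ D l := fun l => lpNorm_nonneg.trans (hs l).2
  set C := K * (1 + lpNorm g 4 π + (lpNorm g 4 π + ∑' l, D l)) with hC
  have hdiff2 : ∀ l, lpNorm (fun x => q (g x) - q (g (splice l x (s l)))) 2 π ≤ C * D l := fun l => by
    have h1 : lpNorm (fun x => g (splice l x (s l))) 4 π ≤ lpNorm g 4 π + ∑' l, D l := by
      have h2 := lpNorm_sub_le hg4 (g := fun x => g x - g (splice l x (s l))) (p := 4) (by norm_num)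
      have h3 : (g - fun x => g x - g (splice l x (s l))) = fun x => g (splice l x (s l)) := by
        ext1 x; simp
      rw [h3] at h2
      linarith [(hs l).2, hD.le_tsum l fun i _ => hD0 i]
    refine (hdiff l).2.trans ?_
    rw [hC]
    calc _ ≤ K * D l * (1 + lpNorm g 4 π + (lpNorm g 4 π + ∑' l, D l)) := by
          have : 0 ≤ lpNorm g 4 π := lpNorm_nonneg
          have h5 : 0 ≤ lpNorm (fun x => g (splice l x (s l))) 4 π := lpNorm_nonneg
          gcongr
          · exact mul_nonneg hK (hD0 l)
          · exact (hs l).2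
      _ = _ := by ring
  -- Approximations must be bounded. The truncation level is chosen so that the additional error at
  -- depth `l` is at most `2⁻ˡ`, which keeps the errors summable.
  choose M hM0 hM using fun l => exists_truncation_lpNorm_le (hG2 l) (hGm l)
    (pow_pos (by norm_num : (0 : ℝ) < 1 / 2) l)
  set U : ℕ → (ℕ → S) → H := fun l x => if ‖q (g x)‖ < M l then q (g x) else 0 with hU
  have hUm : ∀ l, StronglyMeasurable (U l) := fun l =>
    StronglyMeasurable.ite (measurableSet_lt hqm.norm.measurable measurable_const) hqm
      stronglyMeasurable_const
  have hUb : ∀ l x, ‖U l x‖ ≤ M l := fun l x => by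
    simp only [hU]
    split_ifs with hx
    · exact hx.le
    · simpa using hM0 l
  set V : ℕ → (ℕ → S) → H := fun l x => U l (splice l x (s l)) with hV
  have hVm : ∀ l, StronglyMeasurable (V l) := fun l => (hUm l).comp_measurable (hsm l)
  have hV2 : ∀ l, MemLp (V l) 2 π := fun l =>
    MemLp.of_bound (hVm l).aestronglyMeasurable (M l) (.of_forall fun x => hUb l _)
  have hE : ∫ ω', q (shiftProcess g e 0 ω') ∂P = ∫ x, q (g x) ∂π := integral_past_eq he hqm 0
  have hmp := measurePreserving_past he
  rw [hE]
  -- The factor `2` in both bounds pays for the centering of the truncated approximations.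
  refine IsWeakDep.of_not_antitone (c := fun l => M l + M l)
    (δ := fun l => 2 * (C * D l + (1 / 2) ^ l))
    (Z := fun l i ω => V l (past e i ω) - ∫ x, V l x ∂π) ?_ ?_ ?_ ?_ ?_ ?_ ?_ ?_
  · exact fun i => (hqc.comp_stronglyMeasurable (hg.stronglyMeasurable_shift i)).sub
      stronglyMeasurable_const
  · exact fun i => (hq2.comp_measurePreserving (hmp i)).sub (memLp_const _)
  · exact fun i => integral_past_sub_eq_zero he hqm hq2 i
  · exact fun l i => ((hUm l).comp_measurable (measurable_splice_past_sig i l (s l))).sub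
      stronglyMeasurable_const
  · intro l i ω
    refine (norm_sub_le _ _).trans (add_le_add (hUb l _) ?_)
    refine (norm_integral_le_of_norm_le_const (.of_forall fun x => hUb l _)).trans ?_
    simp
  · exact fun l i => integral_past_sub_eq_zero he (hVm l) (hV2 l) i
  · intro l i
    have hW : MemLp (fun x => q (g x) - V l x) 2 π := hq2.sub (hV2 l)
    have h1 : lpNorm (fun x => q (g x) - V l x) 2 π ≤ C * D l + (1 / 2) ^ l := by
      have h2 : (fun x => q (g x) - V l x) = (fun x => q (g x) - q (g (splice l x (s l)))) +
          fun x => q (g (splice l x (s l))) - V l x := by ext1 x; simp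
      rw [h2]
      refine (lpNorm_add_le (hdiff l).1 (by norm_num)).trans (add_le_add (hdiff2 l) (hM l))
    have h3 := lpNorm_sub_integral_le hW
    have h4 : (fun ω => q (shiftProcess g e i ω) - ∫ x, q (g x) ∂π -
        (V l (past e i ω) - ∫ x, V l x ∂π)) =
        (fun x => q (g x) - V l x - ∫ x', (q (g x') - V l x') ∂π) ∘ past e i := by
      ext1 ω
      rw [integral_sub (hq2.integrable (by norm_num)) ((hV2 l).integrable (by norm_num))]
      change q (g (past e i ω)) - _ - _ = q (g (past e i ω)) - V l (past e i ω) - _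
      abel
    have hm : AEStronglyMeasurable (fun x => q (g x) - V l x - ∫ x', (q (g x') - V l x') ∂π) π :=
      hW.1.sub aestronglyMeasurable_const
    rw [h4, ← toReal_eLpNorm (hm.comp_measurePreserving (hmp i)),
      eLpNorm_comp_measurePreserving hm (hmp i), toReal_eLpNorm hm]
    linarith
  · exact ((hD.mul_left C).add (summable_geometric_of_lt_one (by norm_num) (by norm_num))).mul_left 2

end Transform

/-! ### Quadratic features and the Hilbert space tensor product. -/

open scoped TensorProduct

section Quadratic

theorem abs_norm_sq_sub_le {E : Type*} [NormedAddCommGroup E] (x y : E) :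
    |‖x‖ ^ 2 - ‖y‖ ^ 2| ≤ 1 * ‖x - y‖ * (1 + ‖x‖ + ‖y‖) := by
  have h : ‖x‖ ^ 2 - ‖y‖ ^ 2 = (‖x‖ - ‖y‖) * (‖x‖ + ‖y‖) := by ring
  rw [h, abs_mul, abs_of_nonneg (by positivity : 0 ≤ ‖x‖ + ‖y‖), one_mul]
  gcongr
  · exact abs_norm_sub_norm_le x y
  · linarith

theorem abs_inner_sq_sub_inner_sq_le {E : Type*} [NormedAddCommGroup E] [InnerProductSpace ℝ E]
    (φ x y : E) :
    |⟪x, φ⟫ ^ 2 - ⟪y, φ⟫ ^ 2| ≤ ‖φ‖ ^ 2 * ‖x - y‖ * (1 + ‖x‖ + ‖y‖) := by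
  have h : ⟪x, φ⟫ ^ 2 - ⟪y, φ⟫ ^ 2 = ⟪x - y, φ⟫ * ⟪x + y, φ⟫ := by
    rw [inner_sub_left, inner_add_left]; ring
  rw [h, abs_mul]
  calc _ ≤ (‖x - y‖ * ‖φ‖) * ((‖x‖ + ‖y‖) * ‖φ‖) := by
        gcongr
        · exact abs_real_inner_le_norm _ _
        · refine (abs_real_inner_le_norm _ _).trans ?_
          gcongr
          exact norm_add_le _ _
    _ = ‖φ‖ ^ 2 * ‖x - y‖ * (‖x‖ + ‖y‖) := by ring
    _ ≤ _ := by gcongr; linarith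

/-- The Hilbert space tensor product of `L²([0,1])` with itself. -/
abbrev L2Tensor : Type := UniformSpace.Completion (L2 ⊗[ℝ] L2)

/-- The elementary tensor `x ⊗ y`. -/
noncomputable def elemTensor (x y : L2) : L2Tensor := ((x ⊗ₜ[ℝ] y : L2 ⊗[ℝ] L2) : L2Tensor)

theorem inner_elemTensor (x y x' y' : L2) :
    ⟪elemTensor x y, elemTensor x' y'⟫ = ⟪x, x'⟫ * ⟪y, y'⟫ := by
  rw [elemTensor, elemTensor, UniformSpace.Completion.inner_coe, TensorProduct.inner_tmul]

theorem norm_elemTensor (x y : L2) : ‖elemTensor x y‖ = ‖x‖ * ‖y‖ := by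
  rw [elemTensor, UniformSpace.Completion.norm_coe, TensorProduct.norm_tmul]

theorem elemTensor_sub_left (x x' y : L2) :
    elemTensor (x - x') y = elemTensor x y - elemTensor x' y := by
  rw [elemTensor, TensorProduct.sub_tmul, UniformSpace.Completion.coe_sub]; rfl

theorem elemTensor_sub_right (x y y' : L2) :
    elemTensor x (y - y') = elemTensor x y - elemTensor x y' := by
  rw [elemTensor, TensorProduct.tmul_sub, UniformSpace.Completion.coe_sub]; rfl

theorem norm_elemTensor_self_sub_le (x y : L2) :
    ‖elemTensor x x - elemTensor y y‖ ≤ 1 * ‖x - y‖ * (1 + ‖x‖ + ‖y‖) := by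
  have h : elemTensor x x - elemTensor y y = elemTensor x (x - y) + elemTensor (x - y) y := by
    rw [elemTensor_sub_left, elemTensor_sub_right]; abel
  rw [h]
  refine (norm_add_le _ _).trans ?_
  rw [norm_elemTensor, norm_elemTensor]
  nlinarith [norm_nonneg (x - y)]

theorem continuous_elemTensor_self : Continuous fun x : L2 => elemTensor x x :=
  (UniformSpace.Completion.continuous_coe _).comp
    (TensorProduct.continuous_tmul.comp (continuous_id.prodMk continuous_id))

/-- The operator norm is at most the Hilbert-Schmidt norm, here the norm of the tensor. Averages of
`x ⊗ x` can thus be estimated in a Hilbert space, where second moments of sums are governed by inner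
products. -/
theorem opNorm_le_of_inner_eq {A : L2 →L[ℝ] L2} {v : L2Tensor}
    (h : ∀ f g, ⟪A f, g⟫ = ⟪v, elemTensor f g⟫) : ‖A‖ ≤ ‖v‖ := by
  refine A.opNorm_le_bound (norm_nonneg v) fun f => ?_
  by_cases h0 : ‖A f‖ = 0
  · rw [h0]; positivity
  have h1 : ‖A f‖ * ‖A f‖ ≤ ‖v‖ * ‖f‖ * ‖A f‖ := by
    rw [← real_inner_self_eq_norm_mul_norm, h]
    refine (real_inner_le_norm _ _).trans_eq ?_
    rw [norm_elemTensor, mul_assoc]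
  exact le_of_mul_le_mul_right h1 (lt_of_le_of_ne (norm_nonneg _) (Ne.symm h0))

theorem pairing_tensorSq (x φ : L2) : pairing (tensorSq x) φ = ⟪x, φ⟫ ^ 2 := by
  simp [pairing, real_inner_smul_left]
  ring

theorem inner_tensorSq (x f g : L2) : ⟪tensorSq x f, g⟫ = ⟪elemTensor x x, elemTensor f g⟫ := by
  rw [inner_elemTensor]
  simp [real_inner_smul_left]

theorem continuous_tensorSq : Continuous fun x : L2 => tensorSq x :=
  (rankOne ℝ (E := L2) (F := L2)).continuous.clm_apply continuous_id

theorem norm_tensorSq (x : L2) : ‖tensorSq x‖ = ‖x‖ ^ 2 := by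
  rw [tensorSq, norm_rankOne, sq]

instance secondCountableTopology_L2 : SecondCountableTopology L2 := by
  have : Fact ((2 : ℝ≥0∞) ≠ ∞) := ⟨by norm_num⟩
  infer_instance

theorem countable_hilbertBasis {ι : Type*} (b : HilbertBasis ι ℝ L2) : Countable ι := by
  refine Pairwise.countable_of_isOpen_disjoint (s := fun i => Metric.ball (b i) (1 / 2)) ?_
    (fun i => Metric.isOpen_ball) fun i => ⟨b i, Metric.mem_ball_self (by norm_num)⟩
  intro i j hij
  refine Metric.ball_disjoint_ball ?_
  have h1 : ‖b i - b j‖ ^ 2 = 2 := by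
    rw [norm_sub_sq_real, b.orthonormal.1, b.orthonormal.1, b.orthonormal.2 hij]; norm_num
  rw [dist_eq_norm]
  nlinarith [norm_nonneg (b i - b j)]

end Quadratic

/-! ### Compactness and trace of covariance operators. -/

section Covariance

variable {Ω : Type*} [MeasurableSpace Ω] {P : Measure Ω} {X : Ω → L2}

theorem covOp_eq (h0 : ∫ ω, X ω ∂P = 0) : covOp P X = ∫ ω, tensorSq (X ω) ∂P := by
  simp [covOp, h0]

theorem integrable_tensorSq (hX : MemLp X 2 P) : Integrable (fun ω => tensorSq (X ω)) P :=
  (MemLp.norm_sq_integrable hX).mono' (continuous_tensorSq.comp_aestronglyMeasurable hX.1)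
    (.of_forall fun _ => (norm_tensorSq _).le)

theorem inner_integral_tensorSq (hX : MemLp X 2 P) (f g : L2) :
    ⟪(∫ ω, tensorSq (X ω) ∂P) f, g⟫ = ∫ ω, ⟪X ω, f⟫ * ⟪X ω, g⟫ ∂P := by
  have hi := integrable_tensorSq hX
  rw [ContinuousLinearMap.integral_apply hi, real_inner_comm, ← integral_inner
    (hi.apply_continuousLinearMap f)]
  refine integral_congr_ae (.of_forall fun ω => ?_)
  simp only
  rw [real_inner_comm, inner_tensorSq, inner_elemTensor]

variable [IsProbabilityMeasure P]

/-- The compact operators form a closed convex set, which contains the mean of any integrable random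
element of it. -/
theorem isPosCompact_integral_tensorSq (hX : MemLp X 2 P) :
    IsPosCompact (∫ ω, tensorSq (X ω) ∂P) := by
  have hi := integrable_tensorSq hX
  constructor
  · refine ContinuousLinearMap.isPositive_iff _ |>.2 ⟨fun x y => ?_, fun x => ?_⟩
    · change ⟪(∫ ω, tensorSq (X ω) ∂P) x, y⟫ = ⟪x, (∫ ω, tensorSq (X ω) ∂P) y⟫
      rw [real_inner_comm ((∫ ω, tensorSq (X ω) ∂P) y) x, inner_integral_tensorSq hX,
        inner_integral_tensorSq hX]
      simp_rw [mul_comm]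
    · rw [inner_integral_tensorSq hX]
      exact integral_nonneg fun ω => mul_self_nonneg _
  · refine Convex.integral_mem (s := {T : L2 →L[ℝ] L2 | IsCompactOperator T}) ?_
      isClosed_setOfPred_isCompactOperator (.of_forall fun ω => isCompactOperator_rankOne _ _) hi
    intro A hA B hB a b _ _ _
    exact (IsCompactOperator.smul hA a).add (IsCompactOperator.smul hB b)

/-- Parseval's identity for a Hilbert basis, integrated term by term. The basis is countable by
separability, as the interchange requires. -/
theorem opTrace_integral_tensorSq (hX : MemLp X 2 P) :
    opTrace (∫ ω, tensorSq (X ω) ∂P) = ∫ ω, ‖X ω‖ ^ 2 ∂P := by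
  obtain ⟨s, b, -⟩ := exists_hilbertBasis ℝ L2
  have := countable_hilbertBasis b
  have hpt : ∀ ω, HasSum (fun k => ⟪X ω, b k⟫ * ⟪X ω, b k⟫) (‖X ω‖ ^ 2) := fun ω => by
    rw [← real_inner_self_eq_norm_sq]
    have h := b.hasSum_inner_mul_inner (X ω) (X ω)
    simp only [fun k => real_inner_comm (X ω) (b k)] at h
    exact h
  have hint : ∀ k, Integrable (fun ω => ⟪X ω, b k⟫ * ⟪X ω, b k⟫) P := fun k => by
    refine (MemLp.norm_sq_integrable hX).mono'
      ((hX.1.inner aestronglyMeasurable_const).mul (hX.1.inner aestronglyMeasurable_const))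
      (.of_forall fun ω => ?_)
    rw [Real.norm_eq_abs, abs_mul, sq]
    have := (abs_real_inner_le_norm (X ω) (b k)).trans_eq
      (by rw [b.orthonormal.1, mul_one] : _ = ‖X ω‖)
    gcongr
  have h1 := hasSum_integral_of_dominated_convergence
    (F := fun k ω => ⟪X ω, b k⟫ * ⟪X ω, b k⟫) (f := fun ω => ‖X ω‖ ^ 2) (μ := P)
    (fun k ω => ⟪X ω, b k⟫ * ⟪X ω, b k⟫) (fun k => (hint k).1)
    (fun k => .of_forall fun ω => (Real.norm_of_nonneg (mul_self_nonneg _)).le)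
    (.of_forall fun ω => (hpt ω).summable)
    (by simp_rw [(hpt _).tsum_eq]; exact (MemLp.norm_sq_integrable hX)) (.of_forall hpt)
  simp_rw [← inner_integral_tensorSq hX] at h1
  rw [opTrace, (hasSum_eigval (isPosCompact_integral_tensorSq hX) b h1.summable).tsum_eq, h1.tsum_eq]

end Covariance

/-! ### Limits of double sums arranged by lag, for two regimes. -/

section Lags

theorem sum_Icc_eq_tsum_lag (n : ℕ) (i : ℤ) (f : ℤ → ℝ) :
    ∑ j ∈ Finset.Icc (1 : ℤ) n, f j =
      ∑' l : ℤ, if i + l ∈ Finset.Icc (1 : ℤ) n then f (i + l) else 0 := by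
  refine Eq.trans ?_
    ((Equiv.addLeft i).tsum_eq fun j => if j ∈ Finset.Icc (1 : ℤ) n then f j else 0).symm
  rw [tsum_eq_sum (s := Finset.Icc (1 : ℤ) n) fun j hj => if_neg hj]
  exact Finset.sum_congr rfl fun j hj => (if_pos hj).symm

theorem sum_sum_eq_tsum_lag (n : ℕ) (r : ℤ → ℤ → ℝ) :
    ∑ i ∈ Finset.Icc (1 : ℤ) n, ∑ j ∈ Finset.Icc (1 : ℤ) n, r i j =
      ∑' l : ℤ, ∑ i ∈ Finset.Icc (1 : ℤ) n,
        if i + l ∈ Finset.Icc (1 : ℤ) n then r i (i + l) else 0 := by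
  rw [Summable.tsum_finsetSum]
  · exact Finset.sum_congr rfl fun i _ => sum_Icc_eq_tsum_lag n i (r i)
  · intro i _
    refine summable_of_ne_finset_zero (s := (Finset.Icc (1 : ℤ) n).image fun j => j - i)
      fun l hl => if_neg fun h => hl ?_
    exact Finset.mem_image.2 ⟨i + l, h, by ring⟩

theorem summable_natAbs {κ : ℕ → ℝ} (hκ : Summable κ) : Summable fun l : ℤ => κ l.natAbs :=
  Summable.of_nat_of_neg (by simpa using hκ) (by simpa using hκ)

theorem tendsto_floor_mul_div (τ : ℝ) :
    Tendsto (fun n : ℕ => ((⌊τ * n⌋ : ℤ) : ℝ) / n) atTop (𝓝 τ) := by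
  have h0 : Tendsto (fun n : ℕ => (1 : ℝ) / n) atTop (𝓝 0) := tendsto_one_div_atTop_nhds_zero_nat
  have h1 : Tendsto (fun n : ℕ => τ - (1 : ℝ) / n) atTop (𝓝 τ) := by
    simpa using tendsto_const_nhds.sub h0
  refine tendsto_of_tendsto_of_tendsto_of_le_of_le' h1 tendsto_const_nhds ?_ ?_
  · filter_upwards [eventually_gt_atTop 0] with n hn
    have hn' : (0 : ℝ) < n := by exact_mod_cast hn
    rw [le_div_iff₀ hn', sub_mul, one_div, inv_mul_cancel₀ hn'.ne']
    exact (Int.sub_one_lt_floor _).le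
  · filter_upwards [eventually_gt_atTop 0] with n hn
    have hn' : (0 : ℝ) < n := by exact_mod_cast hn
    rw [div_le_iff₀ hn']
    exact Int.floor_le _

/-- The sum over the observations of a function that is constant in each regime. -/
theorem sum_Icc_ite_le (n : ℕ) {k : ℤ} (hk0 : 0 ≤ k) (hkn : k ≤ n) (a b : ℝ) :
    ∑ i ∈ Finset.Icc (1 : ℤ) n, (if i ≤ k then a else b) = k * a + (n - k) * b := by
  rw [Finset.sum_ite, Finset.sum_const, Finset.sum_const]
  have h1 : (Finset.Icc (1 : ℤ) n).filter (· ≤ k) = Finset.Icc 1 k := by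
    ext i; simp only [Finset.mem_filter, Finset.mem_Icc]; omega
  have h2 : (Finset.Icc (1 : ℤ) n).filter (fun i => ¬ i ≤ k) = Finset.Icc (k + 1) n := by
    ext i; simp only [Finset.mem_filter, Finset.mem_Icc]; omega
  rw [h1, h2, Int.card_Icc, Int.card_Icc, nsmul_eq_mul, nsmul_eq_mul]
  have h3 : (((k + 1 - 1).toNat : ℕ) : ℝ) = k := by
    rw [← Int.cast_natCast, Int.toNat_of_nonneg (by omega)]; push_cast; ring
  have h4 : (((n + 1 - (k + 1) : ℤ).toNat : ℕ) : ℝ) = n - k := by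
    rw [← Int.cast_natCast, Int.toNat_of_nonneg (by omega)]; push_cast; ring
  rw [h3, h4]

/-- A sum of products at a given lag over the sample, compared with its version without
boundary effects. -/
theorem abs_sum_lag_sub_le {r : ℤ → ℤ → ℝ} {γ₁ γ₂ M : ℝ} (n : ℕ) (k l : ℤ)
    (hM : ∀ i, |r i (i + l)| ≤ M)
    (h₁ : ∀ i, i ≤ k → i + l ≤ k → r i (i + l) = γ₁)
    (h₂ : ∀ i, k < i → k < i + l → r i (i + l) = γ₂) :
    |∑ i ∈ Finset.Icc (1 : ℤ) n, (if i + l ∈ Finset.Icc (1 : ℤ) n then r i (i + l) else 0) -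
      ∑ i ∈ Finset.Icc (1 : ℤ) n, (if i ≤ k then γ₁ else γ₂)| ≤
      (6 * l.natAbs + 3) * (M + |γ₁| + |γ₂|) := by
  set C := M + |γ₁| + |γ₂| with hC
  have hM0 : 0 ≤ M := (abs_nonneg _).trans (hM 0)
  rw [← Finset.sum_sub_distrib]
  set L : ℤ := (l.natAbs : ℤ) with hL
  -- Outside `E` the index `i + l` is in the sample and on the same side of the break as `i`. The
  -- three intervals have `2|l| + 1` points each.
  set E : Finset ℤ := Finset.Icc (-L) L ∪ Finset.Icc (n - L) (n + L) ∪ Finset.Icc (k - L) (k + L)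
    with hE
  have hcard : ((E.card : ℕ) : ℝ) ≤ 6 * l.natAbs + 3 := by
    have h1 : E.card ≤ (Finset.Icc (-L) L ∪ Finset.Icc (n - L) (n + L)).card +
      (Finset.Icc (k - L) (k + L)).card := Finset.card_union_le _ _
    have h2 := Finset.card_union_le (Finset.Icc (-L) L) (Finset.Icc (n - L) (n + L))
    simp only [Int.card_Icc] at h1 h2
    have h3 : E.card ≤ 6 * l.natAbs + 3 := by omega
    exact_mod_cast h3
  calc _ ≤ ∑ i ∈ Finset.Icc (1 : ℤ) n, if i ∈ E then C else 0 := by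
        refine (Finset.abs_sum_le_sum_abs _ _).trans (Finset.sum_le_sum fun i hi => ?_)
        by_cases hiE : i ∈ E
        · rw [if_pos hiE]
          refine (norm_sub_le (E := ℝ) _ _).trans ?_
          rw [hC, add_assoc, Real.norm_eq_abs, Real.norm_eq_abs]
          refine add_le_add ?_ ?_
          · split_ifs
            · exact hM i
            · simpa using hM0
          · split_ifs
            · simp
            · simp
        · rw [if_neg hiE]
          simp only [hE, Finset.mem_union, Finset.mem_Icc, not_or, not_and, not_le] at hiE hi
          have hl : |l| = L := by rw [hL]; exact Int.abs_eq_natAbs l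
          have hl1 := le_abs_self l
          have hl2 := neg_abs_le l
          have hmem : i + l ∈ Finset.Icc (1 : ℤ) n := by
            rw [Finset.mem_Icc]
            constructor
            · have := hiE.1.1; omega
            · have := hiE.1.2; omega
          rw [if_pos hmem]
          have h3 := hiE.2
          split_ifs with hik
          · rw [h₁ i hik (by omega)]; simp
          · rw [h₂ i (not_le.1 hik) (by omega)]; simp
    _ ≤ (E.card : ℝ) * C := by
        rw [← Finset.sum_filter, Finset.sum_const, nsmul_eq_mul]
        gcongr
        intro i hi
        exact (Finset.mem_filter.1 hi).2
    _ ≤ _ := by gcongr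

theorem floor_mul_nonneg {τ : ℝ} (hτ : τ ∈ Set.Ioo (0 : ℝ) 1) (n : ℕ) : 0 ≤ ⌊τ * n⌋ :=
  Int.floor_nonneg.2 (mul_nonneg hτ.1.le n.cast_nonneg)

theorem floor_mul_le {τ : ℝ} (hτ : τ ∈ Set.Ioo (0 : ℝ) 1) (n : ℕ) : ⌊τ * n⌋ ≤ n := by
  have := Int.floor_le (τ * n)
  have h3 : ((⌊τ * n⌋ : ℤ) : ℝ) ≤ ((n : ℤ) : ℝ) := by
    push_cast
    nlinarith [hτ.2, (n.cast_nonneg : (0 : ℝ) ≤ n)]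
  exact_mod_cast h3

/-- For a fixed lag, the average of the products over the sample converges to the mixture of the
lag covariances of the two regimes. -/
theorem tendsto_lag_average {τ : ℝ} (hτ : τ ∈ Set.Ioo (0 : ℝ) 1) {M : ℝ} {r : ℕ → ℤ → ℤ → ℝ}
    {γ₁ γ₂ : ℤ → ℝ} (l : ℤ) (hM : ∀ n i, |r n i (i + l)| ≤ M)
    (h₁ : ∀ (n : ℕ) i j, i ≤ ⌊τ * n⌋ → j ≤ ⌊τ * n⌋ → r n i j = γ₁ (j - i))
    (h₂ : ∀ (n : ℕ) i j, ⌊τ * n⌋ < i → ⌊τ * n⌋ < j → r n i j = γ₂ (j - i)) :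
    Tendsto (fun n : ℕ => (n : ℝ)⁻¹ * ∑ i ∈ Finset.Icc (1 : ℤ) n,
      if i + l ∈ Finset.Icc (1 : ℤ) n then r n i (i + l) else 0) atTop
      (𝓝 (τ * γ₁ l + (1 - τ) * γ₂ l)) := by
  set C := M + |γ₁ l| + |γ₂ l| with hC
  have key : ∀ n : ℕ, |(n : ℝ)⁻¹ * ∑ i ∈ Finset.Icc (1 : ℤ) n,
      (if i + l ∈ Finset.Icc (1 : ℤ) n then r n i (i + l) else 0) -
      (n : ℝ)⁻¹ * ∑ i ∈ Finset.Icc (1 : ℤ) n, (if i ≤ ⌊τ * n⌋ then γ₁ l else γ₂ l)| ≤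
      (6 * l.natAbs + 3) * C * (1 / n) := by
    intro n
    rw [← mul_sub, abs_mul, abs_of_nonneg (by positivity : 0 ≤ (n : ℝ)⁻¹), one_div, mul_comm]
    gcongr
    exact abs_sum_lag_sub_le n ⌊τ * n⌋ l (hM n) (fun i hi hi' => by rw [h₁ n i _ hi hi']; simp)
      (fun i hi hi' => by rw [h₂ n i _ hi hi']; simp)
  have hmain : Tendsto (fun n : ℕ => (n : ℝ)⁻¹ * ∑ i ∈ Finset.Icc (1 : ℤ) n,
      (if i ≤ ⌊τ * n⌋ then γ₁ l else γ₂ l)) atTop (𝓝 (τ * γ₁ l + (1 - τ) * γ₂ l)) := by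
    have h1 := tendsto_floor_mul_div τ
    have h2 := (h1.mul_const (γ₁ l)).add (((tendsto_const_nhds (x := (1 : ℝ))).sub h1).mul_const (γ₂ l))
    refine h2.congr' ?_
    filter_upwards [eventually_gt_atTop 0] with n hn
    have hn' : (0 : ℝ) < n := by exact_mod_cast hn
    rw [sum_Icc_ite_le n (floor_mul_nonneg hτ n) (floor_mul_le hτ n)]
    field_simp
  have herr : Tendsto (fun n : ℕ => (6 * (l.natAbs : ℝ) + 3) * C * (1 / n)) atTop (𝓝 0) := by
    simpa using tendsto_one_div_atTop_nhds_zero_nat.const_mul ((6 * (l.natAbs : ℝ) + 3) * C)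
  have h := (squeeze_zero_norm key herr).add hmain
  simpa using h

/-- Limits of weighted double sums over two regimes. -/
theorem tendsto_lag_sum {τ : ℝ} (hτ : τ ∈ Set.Ioo (0 : ℝ) 1) {κ : ℕ → ℝ}
    (hκs : Summable κ) {r : ℕ → ℤ → ℤ → ℝ} {γ₁ γ₂ : ℤ → ℝ}
    (hκ : ∀ n i j, |r n i j| ≤ κ (j - i).natAbs)
    (h₁ : ∀ (n : ℕ) i j, i ≤ ⌊τ * n⌋ → j ≤ ⌊τ * n⌋ → r n i j = γ₁ (j - i))
    (h₂ : ∀ (n : ℕ) i j, ⌊τ * n⌋ < i → ⌊τ * n⌋ < j → r n i j = γ₂ (j - i))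
    {u : ℕ → ℤ → ℝ} {W : ℝ} (huW : ∀ n l, |u n l| ≤ W)
    (hu : ∀ l, Tendsto (fun n => u n l) atTop (𝓝 1))
    (hγ₁ : Summable γ₁) (hγ₂ : Summable γ₂) :
    Tendsto (fun n : ℕ => (n : ℝ)⁻¹ * ∑ i ∈ Finset.Icc (1 : ℤ) n, ∑ j ∈ Finset.Icc (1 : ℤ) n,
      u n (j - i) * r n i j) atTop (𝓝 (τ * ∑' l, γ₁ l + (1 - τ) * ∑' l, γ₂ l)) := by
  have hW0 : 0 ≤ W := (abs_nonneg _).trans (huW 0 0)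
  have e1 : ∀ n : ℕ, (n : ℝ)⁻¹ * ∑ i ∈ Finset.Icc (1 : ℤ) n, ∑ j ∈ Finset.Icc (1 : ℤ) n,
      u n (j - i) * r n i j = ∑' l : ℤ, u n l * ((n : ℝ)⁻¹ * ∑ i ∈ Finset.Icc (1 : ℤ) n,
        if i + l ∈ Finset.Icc (1 : ℤ) n then r n i (i + l) else 0) := by
    intro n
    rw [sum_sum_eq_tsum_lag n fun i j => u n (j - i) * r n i j, ← tsum_mul_left]
    refine tsum_congr fun l => ?_
    rw [mul_left_comm]
    congr 1
    rw [Finset.mul_sum]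
    refine Finset.sum_congr rfl fun i _ => ?_
    rw [add_sub_cancel_left, mul_ite, mul_zero]
  simp_rw [e1]
  rw [← tsum_mul_left, ← tsum_mul_left, ← (hγ₁.mul_left τ).tsum_add (hγ₂.mul_left (1 - τ))]
  -- Dominated convergence over lags, with dominating series `W * κ |l|`; for a fixed lag the pairs
  -- straddling the break are a vanishing fraction.
  refine tendsto_tsum_of_dominated_convergence
    ((summable_natAbs hκs).mul_left W) (fun l => ?_) (.of_forall fun n l => ?_)
  · have := (hu l).mul (tendsto_lag_average hτ l (M := κ l.natAbs)
      (fun n i => by simpa using hκ n i (i + l)) h₁ h₂)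
    simpa using this
  · rw [norm_mul]
    have hκl : 0 ≤ κ l.natAbs := (abs_nonneg _).trans (by simpa using hκ 0 0 l)
    refine mul_le_mul (huW n l) ?_ (norm_nonneg _) hW0
    rw [norm_mul, norm_inv, Real.norm_natCast]
    calc _ ≤ (n : ℝ)⁻¹ * (n * κ l.natAbs) := by
          gcongr
          refine (norm_sum_le _ _).trans ((Finset.sum_le_card_nsmul _ _ (κ l.natAbs)
            fun i _ => ?_).trans_eq ?_)
          · split_ifs
            · simpa using hκ n i (i + l)
            · simpa using hκl
          · simp
      _ ≤ κ l.natAbs := by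
          rcases Nat.eq_zero_or_pos n with rfl | hn
          · simpa using hκl
          · rw [← mul_assoc, inv_mul_cancel₀ (by positivity), one_mul]

end Lags

/-! ### Stationarity of lagged products. -/

section Stationary

theorem past_eq_past_add {Ω S : Type*} (e : ℤ → Ω → S) (i : ℤ) (a : ℕ) (ω : Ω) :
    past e i ω = fun m => past e (i + a) ω (m + a) := by
  ext m
  simp only [past]
  congr 1
  push_cast
  ring

variable {Ω S : Type*} [MeasurableSpace Ω] [MeasurableSpace S] {P : Measure Ω} {ν : Measure S}
  [IsProbabilityMeasure ν] {e : ℤ → Ω → S}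

/-- Both factors are functions of the later of the two pasts, since the earlier one is a shift of
it, and the law of the past does not depend on time. -/
theorem integral_past_mul_eq (he : IsIIDInnovation P ν e) {U V : (ℕ → S) → ℝ}
    (hU : StronglyMeasurable U) (hV : StronglyMeasurable V) (i l : ℤ) :
    ∫ ω, U (past e i ω) * V (past e (i + l) ω) ∂P = ∫ ω, U (past e 0 ω) * V (past e l ω) ∂P := by
  have hs : ∀ a : ℕ, Measurable fun (x : ℕ → S) (m : ℕ) => x (m + a) := fun a => by fun_prop
  rcases le_total 0 l with hl | hl
  · obtain ⟨a, rfl⟩ := Int.eq_ofNat_of_zero_le hl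
    have h := integral_past_eq he (U := fun x => U (fun m => x (m + a)) * V x)
      ((hU.comp_measurable (hs a)).mul hV)
    have h1 := h (i + a)
    have h2 := h (0 + a)
    simp_rw [← past_eq_past_add] at h1 h2
    rw [zero_add] at h2
    exact h1.trans h2.symm
  · obtain ⟨a, ha⟩ := Int.exists_eq_neg_ofNat hl
    have h := integral_past_eq he (U := fun x => U x * V (fun m => x (m + a)))
      (hU.mul (hV.comp_measurable (hs a)))
    have h1 := h (i + l + a)
    have h2 := h (l + a)
    simp_rw [← past_eq_past_add] at h1 h2
    rw [ha] at h1 h2 ⊢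
    simp only [neg_add_cancel_right, neg_add_cancel] at h1 h2
    exact h1.trans h2.symm

end Stationary

/-! ### Features of the errors and the limit of their quadratic forms. -/

section Features

variable {Ω S : Type*} [MeasurableSpace Ω] [MeasurableSpace S] {P : Measure Ω} {ν : Measure S}
  {e : ℤ → Ω → S} {g g₁ g₂ : (ℕ → S) → L2}
  {H : Type*} [NormedAddCommGroup H] [InnerProductSpace ℝ H]

theorem exists_abs_integral_mul_le [IsProbabilityMeasure P] {Y Y' : ℤ → ℤ → Ω → ℝ} (he : IsIIDInnovation P ν e)
    {c δ c' δ' : ℕ → ℝ} (h : ∀ k, ∃ Z, IsWeakDep P e c δ (Y k) Z)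
    (h' : ∀ k, ∃ Z, IsWeakDep P e c' δ' (Y' k) Z) :
    ∃ κ : ℕ → ℝ, Summable κ ∧ ∀ k i j, |∫ ω, Y k i ω * Y' k j ω ∂P| ≤ κ (j - i).natAbs := by
  obtain ⟨Z, hZ⟩ := h 0
  obtain ⟨Z', hZ'⟩ := h' 0
  refine ⟨fun l => max (δ 0) (δ' 0) * (δ l + δ' l),
    (hZ.summable.add hZ'.summable).mul_left _, fun k i j => ?_⟩
  obtain ⟨Z₂, hZ₂⟩ := h k
  obtain ⟨Z₂', hZ₂'⟩ := h' k
  have h1 := hZ₂.abs_integral_inner_le hZ₂' he i j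
  have e1 : ∫ ω, ⟪Y k i ω, Y' k j ω⟫ ∂P = ∫ ω, Y k i ω * Y' k j ω ∂P :=
    integral_congr_ae (.of_forall fun ω => by simp [mul_comm])
  rw [e1] at h1
  rw [← Int.natAbs_neg, neg_sub]
  refine h1.trans (mul_le_mul_of_nonneg_left ?_ ((hZ.nonneg 0).trans (le_max_left _ _)))
  exact max_le (le_add_of_nonneg_right (hZ'.nonneg _)) (le_add_of_nonneg_left (hZ.nonneg _))

variable [IsProbabilityMeasure ν]

/-- A locally Lipschitz function of at most quadratic growth. -/
structure IsQuadratic (q : L2 → H) : Prop where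
  continuous : Continuous q
  lipschitz : ∃ K : ℝ, 0 ≤ K ∧ ∀ x y, ‖q x - q y‖ ≤ K * ‖x - y‖ * (1 + ‖x‖ + ‖y‖)

theorem isQuadratic_id : IsQuadratic (fun x : L2 => x) :=
  ⟨continuous_id, 1, zero_le_one, fun x y => by
    nlinarith [norm_nonneg (x - y), norm_nonneg x, norm_nonneg y,
      mul_nonneg (norm_nonneg (x - y)) (norm_nonneg x),
      mul_nonneg (norm_nonneg (x - y)) (norm_nonneg y)]⟩

theorem isQuadratic_norm_sq : IsQuadratic (fun x : L2 => ‖x‖ ^ 2) :=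
  ⟨by fun_prop, 1, zero_le_one, abs_norm_sq_sub_le⟩

theorem isQuadratic_inner_sq (φ : L2) : IsQuadratic (fun x : L2 => ⟪x, φ⟫ ^ 2) :=
  ⟨by fun_prop, ‖φ‖ ^ 2, by positivity, abs_inner_sq_sub_inner_sq_le φ⟩

theorem isQuadratic_elemTensor : IsQuadratic (fun x : L2 => elemTensor x x) :=
  ⟨continuous_elemTensor_self, 1, zero_le_one, norm_elemTensor_self_sub_le⟩

/-- A function of the errors of one regime, centered. -/
noncomputable def centeredFeature (P : Measure Ω) (g : (ℕ → S) → L2) (e : ℤ → Ω → S) (q : L2 → H) (i : ℤ)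
    (ω : Ω) : H :=
  q (shiftProcess g e i ω) - ∫ ω', q (shiftProcess g e 0 ω') ∂P

/-- A function of the errors, centered in each of the two regimes `i ≤ k` and `k < i`. -/
noncomputable def feature (P : Measure Ω) (g₁ g₂ : (ℕ → S) → L2) (e : ℤ → Ω → S) (q : L2 → H) (k i : ℤ)
    (ω : Ω) : H :=
  if i ≤ k then centeredFeature P g₁ e q i ω else centeredFeature P g₂ e q i ω

/-- The cross covariance at lag `l` of two functions of the errors of one regime. -/
noncomputable def lagCov (P : Measure Ω) (g : (ℕ → S) → L2) (e : ℤ → Ω → S) (q q' : L2 → ℝ) (l : ℤ) : ℝ :=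
  ∫ ω, centeredFeature P g e q 0 ω * centeredFeature P g e q' l ω ∂P

theorem integral_centeredFeature_mul (he : IsIIDInnovation P ν e) (hg : IsSegment P ν e g)
    {q q' : L2 → ℝ} (hq : IsQuadratic q) (hq' : IsQuadratic q') (i j : ℤ) :
    ∫ ω, centeredFeature P g e q i ω * centeredFeature P g e q' j ω ∂P =
      lagCov P g e q q' (j - i) := by
  have h := integral_past_mul_eq he
    (U := fun x => q (g x) - ∫ ω', q (shiftProcess g e 0 ω') ∂P)
    (V := fun x => q' (g x) - ∫ ω', q' (shiftProcess g e 0 ω') ∂P)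
    ((hq.continuous.comp_stronglyMeasurable hg.measurable).sub stronglyMeasurable_const)
    ((hq'.continuous.comp_stronglyMeasurable hg.measurable).sub stronglyMeasurable_const) i (j - i)
  rw [add_sub_cancel] at h
  exact h

theorem lagCov_symm (he : IsIIDInnovation P ν e) (hg : IsSegment P ν e g)
    {q q' : L2 → ℝ} (hq : IsQuadratic q) (hq' : IsQuadratic q') (l : ℤ) :
    lagCov P g e q q' (-l) = lagCov P g e q' q l := by
  have h := integral_centeredFeature_mul he hg hq hq' l 0
  rw [zero_sub] at h
  rw [← h, lagCov]
  simp_rw [mul_comm]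

variable [IsProbabilityMeasure P] [CompleteSpace H]

theorem IsSegment.exists_isWeakDep_feature (he : IsIIDInnovation P ν e) (hg : IsSegment P ν e g)
    {q : L2 → H} (hq : IsQuadratic q) :
    ∃ c δ Z, IsWeakDep P e c δ (centeredFeature P g e q) Z := by
  obtain ⟨K, hK, h⟩ := hq.lipschitz
  exact hg.exists_isWeakDep he hq.continuous hK h

/-- The bounds are independent of the position `k` of the break, so the uniform concentration result
applies although the break moves with `n`. -/
theorem exists_isWeakDep_feature (he : IsIIDInnovation P ν e) (hg₁ : IsSegment P ν e g₁)
    (hg₂ : IsSegment P ν e g₂) {q : L2 → H} (hq : IsQuadratic q) :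
    ∃ c δ : ℕ → ℝ, ∀ k : ℤ, ∃ Z, IsWeakDep P e c δ (feature P g₁ g₂ e q k) Z := by
  obtain ⟨c₁, δ₁, Z₁, h₁⟩ := hg₁.exists_isWeakDep_feature he hq
  obtain ⟨c₂, δ₂, Z₂, h₂⟩ := hg₂.exists_isWeakDep_feature he hq
  have : Nonempty Ω := P.nonempty_of_neZero
  obtain ⟨c, δ, h⟩ := h₁.exists_piecewise h₂
  refine ⟨c, δ, fun k => ?_⟩
  obtain ⟨Z, hZ⟩ := h k
  refine ⟨Z, ?_⟩
  have e1 : feature P g₁ g₂ e q k = fun i =>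
      if i ≤ k then centeredFeature P g₁ e q i else centeredFeature P g₂ e q i := by
    ext i ω
    simp only [feature]
    split_ifs <;> rfl
  rwa [e1]

theorem memLp_feature (he : IsIIDInnovation P ν e) (hg₁ : IsSegment P ν e g₁)
    (hg₂ : IsSegment P ν e g₂) {q : L2 → H} (hq : IsQuadratic q) (k i : ℤ) :
    MemLp (feature P g₁ g₂ e q k i) 2 P := by
  obtain ⟨c, δ, h⟩ := exists_isWeakDep_feature he hg₁ hg₂ hq
  obtain ⟨Z, hZ⟩ := h k
  exact hZ.memLp i

theorem exists_integral_norm_sum_feature_sq_le (he : IsIIDInnovation P ν e)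
    (hg₁ : IsSegment P ν e g₁) (hg₂ : IsSegment P ν e g₂) {q : L2 → H} (hq : IsQuadratic q) :
    ∃ K : ℝ, 0 ≤ K ∧ ∀ (k : ℤ) (s : Finset ℤ) (t : ℤ → ℝ),
      ∫ ω, ‖∑ i ∈ s, t i • feature P g₁ g₂ e q k i ω‖ ^ 2 ∂P ≤ K * ∑ i ∈ s, t i ^ 2 := by
  obtain ⟨c, δ, h⟩ := exists_isWeakDep_feature he hg₁ hg₂ hq
  obtain ⟨Z, hZ⟩ := h 0
  refine ⟨2 * (δ 0 * ∑' l, δ l), ?_, fun k s t => ?_⟩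
  · have := hZ.nonneg
    exact mul_nonneg zero_le_two (mul_nonneg (this 0) (tsum_nonneg this))
  · obtain ⟨Z', hZ'⟩ := h k
    exact hZ'.integral_norm_sum_sq_le he s t

theorem summable_lagCov (he : IsIIDInnovation P ν e) (hg : IsSegment P ν e g)
    {q q' : L2 → ℝ} (hq : IsQuadratic q) (hq' : IsQuadratic q') :
    Summable (lagCov P g e q q') := by
  obtain ⟨c, δ, Z, h⟩ := hg.exists_isWeakDep_feature he hq
  obtain ⟨c', δ', Z', h'⟩ := hg.exists_isWeakDep_feature he hq'
  obtain ⟨κ, hκ, hle⟩ := exists_abs_integral_mul_le (Y := fun _ => centeredFeature P g e q)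
    (Y' := fun _ => centeredFeature P g e q') he (fun _ => ⟨Z, h⟩) (fun _ => ⟨Z', h'⟩)
  refine (summable_natAbs hκ).of_norm_bounded fun l => ?_
  have := hle 0 0 l
  rwa [sub_zero] at this

/-- Within a regime the covariances depend on the lag alone, and a summable bound on all covariances
controls the pairs that straddle the break. -/
theorem tendsto_integral_quadForm_feature {τ : ℝ} (hτ : τ ∈ Set.Ioo (0 : ℝ) 1)
    (he : IsIIDInnovation P ν e) (hg₁ : IsSegment P ν e g₁) (hg₂ : IsSegment P ν e g₂)
    {q q' : L2 → ℝ} (hq : IsQuadratic q) (hq' : IsQuadratic q') {u : ℕ → ℤ → ℝ} {W : ℝ}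
    (huW : ∀ n l, |u n l| ≤ W) (hu : ∀ l, Tendsto (fun n => u n l) atTop (𝓝 1)) :
    Tendsto (fun n : ℕ => ∫ ω, quadForm (u n) n (fun i => feature P g₁ g₂ e q ⌊τ * n⌋ i ω)
      (fun i => feature P g₁ g₂ e q' ⌊τ * n⌋ i ω) ∂P) atTop
      (𝓝 (τ * ∑' l, lagCov P g₁ e q q' l + (1 - τ) * ∑' l, lagCov P g₂ e q q' l)) := by
  obtain ⟨c, δ, h⟩ := exists_isWeakDep_feature he hg₁ hg₂ hq
  obtain ⟨c', δ', h'⟩ := exists_isWeakDep_feature he hg₁ hg₂ hq'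
  obtain ⟨κ, hκ, hle⟩ := exists_abs_integral_mul_le he h h'
  have hm := memLp_feature he hg₁ hg₂ hq
  have hm' := memLp_feature he hg₁ hg₂ hq'
  have key := tendsto_lag_sum hτ hκ
    (r := fun n i j => ∫ ω, feature P g₁ g₂ e q ⌊τ * n⌋ i ω * feature P g₁ g₂ e q' ⌊τ * n⌋ j ω ∂P)
    (γ₁ := lagCov P g₁ e q q') (γ₂ := lagCov P g₂ e q q') (fun n i j => hle _ i j)
    (fun n i j hi hj => by
      simp only [feature, hi, hj, if_true]
      exact integral_centeredFeature_mul he hg₁ hq hq' i j)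
    (fun n i j hi hj => by
      simp only [feature, not_le.2 hi, not_le.2 hj, if_false]
      exact integral_centeredFeature_mul he hg₂ hq hq' i j)
    huW hu (summable_lagCov he hg₁ hq hq') (summable_lagCov he hg₂ hq hq')
  refine key.congr fun n => ?_
  have hint : ∀ i j, Integrable (fun ω => u n (j - i) * (feature P g₁ g₂ e q ⌊τ * n⌋ i ω *
      feature P g₁ g₂ e q' ⌊τ * n⌋ j ω)) P := fun i j =>
    ((hm _ i).integrable_mul (hm' _ j)).const_mul _
  simp only [quadForm]
  rw [integral_const_mul, integral_finsetSum _ fun i _ => integrable_finsetSum _ fun j _ => hint i j]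
  congr 1
  refine Finset.sum_congr rfl fun i _ => ?_
  rw [integral_finsetSum _ fun j _ => hint i j]
  exact Finset.sum_congr rfl fun j _ => (integral_const_mul _ _).symm

/-- The quadratic form of two features converges in `L¹` to the mixture of the long-run
covariances. -/
theorem tendsto_integral_abs_quadForm_feature_sub {τ : ℝ} (hτ : τ ∈ Set.Ioo (0 : ℝ) 1)
    (he : IsIIDInnovation P ν e) (hg₁ : IsSegment P ν e g₁) (hg₂ : IsSegment P ν e g₂)
    {q q' : L2 → ℝ} (hq : IsQuadratic q) (hq' : IsQuadratic q') {u : ℕ → ℤ → ℝ} {W : ℝ}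
    {B : ℕ → ℕ} (huB : ∀ n, IsBandKernel (u n) W (B n))
    (hB : Tendsto (fun n : ℕ => (2 * (B n : ℝ) + 1) / n) atTop (𝓝 0))
    (hu : ∀ l, Tendsto (fun n => u n l) atTop (𝓝 1)) :
    Tendsto (fun n : ℕ => ∫ ω, |quadForm (u n) n (fun i => feature P g₁ g₂ e q ⌊τ * n⌋ i ω)
      (fun i => feature P g₁ g₂ e q' ⌊τ * n⌋ i ω) -
      (τ * ∑' l, lagCov P g₁ e q q' l + (1 - τ) * ∑' l, lagCov P g₂ e q q' l)| ∂P) atTop (𝓝 0) := by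
  obtain ⟨c, δ, h⟩ := exists_isWeakDep_feature he hg₁ hg₂ hq
  obtain ⟨c', δ', h'⟩ := exists_isWeakDep_feature he hg₁ hg₂ hq'
  set Λ := τ * ∑' l, lagCov P g₁ e q q' l + (1 - τ) * ∑' l, lagCov P g₂ e q q' l with hΛ
  have h1 := tendsto_integral_quadForm_feature hτ he hg₁ hg₂ hq hq' (fun n => (huB n).bound) hu
  set Q : ℕ → Ω → ℝ := fun n ω => quadForm (u n) n (fun i => feature P g₁ g₂ e q ⌊τ * n⌋ i ω)
      (fun i => feature P g₁ g₂ e q' ⌊τ * n⌋ i ω) with hQ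
  have hQi : ∀ n, Integrable (Q n) P := fun n => integrable_quadForm (u n) n
    (memLp_feature he hg₁ hg₂ hq _) (memLp_feature he hg₁ hg₂ hq' _)
  have h2 : Tendsto (fun n => ∫ ω, |Q n ω - ∫ ω', Q n ω' ∂P| ∂P) atTop (𝓝 0) := by
    rw [Metric.tendsto_atTop']
    intro ε hε
    have h3 := eventually_integral_abs_quadForm_sub_le he huB hB (dyadicBound c) (dyadicNorm δ)
      (dyadicBound c') (dyadicNorm δ') (half_pos hε)
    obtain ⟨N, hN⟩ := eventually_atTop.1 h3
    refine ⟨N, fun n hn => ?_⟩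
    obtain ⟨Z, hZ⟩ := h ⌊τ * n⌋
    obtain ⟨Z', hZ'⟩ := h' ⌊τ * n⌋
    rw [Real.dist_0_eq_abs, abs_of_nonneg (integral_nonneg fun ω => abs_nonneg _)]
    exact (hN n hn.le _ _ _ _ (hZ.isMultiScale he) (hZ'.isMultiScale he)).trans_lt (half_lt_self hε)
  have h3 : Tendsto (fun n => ∫ ω, |Q n ω - ∫ ω', Q n ω' ∂P| ∂P + |∫ ω', Q n ω' ∂P - Λ|) atTop
      (𝓝 0) := by
    have h4 := h2.add ((h1.sub_const Λ).abs)
    rwa [← hΛ, sub_self, abs_zero, add_zero] at h4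
  refine squeeze_zero (fun n => integral_nonneg fun ω => abs_nonneg _) (fun n => ?_) h3
  have hi : Integrable (fun ω => |Q n ω - ∫ ω', Q n ω' ∂P|) P :=
    ((hQi n).sub (integrable_const _)).abs
  have hi2 : Integrable (fun ω => |Q n ω - Λ|) P := ((hQi n).sub (integrable_const _)).abs
  calc ∫ ω, |Q n ω - Λ| ∂P ≤ ∫ ω, (|Q n ω - ∫ ω', Q n ω' ∂P| + |∫ ω', Q n ω' ∂P - Λ|) ∂P :=
        integral_mono hi2 (hi.add (integrable_const _)) fun ω => abs_sub_le _ _ _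
    _ = _ := by rw [integral_add hi (integrable_const _)]; simp

/-- Long-run variances are nonnegative. -/
theorem tsum_lagCov_nonneg (he : IsIIDInnovation P ν e) (hg : IsSegment P ν e g)
    {ι : Type*} (s : Finset ι) (x : ι → ℝ) {q : ι → L2 → ℝ} (hq : ∀ j, IsQuadratic (q j)) :
    0 ≤ ∑ j ∈ s, ∑ j' ∈ s, x j * x j' * ∑' l, lagCov P g e (q j) (q j') l := by
  -- With the same segment on both sides the break is fictitious and `1 / 2` is arbitrary. With
  -- constant weight `1` the combined form is `n⁻¹` times the square of a sum, so its expectation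
  -- and the limit are nonnegative.
  have h1 := fun j j' => tendsto_integral_quadForm_feature (P := P) (τ := 1 / 2)
    ⟨by norm_num, by norm_num⟩ he hg hg (hq j) (hq j') (u := fun _ _ => 1) (W := 1)
    (fun _ _ => by simp) (fun _ => tendsto_const_nhds)
  have h2 := tendsto_finsetSum s fun j _ => tendsto_finsetSum s fun j' _ =>
    (h1 j j').const_mul (x j * x j')
  have e1 : ∀ a : ℝ, 1 / 2 * a + (1 - 1 / 2) * a = a := fun a => by ring
  simp only [e1] at h2
  refine ge_of_tendsto' h2 fun n => ?_
  have hm := fun j => memLp_feature he hg hg (hq j)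
  have hi := fun j j' => (integrable_quadForm (fun _ => 1) n (hm j ⌊1 / 2 * (n : ℝ)⌋)
    (hm j' ⌊1 / 2 * (n : ℝ)⌋)).const_mul (x j * x j')
  simp_rw [← integral_const_mul]
  simp_rw [← integral_finsetSum s fun j' _ => hi _ j']
  rw [← integral_finsetSum s fun j _ => integrable_finsetSum s fun j' _ => hi j j']
  refine integral_nonneg fun ω => ?_
  have e2 : ∑ j ∈ s, ∑ j' ∈ s, x j * x j' *
      quadForm (fun _ => 1) n (fun i => feature P g g e (q j) ⌊1 / 2 * (n : ℝ)⌋ i ω)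
        (fun i => feature P g g e (q j') ⌊1 / 2 * (n : ℝ)⌋ i ω) =
      (n : ℝ)⁻¹ * (∑ j ∈ s, x j * ∑ i ∈ Finset.Icc (1 : ℤ) n,
        feature P g g e (q j) ⌊1 / 2 * (n : ℝ)⌋ i ω) ^ 2 := by
    rw [sq, Finset.sum_mul_sum, Finset.mul_sum]
    refine Finset.sum_congr rfl fun j _ => ?_
    rw [Finset.mul_sum]
    refine Finset.sum_congr rfl fun j' _ => ?_
    have e3 : ∀ a b : ℤ → ℝ, quadForm (fun _ => 1) n a b =
        (n : ℝ)⁻¹ * ((∑ i ∈ Finset.Icc (1 : ℤ) n, a i) * ∑ i ∈ Finset.Icc (1 : ℤ) n, b i) :=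
      fun a b => by simp only [quadForm, one_mul, Finset.sum_mul_sum]
    rw [e3]
    ring
  rw [Pi.zero_apply, e2]
  positivity

end Features

/-! ### Root mean squares and a deterministic bound for banded forms. -/

section SampleNorm

/-- The root mean square of a sample. -/
noncomputable def rms (n : ℕ) (a : ℤ → ℝ) : ℝ :=
  √((n : ℝ)⁻¹ * ∑ i ∈ Finset.Icc (1 : ℤ) n, a i ^ 2)

theorem rms_nonneg (n : ℕ) (a : ℤ → ℝ) : 0 ≤ rms n a := Real.sqrt_nonneg _

theorem rms_sq (n : ℕ) (a : ℤ → ℝ) :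
    rms n a ^ 2 = (n : ℝ)⁻¹ * ∑ i ∈ Finset.Icc (1 : ℤ) n, a i ^ 2 :=
  Real.sq_sqrt (mul_nonneg (by positivity) (Finset.sum_nonneg fun i _ => sq_nonneg _))

/-- Cauchy-Schwarz over the pairs in the band: each index belongs to at most `2 * B + 1` of them. -/
theorem abs_quadForm_le_rms {u : ℤ → ℝ} {W : ℝ} {B : ℕ} (hu : IsBandKernel u W B) (n : ℕ)
    (a b : ℤ → ℝ) : |quadForm u n a b| ≤ (2 * B + 1) * W * (rms n a * rms n b) := by
  have hW := hu.nonneg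
  set s := Finset.Icc (1 : ℤ) n with hs
  set N : ℤ → ℤ → ℝ := fun i j => if (j - i).natAbs ≤ B then 1 else 0 with hN
  have hN2 : ∀ i j, N i j ^ 2 = N i j := fun i j => by simp only [hN]; split_ifs <;> simp
  have hrow : ∀ i, ∑ j ∈ s, N i j ≤ 2 * B + 1 := fun i => by
    simp only [hN]
    rw [← Finset.sum_filter, Finset.sum_const, nsmul_eq_mul, mul_one]
    exact_mod_cast card_near_le s i B
  have hcol : ∀ j, ∑ i ∈ s, N i j ≤ 2 * B + 1 := fun j => by
    refine (Finset.sum_congr rfl fun i _ => ?_).trans_le (hrow j)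
    simp only [hN]
    rw [← Int.natAbs_neg, neg_sub]
  have h1 : ∑ i ∈ s, ∑ j ∈ s, N i j * (|a i| * |b j|) ≤
      √((2 * B + 1) * ∑ i ∈ s, a i ^ 2) * √((2 * B + 1) * ∑ i ∈ s, b i ^ 2) := by
    have h2 := Finset.sum_mul_sq_le_sq_mul_sq (s ×ˢ s) (fun p => N p.1 p.2 * |a p.1|)
      (fun p => N p.1 p.2 * |b p.2|)
    have e1 : ∑ p ∈ s ×ˢ s, N p.1 p.2 * |a p.1| * (N p.1 p.2 * |b p.2|) =
        ∑ i ∈ s, ∑ j ∈ s, N i j * (|a i| * |b j|) := by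
      rw [Finset.sum_product]
      refine Finset.sum_congr rfl fun i _ => Finset.sum_congr rfl fun j _ => ?_
      rw [mul_mul_mul_comm, ← sq, hN2]
    have e2 : ∑ p ∈ s ×ˢ s, (N p.1 p.2 * |a p.1|) ^ 2 ≤ (2 * B + 1) * ∑ i ∈ s, a i ^ 2 := by
      rw [Finset.sum_product, Finset.mul_sum]
      refine Finset.sum_le_sum fun i _ => ?_
      simp_rw [mul_pow, hN2, sq_abs, ← Finset.sum_mul]
      exact mul_le_mul_of_nonneg_right (hrow i) (sq_nonneg _)
    have e3 : ∑ p ∈ s ×ˢ s, (N p.1 p.2 * |b p.2|) ^ 2 ≤ (2 * B + 1) * ∑ i ∈ s, b i ^ 2 := by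
      rw [Finset.sum_product_right, Finset.mul_sum]
      refine Finset.sum_le_sum fun i _ => ?_
      simp_rw [mul_pow, hN2, sq_abs, ← Finset.sum_mul]
      exact mul_le_mul_of_nonneg_right (hcol i) (sq_nonneg _)
    rw [e1] at h2
    rw [← Real.sqrt_mul (mul_nonneg (by positivity) (Finset.sum_nonneg fun i _ => sq_nonneg _))]
    refine Real.le_sqrt_of_sq_le (h2.trans (mul_le_mul e2 e3
      (Finset.sum_nonneg fun i _ => sq_nonneg _) ?_))
    exact mul_nonneg (by positivity) (Finset.sum_nonneg fun i _ => sq_nonneg _)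
  have h3 : |quadForm u n a b| ≤ (n : ℝ)⁻¹ * (W * ∑ i ∈ s, ∑ j ∈ s, N i j * (|a i| * |b j|)) := by
    rw [quadForm, abs_mul, abs_of_nonneg (by positivity : (0 : ℝ) ≤ (n : ℝ)⁻¹)]
    gcongr
    refine (Finset.abs_sum_le_sum_abs _ _).trans ?_
    rw [Finset.mul_sum]
    refine Finset.sum_le_sum fun i _ => (Finset.abs_sum_le_sum_abs _ _).trans ?_
    rw [Finset.mul_sum]
    refine Finset.sum_le_sum fun j _ => ?_
    have hk : |u (j - i)| ≤ W * N i j := by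
      simp only [hN]
      split_ifs with hij
      · simpa using hu.bound _
      · have h0 := hu.band (j - i) (not_le.1 hij)
        simp [h0]
    rw [abs_mul, abs_mul]
    calc _ ≤ W * N i j * (|a i| * |b j|) := mul_le_mul_of_nonneg_right hk (by positivity)
      _ = _ := by ring
  have h4 : √((2 * B + 1) * ∑ i ∈ s, a i ^ 2) * √((2 * B + 1) * ∑ i ∈ s, b i ^ 2) =
      (2 * B + 1) * (√(∑ i ∈ s, a i ^ 2) * √(∑ i ∈ s, b i ^ 2)) := by
    have h5 : (0 : ℝ) ≤ 2 * B + 1 := by positivity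
    rw [Real.sqrt_mul h5, Real.sqrt_mul h5, mul_mul_mul_comm, Real.mul_self_sqrt h5]
  have h6 : ∀ f : ℤ → ℝ, rms n f = √((n : ℝ)⁻¹) * √(∑ i ∈ s, f i ^ 2) := fun f => by
    rw [rms, Real.sqrt_mul (by positivity)]
  refine h3.trans ?_
  calc _ ≤ (n : ℝ)⁻¹ * (W * ((2 * B + 1) * (√(∑ i ∈ s, a i ^ 2) * √(∑ i ∈ s, b i ^ 2)))) := by
        rw [← h4]; gcongr
    _ = _ := by
        rw [h6, h6, mul_mul_mul_comm (√((n : ℝ)⁻¹)), Real.mul_self_sqrt (by positivity)]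
        ring

theorem quadForm_comm {u : ℤ → ℝ} (hu : ∀ l, u (-l) = u l) (n : ℕ) (a b : ℤ → ℝ) :
    quadForm u n a b = quadForm u n b a := by
  rw [quadForm, quadForm, Finset.sum_comm]
  congr 1
  refine Finset.sum_congr rfl fun i _ => Finset.sum_congr rfl fun j _ => ?_
  rw [← hu, neg_sub, mul_comm (a j)]

end SampleNorm

/-! ### The lag window as a banded quadratic form, and Riemann sums of the weights. -/

section LagWindow

/-- The sample, centered at its mean. -/
noncomputable def center (n : ℕ) (a : ℤ → ℝ) (i : ℤ) : ℝ :=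
  a i - (n : ℝ)⁻¹ * ∑ k ∈ Finset.Icc (1 : ℤ) n, a k

theorem lagWindow_eq_quadForm (w : ℝ → ℝ) (h : ℝ) (n : ℕ) (a b : ℤ → ℝ) :
    lagWindow w h n a b = quadForm (fun l => w (l / h)) n (center n a) (center n b) := by
  rw [quadForm, sum_sum_eq_tsum_lag n fun i j => w ((j - i : ℤ) / h) * (center n a i * center n b j),
    ← tsum_mul_left, lagWindow]
  refine tsum_congr fun l => ?_
  rw [sampleCrossCov, mul_left_comm, ← Finset.sum_filter, Finset.mul_sum]
  congr 1
  refine Finset.sum_congr ?_ fun i _ => ?_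
  · ext i
    simp only [Finset.mem_Icc, Finset.mem_filter, max_le_iff, le_min_iff]
    omega
  · rw [add_sub_cancel_left]; rfl

/-- The lag weights, set to `0` for bandwidths that are not positive. -/
noncomputable def lagWeight (w : ℝ → ℝ) (h : ℝ) (l : ℤ) : ℝ := if 0 < h then w (l / h) else 0

theorem IsWeight.exists_bound {w : ℝ → ℝ} (hw : IsWeight w) : ∃ W : ℝ, ∀ u, |w u| ≤ W := by
  obtain ⟨m, -, hm⟩ := hw.bounded_support
  have hc : HasCompactSupport w := HasCompactSupport.intro (isCompact_Icc (a := -m) (b := m))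
    fun u hu => hm u (by
      rw [Set.mem_Icc, not_and_or, not_le, not_le] at hu
      rw [lt_abs]
      rcases hu with hu | hu
      · right; linarith
      · left; exact hu)
  exact hc.exists_bound_of_continuous hw.continuous

theorem lagWeight_neg {w : ℝ → ℝ} (hw : IsWeight w) (h : ℝ) (l : ℤ) :
    lagWeight w h (-l) = lagWeight w h l := by
  rw [lagWeight, lagWeight]
  push_cast
  rw [neg_div, hw.even]

theorem isBandKernel_lagWeight {w : ℝ → ℝ} {W m : ℝ} (hW : ∀ u, |w u| ≤ W)
    (hm : ∀ u, m < |u| → w u = 0) (h : ℝ) : IsBandKernel (lagWeight w h) W ⌈m * h⌉₊ where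
  bound l := by
    rw [lagWeight]
    split_ifs
    · exact hW _
    · simpa using (abs_nonneg _).trans (hW 0)
  band l hl := by
    rw [lagWeight]
    split_ifs with h0
    · refine hm _ ?_
      rw [abs_div, abs_of_pos h0, lt_div_iff₀ h0]
      refine (Nat.le_ceil _).trans_lt ?_
      rw [← Int.cast_abs, Int.abs_eq_natAbs]
      exact_mod_cast hl
    · rfl

theorem tendsto_lagWeight {w : ℝ → ℝ} (hw : IsWeight w) {h : ℕ → ℝ} (hh : IsBandwidth h) (l : ℤ) :
    Tendsto (fun n => lagWeight w (h n) l) atTop (𝓝 1) := by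
  have h1 : Tendsto (fun n => w (l / h n)) atTop (𝓝 1) := by
    rw [← hw.zero]
    exact (hw.continuous.tendsto 0).comp (tendsto_const_nhds.div_atTop hh.tendsto_atTop)
  refine h1.congr' ?_
  filter_upwards [hh.tendsto_atTop.eventually_gt_atTop 0] with n hn
  rw [lagWeight, if_pos hn]

theorem tendsto_band_div_sqrt {h : ℕ → ℝ} (hh : IsBandwidth h) {m : ℝ} (hm : 0 < m) :
    Tendsto (fun n : ℕ => (2 * (⌈m * h n⌉₊ : ℝ) + 1) / √(n : ℝ)) atTop (𝓝 0) := by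
  have h1 : Tendsto (fun n : ℕ => 2 * m * (h n / √(n : ℝ)) + 3 * (1 / √(n : ℝ))) atTop (𝓝 0) := by
    have h2 : Tendsto (fun n : ℕ => 1 / √(n : ℝ)) atTop (𝓝 0) :=
      tendsto_const_nhds.div_atTop (Real.tendsto_sqrt_atTop.comp tendsto_natCast_atTop_atTop)
    simpa using (hh.rate.const_mul (2 * m)).add (h2.const_mul 3)
  refine squeeze_zero' (.of_forall fun n => by positivity) ?_ h1
  filter_upwards [hh.tendsto_atTop.eventually_gt_atTop 0] with n hn
  have h3 := Nat.ceil_lt_add_one (mul_pos hm hn).le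
  calc _ ≤ (2 * (m * h n + 1) + 1) / √(n : ℝ) := by gcongr
    _ = _ := by ring

/-- Riemann sums of a weight function. -/
theorem abs_sum_div_sub_integral_le {w : ℝ → ℝ} (hc : Continuous w) {m h ε : ℝ} (hh : 1 ≤ h)
    (hm0 : 0 < m) (hm : ∀ u, m < |u| → w u = 0) (hε : ∀ x y, |x - y| ≤ 1 / h → |w x - w y| ≤ ε) :
    |(∑ l ∈ Finset.Ico (-((⌈m * h⌉₊ : ℤ) + 1)) (⌈m * h⌉₊ + 1), w (l / h)) / h - ∫ u, w u| ≤
      (2 * m + 4) * ε := by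
  have h0 : 0 < h := by linarith
  -- The extra `1` makes `m < N / h` strict, so that the support of `w` lies in the half-open
  -- interval from `-N/h` to `N/h`.
  set N : ℕ := ⌈m * h⌉₊ + 1 with hN
  have hNm : m * h < N := by
    rw [hN]; push_cast; linarith [Nat.le_ceil (m * h)]
  have hN2 : (N : ℝ) ≤ (m + 2) * h := by
    rw [hN]; push_cast; nlinarith [Nat.ceil_lt_add_one (mul_pos hm0 h0).le]
  set a : ℕ → ℝ := fun i => ((i : ℝ) - N) / h with ha
  have hε0 : 0 ≤ ε := (abs_nonneg _).trans (hε 0 0 (by simp; positivity))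
  have e1 : ∫ u, w u = ∑ i ∈ Finset.range (2 * N), ∫ x in a i..a (i + 1), w x := by
    rw [intervalIntegral.sum_integral_adjacent_intervals
      fun i _ => hc.intervalIntegrable _ _]
    refine (intervalIntegral.integral_eq_integral_of_support_subset fun u hu => ?_).symm
    have hu' : |u| ≤ m := not_lt.1 fun h => hu (hm u h)
    rw [abs_le] at hu'
    have hmN : m < N / h := by rwa [lt_div_iff₀ h0]
    simp only [ha, Set.mem_Ioc]
    push_cast
    constructor
    · rw [show ((0 : ℝ) - N) / h = -(N / h) by ring]; linarith
    · rw [show (2 * (N : ℝ) - N) / h = N / h by ring]; linarith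
  have e2 : (∑ l ∈ Finset.Ico (-((⌈m * h⌉₊ : ℤ) + 1)) (⌈m * h⌉₊ + 1), w (l / h)) / h =
      ∑ i ∈ Finset.range (2 * N), ∫ _ in a i..a (i + 1), w (a i) := by
    rw [Finset.sum_div]
    refine (Finset.sum_nbij' (fun i : ℕ => (i : ℤ) - N) (fun l : ℤ => (l + N).toNat) ?_ ?_ ?_ ?_ ?_).symm
    · intro i hi
      simp only [Finset.mem_range, Finset.mem_Ico] at hi ⊢
      omega
    · intro l hl
      simp only [Finset.mem_range, Finset.mem_Ico] at hl ⊢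
      omega
    · intro i hi
      simp
    · intro l hl
      simp only [Finset.mem_Ico] at hl
      omega
    · intro i hi
      rw [intervalIntegral.integral_const, smul_eq_mul]
      simp only [ha]
      push_cast
      field_simp
      ring
  rw [e1, e2, ← Finset.sum_sub_distrib]
  calc _ ≤ ∑ i ∈ Finset.range (2 * N), ε * (1 / h) := by
        refine (Finset.abs_sum_le_sum_abs _ _).trans (Finset.sum_le_sum fun i _ => ?_)
        rw [← intervalIntegral.integral_sub (by simp) (hc.intervalIntegrable _ _)]
        have hai : a (i + 1) - a i = 1 / h := by simp only [ha]; push_cast; ring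
        have h5 := intervalIntegral.norm_integral_le_of_norm_le_const (a := a i) (b := a (i + 1))
          (f := fun x => w (a i) - w x) (C := ε) fun x hx => ?_
        · rw [hai, abs_of_nonneg (by positivity)] at h5
          exact h5
        · rw [Set.uIoc_of_le (by rw [← sub_nonneg, hai]; positivity), Set.mem_Ioc] at hx
          refine hε _ _ ?_
          rw [abs_le]
          constructor <;> linarith
    _ = 2 * (N / h) * ε := by
        rw [Finset.sum_const, Finset.card_range, nsmul_eq_mul]; push_cast; ring
    _ ≤ 2 * (m + 2) * ε := by
        gcongr
        rwa [div_le_iff₀ h0]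
    _ = _ := by ring

/-- The sum is `h` times a Riemann sum of `w`, hence eventually at least `h * (∫ w) / 2`. This is
where the positivity of `∫ w` enters. -/
theorem tendsto_sum_lagWeight {w : ℝ → ℝ} (hw : IsWeight w) {h : ℕ → ℝ} (hh : IsBandwidth h) {m : ℝ}
    (hm0 : 0 < m) (hm : ∀ u, m < |u| → w u = 0) :
    Tendsto (fun n => ∑ l ∈ Finset.Ico (-((⌈m * h n⌉₊ : ℤ) + 1)) (⌈m * h n⌉₊ + 1),
      lagWeight w (h n) l) atTop atTop := by
  have hu : UniformContinuous w := by
    refine HasCompactSupport.uniformContinuous_of_continuous ?_ hw.continuous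
    refine HasCompactSupport.intro (isCompact_Icc (a := -m) (b := m)) fun u hu => hm u ?_
    rw [Set.mem_Icc, not_and_or, not_le, not_le] at hu
    rw [lt_abs]
    rcases hu with hu | hu
    · right; linarith
    · left; exact hu
  set I := ∫ u, w u with hI
  have hI0 : 0 < I := hw.integral_pos
  obtain ⟨η, hη, hwη⟩ := Metric.uniformContinuous_iff.1 hu (I / 2 / (2 * m + 4)) (by positivity)
  have h1 : Tendsto (fun n => h n * (I / 2)) atTop atTop :=
    hh.tendsto_atTop.atTop_mul_const (by positivity)
  refine tendsto_atTop_mono' _ ?_ h1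
  filter_upwards [hh.tendsto_atTop.eventually_ge_atTop 1,
    hh.tendsto_atTop.eventually_gt_atTop (1 / η)] with n hn1 hn2
  have hn0 : 0 < h n := by linarith
  have h2 := abs_sum_div_sub_integral_le hw.continuous hn1 hm0 hm
    (ε := I / 2 / (2 * m + 4)) fun x y hxy => (hwη (by
      rw [Real.dist_eq]
      refine hxy.trans_lt ?_
      rw [div_lt_iff₀ hn0]
      rwa [div_lt_iff₀ hη, mul_comm] at hn2)).le
  rw [mul_div_cancel₀ _ (by positivity : (2 * m + 4) ≠ 0)] at h2
  have h3 := (abs_le.1 h2).1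
  simp only [lagWeight, if_pos hn0]
  have h4 : I / 2 ≤ (∑ l ∈ Finset.Ico (-((⌈m * h n⌉₊ : ℤ) + 1)) (⌈m * h n⌉₊ + 1), w (l / h n)) / h n := by
    linarith
  rw [le_div_iff₀ hn0] at h4
  linarith

end LagWindow

/-! ### The lag-window form of a centered step. -/

section Step

/-- The centered step at `k`. -/
noncomputable def stepSeq (n : ℕ) (k i : ℤ) : ℝ := (if i ≤ k then 1 else 0) - k / n

theorem div_mem_Icc {n : ℕ} {k : ℤ} (hk0 : 0 ≤ k) (hkn : k ≤ n) :
    (0 : ℝ) ≤ k / n ∧ (k : ℝ) / n ≤ 1 := by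
  have h1 : (0 : ℝ) ≤ k := by exact_mod_cast hk0
  have h2 : (k : ℝ) ≤ n := by exact_mod_cast hkn
  exact ⟨by positivity, div_le_one_of_le₀ h2 (by positivity)⟩

theorem abs_stepSeq_le {n : ℕ} {k : ℤ} (hk0 : 0 ≤ k) (hkn : k ≤ n) (i : ℤ) :
    |stepSeq n k i| ≤ 1 := by
  obtain ⟨h1, h2⟩ := div_mem_Icc hk0 hkn
  rw [stepSeq, abs_le]
  split_ifs <;> constructor <;> linarith

theorem rms_le_one {n : ℕ} {a : ℤ → ℝ} (ha : ∀ i, |a i| ≤ 1) : rms n a ≤ 1 := by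
  rw [rms]
  refine Real.sqrt_le_one.2 ?_
  have h1 : ∑ i ∈ Finset.Icc (1 : ℤ) n, a i ^ 2 ≤ n := by
    refine (Finset.sum_le_card_nsmul _ _ 1 fun i _ => ?_).trans_eq (by simp)
    rw [← sq_abs]
    exact pow_le_one₀ (abs_nonneg _) (ha i)
  rcases Nat.eq_zero_or_pos n with rfl | hn
  · simp
  · rw [inv_mul_le_iff₀ (by positivity), mul_one]
    exact h1

theorem sum_stepSeq {n : ℕ} {k : ℤ} (hk0 : 0 ≤ k) (hkn : k ≤ n) :
    ∑ i ∈ Finset.Icc (1 : ℤ) n, stepSeq n k i = 0 := by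
  rcases Nat.eq_zero_or_pos n with rfl | hn
  · simp
  simp only [stepSeq]
  rw [Finset.sum_sub_distrib, sum_Icc_ite_le n hk0 hkn]
  simp
  field_simp
  ring

/-- At a fixed lag the product of step values is `(1 - p)²` before the break and `p²` after it, with
average `p(1 - p)`, except at `O(|l|)` indices. Over the `O(B)` lags of the band the errors add up
to `O(B² / n)`. -/
theorem abs_quadForm_stepSeq_sub_le {u : ℤ → ℝ} {W : ℝ} {B : ℕ} (hu : IsBandKernel u W B) {n : ℕ}
    {k : ℤ} (hk0 : 0 ≤ k) (hkn : k ≤ n) :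
    |quadForm u n (stepSeq n k) (stepSeq n k) -
      (k / n) * (1 - k / n) * ∑ l ∈ Finset.Ico (-((B : ℤ) + 1)) (B + 1), u l| ≤
      54 * W * ((2 * B + 1) / √(n : ℝ)) ^ 2 := by
  have hW := hu.nonneg
  rcases Nat.eq_zero_or_pos n with rfl | hn
  · simp [quadForm]
  have hn' : (0 : ℝ) < n := by exact_mod_cast hn
  obtain ⟨hp0, hp1⟩ := div_mem_Icc hk0 hkn
  set p : ℝ := k / n with hp
  have hs : ∀ i, |stepSeq n k i| ≤ 1 := abs_stepSeq_le hk0 hkn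
  set T : ℤ → ℝ := fun l => ∑ i ∈ Finset.Icc (1 : ℤ) n,
    if i + l ∈ Finset.Icc (1 : ℤ) n then stepSeq n k i * stepSeq n k (i + l) else 0 with hT
  have e1 : quadForm u n (stepSeq n k) (stepSeq n k) =
      ∑ l ∈ Finset.Ico (-((B : ℤ) + 1)) (B + 1), u l * ((n : ℝ)⁻¹ * T l) := by
    rw [quadForm, sum_sum_eq_tsum_lag n fun i j => u (j - i) * (stepSeq n k i * stepSeq n k j),
      ← tsum_mul_left, tsum_eq_sum (s := Finset.Ico (-((B : ℤ) + 1)) (B + 1))]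
    · refine Finset.sum_congr rfl fun l _ => ?_
      rw [mul_left_comm]
      congr 1
      rw [hT, Finset.mul_sum]
      refine Finset.sum_congr rfl fun i _ => ?_
      rw [add_sub_cancel_left, mul_ite, mul_zero]
    · intro l hl
      have h0 : u l = 0 := hu.band l (by simp only [Finset.mem_Ico] at hl; omega)
      refine mul_eq_zero_of_right _ (Finset.sum_eq_zero (s := Finset.Icc (1 : ℤ) n) fun i _ => ?_)
      rw [add_sub_cancel_left, h0]
      simp
  have e2 : (n : ℝ)⁻¹ * ∑ i ∈ Finset.Icc (1 : ℤ) n, (if i ≤ k then (1 - p) ^ 2 else p ^ 2) =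
      p * (1 - p) := by
    rw [sum_Icc_ite_le n hk0 hkn]
    have : (k : ℝ) = p * n := by rw [hp]; field_simp
    rw [this]
    field_simp
    ring
  have h1 : ∀ l ∈ Finset.Ico (-((B : ℤ) + 1)) (B + 1),
      |u l * ((n : ℝ)⁻¹ * T l) - p * (1 - p) * u l| ≤ W * ((n : ℝ)⁻¹ * ((6 * (B + 1) + 3) * 3)) := by
    intro l hl
    have h2 := abs_sum_lag_sub_le (r := fun i j => stepSeq n k i * stepSeq n k j)
      (γ₁ := (1 - p) ^ 2) (γ₂ := p ^ 2) (M := 1) n k l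
      (fun i => by rw [abs_mul]; exact mul_le_one₀ (hs _) (abs_nonneg _) (hs _))
      (fun i hi hi' => by simp only [stepSeq, hi, hi', if_true]; ring)
      (fun i hi hi' => by simp only [stepSeq, not_le.2 hi, not_le.2 hi', if_false]; ring)
    rw [mul_comm (p * (1 - p)), ← mul_sub, abs_mul, ← e2, ← mul_sub, abs_mul,
      abs_of_nonneg (by positivity : (0 : ℝ) ≤ (n : ℝ)⁻¹)]
    have h3 : ((l.natAbs : ℕ) : ℝ) ≤ B + 1 := by
      have : l.natAbs ≤ B + 1 := by simp only [Finset.mem_Ico] at hl; omega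
      exact_mod_cast this
    have h4 : 1 + |(1 - p) ^ 2| + |p ^ 2| ≤ 3 := by
      rw [abs_of_nonneg (sq_nonneg _), abs_of_nonneg (sq_nonneg _)]
      nlinarith
    refine mul_le_mul (hu.bound l) ?_ (by positivity) hW
    gcongr
    exact h2.trans (by gcongr)
  rw [e1, Finset.mul_sum, ← Finset.sum_sub_distrib]
  refine (Finset.abs_sum_le_sum_abs _ _).trans ((Finset.sum_le_sum h1).trans ?_)
  rw [Finset.sum_const, Int.card_Ico, nsmul_eq_mul, div_pow, Real.sq_sqrt hn'.le]
  have h5 : (((B + 1 - -((B : ℤ) + 1) : ℤ).toNat : ℕ) : ℝ) = 2 * B + 2 := by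
    have : (B + 1 - -((B : ℤ) + 1) : ℤ).toNat = 2 * B + 2 := by omega
    rw [this]; push_cast; ring
  rw [h5]
  -- Number of lags times the number of exceptional indices times the bound `3` on the summands;
  -- equality at `B = 0` fixes the constant `54`.
  have h6 : (2 * (B : ℝ) + 2) * ((6 * (B + 1) + 3) * 3) ≤ 54 * (2 * B + 1) ^ 2 := by
    nlinarith [(B.cast_nonneg : (0 : ℝ) ≤ B)]
  calc _ = W / n * ((2 * (B : ℝ) + 2) * ((6 * (B + 1) + 3) * 3)) := by field_simp
    _ ≤ W / n * (54 * (2 * B + 1) ^ 2) := by gcongr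
    _ = _ := by ring

/-- The main term is `τ(1 - τ)` times the diverging sum of weights, and the error `O(h² / n)`
vanishes by the bandwidth rate. -/
theorem tendsto_quadForm_stepSeq {w : ℝ → ℝ} (hw : IsWeight w) {h : ℕ → ℝ} (hh : IsBandwidth h)
    {τ : ℝ} (hτ : τ ∈ Set.Ioo (0 : ℝ) 1) :
    Tendsto (fun n : ℕ => quadForm (lagWeight w (h n)) n (stepSeq n ⌊τ * n⌋) (stepSeq n ⌊τ * n⌋))
      atTop atTop := by
  obtain ⟨m, hm0, hm⟩ := hw.bounded_support
  obtain ⟨W, hW⟩ := hw.exists_bound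
  have h1 := tendsto_sum_lagWeight hw hh hm0 hm
  have h2 := tendsto_floor_mul_div τ
  have h3 : Tendsto (fun n : ℕ => ((⌊τ * n⌋ : ℤ) : ℝ) / n * (1 - ((⌊τ * n⌋ : ℤ) : ℝ) / n)) atTop
      (𝓝 (τ * (1 - τ))) := h2.mul (tendsto_const_nhds.sub h2)
  have h4 := h3.pos_mul_atTop (mul_pos hτ.1 (sub_pos.2 hτ.2)) h1
  have h5 := ((tendsto_band_div_sqrt hh hm0).pow 2).const_mul (54 * W)
  refine tendsto_atTop_mono (fun n => ?_) (h4.atTop_add h5.neg)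
  have h6 := abs_quadForm_stepSeq_sub_le (isBandKernel_lagWeight hW hm (h n))
    (floor_mul_nonneg hτ n) (floor_mul_le hτ n)
  have := (abs_le.1 h6).1
  linarith

end Step

/-! ### Convergence and boundedness in probability as statements about a filter. -/

section ProbFilter

variable {Ω : Type*} [MeasurableSpace Ω]

/-- The filter of convergence in probability: a property of `(n, ω)` holds along it if the
probability that it fails tends to `0`. -/
def probFilter (P : Measure Ω) : Filter (ℕ × Ω) where
  -- `P` acts as an outer measure, so nothing has to be measurable; this allows an arbitrary choice
  -- of sample eigenfunctions.
  sets := {s | Tendsto (fun n => P {ω | (n, ω) ∉ s}) atTop (𝓝 0)}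
  univ_sets := by simp
  sets_of_superset {s t} hs hst := by
    refine tendsto_of_tendsto_of_tendsto_of_le_of_le tendsto_const_nhds hs (fun _ => zero_le)
      fun n => measure_mono fun ω hω hs => hω (hst hs)
  inter_sets {s t} hs ht := by
    have h : Tendsto (fun n => P {ω | (n, ω) ∉ s} + P {ω | (n, ω) ∉ t}) atTop (𝓝 0) := by
      simpa using Tendsto.add hs ht
    refine tendsto_of_tendsto_of_tendsto_of_le_of_le tendsto_const_nhds h (fun _ => zero_le)
      fun n => ?_
    refine le_trans (measure_mono fun ω hω => ?_) (measure_union_le _ _)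
    by_cases h1 : (n, ω) ∈ s
    · exact Or.inr fun h2 => hω ⟨h1, h2⟩
    · exact Or.inl h1

variable {P : Measure Ω}

theorem mem_probFilter {s : Set (ℕ × Ω)} :
    s ∈ probFilter P ↔ Tendsto (fun n => P {ω | (n, ω) ∉ s}) atTop (𝓝 0) := Iff.rfl

theorem tendsto_fst_probFilter : Tendsto Prod.fst (probFilter P) atTop := by
  intro s hs
  rw [mem_map, mem_probFilter]
  refine tendsto_const_nhds.congr' ?_
  filter_upwards [hs] with n hn
  simp [hn]

theorem tendstoInProbTop_of_tendsto {Y : ℕ → Ω → ℝ}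
    (h : Tendsto (fun p : ℕ × Ω => Y p.1 p.2) (probFilter P) atTop) : TendstoInProbTop P Y := by
  intro K
  have := mem_probFilter.1 (h.eventually_gt_atTop K)
  simpa using this

/-- Markov's inequality. -/
theorem tendsto_probFilter_of_integral {Y : ℕ → Ω → ℝ} (hi : ∀ n, Integrable (Y n) P)
    (h : Tendsto (fun n => ∫ ω, |Y n ω| ∂P) atTop (𝓝 0)) :
    Tendsto (fun p : ℕ × Ω => Y p.1 p.2) (probFilter P) (𝓝 0) := by
  rw [Metric.tendsto_nhds]
  intro ε hε
  rw [Filter.Eventually, mem_probFilter]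
  have h1 : Tendsto (fun n => ENNReal.ofReal ((∫ ω, |Y n ω| ∂P) / ε)) atTop (𝓝 0) := by
    have h0 : Tendsto (fun n => (∫ ω, |Y n ω| ∂P) / ε) atTop (𝓝 0) := by
      simpa using h.div_const ε
    simpa [Function.comp_def] using (ENNReal.continuous_ofReal.tendsto 0).comp h0
  refine tendsto_of_tendsto_of_tendsto_of_le_of_le tendsto_const_nhds h1 (fun _ => zero_le)
    fun n => ?_
  have h2 := mul_meas_ge_le_lintegral₀ (μ := P) (f := fun ω => ENNReal.ofReal |Y n ω|)
    (hi n).abs.1.aemeasurable.ennreal_ofReal (ENNReal.ofReal ε)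
  rw [← ofReal_integral_eq_lintegral_ofReal (hi n).abs (.of_forall fun ω => abs_nonneg _)] at h2
  have e1 : {ω | (n, ω) ∉ {p : ℕ × Ω | dist (Y p.1 p.2) 0 < ε}} =
      {ω | ENNReal.ofReal ε ≤ ENNReal.ofReal |Y n ω|} := by
    ext ω
    simp only [Set.mem_ofPred_eq, not_lt, Real.dist_0_eq_abs]
    exact (ENNReal.ofReal_le_ofReal_iff (abs_nonneg _)).symm
  rw [e1, ENNReal.ofReal_div_of_pos hε]
  rw [ENNReal.le_div_iff_mul_le (.inl (by simpa using hε)) (.inl ENNReal.ofReal_ne_top), mul_comm]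
  exact h2

/-- Boundedness in probability: the product with any null sequence is null. -/
def IsTight (P : Measure Ω) (Y : ℕ × Ω → ℝ) : Prop :=
  ∀ a : ℕ → ℝ, Tendsto a atTop (𝓝 0) → Tendsto (fun p => a p.1 * Y p) (probFilter P) (𝓝 0)

theorem IsTight.add {Y Y' : ℕ × Ω → ℝ} (h : IsTight P Y) (h' : IsTight P Y') :
    IsTight P fun p => Y p + Y' p := fun a ha => by
  simpa [mul_add] using (h a ha).add (h' a ha)

theorem IsTight.mul {Y Y' : ℕ × Ω → ℝ} (h : IsTight P Y) (h' : IsTight P Y') :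
    IsTight P fun p => Y p * Y' p := fun a ha => by
  -- The null sequence is split into two null factors, one for each tight sequence.
  have h1 : Tendsto (fun n => √|a n|) atTop (𝓝 0) := by simpa using ha.abs.sqrt
  have h2 : Tendsto (fun p : ℕ × Ω => |a p.1 * (Y p * Y' p)|) (probFilter P) (𝓝 0) := by
    have := ((h _ h1).mul (h' _ h1)).abs
    simp only [mul_zero, abs_zero] at this
    refine this.congr fun p => ?_
    rw [mul_mul_mul_comm, Real.mul_self_sqrt (abs_nonneg _), abs_mul, abs_abs, ← abs_mul]
  exact (tendsto_zero_iff_abs_tendsto_zero _).2 h2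

theorem IsTight.mono {Y Y' : ℕ × Ω → ℝ} (h : IsTight P Y)
    (hle : ∀ᶠ p in probFilter P, |Y' p| ≤ |Y p|) : IsTight P Y' := fun a ha => by
  refine squeeze_zero_norm' ?_ (tendsto_zero_iff_abs_tendsto_zero _ |>.1 (h a ha))
  filter_upwards [hle] with p hp
  simp only [Function.comp_apply]
  rw [Real.norm_eq_abs, abs_mul, abs_mul]
  gcongr

theorem isTight_const (c : ℝ) : IsTight P fun _ => c := fun a ha => by
  simpa using (ha.comp tendsto_fst_probFilter).mul_const c

theorem IsTight.const_mul {Y : ℕ × Ω → ℝ} (h : IsTight P Y) (c : ℝ) : IsTight P fun p => c * Y p :=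
  (isTight_const c).mul h

theorem isTight_of_tendsto {Y : ℕ × Ω → ℝ} {c : ℝ} (h : Tendsto Y (probFilter P) (𝓝 c)) :
    IsTight P Y := fun a ha => by
  simpa using (ha.comp tendsto_fst_probFilter).mul h

theorem isTight_of_integral_le {Y : ℕ → Ω → ℝ} (hi : ∀ n, Integrable (Y n) P) {C : ℝ}
    (h : ∀ n, ∫ ω, |Y n ω| ∂P ≤ C) : IsTight P fun p => Y p.1 p.2 := fun a ha => by
  refine tendsto_probFilter_of_integral (Y := fun n ω => a n * Y n ω)
    (fun n => (hi n).const_mul _) ?_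
  have h1 : Tendsto (fun n => |a n| * C) atTop (𝓝 0) := by simpa using ha.abs.mul_const C
  refine squeeze_zero (fun n => integral_nonneg fun ω => abs_nonneg _) (fun n => ?_) h1
  simp_rw [abs_mul]
  rw [integral_const_mul]
  gcongr
  exact h n

/-- Tightness of a normalized sequence gives convergence to zero. -/
theorem IsTight.tendsto_of_mul_sqrt {Y : ℕ × Ω → ℝ} (h : IsTight P fun p => √(p.1 : ℝ) * Y p) :
    Tendsto Y (probFilter P) (𝓝 0) := by
  have h1 : Tendsto (fun n : ℕ => (√(n : ℝ))⁻¹) atTop (𝓝 0) :=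
    tendsto_inv_atTop_zero.comp (Real.tendsto_sqrt_atTop.comp tendsto_natCast_atTop_atTop)
  refine (h _ h1).congr' ?_
  filter_upwards [tendsto_fst_probFilter.eventually_gt_atTop 0] with p hp
  have : √(p.1 : ℝ) ≠ 0 := (Real.sqrt_pos.2 (by exact_mod_cast hp)).ne'
  rw [inv_mul_cancel_left₀ this]

end ProbFilter

/-! ### Rates for averages of features. -/

section Averages

variable {Ω S : Type*} [MeasurableSpace Ω] [MeasurableSpace S] {P : Measure Ω} {ν : Measure S}
  {e : ℤ → Ω → S} {g₁ g₂ : (ℕ → S) → L2}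
  {H : Type*} [NormedAddCommGroup H] [InnerProductSpace ℝ H]

/-- The errors of the sample with a break after time `k`. -/
def breakErr {Ω S : Type*} (g₁ g₂ : (ℕ → S) → L2) (e : ℤ → Ω → S) (k i : ℤ) (ω : Ω) : L2 :=
  if i ≤ k then shiftProcess g₁ e i ω else shiftProcess g₂ e i ω

theorem memLp_norm_sq {E : Type*} [NormedAddCommGroup E] {p r : ℝ≥0∞} [ENNReal.HolderTriple p p r]
    {f : Ω → E} (hf : MemLp f p P) : MemLp (fun ω => ‖f ω‖ ^ 2) r P := by
  have h1 : MemLp (fun ω => ‖f ω‖) p P := hf.norm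
  have h2 : MemLp (fun ω => ‖f ω‖ * ‖f ω‖) r P := MemLp.mul' h1 h1
  simpa only [sq] using h2

theorem isTight_average {Y : ℕ → ℤ → Ω → ℝ} {C : ℝ} (hC : 0 ≤ C) (hi : ∀ n i, Integrable (Y n i) P)
    (h : ∀ n i, ∫ ω, |Y n i ω| ∂P ≤ C) :
    IsTight P fun p => (p.1 : ℝ)⁻¹ * ∑ i ∈ Finset.Icc (1 : ℤ) p.1, Y p.1 i p.2 := by
  have hs : ∀ n : ℕ, Integrable (fun ω => ∑ i ∈ Finset.Icc (1 : ℤ) n, Y n i ω) P := fun n =>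
    integrable_finsetSum _ fun i _ => hi n i
  refine isTight_of_integral_le (Y := fun n ω => (n : ℝ)⁻¹ * ∑ i ∈ Finset.Icc (1 : ℤ) n, Y n i ω)
    (C := C) (fun n => (hs n).const_mul _) fun n => ?_
  simp_rw [abs_mul, integral_const_mul, abs_of_nonneg (by positivity : (0 : ℝ) ≤ (n : ℝ)⁻¹)]
  have h1 : ∫ ω, |∑ i ∈ Finset.Icc (1 : ℤ) n, Y n i ω| ∂P ≤ n * C := by
    calc _ ≤ ∫ ω, ∑ i ∈ Finset.Icc (1 : ℤ) n, |Y n i ω| ∂P :=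
          integral_mono (hs n).abs (integrable_finsetSum _ fun i _ => (hi n i).abs)
            fun ω => Finset.abs_sum_le_sum_abs _ _
      _ = ∑ i ∈ Finset.Icc (1 : ℤ) n, ∫ ω, |Y n i ω| ∂P :=
          integral_finsetSum _ fun i _ => (hi n i).abs
      _ ≤ n * C := by
          refine (Finset.sum_le_card_nsmul _ _ C fun i _ => h n i).trans_eq ?_
          simp
  rcases Nat.eq_zero_or_pos n with rfl | hn
  · simpa using hC
  · rw [inv_mul_le_iff₀ (by exact_mod_cast hn)]
    exact h1

variable [IsProbabilityMeasure ν]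

theorem memLp_breakErr (he : IsIIDInnovation P ν e) (hg₁ : IsSegment P ν e g₁)
    (hg₂ : IsSegment P ν e g₂) (k i : ℤ) : MemLp (breakErr g₁ g₂ e k i) 4 P := by
  by_cases hi : i ≤ k
  · have : breakErr g₁ g₂ e k i = shiftProcess g₁ e i := by ext1 ω; simp [breakErr, hi]
    rw [this]; exact hg₁.memLp_shift he i
  · have : breakErr g₁ g₂ e k i = shiftProcess g₂ e i := by ext1 ω; simp [breakErr, hi]
    rw [this]; exact hg₂.memLp_shift he i

variable [IsProbabilityMeasure P] [CompleteSpace H]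

/-- The second moment of the sum is `O(n)`, uniformly in the position of the break; `x ≤ 1 + x²`
turns this into a bound on the first moment. -/
theorem isTight_sqrt_mul_norm_average (he : IsIIDInnovation P ν e) (hg₁ : IsSegment P ν e g₁)
    (hg₂ : IsSegment P ν e g₂) {q : L2 → H} (hq : IsQuadratic q) (k : ℕ → ℤ) {m : ℕ → ℤ}
    (hm : ∀ n, m n ≤ n) :
    IsTight P fun p => √(p.1 : ℝ) * ‖(p.1 : ℝ)⁻¹ • ∑ i ∈ Finset.Icc (1 : ℤ) (m p.1),
      feature P g₁ g₂ e q (k p.1) i p.2‖ := by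
  obtain ⟨K, hK, h⟩ := exists_integral_norm_sum_feature_sq_le he hg₁ hg₂ hq
  have hL : ∀ n : ℕ, MemLp (fun ω => ∑ i ∈ Finset.Icc (1 : ℤ) (m n), feature P g₁ g₂ e q (k n) i ω) 2 P :=
    fun n => memLp_finsetSum _ fun i _ => memLp_feature he hg₁ hg₂ hq (k n) i
  set A : ℕ → Ω → H := fun n ω => ∑ i ∈ Finset.Icc (1 : ℤ) (m n), feature P g₁ g₂ e q (k n) i ω
    with hA
  have hi0 : ∀ n : ℕ, Integrable (fun ω => (n : ℝ)⁻¹ • A n ω) P := fun n =>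
    ((hL n).integrable (by norm_num)).smul (n : ℝ)⁻¹
  have hi1 : ∀ n : ℕ, Integrable (fun ω => √(n : ℝ) * ‖(n : ℝ)⁻¹ • A n ω‖) P := fun n =>
    (hi0 n).norm.const_mul _
  have hsq : ∀ n, Integrable (fun ω => ‖A n ω‖ ^ 2) P := fun n => MemLp.norm_sq_integrable (hL n)
  have hsq2 : ∀ n : ℕ, Integrable (fun ω => (n : ℝ)⁻¹ * ‖A n ω‖ ^ 2) P := fun n =>
    (hsq n).const_mul _
  refine isTight_of_integral_le (Y := fun n ω => √(n : ℝ) * ‖(n : ℝ)⁻¹ • A n ω‖) (C := 1 + K) hi1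
    fun n => ?_
  have hi2 : Integrable (fun ω => 1 + (n : ℝ)⁻¹ * ‖A n ω‖ ^ 2) P :=
    (integrable_const 1).add (hsq2 n)
  calc ∫ ω, |√(n : ℝ) * ‖(n : ℝ)⁻¹ • A n ω‖| ∂P ≤ ∫ ω, (1 + (n : ℝ)⁻¹ * ‖A n ω‖ ^ 2) ∂P := by
        refine integral_mono (hi1 n).abs hi2 fun ω => ?_
        simp only
        rw [abs_of_nonneg (by positivity), norm_smul, norm_inv, Real.norm_natCast]
        generalize ‖A n ω‖ = x
        have h1 : √(n : ℝ) * ((n : ℝ)⁻¹ * x) ≤ 1 + (√(n : ℝ) * ((n : ℝ)⁻¹ * x)) ^ 2 := by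
          nlinarith [sq_nonneg (√(n : ℝ) * ((n : ℝ)⁻¹ * x) - 1)]
        refine h1.trans_eq ?_
        rw [mul_pow, mul_pow, Real.sq_sqrt n.cast_nonneg]
        rcases Nat.eq_zero_or_pos n with rfl | hn
        · simp
        · field_simp
    _ = 1 + (n : ℝ)⁻¹ * ∫ ω, ‖A n ω‖ ^ 2 ∂P := by
        rw [integral_add (integrable_const _) (hsq2 n), integral_const_mul]
        simp
    _ ≤ 1 + (n : ℝ)⁻¹ * (K * n) := by
        have h2 := h (k n) (Finset.Icc (1 : ℤ) (m n)) fun _ => 1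
        simp only [one_smul, one_pow, Finset.sum_const, nsmul_eq_mul, mul_one, Int.card_Icc] at h2
        have h3 : ((m n + 1 - 1 : ℤ).toNat : ℝ) ≤ n := by
          have : (m n + 1 - 1 : ℤ).toNat ≤ n := by have := hm n; omega
          exact_mod_cast this
        gcongr
        exact h2.trans (by gcongr)
    _ ≤ 1 + K := by
        rcases Nat.eq_zero_or_pos n with rfl | hn
        · simpa using hK
        · have : (0 : ℝ) < n := by exact_mod_cast hn
          field_simp
          exact le_rfl

theorem isTight_rms_feature (he : IsIIDInnovation P ν e) (hg₁ : IsSegment P ν e g₁)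
    (hg₂ : IsSegment P ν e g₂) {q : L2 → ℝ} (hq : IsQuadratic q) (k : ℕ → ℤ) :
    IsTight P fun p => rms p.1 fun i => feature P g₁ g₂ e q (k p.1) i p.2 := by
  obtain ⟨K, hK, h⟩ := exists_integral_norm_sum_feature_sq_le he hg₁ hg₂ hq
  have h1 := isTight_average (P := P) (Y := fun n i ω => feature P g₁ g₂ e q (k n) i ω ^ 2) hK
    (fun n i => (memLp_feature he hg₁ hg₂ hq (k n) i).integrable_sq) fun n i => by
      have := h (k n) {i} fun _ => 1
      simpa using this
  refine ((isTight_const 1).add h1).mono (.of_forall fun p => ?_)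
  rw [← rms_sq, abs_of_nonneg (rms_nonneg _ _), abs_of_nonneg (by positivity)]
  nlinarith [sq_nonneg (rms p.1 (fun i => feature P g₁ g₂ e q (k p.1) i p.2) - 1)]

/-- The weight `1 + ‖ε_i‖²` measures how much a quadratic feature reacts to a perturbation of its
argument. Its square is integrable because the errors have four moments. -/
theorem isTight_average_weight (he : IsIIDInnovation P ν e) (hg₁ : IsSegment P ν e g₁)
    (hg₂ : IsSegment P ν e g₂) (k : ℕ → ℤ) :
    IsTight P fun p => (p.1 : ℝ)⁻¹ * ∑ i ∈ Finset.Icc (1 : ℤ) p.1,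
      (1 + ‖breakErr g₁ g₂ e (k p.1) i p.2‖ ^ 2) ^ 2 := by
  have hm : ∀ k i, MemLp (fun ω => 1 + ‖breakErr g₁ g₂ e k i ω‖ ^ 2) 2 P := fun k i => by
    have h0 : MemLp (fun _ : Ω => (1 : ℝ)) 2 P := memLp_const 1
    have h2 : MemLp (fun ω => ‖breakErr g₁ g₂ e k i ω‖ ^ 2) 2 P :=
      memLp_norm_sq (memLp_breakErr he hg₁ hg₂ k i)
    exact h0.add h2
  have hst : ∀ (g : (ℕ → S) → L2), IsSegment P ν e g → ∀ i,
      ∫ ω, (1 + ‖(shiftProcess g e i ω)‖ ^ 2) ^ 2 ∂P = ∫ ω, (1 + ‖(shiftProcess g e 0 ω)‖ ^ 2) ^ 2 ∂P :=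
    fun g hg i => by
      have hU : StronglyMeasurable fun x => (1 + ‖g x‖ ^ 2) ^ 2 :=
        ((hg.measurable.norm.pow 2).const_add 1).pow 2
      exact (integral_past_eq he hU i).trans (integral_past_eq he hU 0).symm
  refine isTight_average (Y := fun n i ω => (1 + ‖breakErr g₁ g₂ e (k n) i ω‖ ^ 2) ^ 2)
    (C := ∫ ω, (1 + ‖(shiftProcess g₁ e 0 ω)‖ ^ 2) ^ 2 ∂P + ∫ ω, (1 + ‖(shiftProcess g₂ e 0 ω)‖ ^ 2) ^ 2 ∂P)
    (by positivity) (fun n i => (hm (k n) i).integrable_sq) fun n i => ?_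
  simp_rw [abs_of_nonneg (sq_nonneg (1 + ‖breakErr g₁ g₂ e (k n) i _‖ ^ 2))]
  by_cases hi : i ≤ k n
  · simp only [breakErr, hi, if_true]
    rw [hst g₁ hg₁ i]
    exact le_add_of_nonneg_right (by positivity)
  · simp only [breakErr, hi, if_false]
    rw [hst g₂ hg₂ i]
    exact le_add_of_nonneg_left (by positivity)

/-- The form is linear in the feature, with coefficients at most `(2B + 1)W / n`. Its second moment
is then `O((2B + 1)² / n)`, so noise and step do not interact in the limit. -/
theorem tendsto_quadForm_feature_const (he : IsIIDInnovation P ν e) (hg₁ : IsSegment P ν e g₁)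
    (hg₂ : IsSegment P ν e g₂) {q : L2 → ℝ} (hq : IsQuadratic q) (k : ℕ → ℤ) {u : ℕ → ℤ → ℝ} {W : ℝ}
    {B : ℕ → ℕ} (hu : ∀ n, IsBandKernel (u n) W (B n))
    (hB : Tendsto (fun n : ℕ => (2 * (B n : ℝ) + 1) / √(n : ℝ)) atTop (𝓝 0)) {s : ℕ → ℤ → ℝ}
    (hs : ∀ n i, |s n i| ≤ 1) :
    Tendsto (fun p : ℕ × Ω => quadForm (u p.1) p.1 (fun i => feature P g₁ g₂ e q (k p.1) i p.2)
      (s p.1)) (probFilter P) (𝓝 0) := by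
  obtain ⟨K, hK, h⟩ := exists_integral_norm_sum_feature_sq_le he hg₁ hg₂ hq
  have hW := (hu 0).nonneg
  have hm := memLp_feature he hg₁ hg₂ hq
  refine tendsto_probFilter_of_integral (Y := fun n ω =>
    quadForm (u n) n (fun i => feature P g₁ g₂ e q (k n) i ω) (s n))
    (fun n => integrable_quadForm (u n) n (hm (k n)) (Y := fun i _ => s n i)
      fun i => memLp_const _) ?_
  have hlim : Tendsto (fun n : ℕ => √K * W * ((2 * (B n : ℝ) + 1) / √(n : ℝ))) atTop (𝓝 0) := by
    simpa using hB.const_mul (√K * W)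
  refine squeeze_zero (fun n => integral_nonneg fun ω => abs_nonneg _) (fun n => ?_) hlim
  set t : ℤ → ℝ := fun i => (n : ℝ)⁻¹ * ∑ j ∈ Finset.Icc (1 : ℤ) n, u n (j - i) * s n j with ht
  have e1 : ∀ ω, quadForm (u n) n (fun i => feature P g₁ g₂ e q (k n) i ω) (s n) =
      ∑ i ∈ Finset.Icc (1 : ℤ) n, t i • feature P g₁ g₂ e q (k n) i ω := fun ω => by
    rw [quadForm, Finset.mul_sum]
    refine Finset.sum_congr rfl fun i _ => ?_
    rw [ht, smul_eq_mul, mul_assoc, Finset.sum_mul]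
    congr 1
    exact Finset.sum_congr rfl fun j _ => by ring
  have ht2 : ∀ i, |t i| ≤ (n : ℝ)⁻¹ * ((2 * B n + 1) * W) := fun i => by
    rw [ht, abs_mul, abs_of_nonneg (by positivity : (0 : ℝ) ≤ (n : ℝ)⁻¹)]
    gcongr
    refine (Finset.abs_sum_le_sum_abs _ _).trans (le_trans ?_ ((hu n).sum_abs_le (Finset.Icc (1 : ℤ) n) i))
    refine Finset.sum_le_sum fun j _ => ?_
    rw [abs_mul]
    exact mul_le_of_le_one_right (abs_nonneg _) (hs n j)
  have hL : MemLp (fun ω => ∑ i ∈ Finset.Icc (1 : ℤ) n, t i • feature P g₁ g₂ e q (k n) i ω) 2 P :=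
    memLp_finsetSum _ fun i _ => (hm (k n) i).const_smul (t i)
  simp_rw [e1]
  refine integral_abs_le_of_sq_le hL (by positivity) ?_
  have h1 := h (k n) (Finset.Icc (1 : ℤ) n) t
  simp_rw [Real.norm_eq_abs, sq_abs] at h1
  refine h1.trans ?_
  have h2 : ∑ i ∈ Finset.Icc (1 : ℤ) n, t i ^ 2 ≤ n * ((n : ℝ)⁻¹ * ((2 * B n + 1) * W)) ^ 2 := by
    refine (Finset.sum_le_card_nsmul _ _ (((n : ℝ)⁻¹ * ((2 * B n + 1) * W)) ^ 2)
      fun i _ => ?_).trans_eq (by simp)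
    rw [← sq_abs]
    exact pow_le_pow_left₀ (abs_nonneg _) (ht2 i) 2
  calc K * ∑ i ∈ Finset.Icc (1 : ℤ) n, t i ^ 2
      ≤ K * (n * ((n : ℝ)⁻¹ * ((2 * B n + 1) * W)) ^ 2) := by gcongr
    _ = _ := by
        rw [mul_pow (√K * W), div_pow, mul_pow (√K), Real.sq_sqrt hK, Real.sq_sqrt n.cast_nonneg]
        rcases Nat.eq_zero_or_pos n with rfl | hn
        · simp
        · field_simp

end Averages

/-! ### Expansion of the lag-window estimator around noise plus a step. -/

section Expansion

/-- The mean of a sample. -/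
noncomputable def mean (n : ℕ) (a : ℤ → ℝ) : ℝ := (n : ℝ)⁻¹ * ∑ i ∈ Finset.Icc (1 : ℤ) n, a i

theorem sq_mean_le (n : ℕ) (a : ℤ → ℝ) : mean n a ^ 2 ≤ rms n a ^ 2 := by
  rw [rms_sq, mean]
  rcases Nat.eq_zero_or_pos n with rfl | hn
  · simp
  have h := sq_sum_le_card_mul_sum_sq (s := Finset.Icc (1 : ℤ) n) (f := a)
  have hn' : (0 : ℝ) < n := by exact_mod_cast hn
  simp only [Int.card_Icc, add_sub_cancel_right, Int.toNat_natCast] at h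
  rw [mul_pow, sq (n : ℝ)⁻¹, mul_assoc]
  gcongr
  rwa [inv_mul_le_iff₀ hn']

/-- The centered version of a sequence that is, up to a constant and a small remainder, the sum of
`θ` and a step of height `D`. -/
theorem rms_center_sub_sq_le {n : ℕ} (hn : 0 < n) {k : ℤ} (hk0 : 0 ≤ k) (hkn : k ≤ n)
    {a θ v : ℤ → ℝ} {c D ρ : ℝ}
    (h : ∀ i ∈ Finset.Icc (1 : ℤ) n, |a i - c - θ i - (if i ≤ k then D else 0)| ≤ ρ * v i) :
    rms n (fun i => center n a i - θ i - D * stepSeq n k i) ^ 2 ≤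
      6 * (ρ ^ 2 * ((n : ℝ)⁻¹ * ∑ i ∈ Finset.Icc (1 : ℤ) n, v i ^ 2)) + 3 * mean n θ ^ 2 := by
  have hn' : (0 : ℝ) < n := by exact_mod_cast hn
  set d : ℤ → ℝ := fun i => a i - c - θ i - (if i ≤ k then D else 0) with hd
  have hstep : ∀ i, (if i ≤ k then D else 0) = D * stepSeq n k i + D * (k / n) := fun i => by
    rw [stepSeq]; split_ifs <;> ring
  have hmean : mean n a = c + mean n θ + D * (k / n) + mean n d := by
    have h1 : ∀ i, a i = d i + c + θ i + (D * stepSeq n k i + D * (k / n)) := fun i => by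
      rw [← hstep]; simp only [hd]; ring
    simp only [mean]
    rw [Finset.sum_congr rfl fun i _ => h1 i, Finset.sum_add_distrib, Finset.sum_add_distrib,
      Finset.sum_add_distrib, Finset.sum_add_distrib, ← Finset.mul_sum, sum_stepSeq hk0 hkn]
    simp
    field_simp
    ring
  have hη : ∀ i, center n a i - θ i - D * stepSeq n k i = d i - mean n d - mean n θ := fun i => by
    have : center n a i = a i - mean n a := rfl
    rw [this, hmean]
    have := hstep i
    simp only [hd]
    linarith
  have hd2 : rms n d ^ 2 ≤ ρ ^ 2 * ((n : ℝ)⁻¹ * ∑ i ∈ Finset.Icc (1 : ℤ) n, v i ^ 2) := by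
    rw [rms_sq, mul_left_comm, Finset.mul_sum (a := ρ ^ 2)]
    gcongr with i hi
    rw [← mul_pow, ← sq_abs (d i)]
    exact pow_le_pow_left₀ (abs_nonneg _) (h i hi) 2
  -- The square of a sum of three terms costs the factor `3`; the mean of `d` is then absorbed into
  -- its root mean square, which doubles it to `6`.
  have h3 : rms n (fun i => center n a i - θ i - D * stepSeq n k i) ^ 2 ≤
      3 * (rms n d ^ 2 + mean n d ^ 2 + mean n θ ^ 2) := by
    simp only [rms_sq, hη]
    calc _ ≤ (n : ℝ)⁻¹ * ∑ i ∈ Finset.Icc (1 : ℤ) n, (3 * d i ^ 2 + 3 * (mean n d ^ 2 + mean n θ ^ 2)) := by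
          gcongr with i hi
          nlinarith [sq_nonneg (d i + mean n d), sq_nonneg (d i + mean n θ),
            sq_nonneg (mean n d - mean n θ)]
      _ = _ := by
          rw [Finset.sum_add_distrib, ← Finset.mul_sum]
          simp
          field_simp
          ring
  have h4 := sq_mean_le n d
  linarith

variable {Ω S : Type*} [MeasurableSpace Ω] [MeasurableSpace S] {P : Measure Ω} {ν : Measure S}
  {e : ℤ → Ω → S} {g₁ g₂ : (ℕ → S) → L2}

/-- The bandwidth is `o(√n)`, so a factor of size `n^{-1/2}` outweighs the number of lags. -/
theorem tendsto_quadForm_of_isTight {u : ℕ → ℤ → ℝ} {W : ℝ}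
    {B : ℕ → ℕ} (hu : ∀ n, IsBandKernel (u n) W (B n))
    (hB : Tendsto (fun n : ℕ => (2 * (B n : ℝ) + 1) / √(n : ℝ)) atTop (𝓝 0))
    {x y : ℕ × Ω → ℤ → ℝ} (hx : IsTight P fun p => rms p.1 (x p))
    (hy : IsTight P fun p => √(p.1 : ℝ) * rms p.1 (y p)) :
    Tendsto (fun p => quadForm (u p.1) p.1 (x p) (y p)) (probFilter P) (𝓝 0) := by
  have h1 : Tendsto (fun n : ℕ => (2 * (B n : ℝ) + 1) / √(n : ℝ) * W) atTop (𝓝 0) := by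
    simpa using hB.mul_const W
  refine squeeze_zero_norm' ?_ ((hx.mul hy) _ h1)
  filter_upwards [tendsto_fst_probFilter.eventually_gt_atTop 0] with p hp
  refine (abs_quadForm_le_rms (hu p.1) p.1 (x p) (y p)).trans_eq ?_
  have : √(p.1 : ℝ) ≠ 0 := (Real.sqrt_pos.2 (by exact_mod_cast hp)).ne'
  field_simp

variable [IsProbabilityMeasure P] [IsProbabilityMeasure ν]

/-- A family of samples that approximates a feature with a step of height `D` at the break. -/
structure IsApproxFeature (P : Measure Ω) (g₁ g₂ : (ℕ → S) → L2) (e : ℤ → Ω → S) (τ : ℝ)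
    (q : L2 → ℝ) (D : ℝ) (a : ℕ × Ω → ℤ → ℝ) : Prop where
  quadratic : IsQuadratic q
  approx : ∃ c ρ : ℕ × Ω → ℝ, (IsTight P fun p => √(p.1 : ℝ) * ρ p) ∧
    ∀ᶠ p in probFilter P, ∀ i ∈ Finset.Icc (1 : ℤ) p.1,
      |a p i - c p - feature P g₁ g₂ e q ⌊τ * p.1⌋ i p.2 - (if i ≤ ⌊τ * p.1⌋ then D else 0)| ≤
        ρ p * (1 + ‖breakErr g₁ g₂ e ⌊τ * p.1⌋ i p.2‖ ^ 2)

theorem IsApproxFeature.isTight_remainder {τ : ℝ} (hτ : τ ∈ Set.Ioo (0 : ℝ) 1)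
    (he : IsIIDInnovation P ν e) (hg₁ : IsSegment P ν e g₁) (hg₂ : IsSegment P ν e g₂)
    {q : L2 → ℝ} {D : ℝ} {a : ℕ × Ω → ℤ → ℝ} (ha : IsApproxFeature P g₁ g₂ e τ q D a) :
    IsTight P fun p => √(p.1 : ℝ) * rms p.1 (fun i => center p.1 (a p) i -
      feature P g₁ g₂ e q ⌊τ * p.1⌋ i p.2 - D * stepSeq p.1 ⌊τ * p.1⌋ i) := by
  obtain ⟨c, ρ, hρ, happ⟩ := ha.approx
  have hv := isTight_average_weight he hg₁ hg₂ (fun n => ⌊τ * n⌋)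
  have hθ := isTight_sqrt_mul_norm_average he hg₁ hg₂ ha.quadratic (fun n => ⌊τ * n⌋)
    (m := fun n => n) (fun n => le_rfl)
  have h1 := ((isTight_const (P := P) 1).add (((hρ.mul hρ).mul hv).const_mul 6)).add
    ((hθ.mul hθ).const_mul 3)
  refine h1.mono ?_
  filter_upwards [happ, tendsto_fst_probFilter.eventually_gt_atTop 0] with p hp hn
  have h2 := rms_center_sub_sq_le hn (floor_mul_nonneg hτ p.1) (floor_mul_le hτ p.1) hp
  set r := rms p.1 (fun i => center p.1 (a p) i -
      feature P g₁ g₂ e q ⌊τ * p.1⌋ i p.2 - D * stepSeq p.1 ⌊τ * p.1⌋ i) with hr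
  have hr0 : 0 ≤ r := rms_nonneg _ _
  have hs := Real.sq_sqrt (p.1.cast_nonneg : (0 : ℝ) ≤ p.1)
  rw [abs_of_nonneg (by positivity)]
  refine le_trans ?_ (le_abs_self _)
  have h3 : √(p.1 : ℝ) * r ≤ 1 + (p.1 : ℝ) * r ^ 2 := by
    nlinarith [sq_nonneg (√(p.1 : ℝ) * r - 1)]
  have h4 := mul_le_mul_of_nonneg_left h2 (p.1.cast_nonneg : (0 : ℝ) ≤ p.1)
  have h5 : mean p.1 (fun i => feature P g₁ g₂ e q ⌊τ * p.1⌋ i p.2) ^ 2 =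
      ‖(p.1 : ℝ)⁻¹ • ∑ i ∈ Finset.Icc (1 : ℤ) p.1, feature P g₁ g₂ e q ⌊τ * p.1⌋ i p.2‖ ^ 2 := by
    rw [Real.norm_eq_abs, sq_abs]; rfl
  rw [h5] at h4
  set N := ‖(p.1 : ℝ)⁻¹ • ∑ i ∈ Finset.Icc (1 : ℤ) p.1, feature P g₁ g₂ e q ⌊τ * p.1⌋ i p.2‖
  refine (h3.trans (add_le_add_right h4 1)).trans_eq ?_
  have e1 : √(p.1 : ℝ) * ρ p * (√(p.1 : ℝ) * ρ p) = p.1 * ρ p ^ 2 := by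
    linear_combination ρ p ^ 2 * hs
  have e2 : √(p.1 : ℝ) * N * (√(p.1 : ℝ) * N) = p.1 * N ^ 2 := by
    linear_combination N ^ 2 * hs
  rw [e1, e2]
  ring

/-- The lag-window estimator of two approximate features: the step contributes a term that grows
with the bandwidth, and the rest converges to the long-run covariance. -/
theorem tendsto_lagWindow_sub {τ : ℝ} (hτ : τ ∈ Set.Ioo (0 : ℝ) 1)
    (he : IsIIDInnovation P ν e) (hg₁ : IsSegment P ν e g₁) (hg₂ : IsSegment P ν e g₂)
    {w : ℝ → ℝ} (hw : IsWeight w) {h : ℕ → ℝ} (hh : IsBandwidth h)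
    {q q' : L2 → ℝ} {D D' : ℝ} {a a' : ℕ × Ω → ℤ → ℝ} (ha : IsApproxFeature P g₁ g₂ e τ q D a)
    (ha' : IsApproxFeature P g₁ g₂ e τ q' D' a') :
    Tendsto (fun p : ℕ × Ω => lagWindow w (h p.1) p.1 (a p) (a' p) -
      quadForm (lagWeight w (h p.1)) p.1 (stepSeq p.1 ⌊τ * p.1⌋) (stepSeq p.1 ⌊τ * p.1⌋) * (D * D'))
      (probFilter P)
      (𝓝 (τ * ∑' l, lagCov P g₁ e q q' l + (1 - τ) * ∑' l, lagCov P g₂ e q q' l)) := by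
  obtain ⟨m, hm0, hm⟩ := hw.bounded_support
  obtain ⟨W, hW⟩ := hw.exists_bound
  set u : ℕ → ℤ → ℝ := fun n => lagWeight w (h n) with hu
  have huB : ∀ n, IsBandKernel (u n) W ⌈m * h n⌉₊ := fun n => isBandKernel_lagWeight hW hm (h n)
  have hB := tendsto_band_div_sqrt hh hm0
  have hB1 : Tendsto (fun n : ℕ => (2 * (⌈m * h n⌉₊ : ℝ) + 1) / n) atTop (𝓝 0) := by
    refine squeeze_zero (fun n => by positivity) (fun n => ?_) hB
    rcases Nat.eq_zero_or_pos n with rfl | hn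
    · simp
    gcongr
    rw [Real.sqrt_le_left (by positivity)]
    have : (1 : ℝ) ≤ n := by exact_mod_cast hn
    nlinarith
  set k : ℕ → ℤ := fun n => ⌊τ * n⌋ with hk
  set θ : ℕ × Ω → ℤ → ℝ := fun p i => feature P g₁ g₂ e q (k p.1) i p.2 with hθ
  set θ' : ℕ × Ω → ℤ → ℝ := fun p i => feature P g₁ g₂ e q' (k p.1) i p.2 with hθ'
  set s : ℕ → ℤ → ℝ := fun n => stepSeq n (k n) with hs
  set η : ℕ × Ω → ℤ → ℝ := fun p i => center p.1 (a p) i - θ p i - D * s p.1 i with hη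
  set η' : ℕ × Ω → ℤ → ℝ := fun p i => center p.1 (a' p) i - θ' p i - D' * s p.1 i with hη'
  have hs1 : ∀ n i, |s n i| ≤ 1 := fun n i =>
    abs_stepSeq_le (floor_mul_nonneg hτ n) (floor_mul_le hτ n) i
  have tη : IsTight P fun p => √(p.1 : ℝ) * rms p.1 (η p) := ha.isTight_remainder hτ he hg₁ hg₂
  have tη' : IsTight P fun p => √(p.1 : ℝ) * rms p.1 (η' p) := ha'.isTight_remainder hτ he hg₁ hg₂
  have tθ : IsTight P fun p => rms p.1 (θ p) := isTight_rms_feature he hg₁ hg₂ ha.quadratic k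
  have tθ' : IsTight P fun p => rms p.1 (θ' p) := isTight_rms_feature he hg₁ hg₂ ha'.quadratic k
  have ts : IsTight P fun p : ℕ × Ω => rms p.1 (s p.1) := (isTight_const 1).mono
    (.of_forall fun p => by
      rw [abs_of_nonneg (rms_nonneg _ _), abs_one]; exact rms_le_one (hs1 p.1))
  have tη0 : IsTight P fun p => rms p.1 (η p) := isTight_of_tendsto tη.tendsto_of_mul_sqrt
  have hsymm : ∀ n x y, quadForm (u n) n x y = quadForm (u n) n y x := fun n =>
    quadForm_comm (lagWeight_neg hw (h n)) n
  -- Expanding `(θ + D s + η)(θ' + D' s + η')` gives nine forms. The one of `s` with itself is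
  -- subtracted in the claim, `L1` is the noise, `L2` and `L3` pair noise with the step, and the
  -- others contain a remainder.
  have L1 : Tendsto (fun p => quadForm (u p.1) p.1 (θ p) (θ' p) -
      (τ * ∑' l, lagCov P g₁ e q q' l + (1 - τ) * ∑' l, lagCov P g₂ e q q' l)) (probFilter P) (𝓝 0) :=
    tendsto_probFilter_of_integral (Y := fun n ω => quadForm (u n) n
        (fun i => feature P g₁ g₂ e q (k n) i ω) (fun i => feature P g₁ g₂ e q' (k n) i ω) -
        (τ * ∑' l, lagCov P g₁ e q q' l + (1 - τ) * ∑' l, lagCov P g₂ e q q' l))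
      (fun n => (integrable_quadForm (u n) n (memLp_feature he hg₁ hg₂ ha.quadratic _)
        (memLp_feature he hg₁ hg₂ ha'.quadratic _)).sub (integrable_const _))
      (tendsto_integral_abs_quadForm_feature_sub hτ he hg₁ hg₂ ha.quadratic ha'.quadratic huB hB1
        (tendsto_lagWeight hw hh))
  have L2 : Tendsto (fun p => quadForm (u p.1) p.1 (θ p) (s p.1)) (probFilter P) (𝓝 0) :=
    tendsto_quadForm_feature_const he hg₁ hg₂ ha.quadratic k huB hB hs1
  have L3 : Tendsto (fun p => quadForm (u p.1) p.1 (θ' p) (s p.1)) (probFilter P) (𝓝 0) :=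
    tendsto_quadForm_feature_const he hg₁ hg₂ ha'.quadratic k huB hB hs1
  have L4 := tendsto_quadForm_of_isTight huB hB tθ tη'
  have L5 := tendsto_quadForm_of_isTight huB hB ts tη'
  have L6 := tendsto_quadForm_of_isTight huB hB tθ' tη
  have L7 := tendsto_quadForm_of_isTight huB hB ts tη
  have L8 := tendsto_quadForm_of_isTight huB hB tη0 tη'
  have L := ((((((((L1.add_const (τ * ∑' l, lagCov P g₁ e q q' l + (1 - τ) *
    ∑' l, lagCov P g₂ e q q' l)).add (L2.const_mul D')).add (L3.const_mul D)).add L4).add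
    (L5.const_mul D)).add L6).add (L7.const_mul D')).add L8)
  simp only [mul_zero, add_zero, zero_add] at L
  refine L.congr' ?_
  filter_upwards [(tendsto_fst_probFilter (P := P)).eventually
    (hh.tendsto_atTop.eventually_gt_atTop 0)] with p hp
  have e0 : (fun l : ℤ => w (l / h p.1)) = u p.1 := by
    ext l; simp only [hu, lagWeight, if_pos hp]
  have e1 : center p.1 (a p) = fun i => θ p i + D * s p.1 i + η p i := by
    ext i; simp only [hη]; ring
  have e2 : center p.1 (a' p) = fun i => θ' p i + D' * s p.1 i + η' p i := by
    ext i; simp only [hη']; ring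
  rw [lagWindow_eq_quadForm, e0, e1, e2]
  simp only [quadForm_add_left, quadForm_add_right, quadForm_mul_left, quadForm_mul_right]
  rw [hsymm p.1 (s p.1) (θ' p), hsymm p.1 (η p) (θ' p), hsymm p.1 (η p) (s p.1)]
  simp only [hu, hs, hk]
  ring

end Expansion

/-! ### Replacing the mean function by the sample mean. -/

section Residuals

variable {Ω S : Type*} {e : ℤ → Ω → S} {g₁ g₂ : (ℕ → S) → L2}

/-- The average of the errors of a sample with a break at `⌊τ n⌋`. -/
noncomputable def errMean (g₁ g₂ : (ℕ → S) → L2) (e : ℤ → Ω → S) (τ : ℝ) (p : ℕ × Ω) : L2 :=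
  (p.1 : ℝ)⁻¹ • ∑ i ∈ Finset.Icc (1 : ℤ) p.1, breakErr g₁ g₂ e ⌊τ * p.1⌋ i p.2

/-- The centered observations. -/
noncomputable def resid (g₁ g₂ : (ℕ → S) → L2) (e : ℤ → Ω → S) (τ : ℝ) (p : ℕ × Ω) (i : ℤ) : L2 :=
  breakErr g₁ g₂ e ⌊τ * p.1⌋ i p.2 - errMean g₁ g₂ e τ p

theorem obs_sub_sampleMean (μ : L2) (τ : ℝ) {p : ℕ × Ω} (hp : 0 < p.1) (i : ℤ) :
    obs μ g₁ g₂ e τ p.1 p.2 i - sampleMean (obs μ g₁ g₂ e τ p.1 p.2) p.1 =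
      resid g₁ g₂ e τ p i := by
  have h : ∀ i, obs μ g₁ g₂ e τ p.1 p.2 i = μ + breakErr g₁ g₂ e ⌊τ * p.1⌋ i p.2 := fun i => rfl
  have hn : (p.1 : ℝ) ≠ 0 := by exact_mod_cast hp.ne'
  rw [sampleMean]
  simp only [h]
  rw [Finset.sum_add_distrib, smul_add, Finset.sum_const, Int.card_Icc, add_sub_cancel_right,
    Int.toNat_natCast, ← Nat.cast_smul_eq_nsmul ℝ, smul_smul, inv_mul_cancel₀ hn, one_smul, resid,
    errMean]
  abel

variable {H : Type*} [NormedAddCommGroup H]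

theorem IsQuadratic.exists_norm_sub_le {q : L2 → H} (hq : IsQuadratic q) :
    ∃ K : ℝ, 0 ≤ K ∧ ∀ x y, ‖q (x - y) - q x‖ ≤ K * (‖y‖ * (2 + ‖y‖)) * (1 + ‖x‖ ^ 2) := by
  obtain ⟨K, hK, h⟩ := hq.lipschitz
  refine ⟨K, hK, fun x y => (h _ _).trans ?_⟩
  have h1 : ‖x - y - x‖ = ‖y‖ := by rw [sub_sub_cancel_left, norm_neg]
  have h2 : 1 + ‖x - y‖ + ‖x‖ ≤ (2 + ‖y‖) * (1 + ‖x‖ ^ 2) := by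
    have := norm_sub_le x y
    have h3 := norm_nonneg y
    nlinarith [sq_nonneg (‖x‖ - 1), mul_nonneg h3 (sq_nonneg ‖x‖)]
  rw [h1]
  calc _ ≤ K * ‖y‖ * ((2 + ‖y‖) * (1 + ‖x‖ ^ 2)) := by gcongr
    _ = _ := by ring

variable [MeasurableSpace Ω] [InnerProductSpace ℝ H] {P : Measure Ω}

/-- The expectation of a function of the errors of the regime at time `i`. -/
noncomputable def regimeMean (P : Measure Ω) (g₁ g₂ : (ℕ → S) → L2) (e : ℤ → Ω → S) (q : L2 → H)
    (k i : ℤ) : H :=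
  if i ≤ k then ∫ ω, q (shiftProcess g₁ e 0 ω) ∂P else ∫ ω, q (shiftProcess g₂ e 0 ω) ∂P

theorem feature_eq (q : L2 → H) (k i : ℤ) (ω : Ω) : feature P g₁ g₂ e q k i ω =
    q (breakErr g₁ g₂ e k i ω) - regimeMean P g₁ g₂ e q k i := by
  simp only [feature, centeredFeature, breakErr, regimeMean]
  split_ifs <;> rfl

variable [MeasurableSpace S] {ν : Measure S} [IsProbabilityMeasure ν] [IsProbabilityMeasure P]

theorem isTight_sqrt_mul_norm_errMean (he : IsIIDInnovation P ν e) (hg₁ : IsSegment P ν e g₁)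
    (hg₂ : IsSegment P ν e g₂) (τ : ℝ) :
    IsTight P fun p => √(p.1 : ℝ) * ‖errMean g₁ g₂ e τ p‖ := by
  have h := isTight_sqrt_mul_norm_average he hg₁ hg₂ isQuadratic_id (fun n => ⌊τ * n⌋)
    (m := fun n => n) fun n => le_rfl
  -- Both regimes are centered, so the identity feature is the error itself.
  have hf : ∀ (k i : ℤ) (ω : Ω), feature P g₁ g₂ e (fun x : L2 => x) k i ω =
      breakErr g₁ g₂ e k i ω := fun k i ω => by
    simp only [feature, centeredFeature, breakErr]
    rw [hg₁.centered, hg₂.centered, sub_zero, sub_zero]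
  simp only [hf] at h
  exact h

theorem isTight_norm_errMean (he : IsIIDInnovation P ν e) (hg₁ : IsSegment P ν e g₁)
    (hg₂ : IsSegment P ν e g₂) (τ : ℝ) : IsTight P fun p => ‖errMean g₁ g₂ e τ p‖ :=
  isTight_of_tendsto (isTight_sqrt_mul_norm_errMean he hg₁ hg₂ τ).tendsto_of_mul_sqrt

theorem isTight_sqrt_mul_error (he : IsIIDInnovation P ν e) (hg₁ : IsSegment P ν e g₁)
    (hg₂ : IsSegment P ν e g₂) (τ K : ℝ) : IsTight P fun p => √(p.1 : ℝ) *
      (K * (‖errMean g₁ g₂ e τ p‖ * (2 + ‖errMean g₁ g₂ e τ p‖))) := by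
  have h := ((isTight_sqrt_mul_norm_errMean he hg₁ hg₂ τ).mul
    ((isTight_const 2).add (isTight_norm_errMean he hg₁ hg₂ τ))).const_mul K
  refine h.mono (.of_forall fun p => le_of_eq ?_)
  congr 1
  ring

/-- The average splits into the one of the features and the effect of centering at the sample mean.
The latter is at most the norm of the mean error, of size `n^{-1/2}`, times a tight average of
weights. -/
theorem isTight_average_resid [CompleteSpace H] (he : IsIIDInnovation P ν e)
    (hg₁ : IsSegment P ν e g₁) (hg₂ : IsSegment P ν e g₂) (τ : ℝ) {q : L2 → H}
    (hq : IsQuadratic q) {m : ℕ → ℤ} (hm : ∀ n, m n ≤ n) :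
    IsTight P fun p => √(p.1 : ℝ) * ‖(p.1 : ℝ)⁻¹ • ∑ i ∈ Finset.Icc (1 : ℤ) (m p.1),
      (q (resid g₁ g₂ e τ p i) - regimeMean P g₁ g₂ e q ⌊τ * p.1⌋ i)‖ := by
  obtain ⟨K, hK, hq2⟩ := hq.exists_norm_sub_le
  have h := (isTight_sqrt_mul_norm_average he hg₁ hg₂ hq (fun n => ⌊τ * n⌋) hm).add
    ((isTight_sqrt_mul_error he hg₁ hg₂ τ K).mul
      (isTight_average_weight he hg₁ hg₂ fun n => ⌊τ * n⌋))
  refine h.mono (.of_forall fun p => ?_)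
  set y := errMean g₁ g₂ e τ p
  have h1 : ∀ i, q (resid g₁ g₂ e τ p i) - regimeMean P g₁ g₂ e q ⌊τ * p.1⌋ i =
      feature P g₁ g₂ e q ⌊τ * p.1⌋ i p.2 +
      (q (breakErr g₁ g₂ e ⌊τ * p.1⌋ i p.2 - y) - q (breakErr g₁ g₂ e ⌊τ * p.1⌋ i p.2)) :=
    fun i => by rw [feature_eq, resid]; abel
  rw [abs_of_nonneg (by positivity)]
  refine le_trans ?_ (le_abs_self _)
  simp only [h1]
  rw [Finset.sum_add_distrib, smul_add, mul_assoc, ← mul_add]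
  refine mul_le_mul_of_nonneg_left ((norm_add_le _ _).trans ?_) (Real.sqrt_nonneg _)
  gcongr
  rw [norm_smul, norm_inv, Real.norm_natCast, mul_left_comm]
  gcongr
  rw [Finset.mul_sum]
  refine (norm_sum_le _ _).trans ?_
  refine (Finset.sum_le_sum_of_subset_of_nonneg (Finset.Icc_subset_Icc_right (hm p.1))
    fun _ _ _ => norm_nonneg _).trans (Finset.sum_le_sum fun i _ => (hq2 _ _).trans ?_)
  gcongr
  exact le_self_pow₀ (by linarith [sq_nonneg ‖breakErr g₁ g₂ e ⌊τ * p.1⌋ i p.2‖]) two_ne_zero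

/-- The expectations of the features of the two regimes, averaged up to the break. -/
theorem isTight_average_resid_break [CompleteSpace H] (he : IsIIDInnovation P ν e)
    (hg₁ : IsSegment P ν e g₁) (hg₂ : IsSegment P ν e g₂) {τ : ℝ} (hτ : τ ∈ Set.Ioo (0 : ℝ) 1)
    {q : L2 → H} (hq : IsQuadratic q) :
    IsTight P fun p => √(p.1 : ℝ) * ‖(p.1 : ℝ)⁻¹ •
      ∑ i ∈ Finset.Icc (1 : ℤ) ⌊τ * p.1⌋, q (resid g₁ g₂ e τ p i) -
      (((⌊τ * p.1⌋ : ℤ) : ℝ) / p.1) • ∫ ω, q (shiftProcess g₁ e 0 ω) ∂P‖ := by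
  refine (isTight_average_resid he hg₁ hg₂ τ hq (m := fun n => ⌊τ * n⌋) (floor_mul_le hτ)).mono
    (.of_forall fun p => le_of_eq ?_)
  congr 3
  rw [Finset.sum_sub_distrib, smul_sub]
  congr 1
  have hr : ∀ i ∈ Finset.Icc (1 : ℤ) ⌊τ * p.1⌋, regimeMean P g₁ g₂ e q ⌊τ * p.1⌋ i =
      ∫ ω, q (shiftProcess g₁ e 0 ω) ∂P := fun i hi => if_pos (Finset.mem_Icc.1 hi).2
  rw [Finset.sum_congr rfl hr, Finset.sum_const, Int.card_Icc, add_sub_cancel_right, ← Nat.cast_smul_eq_nsmul ℝ, smul_smul]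
  have : ((⌊τ * p.1⌋.toNat : ℤ) : ℝ) = ⌊τ * p.1⌋ := by
    rw [Int.toNat_of_nonneg (floor_mul_nonneg hτ p.1)]
  rw [div_eq_inv_mul, ← this, Int.cast_natCast]

/-- Replacing `⌊τ n⌋ / n` by `τ` costs at most `1 / n`, which is harmless at the scale `√n`. -/
theorem isTight_average_resid_all [CompleteSpace H] (he : IsIIDInnovation P ν e)
    (hg₁ : IsSegment P ν e g₁) (hg₂ : IsSegment P ν e g₂) {τ : ℝ} (hτ : τ ∈ Set.Ioo (0 : ℝ) 1)
    {q : L2 → H} (hq : IsQuadratic q) :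
    IsTight P fun p => √(p.1 : ℝ) * ‖(p.1 : ℝ)⁻¹ •
      ∑ i ∈ Finset.Icc (1 : ℤ) p.1, q (resid g₁ g₂ e τ p i) -
      (τ • (∫ ω, q (shiftProcess g₁ e 0 ω) ∂P) +
        (1 - τ) • ∫ ω, q (shiftProcess g₂ e 0 ω) ∂P)‖ := by
  set E₁ := ∫ ω, q (shiftProcess g₁ e 0 ω) ∂P with hE₁
  set E₂ := ∫ ω, q (shiftProcess g₂ e 0 ω) ∂P with hE₂
  have h := (isTight_average_resid he hg₁ hg₂ τ hq (m := fun n => n) fun n => le_rfl).add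
    (isTight_const ‖E₁ - E₂‖)
  refine h.mono ?_
  filter_upwards [tendsto_fst_probFilter.eventually_gt_atTop 0] with p hp
  have hn : (1 : ℝ) ≤ p.1 := by exact_mod_cast hp
  set k := ⌊τ * p.1⌋ with hk
  have h1 : ∑ i ∈ Finset.Icc (1 : ℤ) p.1, regimeMean P g₁ g₂ e q k i =
      (p.1 : ℝ) • E₂ + (k : ℝ) • (E₁ - E₂) := by
    have h2 : ∀ i, regimeMean P g₁ g₂ e q k i = E₂ + (if i ≤ k then (1 : ℝ) else 0) • (E₁ - E₂) :=
      fun i => by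
        rw [regimeMean]; split_ifs
        · rw [one_smul, ← hE₁]; abel
        · rw [zero_smul, add_zero]
    rw [Finset.sum_congr rfl fun i _ => h2 i, Finset.sum_add_distrib, ← Finset.sum_smul,
      sum_Icc_ite_le p.1 (floor_mul_nonneg hτ p.1) (floor_mul_le hτ p.1), Finset.sum_const,
      Int.card_Icc, add_sub_cancel_right, Int.toNat_natCast, ← Nat.cast_smul_eq_nsmul ℝ]
    simp [hk]
  have h3 : (p.1 : ℝ)⁻¹ • ∑ i ∈ Finset.Icc (1 : ℤ) p.1, q (resid g₁ g₂ e τ p i) -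
      (τ • E₁ + (1 - τ) • E₂) = (p.1 : ℝ)⁻¹ • ∑ i ∈ Finset.Icc (1 : ℤ) p.1,
      (q (resid g₁ g₂ e τ p i) - regimeMean P g₁ g₂ e q k i) + ((k : ℝ) / p.1 - τ) • (E₁ - E₂) := by
    rw [Finset.sum_sub_distrib, h1, smul_sub, smul_add, smul_smul, smul_smul,
      inv_mul_cancel₀ (by linarith), div_eq_inv_mul]
    module
  rw [h3, abs_of_nonneg (by positivity)]
  refine le_trans ?_ (le_abs_self _)
  refine (mul_le_mul_of_nonneg_left (norm_add_le _ _) (Real.sqrt_nonneg _)).trans ?_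
  rw [mul_add]
  gcongr
  rw [norm_smul, ← mul_assoc]
  refine mul_le_of_le_one_left (norm_nonneg _) ?_
  have h4 : ‖(k : ℝ) / p.1 - τ‖ ≤ 1 / p.1 := by
    have e1 : (k : ℝ) / p.1 - τ = -((τ * p.1 - k) / p.1) := by field_simp; ring
    rw [e1, norm_neg, Real.norm_eq_abs, abs_of_nonneg (div_nonneg (by
      linarith [Int.floor_le (τ * p.1)]) (by linarith))]
    gcongr
    linarith [Int.lt_floor_add_one (τ * p.1)]
  refine (mul_le_mul_of_nonneg_left h4 (Real.sqrt_nonneg _)).trans ?_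
  rw [mul_one_div, div_le_one (by linarith), Real.sqrt_le_left (by linarith)]
  nlinarith

end Residuals

/-! ### Sample covariance operators and estimated scores. -/

section Operators

variable {Ω S : Type*} {e : ℤ → Ω → S} {g g₁ g₂ : (ℕ → S) → L2}

theorem partialCov_obs (μ : L2) (τ : ℝ) {p : ℕ × Ω} (hp : 0 < p.1) (u : ℝ) :
    partialCov (obs μ g₁ g₂ e τ p.1 p.2) p.1 u =
      (p.1 : ℝ)⁻¹ • ∑ i ∈ Finset.Icc (1 : ℤ) ⌊p.1 * u⌋, tensorSq (resid g₁ g₂ e τ p i) := by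
  simp only [partialCov, obs_sub_sampleMean μ τ hp]

variable [MeasurableSpace Ω] {P : Measure Ω}

/-- The regime means are a constant plus a step at the break; the constant is absorbed into `c`,
since the lag window centers its arguments. -/
theorem isApproxFeature_of_sub_le {q : L2 → ℝ} (hq : IsQuadratic q) {τ : ℝ} {a : ℕ × Ω → ℤ → ℝ}
    (c ρ : ℕ × Ω → ℝ) (hρ : IsTight P fun p => √(p.1 : ℝ) * ρ p)
    (h : ∀ᶠ p in probFilter P, ∀ i, |a p i - c p - q (breakErr g₁ g₂ e ⌊τ * p.1⌋ i p.2)| ≤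
      ρ p * (1 + ‖breakErr g₁ g₂ e ⌊τ * p.1⌋ i p.2‖ ^ 2)) :
    IsApproxFeature P g₁ g₂ e τ q
      (∫ ω, q (shiftProcess g₁ e 0 ω) ∂P - ∫ ω, q (shiftProcess g₂ e 0 ω) ∂P) a := by
  refine ⟨hq, fun p => c p + ∫ ω, q (shiftProcess g₂ e 0 ω) ∂P, ρ, hρ, ?_⟩
  filter_upwards [h] with p hp i _
  refine (le_of_eq ?_).trans (hp i)
  congr 1
  rw [feature_eq, regimeMean]
  split_ifs <;> ring

variable [MeasurableSpace S] {ν : Measure S}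

theorem inner_smul_apply (c : ℝ) (A : L2 →L[ℝ] L2) (f g : L2) :
    ⟪(c • A) f, g⟫ = c * ⟪A f, g⟫ := by
  rw [smul_apply, real_inner_smul_left]

theorem inner_integral_tensorSq_eq [IsProbabilityMeasure P] {X : Ω → L2} (hX : MemLp X 2 P)
    (f g : L2) :
    ⟪(∫ ω, tensorSq (X ω) ∂P) f, g⟫ = ⟪∫ ω, elemTensor (X ω) (X ω) ∂P, elemTensor f g⟫ := by
  have hi : Integrable (fun ω => elemTensor (X ω) (X ω)) P :=
    (MemLp.norm_sq_integrable hX).mono' (continuous_elemTensor_self.comp_aestronglyMeasurable hX.1)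
      (.of_forall fun _ => by rw [norm_elemTensor, sq])
  rw [inner_integral_tensorSq hX, real_inner_comm, ← integral_inner hi]
  refine integral_congr_ae (.of_forall fun ω => ?_)
  simp only
  rw [inner_elemTensor, real_inner_comm (X ω) f, real_inner_comm (X ω) g]

variable [IsProbabilityMeasure ν]

theorem IsSegment.covOp_eq (hg : IsSegment P ν e g) :
    covOp P (shiftProcess g e 0) = ∫ ω, tensorSq (shiftProcess g e 0 ω) ∂P :=
  SpectralBreak.covOp_eq hg.centered

variable [IsProbabilityMeasure P]

theorem IsSegment.memLp_shift_two (he : IsIIDInnovation P ν e) (hg : IsSegment P ν e g) (i : ℤ) :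
    MemLp (shiftProcess g e i) 2 P :=
  MemLp.mono_exponent (hg.memLp_shift he i) (by norm_num)

theorem IsSegment.isPosCompact_covOp (he : IsIIDInnovation P ν e) (hg : IsSegment P ν e g) :
    IsPosCompact (covOp P (shiftProcess g e 0)) := by
  rw [hg.covOp_eq]
  exact isPosCompact_integral_tensorSq (hg.memLp_shift_two he 0)

theorem IsSegment.opTrace_covOp (he : IsIIDInnovation P ν e) (hg : IsSegment P ν e g) :
    opTrace (covOp P (shiftProcess g e 0)) = ∫ ω, ‖(shiftProcess g e 0 ω)‖ ^ 2 ∂P := by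
  rw [hg.covOp_eq]
  exact opTrace_integral_tensorSq (hg.memLp_shift_two he 0)

theorem IsSegment.inner_covOp (he : IsIIDInnovation P ν e) (hg : IsSegment P ν e g) (φ : L2) :
    ⟪covOp P (shiftProcess g e 0) φ, φ⟫ = ∫ ω, ⟪(shiftProcess g e 0 ω), φ⟫ ^ 2 ∂P := by
  rw [hg.covOp_eq, inner_integral_tensorSq (hg.memLp_shift_two he 0)]
  simp_rw [sq]

theorem inner_average_tensorSq (c : ℝ) (s : Finset ℤ) (x : ℤ → L2) (f g : L2) :
    ⟪(c • ∑ i ∈ s, tensorSq (x i)) f, g⟫ =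
      ⟪c • ∑ i ∈ s, elemTensor (x i) (x i), elemTensor f g⟫ := by
  rw [smul_apply, sum_apply, real_inner_smul_left, real_inner_smul_left, sum_inner, sum_inner]
  simp only [inner_tensorSq]

theorem isTight_partialCov_one (he : IsIIDInnovation P ν e) (hg₁ : IsSegment P ν e g₁)
    (hg₂ : IsSegment P ν e g₂) {τ : ℝ} (hτ : τ ∈ Set.Ioo (0 : ℝ) 1) (μ : L2) :
    IsTight P fun p => √(p.1 : ℝ) * ‖partialCov (obs μ g₁ g₂ e τ p.1 p.2) p.1 1 -
      (τ • covOp P (shiftProcess g₁ e 0) + (1 - τ) • covOp P (shiftProcess g₂ e 0))‖ := by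
  refine (isTight_average_resid_all he hg₁ hg₂ hτ isQuadratic_elemTensor).mono ?_
  filter_upwards [tendsto_fst_probFilter.eventually_gt_atTop 0] with p hp
  rw [abs_of_nonneg (by positivity), abs_of_nonneg (by positivity)]
  refine mul_le_mul_of_nonneg_left (opNorm_le_of_inner_eq fun f g => ?_) (Real.sqrt_nonneg _)
  rw [partialCov_obs μ τ hp, mul_one, Int.floor_natCast, sub_apply, add_apply,
    inner_sub_left, inner_add_left, inner_smul_apply τ, inner_smul_apply (1 - τ), hg₁.covOp_eq, hg₂.covOp_eq, inner_average_tensorSq,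
    inner_integral_tensorSq_eq (hg₁.memLp_shift_two he 0),
    inner_integral_tensorSq_eq (hg₂.memLp_shift_two he 0), inner_sub_left, inner_add_left,
    real_inner_smul_left (r := τ), real_inner_smul_left (r := 1 - τ)]

theorem isTight_partialCov_break (he : IsIIDInnovation P ν e) (hg₁ : IsSegment P ν e g₁)
    (hg₂ : IsSegment P ν e g₂) {τ : ℝ} (hτ : τ ∈ Set.Ioo (0 : ℝ) 1) (μ : L2) :
    IsTight P fun p => √(p.1 : ℝ) * ‖partialCov (obs μ g₁ g₂ e τ p.1 p.2) p.1 τ -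
      (((⌊τ * p.1⌋ : ℤ) : ℝ) / p.1) • covOp P (shiftProcess g₁ e 0)‖ := by
  refine (isTight_average_resid_break he hg₁ hg₂ hτ isQuadratic_elemTensor).mono ?_
  filter_upwards [tendsto_fst_probFilter.eventually_gt_atTop 0] with p hp
  rw [abs_of_nonneg (by positivity), abs_of_nonneg (by positivity)]
  refine mul_le_mul_of_nonneg_left (opNorm_le_of_inner_eq fun f g => ?_) (Real.sqrt_nonneg _)
  rw [partialCov_obs μ τ hp, mul_comm (p.1 : ℝ) τ, sub_apply, inner_sub_left,
    inner_smul_apply (_ / _), hg₁.covOp_eq, inner_average_tensorSq,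
    inner_integral_tensorSq_eq (hg₁.memLp_shift_two he 0), inner_sub_left,
    real_inner_smul_left (r := _ / _)]

theorem isApproxFeature_norm_sq (he : IsIIDInnovation P ν e) (hg₁ : IsSegment P ν e g₁)
    (hg₂ : IsSegment P ν e g₂) (τ : ℝ) (μ : L2) :
    IsApproxFeature P g₁ g₂ e τ (fun x => ‖x‖ ^ 2)
      (opTrace (covOp P (shiftProcess g₁ e 0)) - opTrace (covOp P (shiftProcess g₂ e 0)))
      fun p i => ‖obs μ g₁ g₂ e τ p.1 p.2 i - sampleMean (obs μ g₁ g₂ e τ p.1 p.2) p.1‖ ^ 2 := by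
  rw [hg₁.opTrace_covOp he, hg₂.opTrace_covOp he]
  obtain ⟨K, hK, hq⟩ := isQuadratic_norm_sq.exists_norm_sub_le
  refine isApproxFeature_of_sub_le isQuadratic_norm_sq (fun _ => 0) _
    (isTight_sqrt_mul_error he hg₁ hg₂ τ K) ?_
  filter_upwards [tendsto_fst_probFilter.eventually_gt_atTop 0] with p hp i
  rw [obs_sub_sampleMean μ τ hp, sub_zero]
  exact hq _ _

/-- The estimated scores are close to the scores. -/
theorem isApproxFeature_thetaHat (he : IsIIDInnovation P ν e) (hg₁ : IsSegment P ν e g₁)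
    (hg₂ : IsSegment P ν e g₂) {τ : ℝ} (hτ : τ ∈ Set.Ioo (0 : ℝ) 1) (μ : L2)
    {c₁ c₂ : L2 →L[ℝ] L2} (hc₁ : c₁ = covOp P (shiftProcess g₁ e 0))
    (hc₂ : c₂ = covOp P (shiftProcess g₂ e 0)) {d : ℕ}
    (hgap₁ : ∀ j : Fin d, eigval c₁ (j + 1) < eigval c₁ j)
    (hgap₂ : ∀ j : Fin d, eigval c₂ (j + 1) < eigval c₂ j)
    (hE : ∀ j : Fin d, eigspace c₁ j = eigspace c₂ j) {φ : Fin d → L2}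
    (hφ : IsEigenfunctions (τ • c₁ + (1 - τ) • c₂) φ) {ψ : ℕ → Ω → Fin d → L2}
    (hψ : ∀ n ω, IsEigenfunctions (partialCov (obs μ g₁ g₂ e τ n ω) n 1) (ψ n ω)) (j : Fin d) :
    IsApproxFeature P g₁ g₂ e τ (fun x => ⟪x, φ j⟫ ^ 2) (eigval c₁ j - eigval c₂ j)
      fun p => thetaHat (obs μ g₁ g₂ e τ p.1 p.2) p.1 (ψ p.1 p.2) j := by
  have hp₁ : IsPosCompact c₁ := hc₁ ▸ hg₁.isPosCompact_covOp he
  have hp₂ : IsPosCompact c₂ := hc₂ ▸ hg₂.isPosCompact_covOp he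
  obtain ⟨e₁, e₂, b, hb, hgap⟩ := common_eigenfunctions hp₁ hp₂ hτ hgap₁ hgap₂ hE hφ j
  -- Because `φ j` is a common eigenfunction, the mean of the squared projection in each regime is
  -- the eigenvalue, so the step height is the eigenvalue difference.
  have hD : ∀ {c : L2 →L[ℝ] L2} {g}, IsSegment P ν e g → c = covOp P (shiftProcess g e 0) →
      c (φ j) = eigval c j • φ j → eigval c j = ∫ ω, ⟪(shiftProcess g e 0 ω), φ j⟫ ^ 2 ∂P :=
    fun {c g} hg hc he' => by
      rw [← hg.inner_covOp he, ← hc, he', real_inner_smul_left, real_inner_self_eq_norm_sq,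
        hφ.1.1 j]
      ring
  have hD₁ := hD hg₁ hc₁ e₁
  have hD₂ := hD hg₂ hc₂ e₂
  obtain ⟨K, hK, hq⟩ := (isQuadratic_inner_sq (φ j)).exists_norm_sub_le
  set R : ℕ × Ω → ℝ := fun p => ‖partialCov (obs μ g₁ g₂ e τ p.1 p.2) p.1 1 -
    (τ • c₁ + (1 - τ) • c₂)‖ with hR
  set y : ℕ × Ω → L2 := errMean g₁ g₂ e τ with hy
  have hRt : IsTight P fun p => √(p.1 : ℝ) * R p := by
    have := isTight_partialCov_one he hg₁ hg₂ hτ μ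
    rwa [← hc₁, ← hc₂] at this
  have hyt : IsTight P fun p => ‖y p‖ := isTight_norm_errMean he hg₁ hg₂ τ
  rw [hD₁, hD₂]
  refine isApproxFeature_of_sub_le (isQuadratic_inner_sq (φ j))
    -- The term from the full-sample covariance does not depend on `i`. In the error that follows,
    -- the first part comes from the sample mean and the second from using `ψ j` for `φ j`.
    (fun p => -pairing (partialCov (obs μ g₁ g₂ e τ p.1 p.2) p.1 1) (ψ p.1 p.2 j))
    (fun p => K * (‖y p‖ * (2 + ‖y p‖)) + 8 / b * R p * (2 * (1 + ‖y p‖ * ‖y p‖))) ?_ ?_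
  · refine ((isTight_sqrt_mul_error he hg₁ hg₂ τ K).add (((hRt.const_mul (8 / b)).mul
      (((isTight_const 1).add (hyt.mul hyt)).const_mul 2)))).mono
      (.of_forall fun p => le_of_eq ?_)
    congr 1
    ring
  filter_upwards [tendsto_fst_probFilter.eventually_gt_atTop 0] with p hp i
  have hA : IsPosCompact (partialCov (obs μ g₁ g₂ e τ p.1 p.2) p.1 1) := by
    rw [partialCov]
    exact (isPosCompact_sum _ fun i _ => isPosCompact_tensorSq _).smul (by positivity)
  have hc : IsPosCompact (τ • c₁ + (1 - τ) • c₂) :=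
    (hp₁.smul hτ.1.le).add (hp₂.smul (by linarith [hτ.2]))
  have h1 := abs_inner_sq_sub_le (hφ.1.1 j) ((hψ p.1 p.2).1.1 j) (hφ.2 j) hb hgap
    ((hψ p.1 p.2).2 j) (abs_eigval_sub_le hA hc j) (resid g₁ g₂ e τ p i)
  set ε := breakErr g₁ g₂ e ⌊τ * p.1⌋ i p.2 with hε
  have h2 := hq ε (y p)
  have h3 : thetaHat (obs μ g₁ g₂ e τ p.1 p.2) p.1 (ψ p.1 p.2) j i =
      ⟪resid g₁ g₂ e τ p i, ψ p.1 p.2 j⟫ ^ 2 -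
      pairing (partialCov (obs μ g₁ g₂ e τ p.1 p.2) p.1 1) (ψ p.1 p.2 j) := by
    rw [thetaHat, obs_sub_sampleMean μ τ hp, ← pairing_tensorSq, pairing, pairing, pairing,
      sub_apply, inner_sub_left]
  rw [h3, sub_neg_eq_add, sub_add_cancel]
  have h4 : resid g₁ g₂ e τ p i = ε - y p := rfl
  rw [h4] at h1 ⊢
  rw [Real.norm_eq_abs] at h2
  have h5 : ‖ε - y p‖ ^ 2 ≤ 2 * (1 + ‖y p‖ * ‖y p‖) * (1 + ‖ε‖ ^ 2) := by
    have h6 : ‖ε - y p‖ ^ 2 ≤ (‖ε‖ + ‖y p‖) ^ 2 := by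
      gcongr
      exact norm_sub_le _ _
    nlinarith [sq_nonneg (‖ε‖ - ‖y p‖), mul_nonneg (sq_nonneg ‖ε‖) (sq_nonneg ‖y p‖)]
  refine (abs_sub_le _ (⟪ε - y p, φ j⟫ ^ 2) _).trans ?_
  rw [add_mul, add_comm]
  refine add_le_add h2 (h1.trans ?_)
  rw [mul_assoc (8 / b * R p)]
  exact mul_le_mul_of_nonneg_left h5 (by positivity)

end Operators

/-! ### Positive definite matrices under rank-one perturbations. -/

section Matrices

variable {d : ℕ}

theorem dotProduct_mulVec_eq_sum (M : Matrix (Fin d) (Fin d) ℝ) (x y : Fin d → ℝ) :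
    x ⬝ᵥ (M *ᵥ y) = ∑ j, ∑ j', x j * y j' * M j j' := by
  simp only [dotProduct, Matrix.mulVec, Finset.mul_sum]
  exact Finset.sum_congr rfl fun j _ => Finset.sum_congr rfl fun j' _ => by ring

/-- Positive definiteness is stable under perturbations that are the sum of a positive semidefinite
matrix of rank one and a small matrix. -/
theorem exists_posDef_of_sub_le {M : Matrix (Fin d) (Fin d) ℝ} (hM : M.PosDef) :
    ∃ r : ℝ, 0 < r ∧ ∀ (N : Matrix (Fin d) (Fin d) ℝ) (c : ℝ) (D : Fin d → ℝ), N.IsHermitian →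
      0 ≤ c → (∑ j, ∑ j', |N j j' - c * (D j * D j') - M j j'| < r) → N.PosDef := by
  have hcont : Continuous fun x : Fin d → ℝ => x ⬝ᵥ (M *ᵥ x) := by
    simp only [dotProduct_mulVec_eq_sum]; fun_prop
  -- A positive lower bound of the form of `M` on the unit sphere of the supremum norm, where
  -- coordinates are at most `1` and entrywise errors add up directly. It does not depend on `c` or
  -- `D`, so `c` may diverge.
  obtain ⟨r, hr, hmin⟩ := (isCompact_sphere (0 : Fin d → ℝ) 1).exists_forall_le' (a := (0 : ℝ))
    hcont.continuousOn fun x hx => by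
      simpa using hM.dotProduct_mulVec_pos (ne_zero_of_mem_unit_sphere ⟨x, hx⟩)
  refine ⟨r, hr, fun N c D hN hc hlt => Matrix.PosDef.of_dotProduct_mulVec_pos hN fun x hx => ?_⟩
  rw [star_trivial]
  have key : ∀ y : Fin d → ℝ, ‖y‖ = 1 → 0 < y ⬝ᵥ (N *ᵥ y) := fun y hy => by
    have h1 := hmin y (by simpa using hy)
    have hyj : ∀ j, |y j| ≤ 1 := fun j => hy ▸ norm_le_pi_norm y j
    have h2 : y ⬝ᵥ (N *ᵥ y) = y ⬝ᵥ (M *ᵥ y) + c * (∑ j, y j * D j) ^ 2 +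
        ∑ j, ∑ j', y j * y j' * (N j j' - c * (D j * D j') - M j j') := by
      rw [sq, Finset.sum_mul_sum, dotProduct_mulVec_eq_sum, dotProduct_mulVec_eq_sum,
        Finset.mul_sum, ← Finset.sum_add_distrib, ← Finset.sum_add_distrib]
      refine Finset.sum_congr rfl fun j _ => ?_
      rw [Finset.mul_sum, ← Finset.sum_add_distrib, ← Finset.sum_add_distrib]
      exact Finset.sum_congr rfl fun j' _ => by ring
    have h3 : |∑ j, ∑ j', y j * y j' * (N j j' - c * (D j * D j') - M j j')| < r := by
      refine lt_of_le_of_lt ((Finset.abs_sum_le_sum_abs _ _).trans (Finset.sum_le_sum fun j _ =>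
        (Finset.abs_sum_le_sum_abs _ _).trans (Finset.sum_le_sum fun j' _ => ?_))) hlt
      rw [abs_mul, abs_mul]
      exact mul_le_of_le_one_left (abs_nonneg _)
        (mul_le_one₀ (hyj j) (abs_nonneg _) (hyj j'))
    have h4 := mul_nonneg hc (sq_nonneg (∑ j, y j * D j))
    rw [h2]
    linarith [(abs_lt.1 h3).1]
  have hx' : ‖x‖ ≠ 0 := norm_ne_zero_iff.2 hx
  have h1 := key (‖x‖⁻¹ • x) (by rw [norm_smul, norm_inv, norm_norm, inv_mul_cancel₀ hx'])
  rw [Matrix.mulVec_smul, smul_dotProduct, dotProduct_smul, smul_eq_mul, smul_eq_mul] at h1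
  have h2 : 0 < ‖x‖⁻¹ := inv_pos.2 (norm_pos_iff.2 hx)
  exact (mul_pos_iff_of_pos_left h2).1 ((mul_pos_iff_of_pos_left h2).1 h1)

/-- Cauchy-Schwarz for the inner product of `N`, applied to `N⁻¹ x` and `D`. It bounds the form of
the inverse from below without computing the inverse of a diverging matrix. -/
theorem sq_dotProduct_le_of_posDef {N : Matrix (Fin d) (Fin d) ℝ} (hN : N.PosDef)
    (x D : Fin d → ℝ) : (x ⬝ᵥ D) ^ 2 ≤ (x ⬝ᵥ (N⁻¹ *ᵥ x)) * (D ⬝ᵥ (N *ᵥ D)) := by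
  set y := N⁻¹ *ᵥ x with hy
  have hdet : IsUnit N.det := (Matrix.isUnit_iff_isUnit_det N).1 hN.isUnit
  have hx : x = N *ᵥ y := by
    rw [hy, Matrix.mulVec_mulVec, Matrix.mul_nonsing_inv _ hdet, Matrix.one_mulVec]
  have hsymm : ∀ a b : Fin d → ℝ, a ⬝ᵥ (N *ᵥ b) = b ⬝ᵥ (N *ᵥ a) := fun a b => by
    rw [Matrix.dotProduct_mulVec, ← Matrix.mulVec_transpose, dotProduct_comm]
    have : Nᵀ = N := by simpa [Matrix.IsHermitian] using hN.1
    rw [this]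
  have h0 : ∀ a : Fin d → ℝ, 0 ≤ a ⬝ᵥ (N *ᵥ a) := fun a => by
    simpa using hN.posSemidef.dotProduct_mulVec_nonneg a
  have h1 : ∀ t : ℝ, 0 ≤ (D ⬝ᵥ (N *ᵥ D)) * (t * t) + 2 * (y ⬝ᵥ (N *ᵥ D)) * t + y ⬝ᵥ (N *ᵥ y) :=
    fun t => by
      have := h0 (y + t • D)
      rw [Matrix.mulVec_add, Matrix.mulVec_smul, add_dotProduct, dotProduct_add, dotProduct_add,
        smul_dotProduct, smul_dotProduct, dotProduct_smul, dotProduct_smul, hsymm D y] at this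
      simp only [smul_eq_mul] at this
      linarith
  have h2 := discrim_le_zero h1
  rw [discrim] at h2
  have h3 : x ⬝ᵥ D = y ⬝ᵥ (N *ᵥ D) := by rw [hx, dotProduct_comm, hsymm]
  have h4 : x ⬝ᵥ y = y ⬝ᵥ (N *ᵥ y) := by rw [hx, dotProduct_comm]
  rw [h3, h4]
  nlinarith

end Matrices

/-! ### Long-run covariance matrices of the scores. -/

section LongRun

variable {Ω S : Type*} [MeasurableSpace Ω] [MeasurableSpace S] {P : Measure Ω} {ν : Measure S}
  {e : ℤ → Ω → S} {g : (ℕ → S) → L2} [IsProbabilityMeasure P] [IsProbabilityMeasure ν] {d : ℕ}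

theorem integral_centeredFeature (he : IsIIDInnovation P ν e) (hg : IsSegment P ν e g)
    {q : L2 → ℝ} (hq : IsQuadratic q) (i : ℤ) : ∫ ω, centeredFeature P g e q i ω ∂P = 0 := by
  have hm := hq.continuous.comp_stronglyMeasurable hg.measurable
  have h0 : ∀ i, ∫ ω, centeredFeature P g e q i ω ∂P =
      ∫ x, (q (g x) - ∫ ω', q (shiftProcess g e 0 ω') ∂P) ∂(Measure.infinitePi fun _ : ℕ => ν) :=
    fun i => integral_past_eq he
      (U := fun x => q (g x) - ∫ ω', q (shiftProcess g e 0 ω') ∂P) (hm.sub stronglyMeasurable_const) i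
  rw [h0 i, ← h0 0]
  have hi : Integrable (fun ω => q (shiftProcess g e 0 ω)) P := by
    have h1 : MemLp (feature P g g e q 0 0) 2 P := memLp_feature he hg hg hq 0 0
    have h2 : Integrable (feature P g g e q 0 0) P := h1.integrable (by norm_num)
    have h3 := h2.add (integrable_const (∫ ω', q (shiftProcess g e 0 ω') ∂P))
    refine h3.congr (.of_forall fun ω => ?_)
    simp [feature, centeredFeature]
  simp only [centeredFeature]
  rw [integral_sub hi (integrable_const _)]
  simp

theorem theta_eq (he : IsIIDInnovation P ν e) (hg : IsSegment P ν e g) (φ : Fin d → L2) (i : ℤ)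
    (j : Fin d) : theta P (shiftProcess g e) φ i j =
      centeredFeature P g e (fun x => ⟪x, φ j⟫ ^ 2) i := by
  ext ω
  have h0 : ∀ i, ∫ ω, ⟪(shiftProcess g e i ω), φ j⟫ ^ 2 ∂P =
      ∫ x, ⟪g x, φ j⟫ ^ 2 ∂(Measure.infinitePi fun _ : ℕ => ν) := fun i =>
    integral_past_eq he (U := fun x => ⟪g x, φ j⟫ ^ 2)
      ((isQuadratic_inner_sq (φ j)).continuous.comp_stronglyMeasurable hg.measurable) i
  have h1 : pairing (∫ ω', tensorSq (shiftProcess g e i ω') ∂P) (φ j) =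
      ∫ ω', ⟪(shiftProcess g e i ω'), φ j⟫ ^ 2 ∂P := by
    rw [pairing, inner_integral_tensorSq (hg.memLp_shift_two he i)]
    simp_rw [sq]
  rw [theta, centeredFeature, h0 0, ← h0 i, ← h1, ← pairing_tensorSq, pairing, pairing, pairing,
    sub_apply, inner_sub_left]

theorem longRunCov_apply (he : IsIIDInnovation P ν e) (hg : IsSegment P ν e g) (φ : Fin d → L2)
    (j j' : Fin d) : longRunCov P (shiftProcess g e) φ j j' =
      ∑' l, lagCov P g e (fun x => ⟪x, φ j⟫ ^ 2) (fun x => ⟪x, φ j'⟫ ^ 2) l := by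
  simp only [longRunCov, Matrix.of_apply]
  refine tsum_congr fun l => ?_
  rw [theta_eq he hg, theta_eq he hg, covariance,
    integral_centeredFeature he hg (isQuadratic_inner_sq _),
    integral_centeredFeature he hg (isQuadratic_inner_sq _), lagCov]
  simp only [sub_zero]

/-- The matrix is symmetric by reflection of the lag and positive semidefinite as a limit of
normalized second moments of sums; invertibility makes it definite. -/
theorem posDef_longRunCov (he : IsIIDInnovation P ν e) (hg : IsSegment P ν e g) (φ : Fin d → L2)
    (hu : IsUnit (longRunCov P (shiftProcess g e) φ)) :
    (longRunCov P (shiftProcess g e) φ).PosDef := by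
  have hs : (longRunCov P (shiftProcess g e) φ).PosSemidef := by
    refine Matrix.posSemidef_iff_dotProduct_mulVec.2 ⟨?_, fun x => ?_⟩
    · ext j j'
      rw [Matrix.conjTranspose_apply, star_trivial, longRunCov_apply he hg, longRunCov_apply he hg,
        ← (Equiv.neg ℤ).tsum_eq]
      exact tsum_congr fun l => lagCov_symm he hg (isQuadratic_inner_sq _) (isQuadratic_inner_sq _) l
    · rw [star_trivial, dotProduct_mulVec_eq_sum]
      simp only [longRunCov_apply he hg]
      exact tsum_lagCov_nonneg he hg Finset.univ x (fun j => isQuadratic_inner_sq (φ j))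
  exact (Matrix.PosSemidef.posDef_iff_isUnit hs).2 hu

end LongRun

/-! ### Bounding the statistics below by their value at the break. -/

section Suprema

/-- Through `⌊n u⌋` the function takes finitely many values on `[δ, 1]`, so the supremum is bounded.
This must be shown because an unbounded supremum would be `0` by default. -/
theorem le_iSup_of_floor {f : ℝ → ℝ} {n : ℕ} {δ τ : ℝ} (hδ : 0 ≤ δ) (hτ : τ ∈ Set.Icc δ 1)
    (hf : ∀ u v : ℝ, ⌊n * u⌋ = ⌊n * v⌋ → f u = f v) : f τ ≤ ⨆ u : Set.Icc δ 1, f u := by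
  have hfac : Function.FactorsThrough (fun u : Set.Icc δ 1 => f u)
      (fun u : Set.Icc δ 1 => ⌊n * (u : ℝ)⌋) := fun u v h => hf u v h
  obtain ⟨F, hF⟩ := (Function.factorsThrough_iff _).1 hfac
  have hbdd : BddAbove (Set.range fun u : Set.Icc δ 1 => f u) := by
    refine (((Set.finite_Icc (0 : ℤ) n).image F).subset ?_).bddAbove
    rw [hF]
    rintro _ ⟨u, rfl⟩
    refine ⟨⌊n * (u : ℝ)⌋, ⟨Int.floor_nonneg.2 (mul_nonneg n.cast_nonneg (hδ.trans u.2.1)), ?_⟩, rfl⟩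
    have : (n : ℝ) * u ≤ n := mul_le_of_le_one_right n.cast_nonneg u.2.2
    exact_mod_cast Int.floor_le_iff.2 (by push_cast; linarith)
  exact le_ciSup hbdd ⟨τ, hτ⟩

theorem kappa_congr {d : ℕ} (x : ℤ → L2) (n : ℕ) {u v : ℝ} (h : ⌊n * u⌋ = ⌊n * v⌋) :
    kappa d x n u = kappa d x n v := by
  ext j
  simp only [kappa, partialCov, h]

theorem le_statJ {d : ℕ} (w : ℝ → ℝ) (h : ℝ) {δ τ : ℝ} (hδ : 0 ≤ δ) (hτ : τ ∈ Set.Icc δ 1)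
    (x : ℤ → L2) (n : ℕ) (φ : Fin d → L2) :
    kappa d x n τ ⬝ᵥ ((sigmaHat w h x n φ)⁻¹ *ᵥ kappa d x n τ) ≤ statJ w h δ x n φ :=
  le_iSup_of_floor (n := n)
    (f := fun u => kappa d x n u ⬝ᵥ ((sigmaHat w h x n φ)⁻¹ *ᵥ kappa d x n u)) hδ hτ
    fun u v huv => by simp only [kappa_congr x n huv]

theorem le_statI {d : ℕ} (w : ℝ → ℝ) (h : ℝ) {δ τ : ℝ} (hδ : 0 ≤ δ) (hτ : τ ∈ Set.Icc δ 1)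
    (x : ℤ → L2) (n : ℕ) (φ : Fin d → L2) (j : Fin d) :
    (√(sigmaHat w h x n φ j j))⁻¹ * |kappa d x n τ j| ≤ statI w h δ x n φ j :=
  le_iSup_of_floor (n := n) (f := fun u => (√(sigmaHat w h x n φ j j))⁻¹ * |kappa d x n u j|) hδ hτ
    fun u v huv => by simp only [kappa_congr x n huv]

theorem partialTrace_nonneg (x : ℤ → L2) (n : ℕ) (u : ℝ) : 0 ≤ partialTrace x n u :=
  mul_nonneg (by positivity) (Finset.sum_nonneg fun i _ => by positivity)

theorem partialTrace_le (x : ℤ → L2) (n : ℕ) {u : ℝ} (hu : u ≤ 1) :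
    partialTrace x n u ≤ partialTrace x n 1 := by
  refine mul_le_mul_of_nonneg_left (Finset.sum_le_sum_of_subset_of_nonneg
    (Finset.Icc_subset_Icc_right ?_) fun i _ _ => by positivity) (by positivity)
  gcongr

theorem le_statM (w : ℝ → ℝ) (h : ℝ) {τ : ℝ} (hτ : τ ∈ Set.Icc (0 : ℝ) 1) (x : ℤ → L2) (n : ℕ) :
    √(n : ℝ) / √(sigmaHatTrace w h x n) * |partialTrace x n τ - τ * partialTrace x n 1| ≤
      statM w h x n := by
  refine le_ciSup (f := fun u : Set.Icc (0 : ℝ) 1 => √(n : ℝ) / √(sigmaHatTrace w h x n) *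
    |partialTrace x n u - u * partialTrace x n 1|) ?_ ⟨τ, hτ⟩
  -- Here `u` also enters outside the floor, so finiteness of values fails; monotonicity of the
  -- partial trace gives the bound instead.
  refine ⟨√(n : ℝ) / √(sigmaHatTrace w h x n) * partialTrace x n 1, ?_⟩
  rintro _ ⟨u, rfl⟩
  refine mul_le_mul_of_nonneg_left ?_ (by positivity)
  have h1 := partialTrace_le x n u.2.2
  have h2 := partialTrace_nonneg x n u
  have h3 := partialTrace_nonneg x n 1
  have h4 := mul_nonneg u.2.1 h3
  have h5 := mul_le_of_le_one_left h3 u.2.2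
  rw [abs_le]
  constructor <;> linarith

end Suprema

/-! ### The step contribution lies strictly between order `1` and order `n`. -/

section Divergence

variable {Ω : Type*} [MeasurableSpace Ω] {P : Measure Ω}

/-- The contribution of the step to the lag-window estimator. -/
noncomputable def stepForm (w : ℝ → ℝ) (h : ℕ → ℝ) (τ : ℝ) (n : ℕ) : ℝ :=
  quadForm (lagWeight w (h n)) n (stepSeq n ⌊τ * n⌋) (stepSeq n ⌊τ * n⌋)

theorem tendsto_stepForm_div {w : ℝ → ℝ} (hw : IsWeight w) {h : ℕ → ℝ} (hh : IsBandwidth h) {τ : ℝ}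
    (hτ : τ ∈ Set.Ioo (0 : ℝ) 1) :
    Tendsto (fun n : ℕ => stepForm w h τ n / n) atTop (𝓝 0) := by
  obtain ⟨m, hm0, hm⟩ := hw.bounded_support
  obtain ⟨W, hW⟩ := hw.exists_bound
  have huB : ∀ n, IsBandKernel (lagWeight w (h n)) W ⌈m * h n⌉₊ := fun n =>
    isBandKernel_lagWeight hW hm (h n)
  have hW0 := (huB 0).nonneg
  have hB := (tendsto_band_div_sqrt hh hm0).mul_const W
  rw [zero_mul] at hB
  refine squeeze_zero_norm' ?_ hB
  filter_upwards [eventually_gt_atTop 0] with n hn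
  have hn' : (1 : ℝ) ≤ n := by exact_mod_cast hn
  have h1 := abs_quadForm_le_rms (huB n) n (stepSeq n ⌊τ * n⌋) (stepSeq n ⌊τ * n⌋)
  have h2 : rms n (stepSeq n ⌊τ * n⌋) ≤ 1 :=
    rms_le_one (abs_stepSeq_le (floor_mul_nonneg hτ n) (floor_mul_le hτ n))
  have h3 := rms_nonneg n (stepSeq n ⌊τ * n⌋)
  have h4 : √(n : ℝ) ≤ n := by
    rw [Real.sqrt_le_left (by linarith)]
    nlinarith
  rw [Real.norm_eq_abs, abs_div, abs_of_pos (by linarith : (0 : ℝ) < n), div_mul_eq_mul_div]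
  have h5 : 0 < √(n : ℝ) := Real.sqrt_pos.2 (by linarith)
  gcongr
  exact h1.trans (mul_le_of_le_one_right (by positivity) (mul_le_one₀ h2 h3 h2))

/-- A random sequence that follows the step contribution is positive and of smaller order than the
sample size. -/
theorem tendsto_div_of_sub_stepForm {w : ℝ → ℝ} (hw : IsWeight w) {h : ℕ → ℝ} (hh : IsBandwidth h)
    {τ : ℝ} (hτ : τ ∈ Set.Ioo (0 : ℝ) 1) {σ : ℕ × Ω → ℝ} {c L : ℝ} (hc : 0 < c)
    (hσ : Tendsto (fun p => σ p - stepForm w h τ p.1 * c) (probFilter P) (𝓝 L)) :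
    (∀ᶠ p in probFilter P, 0 < σ p) ∧
      Tendsto (fun p => (p.1 : ℝ) / σ p) (probFilter P) atTop := by
  have h1 : Tendsto (fun p : ℕ × Ω => stepForm w h τ p.1 * c) (probFilter P) atTop :=
    ((tendsto_quadForm_stepSeq hw hh hτ).comp tendsto_fst_probFilter).atTop_mul_const hc
  have h2 : Tendsto σ (probFilter P) atTop := by
    have := hσ.add_atTop h1
    simpa using this
  have hpos := h2.eventually_gt_atTop 0
  refine ⟨hpos, ?_⟩
  have hn : Tendsto (fun p : ℕ × Ω => (p.1 : ℝ)) (probFilter P) atTop :=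
    tendsto_natCast_atTop_atTop.comp tendsto_fst_probFilter
  have h3 := (hσ.div_atTop hn).add
    (((tendsto_stepForm_div hw hh hτ).comp (tendsto_fst_probFilter (P := P))).mul_const c)
  have h4 : Tendsto (fun p => σ p / p.1) (probFilter P) (𝓝[>] 0) := by
    refine tendsto_nhdsWithin_iff.2 ⟨?_, ?_⟩
    · rw [zero_mul, add_zero] at h3
      refine h3.congr fun p => ?_
      rw [Function.comp_apply]
      ring
    · filter_upwards [hpos, tendsto_fst_probFilter.eventually_gt_atTop 0] with p hp hp0
      exact div_pos hp (by exact_mod_cast hp0)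
  exact h4.inv_tendsto_nhdsGT_zero.congr fun p => inv_div _ _

end Divergence

/-! ### Divergence of the three statistics. -/

section Main

variable {Ω S : Type*} [MeasurableSpace Ω] [MeasurableSpace S] {P : Measure Ω} {ν : Measure S}
  {e : ℤ → Ω → S} {g₁ g₂ : (ℕ → S) → L2} [IsProbabilityMeasure P] [IsProbabilityMeasure ν]

/-- The trace statistic diverges if the traces of the covariance operators differ. -/
theorem tendsto_statM (he : IsIIDInnovation P ν e) (hg₁ : IsSegment P ν e g₁)
    (hg₂ : IsSegment P ν e g₂) {τ : ℝ} (hτ : τ ∈ Set.Ioo (0 : ℝ) 1) (μ : L2)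
    {w : ℝ → ℝ} (hw : IsWeight w) {h : ℕ → ℝ} (hh : IsBandwidth h)
    (hD : opTrace (covOp P (shiftProcess g₁ e 0)) ≠ opTrace (covOp P (shiftProcess g₂ e 0))) :
    Tendsto (fun p => statM w (h p.1) (obs μ g₁ g₂ e τ p.1 p.2) p.1) (probFilter P) atTop := by
  have ha := isApproxFeature_norm_sq he hg₁ hg₂ τ μ
  set t₁ := opTrace (covOp P (shiftProcess g₁ e 0)) with ht₁
  set t₂ := opTrace (covOp P (shiftProcess g₂ e 0)) with ht₂
  have hD' : 0 < (t₁ - t₂) * (t₁ - t₂) := mul_self_pos.2 (sub_ne_zero.2 hD)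
  obtain ⟨hpos, hσ⟩ := tendsto_div_of_sub_stepForm hw hh hτ hD'
    (tendsto_lagWindow_sub hτ he hg₁ hg₂ hw hh ha ha)
  have L1 := tendsto_iff_norm_sub_tendsto_zero.2
    (isTight_average_resid_all he hg₁ hg₂ hτ isQuadratic_norm_sq).tendsto_of_mul_sqrt
  have hk : Tendsto (fun p : ℕ × Ω => ((⌊τ * p.1⌋ : ℤ) : ℝ) / p.1) (probFilter P) (𝓝 τ) :=
    (tendsto_floor_mul_div τ).comp tendsto_fst_probFilter
  have L2 := (tendsto_zero_iff_norm_tendsto_zero.2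
    (isTight_average_resid_break he hg₁ hg₂ hτ isQuadratic_norm_sq).tendsto_of_mul_sqrt).add
    (hk.smul_const (∫ ω, ‖(shiftProcess g₁ e 0 ω)‖ ^ 2 ∂P))
  simp only [sub_add_cancel, zero_add] at L2
  rw [← hg₁.opTrace_covOp he, ← ht₁] at L1 L2
  rw [← hg₂.opTrace_covOp he, ← ht₂] at L1
  have L3 := (L2.sub (L1.const_mul τ)).abs
  have hlim : 0 < |τ • t₁ - τ * (τ • t₁ + (1 - τ) • t₂)| := by
    have e1 : τ • t₁ - τ * (τ • t₁ + (1 - τ) • t₂) = τ * (1 - τ) * (t₁ - t₂) := by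
      simp only [smul_eq_mul]; ring
    rw [e1]
    exact abs_pos.2 (mul_ne_zero (mul_ne_zero hτ.1.ne' (sub_pos.2 hτ.2).ne') (sub_ne_zero.2 hD))
  refine tendsto_atTop_mono' _ ?_
    ((Real.tendsto_sqrt_atTop.comp hσ).atTop_mul_pos hlim L3)
  filter_upwards [tendsto_fst_probFilter.eventually_gt_atTop 0] with p hp
  refine le_trans (le_of_eq ?_) (le_statM w (h p.1) ⟨hτ.1.le, hτ.2.le⟩ _ p.1)
  simp only [Function.comp_apply]
  rw [Real.sqrt_div p.1.cast_nonneg]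
  simp only [sigmaHatTrace, partialTrace, obs_sub_sampleMean μ τ hp, smul_eq_mul, mul_one,
    Int.floor_natCast, mul_comm (p.1 : ℝ) τ]

variable {c₁ c₂ : L2 →L[ℝ] L2} {d : ℕ} {φ : Fin d → L2}

theorem isPosCompact_partialCov (x : ℤ → L2) (n : ℕ) (u : ℝ) : IsPosCompact (partialCov x n u) := by
  rw [partialCov]
  exact (isPosCompact_sum _ fun i _ => isPosCompact_tensorSq _).smul (by positivity)

/-- The CUSUM of the eigenvalues at the break. -/
theorem tendsto_kappa_div (he : IsIIDInnovation P ν e) (hg₁ : IsSegment P ν e g₁)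
    (hg₂ : IsSegment P ν e g₂) {τ : ℝ} (hτ : τ ∈ Set.Ioo (0 : ℝ) 1) (μ : L2)
    (hc₁ : c₁ = covOp P (shiftProcess g₁ e 0)) (hc₂ : c₂ = covOp P (shiftProcess g₂ e 0))
    (hgap₁ : ∀ j : Fin d, eigval c₁ (j + 1) < eigval c₁ j)
    (hgap₂ : ∀ j : Fin d, eigval c₂ (j + 1) < eigval c₂ j)
    (hE : ∀ j : Fin d, eigspace c₁ j = eigspace c₂ j)
    (hφ : IsEigenfunctions (τ • c₁ + (1 - τ) • c₂) φ) (j : Fin d) :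
    Tendsto (fun p => kappa d (obs μ g₁ g₂ e τ p.1 p.2) p.1 τ j / √(p.1 : ℝ)) (probFilter P)
      (𝓝 (τ * (1 - τ) * (eigval c₁ j - eigval c₂ j))) := by
  have hp₁ : IsPosCompact c₁ := hc₁ ▸ hg₁.isPosCompact_covOp he
  have hp₂ : IsPosCompact c₂ := hc₂ ▸ hg₂.isPosCompact_covOp he
  have hτ' : 0 < 1 - τ := sub_pos.2 hτ.2
  have hc : IsPosCompact (τ • c₁ + (1 - τ) • c₂) := (hp₁.smul hτ.1.le).add (hp₂.smul hτ'.le)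
  obtain ⟨e₁, e₂, -⟩ := common_eigenfunctions hp₁ hp₂ hτ hgap₁ hgap₂ hE hφ j
  -- Pairing the eigenvalue equation with the common eigenfunction shows that here the eigenvalue of
  -- the mixture is the mixture of the eigenvalues.
  have hstar : eigval (τ • c₁ + (1 - τ) • c₂) j = τ * eigval c₁ j + (1 - τ) * eigval c₂ j := by
    have h1 : ⟪(τ • c₁ + (1 - τ) • c₂) (φ j), φ j⟫ =
        eigval (τ • c₁ + (1 - τ) • c₂) j * ⟪φ j, φ j⟫ := by
      rw [hφ.2 j, real_inner_smul_left]
    rw [add_apply, inner_add_left, inner_smul_apply, inner_smul_apply, e₁, e₂,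
      real_inner_smul_left, real_inner_smul_left, real_inner_self_eq_norm_sq, hφ.1.1 j] at h1
    linarith
  have hk : Tendsto (fun p : ℕ × Ω => ((⌊τ * p.1⌋ : ℤ) : ℝ) / p.1) (probFilter P) (𝓝 τ) :=
    (tendsto_floor_mul_div τ).comp tendsto_fst_probFilter
  have L1 : Tendsto (fun p => eigval (partialCov (obs μ g₁ g₂ e τ p.1 p.2) p.1 1) j) (probFilter P)
      (𝓝 (τ * eigval c₁ j + (1 - τ) * eigval c₂ j)) := by
    have h1 := (isTight_partialCov_one he hg₁ hg₂ hτ μ).tendsto_of_mul_sqrt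
    rw [← hc₁, ← hc₂] at h1
    rw [← hstar]
    exact tendsto_iff_norm_sub_tendsto_zero.2 (squeeze_zero (fun _ => norm_nonneg _)
      (fun p => abs_eigval_sub_le (isPosCompact_partialCov _ _ _) hc j) h1)
  have L2 : Tendsto (fun p => eigval (partialCov (obs μ g₁ g₂ e τ p.1 p.2) p.1 τ) j) (probFilter P)
      (𝓝 (τ * eigval c₁ j)) := by
    have h1 := (isTight_partialCov_break he hg₁ hg₂ hτ μ).tendsto_of_mul_sqrt
    rw [← hc₁] at h1
    have h0 : ∀ n : ℕ, 0 ≤ ((⌊τ * n⌋ : ℤ) : ℝ) / n := fun n =>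
      (div_mem_Icc (floor_mul_nonneg hτ n) (floor_mul_le hτ n)).1
    have h2 : Tendsto (fun p : ℕ × Ω => eigval (partialCov (obs μ g₁ g₂ e τ p.1 p.2) p.1 τ) j -
        ((⌊τ * p.1⌋ : ℤ) : ℝ) / p.1 * eigval c₁ j) (probFilter P) (𝓝 0) := by
      refine squeeze_zero_norm (fun p => ?_) h1
      rw [← eigval_smul hp₁ (h0 p.1)]
      exact abs_eigval_sub_le (isPosCompact_partialCov _ _ _) (hp₁.smul (h0 p.1)) j
    simpa using h2.add (hk.mul_const (eigval c₁ j))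
  have L3 := L2.sub (hk.mul L1)
  have e3 : τ * eigval c₁ j - τ * (τ * eigval c₁ j + (1 - τ) * eigval c₂ j) =
      τ * (1 - τ) * (eigval c₁ j - eigval c₂ j) := by ring
  rw [e3] at L3
  refine L3.congr' ?_
  filter_upwards [tendsto_fst_probFilter.eventually_gt_atTop 0] with p hp
  have : √(p.1 : ℝ) ≠ 0 := (Real.sqrt_pos.2 (by exact_mod_cast hp)).ne'
  rw [kappa, mul_div_cancel_left₀ _ this, mul_comm (p.1 : ℝ) τ]

theorem tendsto_sigmaHat_sub (he : IsIIDInnovation P ν e) (hg₁ : IsSegment P ν e g₁)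
    (hg₂ : IsSegment P ν e g₂) {τ : ℝ} (hτ : τ ∈ Set.Ioo (0 : ℝ) 1) (μ : L2)
    (hc₁ : c₁ = covOp P (shiftProcess g₁ e 0)) (hc₂ : c₂ = covOp P (shiftProcess g₂ e 0))
    (hgap₁ : ∀ j : Fin d, eigval c₁ (j + 1) < eigval c₁ j)
    (hgap₂ : ∀ j : Fin d, eigval c₂ (j + 1) < eigval c₂ j)
    (hE : ∀ j : Fin d, eigspace c₁ j = eigspace c₂ j)
    (hφ : IsEigenfunctions (τ • c₁ + (1 - τ) • c₂) φ)
    {w : ℝ → ℝ} (hw : IsWeight w) {h : ℕ → ℝ} (hh : IsBandwidth h) {ψ : ℕ → Ω → Fin d → L2}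
    (hψ : ∀ n ω, IsEigenfunctions (partialCov (obs μ g₁ g₂ e τ n ω) n 1) (ψ n ω)) (j j' : Fin d) :
    Tendsto (fun p => sigmaHat w (h p.1) (obs μ g₁ g₂ e τ p.1 p.2) p.1 (ψ p.1 p.2) j j' -
      stepForm w h τ p.1 * ((eigval c₁ j - eigval c₂ j) * (eigval c₁ j' - eigval c₂ j')))
      (probFilter P) (𝓝 ((τ • longRunCov P (shiftProcess g₁ e) φ +
        (1 - τ) • longRunCov P (shiftProcess g₂ e) φ) j j')) := by
  have ha := isApproxFeature_thetaHat he hg₁ hg₂ hτ μ hc₁ hc₂ hgap₁ hgap₂ hE hφ hψ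
  have := tendsto_lagWindow_sub hτ he hg₁ hg₂ hw hh (ha j) (ha j')
  rw [Matrix.add_apply, Matrix.smul_apply, Matrix.smul_apply, longRunCov_apply he hg₁,
    longRunCov_apply he hg₂]
  exact this

/-- At `u = τ` the statistic is `√(n / σ̂_j²)` times `|κ_j| / √n`: the first factor diverges, the
second has a positive limit. The condition `δ < τ` puts the break inside the range of the supremum.
-/
theorem tendsto_statI (he : IsIIDInnovation P ν e) (hg₁ : IsSegment P ν e g₁)
    (hg₂ : IsSegment P ν e g₂) {τ : ℝ} (hτ : τ ∈ Set.Ioo (0 : ℝ) 1) (μ : L2)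
    (hc₁ : c₁ = covOp P (shiftProcess g₁ e 0)) (hc₂ : c₂ = covOp P (shiftProcess g₂ e 0))
    (hgap₁ : ∀ j : Fin d, eigval c₁ (j + 1) < eigval c₁ j)
    (hgap₂ : ∀ j : Fin d, eigval c₂ (j + 1) < eigval c₂ j)
    (hE : ∀ j : Fin d, eigspace c₁ j = eigspace c₂ j)
    (hφ : IsEigenfunctions (τ • c₁ + (1 - τ) • c₂) φ)
    {w : ℝ → ℝ} (hw : IsWeight w) {h : ℕ → ℝ} (hh : IsBandwidth h) {ψ : ℕ → Ω → Fin d → L2}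
    (hψ : ∀ n ω, IsEigenfunctions (partialCov (obs μ g₁ g₂ e τ n ω) n 1) (ψ n ω))
    {δ : ℝ} (hδ : 0 < δ) (hδτ : δ < τ) {j : Fin d} (hj : eigval c₁ j ≠ eigval c₂ j) :
    Tendsto (fun p => statI w (h p.1) δ (obs μ g₁ g₂ e τ p.1 p.2) p.1 (ψ p.1 p.2) j)
      (probFilter P) atTop := by
  have hD := sub_ne_zero.2 hj
  obtain ⟨hpos, hσ⟩ := tendsto_div_of_sub_stepForm hw hh hτ (mul_self_pos.2 hD)
    (tendsto_sigmaHat_sub he hg₁ hg₂ hτ μ hc₁ hc₂ hgap₁ hgap₂ hE hφ hw hh hψ j j)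
  have L := (tendsto_kappa_div he hg₁ hg₂ hτ μ hc₁ hc₂ hgap₁ hgap₂ hE hφ j).abs
  have hlim := abs_pos.2 (mul_ne_zero (mul_ne_zero hτ.1.ne' (sub_pos.2 hτ.2).ne') hD)
  refine tendsto_atTop_mono' _ ?_ ((Real.tendsto_sqrt_atTop.comp hσ).atTop_mul_pos hlim L)
  filter_upwards [tendsto_fst_probFilter.eventually_gt_atTop 0] with p hp
  refine le_trans (le_of_eq ?_) (le_statI w (h p.1) hδ.le ⟨hδτ.le, hτ.2.le⟩ _ p.1 _ j)
  have : √(p.1 : ℝ) ≠ 0 := (Real.sqrt_pos.2 (by exact_mod_cast hp)).ne'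
  simp only [Function.comp_apply]
  rw [Real.sqrt_div p.1.cast_nonneg, abs_div, abs_of_nonneg (Real.sqrt_nonneg (p.1 : ℝ))]
  field_simp

theorem sigmaHat_isHermitian {w : ℝ → ℝ} (hw : IsWeight w) (h : ℝ) (x : ℤ → L2) (n : ℕ)
    (φ : Fin d → L2) : (sigmaHat w h x n φ).IsHermitian := by
  ext j j'
  rw [Matrix.conjTranspose_apply, star_trivial, sigmaHat, Matrix.of_apply, Matrix.of_apply,
    lagWindow_eq_quadForm, lagWindow_eq_quadForm]
  exact quadForm_comm (fun l => by push_cast; rw [neg_div, hw.even]) _ _ _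

/-- At the break the statistic is at least `(κ·D)² / (Dᵀ Σ̂ D)`. The numerator is of order `n`, and
the denominator follows the step contribution times `(D·D)²`, so the scalar argument applies with
`(D·D)²` in place of `D_j²`. -/
theorem tendsto_statJ (he : IsIIDInnovation P ν e) (hg₁ : IsSegment P ν e g₁)
    (hg₂ : IsSegment P ν e g₂) {τ : ℝ} (hτ : τ ∈ Set.Ioo (0 : ℝ) 1) (μ : L2)
    (hc₁ : c₁ = covOp P (shiftProcess g₁ e 0)) (hc₂ : c₂ = covOp P (shiftProcess g₂ e 0))
    (hgap₁ : ∀ j : Fin d, eigval c₁ (j + 1) < eigval c₁ j)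
    (hgap₂ : ∀ j : Fin d, eigval c₂ (j + 1) < eigval c₂ j)
    (hE : ∀ j : Fin d, eigspace c₁ j = eigspace c₂ j)
    (hφ : IsEigenfunctions (τ • c₁ + (1 - τ) • c₂) φ)
    (hLR₁ : IsUnit (longRunCov P (shiftProcess g₁ e) φ))
    (hLR₂ : IsUnit (longRunCov P (shiftProcess g₂ e) φ))
    {w : ℝ → ℝ} (hw : IsWeight w) {h : ℕ → ℝ} (hh : IsBandwidth h) {ψ : ℕ → Ω → Fin d → L2}
    (hψ : ∀ n ω, IsEigenfunctions (partialCov (obs μ g₁ g₂ e τ n ω) n 1) (ψ n ω))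
    {δ : ℝ} (hδ : 0 < δ) (hδτ : δ < τ)
    (hA : (fun j : Fin d => eigval c₁ j) ≠ fun j : Fin d => eigval c₂ j) :
    Tendsto (fun p => statJ w (h p.1) δ (obs μ g₁ g₂ e τ p.1 p.2) p.1 (ψ p.1 p.2))
      (probFilter P) atTop := by
  set D : Fin d → ℝ := fun j => eigval c₁ j - eigval c₂ j with hD
  set V := τ • longRunCov P (shiftProcess g₁ e) φ + (1 - τ) • longRunCov P (shiftProcess g₂ e) φ
    with hV
  set U : ℕ × Ω → Matrix (Fin d) (Fin d) ℝ := fun p =>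
    sigmaHat w (h p.1) (obs μ g₁ g₂ e τ p.1 p.2) p.1 (ψ p.1 p.2) with hU
  set κ : ℕ × Ω → Fin d → ℝ := fun p => kappa d (obs μ g₁ g₂ e τ p.1 p.2) p.1 τ with hκ
  have hDD : 0 < D ⬝ᵥ D := by
    have hne : D ≠ 0 := fun h0 => hA (funext fun j => sub_eq_zero.1 (congrFun h0 j))
    have h1 : 0 ≤ D ⬝ᵥ D := Finset.sum_nonneg fun j _ => mul_self_nonneg _
    exact lt_of_le_of_ne h1 fun h0 => hne (dotProduct_self_eq_zero.1 h0.symm)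
  have hpd : V.PosDef := ((posDef_longRunCov he hg₁ φ hLR₁).smul hτ.1).add
    ((posDef_longRunCov he hg₂ φ hLR₂).smul (sub_pos.2 hτ.2))
  have L : ∀ j j', Tendsto (fun p => U p j j' - stepForm w h τ p.1 * (D j * D j')) (probFilter P)
      (𝓝 (V j j')) :=
    tendsto_sigmaHat_sub he hg₁ hg₂ hτ μ hc₁ hc₂ hgap₁ hgap₂ hE hφ hw hh hψ
  obtain ⟨r, hr, hstab⟩ := exists_posDef_of_sub_le hpd
  have L1 : Tendsto (fun p => ∑ j, ∑ j', |U p j j' - stepForm w h τ p.1 * (D j * D j') - V j j'|)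
      (probFilter P) (𝓝 0) := by
    have := tendsto_finsetSum Finset.univ fun j _ => tendsto_finsetSum Finset.univ fun j' _ =>
      ((L j j').sub_const (V j j')).abs
    simpa using this
  -- Convergence of `U` fails along `D Dᵀ`; it is enough that the diverging coefficient is
  -- nonnegative and that the rest is close to the positive definite `V`.
  have hpos : ∀ᶠ p in probFilter P, (U p).PosDef := by
    filter_upwards [L1.eventually_lt_const hr, (tendsto_fst_probFilter (P := P)).eventually
      ((tendsto_quadForm_stepSeq hw hh hτ).eventually_ge_atTop 0)] with p h1 h3
    exact hstab (U p) (stepForm w h τ p.1) D (sigmaHat_isHermitian hw _ _ _ _) h3 h1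
  have L2 : Tendsto (fun p => D ⬝ᵥ (U p *ᵥ D) - stepForm w h τ p.1 * (D ⬝ᵥ D * D ⬝ᵥ D))
      (probFilter P) (𝓝 (D ⬝ᵥ (V *ᵥ D))) := by
    have := tendsto_finsetSum Finset.univ fun j _ => tendsto_finsetSum Finset.univ fun j' _ =>
      (L j j').const_mul (D j * D j')
    rw [← dotProduct_mulVec_eq_sum] at this
    refine this.congr fun p => ?_
    rw [dotProduct_mulVec_eq_sum, dotProduct, Finset.sum_mul_sum, Finset.mul_sum,
      ← Finset.sum_sub_distrib]
    refine Finset.sum_congr rfl fun j _ => ?_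
    rw [Finset.mul_sum, ← Finset.sum_sub_distrib]
    exact Finset.sum_congr rfl fun j' _ => by ring
  obtain ⟨hpos2, hσ⟩ := tendsto_div_of_sub_stepForm hw hh hτ (mul_pos hDD hDD) L2
  have L3 : Tendsto (fun p => (κ p ⬝ᵥ D / √(p.1 : ℝ)) ^ 2) (probFilter P)
      (𝓝 ((τ * (1 - τ) * (D ⬝ᵥ D)) ^ 2)) := by
    have := tendsto_finsetSum Finset.univ fun j _ =>
      (tendsto_kappa_div he hg₁ hg₂ hτ μ hc₁ hc₂ hgap₁ hgap₂ hE hφ j).mul_const (D j)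
    have e1 : ∑ j : Fin d, τ * (1 - τ) * (eigval c₁ j - eigval c₂ j) * D j = τ * (1 - τ) * (D ⬝ᵥ D) := by
      rw [dotProduct, Finset.mul_sum]
      exact Finset.sum_congr rfl fun j _ => by ring
    rw [e1] at this
    refine (this.congr fun p => ?_).pow 2
    rw [dotProduct, Finset.sum_div]
    exact Finset.sum_congr rfl fun j _ => by ring
  have hlim : 0 < (τ * (1 - τ) * (D ⬝ᵥ D)) ^ 2 :=
    pow_pos (mul_pos (mul_pos hτ.1 (sub_pos.2 hτ.2)) hDD) 2
  refine tendsto_atTop_mono' _ ?_ (hσ.atTop_mul_pos hlim L3)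
  filter_upwards [tendsto_fst_probFilter.eventually_gt_atTop 0, hpos, hpos2] with p hp h1 h2
  refine le_trans ?_ (le_statJ w (h p.1) hδ.le ⟨hδτ.le, hτ.2.le⟩ _ p.1 _)
  have h3 := sq_dotProduct_le_of_posDef h1 (κ p) D
  have hp' : (0 : ℝ) < p.1 := by exact_mod_cast hp
  rw [div_pow, Real.sq_sqrt p.1.cast_nonneg, div_mul_div_comm, mul_comm (p.1 : ℝ),
    mul_div_mul_right _ _ hp'.ne']
  exact (div_le_iff₀ h2).2 h3

end Main
end SpectralBreak

open SpectralBreak in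
theorem mainTheorem6 {Ω S : Type*} [MeasurableSpace Ω] [MeasurableSpace S]
    (P : Measure Ω) [IsProbabilityMeasure P] (ν : Measure S) [IsProbabilityMeasure ν]
    -- the break fraction, the mean function, the innovations and the two error mechanisms
    (τ : ℝ) (hτ : τ ∈ Set.Ioo (0 : ℝ) 1)
    (μ : L2) (e : ℤ → Ω → S) (he : IsIIDInnovation P ν e)
    (g₁ g₂ : (ℕ → S) → L2) (hg₁ : IsSegment P ν e g₁) (hg₂ : IsSegment P ν e g₂)
    -- the covariance operators before and after the break, and their mixture
    (c₁ c₂ cStar : L2 →L[ℝ] L2)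
    (hc₁ : c₁ = covOp P (shiftProcess g₁ e 0)) (hc₂ : c₂ = covOp P (shiftProcess g₂ e 0))
    (hcStar : cStar = τ • c₁ + (1 - τ) • c₂)
    -- the first `d` eigenspaces before and after the break are one-dimensional
    (d : ℕ)
    (hgap₁ : ∀ j : Fin d, eigval c₁ (j + 1) < eigval c₁ j)
    (hgap₂ : ∀ j : Fin d, eigval c₂ (j + 1) < eigval c₂ j)
    -- the long-run covariance matrices of the two segments are invertible
    (φStar : Fin d → L2) (hφStar : IsEigenfunctions cStar φStar)
    (hLR₁ : IsUnit (longRunCov P (shiftProcess g₁ e) φStar))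
    (hLR₂ : IsUnit (longRunCov P (shiftProcess g₂ e) φStar))
    -- the alternative: the vector of the `d` largest eigenvalues changes
    (hA : (fun j : Fin d => eigval c₁ j) ≠ fun j : Fin d => eigval c₂ j)
    -- weight function and bandwidth, and any choice of the sample eigenfunctions
    (w : ℝ → ℝ) (hw : IsWeight w) (h : ℕ → ℝ) (hh : IsBandwidth h)
    (φHat : ℕ → Ω → Fin d → L2)
    (hφHat : ∀ n ω, IsEigenfunctions (partialCov (obs μ g₁ g₂ e τ n ω) n 1) (φHat n ω)) :
    -- parts (a) and (b), if the first `d` eigenspaces are the same before and after the break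
    ((∀ j : Fin d, eigspace c₁ j = eigspace c₂ j) →
      (∀ δ : ℝ, 0 < δ → δ < τ →
        TendstoInProbTop P fun n ω => statJ w (h n) δ (obs μ g₁ g₂ e τ n ω) n (φHat n ω)) ∧
      (∀ δ : ℝ, 0 < δ → δ < τ → ∀ j : Fin d, eigval c₁ j ≠ eigval c₂ j →
        TendstoInProbTop P fun n ω =>
          statI w (h n) δ (obs μ g₁ g₂ e τ n ω) n (φHat n ω) j)) ∧
    -- part (c)
    (opTrace c₁ ≠ opTrace c₂ →
      TendstoInProbTop P fun n ω => statM w (h n) (obs μ g₁ g₂ e τ n ω) n) := by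
  subst hcStar
  refine ⟨fun hE => ⟨fun δ hδ hδτ => tendstoInProbTop_of_tendsto ?_,
    fun δ hδ hδτ j hj => tendstoInProbTop_of_tendsto ?_⟩, fun hD => tendstoInProbTop_of_tendsto ?_⟩
  · exact tendsto_statJ he hg₁ hg₂ hτ μ hc₁ hc₂ hgap₁ hgap₂ hE hφStar hLR₁ hLR₂ hw hh hφHat hδ hδτ hA
  · exact tendsto_statI he hg₁ hg₂ hτ μ hc₁ hc₂ hgap₁ hgap₂ hE hφStar hw hh hφHat hδ hδτ hj
  · subst hc₁ hc₂
    exact tendsto_statM he hg₁ hg₂ hτ μ hw hh hD
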